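/- **Setting.** Let $I$ be a set with a symmetrizable Cartan datum (for example of finite or affine type), with simple roots $\alpha_i$ and Cartan matrix $(c_{ij})$, and let $\Bbbk$ be a commutative ring. For $i\neq j$ let $Q_{ij}(u,v)\in\Bbbk[u,v]$ satisfy $Q_{ij}(u,v)=Q_{ji}(v,u)$ and be, as a polynomial in $u$, of degree $-c_{ij}$ with leading coefficient a unit of $\Bbbk$. (In type $A^{(1)}_{e-1}$, $e\ge 2$, $I=\mathbb Z/e$, one takes $Q_{ij}=u-v$ if $i=j+1\ne j-1$, $v-u$ if $i=j-1\neq j+1$, $-(u-v)^2$ if $i=j+1=j-1$, and $1$ for the other $i\ne j$.) Let $\Lambda$ be a dominant weight, $\Lambda_i=\langle\Lambda,\alpha_i^\vee\rangle\in\mathbb Z_{\ge0}$. Let $\chi(\alpha_i)\in\mathbb R$ be arbitrary, and extend $\chi$ linearly to the root lattice; let $h$ be the linear function with $h(\alpha_i)=1$. The slope of a nonzero $\beta\in\sum_i\mathbb Z_{\ge0}\alpha_i$ is $\chi(\beta)/h(\beta)$. For a word $\mathbf i=(i_1,\dots,i_k)$ put $\alpha_{\mathbf i}=\alpha_{i_1}+\dots+\alpha_{i_k}$.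 Throughout $\alpha=\sum_i b_i\alpha_i$ with $b_i\in\mathbb Z_{\ge0}$. **Algebras.** $R_\alpha$ is the KLR algebra over $\Bbbk$: linear combinations, up to isotopy, of diagrams with $b_i$ dotted strands labelled $i$, with product $xy$ given by stacking $x$ on top of $y$. Write $y_k$ for a dot on the $k$th strand and $\psi_k$ for a crossing of the $k$th and $(k+1)$st strands. The relations are that dots slide through crossings, except $\psi_1y_1-y_2\psi_1=y_1\psi_1-\psi_1y_2=1$ on two strands with equal labels; that $\psi_1^2=0$ on strands $ii$ and $\psi_1^2=Q_{ij}(y_1,y_2)$ on strands $ij$ with $i\neq j$; and that $\psi_1\psi_2\psi_1-\psi_2\psi_1\psi_2$ on three strands is $\frac{Q_{ij}(y_1,y_2)-Q_{ij}(y_3,y_2)}{y_1-y_3}$ for labels $iji$ with $i\ne j$, and $0$ otherwise. $R_0(\Lambda,\alpha)$ is the KLRW algebra, whose diagrams have in addition one undotted red strand: dots slide through crossings with the red strand; a strand labelled $i$ crossing the red strand and back equals $\Lambda_i$ dots on that strand; and $\psi_1\psi_2\psi_1-\psi_2\psi_1\psi_2$ is $\sum_{a+b=\Lambda_i-1}y_1^ay_3^b$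 on the three strands $i$, red, $i$, and $0$ on all other triples containing the red strand. Its straight-line idempotents are $e(\boldsymbol\ell,\mathbf r)$, where $\boldsymbol\ell$ lists the labels to the left of the red strand from left to right and $\mathbf r$ those to its right from right to left. The *semicuspidal quotient* $C_\beta$ is the quotient of $R_\beta$ by the two-sided ideal generated by the straight-line idempotents $e(\mathbf i\mathbf j)$ (labels read from left to right) with $\mathbf i,\mathbf j$ non-empty and the slope of $\alpha_{\mathbf i}$ strictly less than that of $\alpha_{\mathbf j}$. The *steadied quotient* $R(\chi,\Lambda,\alpha)$ is the quotient of $R_0(\Lambda,\alpha)$ by the two-sided ideal generated by the $e(\boldsymbol\ell,\mathbf r)$ such that $\chi(\alpha_{(\ell_1,\dots,\ell_m)})<0$ or $\chi(\alpha_{(r_1,\dots,r_m)})>0$ for some $m$. **Slope data.** A *slope datum* for $\alpha$ is a sequence $\boldsymbol\gamma=(\gamma_{-s},\dots,\gamma_0,\dots,\gamma_t)$ of elements of $\sum_i\mathbb Z_{\geq 0}\alpha_i$ with sum $\alpha$, with $\gamma_p\neq0$ for $p\ne0$, such that the slopes of the $\gamma_p$, $p\neq 0$, are strictly increasing in $p$,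 negative for $p<0$ and positive for $p>0$. Let $f^+_{\boldsymbol\gamma}$ (resp. $f^-_{\boldsymbol\gamma}$) be the piecewise linear function on $\mathbb R_{\ge0}$ whose graph starts at the origin, moves successively by the vectors $(h(\gamma_p),\chi(\gamma_p))$ for $p=t,t-1,\dots,1$ (resp. $p=-s,\dots,-1$), and is then constant. Write $\boldsymbol\gamma\le\boldsymbol\gamma'$ if $f^+_{\boldsymbol\gamma}\le f^+_{\boldsymbol\gamma'}$ and $f^-_{\boldsymbol\gamma}\ge f^-_{\boldsymbol\gamma'}$. The slope datum $\boldsymbol\gamma(\boldsymbol\ell,\mathbf r)$ is found as follows. From the path through the points $(m,\chi(\alpha_{(r_1,\dots,r_m)}))$, starting at the origin, repeatedly take the ray of greatest positive slope from the current point that meets the rest of the path, and go to its last point on the path, as long as there is such a ray. The sums of the labels passed in these steps are $\gamma_t,\gamma_{t-1},\dots,\gamma_1$. In the same way $\boldsymbol\ell$, with the ray of most negative slope, gives $\gamma_{-s},\dots,\gamma_{-1}$. All remaining labels sum to $\gamma_0$. **Modules.** The standard module $\Delta(\boldsymbol\ell,\mathbf r)$ is the quotient of the left module $R_0(\Lambda,\alpha)e(\boldsymbol\ell,\mathbf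 r)$ by the submodule generated by $e(\boldsymbol\ell',\mathbf r')R_0(\Lambda,\alpha)e(\boldsymbol\ell,\mathbf r)$ for all $(\boldsymbol\ell',\mathbf r')$ with $\boldsymbol\gamma(\boldsymbol\ell',\mathbf r')\not\le\boldsymbol\gamma(\boldsymbol\ell,\mathbf r)$, and $\Delta(\boldsymbol\gamma)=\bigoplus\Delta(\boldsymbol\ell,\mathbf r)$ over all $(\boldsymbol\ell,\mathbf r)$ with $\alpha_{\boldsymbol\ell}+\alpha_{\mathbf r}=\alpha$ and $\boldsymbol\gamma(\boldsymbol\ell,\mathbf r)=\boldsymbol\gamma$. Put $$R_{\boldsymbol\gamma}=R_{\gamma_{-s}}\otimes\cdots\otimes R_0(\Lambda,\gamma_0)\otimes\cdots\otimes R_{\gamma_t},\qquad C_{\boldsymbol\gamma}=C_{\gamma_{-s}}\otimes\cdots\otimes R(\chi,\Lambda,\gamma_0)\otimes\cdots\otimes C_{\gamma_t}$$ (tensor products over $\Bbbk$). Horizontal composition is a (non-unital) homomorphism $R_{\boldsymbol\gamma}\to R_0(\Lambda,\alpha)$; put $C_{\gamma_{-s}}\circ\cdots\circ R(\chi,\Lambda,\gamma_0)\circ\cdots\circ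 C_{\gamma_t}=R_0(\Lambda,\alpha)\otimes_{R_{\boldsymbol\gamma}}C_{\boldsymbol\gamma}$. **Theorem.** For every slope datum $\boldsymbol\gamma$ for $\alpha$ there are isomorphisms $$\Delta(\boldsymbol\gamma)\cong C_{\gamma_{-s}}\circ\cdots\circ R(\chi,\Lambda,\gamma_0)\circ\cdots\circ C_{\gamma_t}\qquad\text{and}\qquad \operatorname{End}_{R_0(\Lambda,\alpha)}(\Delta(\boldsymbol\gamma))^{\mathrm{op}}\cong C_{\boldsymbol\gamma}$$ of left $R_0(\Lambda,\alpha)$-modules and of $\Bbbk$-algebras, respectively. -/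

import Mathlib

open scoped TensorProduct DirectSum

noncomputable section

namespace KLRW

universe u v

/-! ## Cartan data and the polynomials `Q i j` -/

/-- A (symmetrizable) Cartan datum on `I`: a symmetric integral form on the lattice with basis
`α i` such that `⟨α i, α i⟩ ∈ 2ℤ_{>0}` and `c i j = 2 ⟨α i, α j⟩ / ⟨α i, α i⟩` is a generalized
Cartan matrix. -/
structure CartanDatum (I : Type u) where
  form : I → I → ℤ
  symm : ∀ i j, form i j = form j i
  even : ∀ i, Even (form i i)
  pos : ∀ i, 0 < form i i
  nonpos : ∀ i j, i ≠ j → form i j ≤ 0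
  dvd : ∀ i j, form i i ∣ 2 * form i j

/-- The entry `c i j` of the Cartan matrix (an exact division). -/
def CartanDatum.cartan {I : Type u} (C : CartanDatum I) (i j : I) : ℤ :=
  2 * C.form i j / C.form i i

/-- `Q i j ∈ 𝕜[u, v]` (`u` is variable `0`, `v` is variable `1`) is an admissible choice for `C`:
`Q i j (u, v) = Q j i (v, u)`, and as a polynomial in `u` it has degree `- c i j`, with leading
coefficient a unit of `𝕜`.  The values `Q i i` are never used. -/
structure IsAdmissible {I : Type u} {𝕜 : Type v} [CommRing 𝕜] (C : CartanDatum I)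
    (Q : I → I → MvPolynomial (Fin 2) 𝕜) : Prop where
  symm : ∀ i j, i ≠ j → Q j i = MvPolynomial.rename (Equiv.swap 0 1) (Q i j)
  unit : ∀ i j, i ≠ j →
    IsUnit ((Q i j).coeff (Finsupp.single 0 (-C.cartan i j).toNat))
  lead : ∀ i j, i ≠ j → ∀ m ∈ (Q i j).support,
    m ≠ Finsupp.single 0 (-C.cartan i j).toNat → m 0 < (-C.cartan i j).toNat

/-! ## Diagrams

A strand is an element of `Option I`: `some i` is a black strand with label `i`, and `none` is a
red strand.  A horizontal slice of a diagram is a list of strands, read from left to right.  Only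
slices with at most one red strand will be used. -/

/-- The elementary diagrams. -/
inductive Piece (I : Type u) : Type u
  /-- a dot on a black strand labelled `i` -/
  | dot (i : I) : Piece I
  /-- a crossing; at the bottom `a` is to the left of `b`, at the top `b` is to the left of `a` -/
  | cross (a b : Option I) : Piece I

/-- Bottom of an elementary diagram. -/
def Piece.src {I : Type u} : Piece I → List (Option I)
  | .dot i => [some i]
  | .cross a b => [a, b]

/-- Top of an elementary diagram. -/
def Piece.tgt {I : Type u} : Piece I → List (Option I)
  | .dot i => [some i]
  | .cross a b => [b, a]

/-- Generators: straight line diagrams, and diagrams with one elementary piece `g` between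
vertical strands `u` (on its left) and `v` (on its right). -/
inductive Gen (I : Type u) : Type u
  | idm (w : List (Option I)) : Gen I
  | put (u : List (Option I)) (g : Piece I) (v : List (Option I)) : Gen I

section Relations

variable {I : Type u} (𝕜 : Type v) [CommRing 𝕜]

/-- The straight line diagram. -/
abbrev fId (w : List (Option I)) : FreeAlgebra 𝕜 (Gen I) := FreeAlgebra.ι 𝕜 (Gen.idm w)

/-- A dot on a strand `i` between `u` and `v`. -/
abbrev fDot (u : List (Option I)) (i : I) (v : List (Option I)) : FreeAlgebra 𝕜 (Gen I) :=
  FreeAlgebra.ι 𝕜 (Gen.put u (.dot i) v)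

/-- A crossing of strands `a`, `b` between `u` and `v`. -/
abbrev fCross (u : List (Option I)) (a b : Option I) (v : List (Option I)) :
    FreeAlgebra 𝕜 (Gen I) :=
  FreeAlgebra.ι 𝕜 (Gen.put u (.cross a b) v)

variable {𝕜}

/-- `P (y, z)` for a polynomial `P (u, v)`. -/
def eval₂ {A : Type*} [Ring A] [Algebra 𝕜 A] (P : MvPolynomial (Fin 2) 𝕜) (y z : A) : A :=
  ∑ m ∈ P.support, P.coeff m • (y ^ m 0 * z ^ m 1)

/-- `∑ x ^ a * z ^ b` over `a + b = p - 1`, that is `(x ^ p - z ^ p) / (x - z)`. -/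
def divPow {A : Type*} [Ring A] (p : ℕ) (x z : A) : A :=
  ∑ a ∈ Finset.range p, x ^ a * z ^ (p - 1 - a)

/-- `(P (x, y) - P (z, y)) / (x - z)` for a polynomial `P (u, v)`. -/
def divDiff {A : Type*} [Ring A] [Algebra 𝕜 A] (P : MvPolynomial (Fin 2) 𝕜) (x y z : A) : A :=
  ∑ m ∈ P.support, P.coeff m • (divPow (m 0) x z * y ^ m 1)

variable [DecidableEq I] (Q : I → I → MvPolynomial (Fin 2) 𝕜) (Λ : I → ℕ)

/-- The relations.  A product `x * y` is the diagram `x` stacked on top of `y`, and is zero if the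
labels do not match.  Here `Λ i` is the number `⟨Λ, αᵢ^∨⟩`. -/
inductive Rel : FreeAlgebra 𝕜 (Gen I) → FreeAlgebra 𝕜 (Gen I) → Prop
  -- vertical composition of diagrams
  | idm_mul_self (w) : Rel (fId 𝕜 w * fId 𝕜 w) (fId 𝕜 w)
  | idm_mul_ne (w w') (h : w ≠ w') : Rel (fId 𝕜 w * fId 𝕜 w') 0
  | tgt_mul (u g v) : Rel (fId 𝕜 (u ++ (g.tgt ++ v)) * FreeAlgebra.ι 𝕜 (Gen.put u g v))
      (FreeAlgebra.ι 𝕜 (Gen.put u g v))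
  | mul_src (u g v) : Rel (FreeAlgebra.ι 𝕜 (Gen.put u g v) * fId 𝕜 (u ++ (g.src ++ v)))
      (FreeAlgebra.ι 𝕜 (Gen.put u g v))
  -- isotopy: elementary pieces `g` and `g'` on disjoint sets of strands can change heights
  | isotopy (u g x g' v) :
      Rel (FreeAlgebra.ι 𝕜 (Gen.put u g (x ++ (g'.tgt ++ v))) *
            FreeAlgebra.ι 𝕜 (Gen.put (u ++ (g.src ++ x)) g' v))
          (FreeAlgebra.ι 𝕜 (Gen.put (u ++ (g.tgt ++ x)) g' v) *
            FreeAlgebra.ι 𝕜 (Gen.put u g (x ++ (g'.src ++ v))))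
  -- dots and crossings
  | dot_left (u i b v) :
      Rel (fCross 𝕜 u (some i) b v * fDot 𝕜 u i (b :: v) -
            fDot 𝕜 (u ++ [b]) i v * fCross 𝕜 u (some i) b v)
          (if b = some i then fId 𝕜 (u ++ some i :: some i :: v) else 0)
  | dot_right (u a i v) :
      Rel (fDot 𝕜 u i (a :: v) * fCross 𝕜 u a (some i) v -
            fCross 𝕜 u a (some i) v * fDot 𝕜 (u ++ [a]) i v)
          (if a = some i then fId 𝕜 (u ++ some i :: some i :: v) else 0)
  -- two strands crossing twice
  | bigon_eq (u a v) : Rel (fCross 𝕜 u a a v * fCross 𝕜 u a a v) 0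
  | bigon_ne (u i j v) (h : i ≠ j) :
      Rel (fCross 𝕜 u (some j) (some i) v * fCross 𝕜 u (some i) (some j) v)
          (fId 𝕜 (u ++ some i :: some j :: v) *
            eval₂ (Q i j) (fDot 𝕜 u i (some j :: v)) (fDot 𝕜 (u ++ [some i]) j v))
  | bigon_red_right (u i v) :
      Rel (fCross 𝕜 u none (some i) v * fCross 𝕜 u (some i) none v)
          (fId 𝕜 (u ++ some i :: none :: v) * fDot 𝕜 u i (none :: v) ^ Λ i)
  | bigon_red_left (u i v) :
      Rel (fCross 𝕜 u (some i) none v * fCross 𝕜 u none (some i) v)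
          (fId 𝕜 (u ++ none :: some i :: v) * fDot 𝕜 (u ++ [none]) i v ^ Λ i)
  -- triple points
  | triple_zero (u a b c v) (h : a ≠ c ∨ a = b) :
      Rel (fCross 𝕜 u b c (a :: v) * fCross 𝕜 (u ++ [b]) a c v * fCross 𝕜 u a b (c :: v))
          (fCross 𝕜 (u ++ [c]) a b v * fCross 𝕜 u a c (b :: v) * fCross 𝕜 (u ++ [a]) b c v)
  | triple_black (u i j v) (h : i ≠ j) :
      Rel (fCross 𝕜 u (some j) (some i) (some i :: v) *
              fCross 𝕜 (u ++ [some j]) (some i) (some i) v *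
              fCross 𝕜 u (some i) (some j) (some i :: v) -
            fCross 𝕜 (u ++ [some i]) (some i) (some j) v *
              fCross 𝕜 u (some i) (some i) (some j :: v) *
              fCross 𝕜 (u ++ [some i]) (some j) (some i) v)
          (fId 𝕜 (u ++ some i :: some j :: some i :: v) *
            divDiff (Q i j) (fDot 𝕜 u i (some j :: some i :: v))
              (fDot 𝕜 (u ++ [some i]) j (some i :: v)) (fDot 𝕜 (u ++ [some i, some j]) i v))
  | triple_red (u i v) :
      Rel (fCross 𝕜 u none (some i) (some i :: v) *
              fCross 𝕜 (u ++ [none]) (some i) (some i) v *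
              fCross 𝕜 u (some i) none (some i :: v) -
            fCross 𝕜 (u ++ [some i]) (some i) none v *
              fCross 𝕜 u (some i) (some i) (none :: v) *
              fCross 𝕜 (u ++ [some i]) none (some i) v)
          (fId 𝕜 (u ++ some i :: none :: some i :: v) *
            divPow (Λ i) (fDot 𝕜 u i (none :: some i :: v))
              (fDot 𝕜 (u ++ [some i, none]) i v))

/-- Linear combinations of all diagrams (with an additional unit, which is cut off below), modulo
the local relations. -/
abbrev Diagrams : Type (max u v) := RingQuot (Rel Q Λ)

/-- The straight line diagram `e(w)` as an element of `Diagrams`. -/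
def dId (w : List (Option I)) : Diagrams Q Λ := RingQuot.mkAlgHom 𝕜 (Rel Q Λ) (fId 𝕜 w)

theorem dId_mul_self (w : List (Option I)) : dId Q Λ w * dId Q Λ w = dId Q Λ w := by
  rw [dId, ← map_mul]; exact RingQuot.mkAlgHom_rel 𝕜 (Rel.idm_mul_self w)

theorem dId_mul_ne {w w' : List (Option I)} (h : w ≠ w') : dId Q Λ w * dId Q Λ w' = 0 := by
  rw [dId, dId, ← map_mul, ← map_zero (RingQuot.mkAlgHom 𝕜 (Rel Q Λ))]
  exact RingQuot.mkAlgHom_rel 𝕜 (Rel.idm_mul_ne w w' h)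

/-- The effect on generators of adding vertical strands `p` on the left and `q` on the right. -/
def Gen.pad (p q : List (Option I)) : Gen I → Gen I
  | .idm w => .idm (p ++ (w ++ q))
  | .put u g v => .put (p ++ u) g (v ++ q)

/-- Adding vertical strands, on the free algebra. -/
def fPad (p q : List (Option I)) : FreeAlgebra 𝕜 (Gen I) →ₐ[𝕜] FreeAlgebra 𝕜 (Gen I) :=
  FreeAlgebra.lift 𝕜 fun x => FreeAlgebra.ι 𝕜 (x.pad p q)

@[simp] theorem fPad_idm (p q w : List (Option I)) :
    fPad p q (FreeAlgebra.ι 𝕜 (Gen.idm w)) = FreeAlgebra.ι 𝕜 (Gen.idm (p ++ (w ++ q))) := by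
  simp [fPad, Gen.pad]

@[simp] theorem fPad_put (p q u : List (Option I)) (g : Piece I) (v : List (Option I)) :
    fPad p q (FreeAlgebra.ι 𝕜 (Gen.put u g v)) =
      FreeAlgebra.ι 𝕜 (Gen.put (p ++ u) g (v ++ q)) := by
  simp [fPad, Gen.pad]

theorem fPad_rel (p q : List (Option I)) {x y : FreeAlgebra 𝕜 (Gen I)} (h : Rel Q Λ x y) :
    Rel Q Λ (fPad p q x) (fPad p q y) := by
  cases h with
  | idm_mul_self w => simpa using Rel.idm_mul_self (p ++ (w ++ q))
  | idm_mul_ne w w' h => simpa using Rel.idm_mul_ne (p ++ (w ++ q)) (p ++ (w' ++ q)) (by simpa)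
  | tgt_mul u g v => simpa using Rel.tgt_mul (p ++ u) g (v ++ q)
  | mul_src u g v => simpa using Rel.mul_src (p ++ u) g (v ++ q)
  | isotopy u g x g' v => simpa using Rel.isotopy (p ++ u) g x g' (v ++ q)
  | dot_left u i b v => simpa [apply_ite (fPad p q)] using Rel.dot_left (p ++ u) i b (v ++ q)
  | dot_right u a i v => simpa [apply_ite (fPad p q)] using Rel.dot_right (p ++ u) a i (v ++ q)
  | bigon_eq u a v => simpa using Rel.bigon_eq (p ++ u) a (v ++ q)
  | bigon_ne u i j v h => simpa [eval₂] using Rel.bigon_ne (p ++ u) i j (v ++ q) h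
  | bigon_red_right u i v => simpa using Rel.bigon_red_right (p ++ u) i (v ++ q)
  | bigon_red_left u i v => simpa using Rel.bigon_red_left (p ++ u) i (v ++ q)
  | triple_zero u a b c v h => simpa using Rel.triple_zero (p ++ u) a b c (v ++ q) h
  | triple_black u i j v h =>
    simpa [divDiff, divPow] using Rel.triple_black (p ++ u) i j (v ++ q) h
  | triple_red u i v => simpa [divPow] using Rel.triple_red (p ++ u) i (v ++ q)

/-- Adding vertical strands `p` on the left and `q` on the right of a diagram. -/
def pad (p q : List (Option I)) : Diagrams Q Λ →ₐ[𝕜] Diagrams Q Λ :=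
  RingQuot.liftAlgHom 𝕜 ⟨(RingQuot.mkAlgHom 𝕜 (Rel Q Λ)).comp (fPad p q),
    fun _ _ h => RingQuot.mkAlgHom_rel 𝕜 (fPad_rel Q Λ p q h)⟩

/-! ## The algebras -/

/-- The words whose multiset of strands is `S`. -/
def wordsOf (S : Multiset (Option I)) : Finset (List (Option I)) := S.lists.toFinset

/-- The sum of all straight line diagrams whose multiset of strands is `S`. -/
def total (S : Multiset (Option I)) : Diagrams Q Λ := ∑ w ∈ wordsOf S, dId Q Λ w

theorem total_idem (S : Multiset (Option I)) : IsIdempotentElem (total Q Λ S) := by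
  unfold IsIdempotentElem total
  rw [Finset.sum_mul]
  refine Finset.sum_congr rfl fun w hw => ?_
  rw [Finset.mul_sum, Finset.sum_eq_single w, dId_mul_self]
  · intro w' _ h
    exact dId_mul_ne Q Λ (Ne.symm h)
  · exact fun h => absurd hw h

/-- The algebra of diagrams whose slices have multiset of strands `S`. -/
def StrandAlg (S : Multiset (Option I)) : Type (max u v) := (total_idem Q Λ S).Corner

instance (S : Multiset (Option I)) : Ring (StrandAlg Q Λ S) :=
  inferInstanceAs (Ring (total_idem Q Λ S).Corner)

variable {Q Λ} in
/-- A diagram in `StrandAlg`, seen in `Diagrams`. -/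
def StrandAlg.val {S : Multiset (Option I)} (x : StrandAlg Q Λ S) : Diagrams Q Λ := Subtype.val x

instance (S : Multiset (Option I)) : Module 𝕜 (StrandAlg Q Λ S) where
  smul c x := ⟨c • x.val, by
    obtain ⟨y, hy⟩ := x.2
    exact ⟨c • y, by simpa [StrandAlg.val] using congrArg (c • ·) hy⟩⟩
  one_smul x := Subtype.ext (one_smul 𝕜 x.val)
  mul_smul c d x := Subtype.ext (mul_smul c d x.val)
  smul_zero c := Subtype.ext (smul_zero c)
  smul_add c x y := Subtype.ext (smul_add c x.val y.val)
  add_smul c d x := Subtype.ext (add_smul c d x.val)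
  zero_smul x := Subtype.ext (zero_smul 𝕜 x.val)

instance (S : Multiset (Option I)) : Algebra 𝕜 (StrandAlg Q Λ S) :=
  Algebra.ofModule (fun c x y => Subtype.ext (smul_mul_assoc c x.val y.val))
    (fun c x y => Subtype.ext (mul_smul_comm c x.val y.val))

/-- The inclusion of `StrandAlg` in `Diagrams`. -/
def incl (S : Multiset (Option I)) : StrandAlg Q Λ S →ₗ[𝕜] Diagrams Q Λ where
  toFun x := x.val
  map_add' _ _ := rfl
  map_smul' _ _ := rfl

/-- The projection of `Diagrams` to `StrandAlg`: it kills every diagram whose top or bottom has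
another multiset of strands. -/
def proj (S : Multiset (Option I)) : Diagrams Q Λ →ₗ[𝕜] StrandAlg Q Λ S where
  toFun x := ⟨total Q Λ S * x * total Q Λ S, x, rfl⟩
  map_add' x y := Subtype.ext (by
    change _ = total Q Λ S * x * total Q Λ S + total Q Λ S * y * total Q Λ S
    simp only [mul_add, add_mul])
  map_smul' c x := Subtype.ext (by
    change _ = c • (total Q Λ S * x * total Q Λ S)
    simp only [mul_smul_comm, smul_mul_assoc])

/-- The idempotent `e(w)` of `StrandAlg` (zero if `S` is not the multiset of strands of `w`). -/
def idem (S : Multiset (Option I)) (w : List (Option I)) : StrandAlg Q Λ S :=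
  proj Q Λ S (dId Q Λ w)

/-- An element `∑ i, bᵢ αᵢ` of the positive part of the root lattice is encoded as the multiset of
labels which contains `i` with multiplicity `bᵢ`.  These are the strands of the KLR algebra
`R_β`. -/
abbrev black (β : Multiset I) : Multiset (Option I) := β.map some

/-- The strands of the KLRW algebra with black strands `β` and one red strand. -/
abbrev withRed (β : Multiset I) : Multiset (Option I) := none ::ₘ β.map some

/-- The KLR algebra `R_β`. -/
abbrev KLRAlg (β : Multiset I) : Type (max u v) := StrandAlg Q Λ (black β)

/-- The KLRW algebra `R₀(Λ, α)`. -/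
abbrev KLRWAlg (α : Multiset I) : Type (max u v) := StrandAlg Q Λ (withRed α)

/-- The slice of `e(ℓ, r)`: `ℓ` is read left to right and `r` is read right to left. -/
def redWord (ℓ r : List I) : List (Option I) := ℓ.map some ++ none :: r.reverse.map some

/-- The idempotent `e(ℓ, r)` of `R₀(Λ, α)`. -/
abbrev idemLR (α : Multiset I) (ℓ r : List I) : KLRWAlg Q Λ α :=
  idem Q Λ (withRed α) (redWord ℓ r)

/-- The quotient of `StrandAlg` by the two-sided ideal generated by the idempotents `e(w)` for all
words `w` (with strands `S`) such that `kill w`. -/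
def Cut (S : Multiset (Option I)) (kill : List (Option I) → Prop) : Type (max u v) :=
  RingQuot fun x y : StrandAlg Q Λ S => (∃ w : List (Option I), (w : Multiset (Option I)) = S ∧
    kill w ∧ x = idem Q Λ S w) ∧ y = 0

instance (S : Multiset (Option I)) (kill : List (Option I) → Prop) : Ring (Cut Q Λ S kill) :=
  inferInstanceAs (Ring (RingQuot _))

instance (S : Multiset (Option I)) (kill : List (Option I) → Prop) : Algebra 𝕜 (Cut Q Λ S kill) :=
  inferInstanceAs (Algebra 𝕜 (RingQuot _))

/-- The quotient map. -/
def toCut (S : Multiset (Option I)) (kill : List (Option I) → Prop) :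
    StrandAlg Q Λ S →ₐ[𝕜] Cut Q Λ S kill :=
  RingQuot.mkAlgHom 𝕜 _

end Relations

/-! ## Pressures and slopes -/

section Slopes

variable {I : Type u} (χ : I → ℝ)

/-- The pressure `χ(β)`. -/
def pressure (β : Multiset I) : ℝ := (β.map χ).sum

/-- The slope `χ(β) / h(β)`, where the height `h(β)` is the number of labels. -/
def slopeOf (β : Multiset I) : ℝ := pressure χ β / Multiset.card β

/-- The words `ij`, with `i` and `j` non-empty, such that the slope of `i` is less than the slope
of `j`. -/
def NotSemicuspidal (w : List (Option I)) : Prop :=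
  ∃ i j : List I, i ≠ [] ∧ j ≠ [] ∧ w = (i ++ j).map some ∧
    slopeOf χ (i : Multiset I) < slopeOf χ (j : Multiset I)

/-- The slices `(ℓ, r)` such that an initial part of `ℓ` has negative pressure or an initial part
of `r` has positive pressure. -/
def Unsteady (w : List (Option I)) : Prop :=
  ∃ ℓ r : List I, w = redWord ℓ r ∧
    ((∃ m, pressure χ (ℓ.take m : Multiset I) < 0) ∨
      ∃ m, 0 < pressure χ (r.take m : Multiset I))

/-- `(γ_{-s}, …, γ_t)`, as `left = [γ_{-s}, …, γ_{-1}]`, `mid = γ_0`, `right = [γ_1, …, γ_t]`. -/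
@[ext]
structure SlopeDatum (I : Type u) where
  left : List (Multiset I)
  mid : Multiset I
  right : List (Multiset I)

/-- `γ` is a slope datum for `α`: the sum of the `γ_p` is `α`, and the slopes of the `γ_p`, `p ≠ 0`,
are strictly increasing, negative for `p < 0` and positive for `p > 0`. -/
structure SlopeDatum.IsFor (γ : SlopeDatum I) (α : Multiset I) : Prop where
  sum_eq : γ.left.sum + γ.mid + γ.right.sum = α
  left_neg : ∀ β ∈ γ.left, slopeOf χ β < 0
  right_pos : ∀ β ∈ γ.right, 0 < slopeOf χ β
  left_lt : γ.left.Pairwise fun β β' => slopeOf χ β < slopeOf χ β'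
  right_lt : γ.right.Pairwise fun β β' => slopeOf χ β < slopeOf χ β'

/-- The ray from the origin through the point `(m, χ(i₁ + ⋯ + i_m))` is the ray of greatest slope
that meets the graph of `f_i`, its slope is positive, and this is the last point where it meets the
graph. -/
def IsBreak (i : List I) (m : ℕ) : Prop :=
  0 < m ∧ m ≤ i.length ∧ 0 < slopeOf χ (i.take m : Multiset I) ∧
    (∀ k, 0 < k → k ≤ i.length →
      slopeOf χ (i.take k : Multiset I) ≤ slopeOf χ (i.take m : Multiset I)) ∧
    ∀ k, m < k → k ≤ i.length →
      slopeOf χ (i.take k : Multiset I) < slopeOf χ (i.take m : Multiset I)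

open Classical in
/-- The sums of the labels of `i` over the intervals on which `f_i^+` is linear with positive slope
(from left to right), and the sum of the remaining labels. -/
def breakUp (i : List I) : List (Multiset I) × Multiset I :=
  if h : ∃ m, IsBreak χ i m then
    ((i.take h.choose : Multiset I) :: (breakUp (i.drop h.choose)).1,
      (breakUp (i.drop h.choose)).2)
  else ([], i)
termination_by i.length
decreasing_by
  all_goals
    have := h.choose_spec.1
    have := h.choose_spec.2.1
    simp only [List.length_drop]
    omega

/-- The slope datum `γ(ℓ, r)`.  As `f_ℓ^-` for `χ` is the negative of `f_ℓ^+` for `-χ`, the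
construction for `f_ℓ^-` is the one for `f_ℓ^+` applied to `-χ`. -/
def slopeDatum (ℓ r : List I) : SlopeDatum I where
  left := (breakUp (fun i => -χ i) ℓ).1
  mid := (breakUp (fun i => -χ i) ℓ).2 + (breakUp χ r).2
  right := (breakUp χ r).1.reverse

/-- The piecewise linear function on `x ≥ 0` whose graph starts at the origin, moves successively
by the vectors `(h(β), χ(β))` for the `β` in the list, and is then constant. -/
def pathFun : List (Multiset I) → ℝ → ℝ
  | [], _ => 0
  | β :: l, x => if x ≤ Multiset.card β then slopeOf χ β * x
      else pressure χ β + pathFun l (x - Multiset.card β)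

/-- `f_γ^+` -/
def SlopeDatum.fPlus (γ : SlopeDatum I) : ℝ → ℝ := pathFun χ γ.right.reverse

/-- `f_γ^-` -/
def SlopeDatum.fMinus (γ : SlopeDatum I) : ℝ → ℝ := pathFun χ γ.left

/-- `γ ≤ γ'` -/
def SlopeDatum.LE (γ γ' : SlopeDatum I) : Prop :=
  ∀ x : ℝ, 0 ≤ x → γ.fPlus χ x ≤ γ'.fPlus χ x ∧ γ'.fMinus χ x ≤ γ.fMinus χ x

end Slopes

/-! ## Semicuspidal and steadied quotients, standard modules, induction -/

section Modules

variable {I : Type u} {𝕜 : Type v} [CommRing 𝕜] [DecidableEq I]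
variable (Q : I → I → MvPolynomial (Fin 2) 𝕜) (Λ : I → ℕ) (χ : I → ℝ)

/-- The semicuspidal quotient `C_β` of `R_β`. -/
abbrev SemicuspidalAlg (β : Multiset I) : Type (max u v) := Cut Q Λ (black β) (NotSemicuspidal χ)

/-- The steadied quotient `R(χ, Λ, α)` of `R₀(Λ, α)`. -/
abbrev SteadiedAlg (α : Multiset I) : Type (max u v) := Cut Q Λ (withRed α) (Unsteady χ)

/-- The left ideal `R₀(Λ, α) e(ℓ, r)`. -/
abbrev projective (α : Multiset I) (ℓ r : List I) : Submodule (KLRWAlg Q Λ α) (KLRWAlg Q Λ α) :=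
  Submodule.span (KLRWAlg Q Λ α) {idemLR Q Λ α ℓ r}

/-- The submodule of `R₀(Λ, α) e(ℓ, r)` generated by all `e(ℓ', r') R₀(Λ, α) e(ℓ, r)` such that
`γ(ℓ', r') ≤ γ(ℓ, r)` does not hold. -/
def upper (α : Multiset I) (ℓ r : List I) : Submodule (KLRWAlg Q Λ α) (projective Q Λ α ℓ r) :=
  (Submodule.span (KLRWAlg Q Λ α)
    {x | ∃ (ℓ' r' : List I) (a : KLRWAlg Q Λ α), (ℓ' : Multiset I) + (r' : Multiset I) = α ∧
      ¬ (slopeDatum χ ℓ' r').LE χ (slopeDatum χ ℓ r) ∧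
      x = idemLR Q Λ α ℓ' r' * a * idemLR Q Λ α ℓ r}).comap (projective Q Λ α ℓ r).subtype

/-- The standard module `Δ(ℓ, r)`. -/
abbrev StandardLR (α : Multiset I) (ℓ r : List I) : Type (max u v) :=
  projective Q Λ α ℓ r ⧸ upper Q Λ χ α ℓ r

/-- The idempotents `e(ℓ, r)` of `R₀(Λ, α)` with slope datum `γ`. -/
abbrev WordsWith (α : Multiset I) (γ : SlopeDatum I) : Type u :=
  {p : List I × List I // (p.1 : Multiset I) + (p.2 : Multiset I) = α ∧ slopeDatum χ p.1 p.2 = γ}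

/-- The standard module `Δ(γ)`. -/
abbrev Standard (α : Multiset I) (γ : SlopeDatum I) : Type (max u v) :=
  ⨁ p : WordsWith χ α γ, StandardLR Q Λ χ α p.1.1 p.1.2

/-- A part `γ_p` of a slope datum, for `p ≠ 0` (`plain`) or `p = 0` (`centre`). -/
inductive Block (I : Type u) : Type u
  | plain (β : Multiset I) : Block I
  | centre (β : Multiset I) : Block I

/-- The strands of a block. -/
def Block.strands : Block I → Multiset (Option I)
  | .plain β => black β
  | .centre β => withRed β

/-- The words that are killed in the quotient for a block. -/
def Block.kill : Block I → List (Option I) → Prop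
  | .plain _ => NotSemicuspidal χ
  | .centre _ => Unsteady χ

/-- `γ_{-s}, …, γ_0, …, γ_t` as a list of blocks. -/
def SlopeDatum.blocks (γ : SlopeDatum I) : List (Block I) :=
  γ.left.map .plain ++ .centre γ.mid :: γ.right.map .plain

/-- `R_{γ_p}` for `p ≠ 0` and `R₀(Λ, γ_0)` for `p = 0`. -/
abbrev BlockAlg (b : Block I) : Type (max u v) := StrandAlg Q Λ b.strands

/-- `C_{γ_p}` for `p ≠ 0` and `R(χ, Λ, γ_0)` for `p = 0`. -/
abbrev BlockQuot (b : Block I) : Type (max u v) := Cut Q Λ b.strands (b.kill χ)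

theorem blockQuot_plain (β : Multiset I) :
    BlockQuot Q Λ χ (.plain β) = SemicuspidalAlg Q Λ χ β := rfl

theorem blockQuot_centre (β : Multiset I) :
    BlockQuot Q Λ χ (.centre β) = SteadiedAlg Q Λ χ β := rfl

/-- `R_γ = R_{γ_{-s}} ⊗ ⋯ ⊗ R₀(Λ, γ_0) ⊗ ⋯ ⊗ R_{γ_t}`. -/
def RGamma (γ : SlopeDatum I) : Type (max u v) :=
  ⨂[𝕜] p : Fin γ.blocks.length, BlockAlg Q Λ (γ.blocks.get p)

instance (γ : SlopeDatum I) : Ring (RGamma Q Λ γ) :=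
  inferInstanceAs (Ring (⨂[𝕜] p : Fin γ.blocks.length, BlockAlg Q Λ (γ.blocks.get p)))

instance (γ : SlopeDatum I) : Algebra 𝕜 (RGamma Q Λ γ) :=
  inferInstanceAs (Algebra 𝕜 (⨂[𝕜] p : Fin γ.blocks.length, BlockAlg Q Λ (γ.blocks.get p)))

/-- `C_γ = C_{γ_{-s}} ⊗ ⋯ ⊗ R(χ, Λ, γ_0) ⊗ ⋯ ⊗ C_{γ_t}`. -/
def CGamma (γ : SlopeDatum I) : Type (max u v) :=
  ⨂[𝕜] p : Fin γ.blocks.length, BlockQuot Q Λ χ (γ.blocks.get p)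

instance (γ : SlopeDatum I) : Ring (CGamma Q Λ χ γ) :=
  inferInstanceAs (Ring (⨂[𝕜] p : Fin γ.blocks.length, BlockQuot Q Λ χ (γ.blocks.get p)))

instance (γ : SlopeDatum I) : Algebra 𝕜 (CGamma Q Λ χ γ) :=
  inferInstanceAs (Algebra 𝕜 (⨂[𝕜] p : Fin γ.blocks.length, BlockQuot Q Λ χ (γ.blocks.get p)))

/-- The quotient map `R_γ → C_γ`. -/
def toCGamma (γ : SlopeDatum I) : RGamma Q Λ γ →ₐ[𝕜] CGamma Q Λ χ γ :=
  PiTensorProduct.liftAlgHom (R := 𝕜)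
    (A := fun p : Fin γ.blocks.length => BlockAlg Q Λ (γ.blocks.get p))
    (S := ⨂[𝕜] p : Fin γ.blocks.length, BlockQuot Q Λ χ (γ.blocks.get p))
    ((PiTensorProduct.tprod 𝕜).compLinearMap fun p =>
      (toCut Q Λ (γ.blocks.get p).strands ((γ.blocks.get p).kill χ)).toLinearMap)
    (by
      simp only [MultilinearMap.compLinearMap_apply, Pi.one_apply, AlgHom.toLinearMap_apply,
        map_one]
      rfl)
    (by
      intro x y
      simp only [MultilinearMap.compLinearMap_apply, Pi.mul_apply, AlgHom.toLinearMap_apply,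
        map_mul, PiTensorProduct.tprod_mul_tprod]
      rfl)

/-- `C_γ` as a module over `R_γ`. -/
instance (γ : SlopeDatum I) : Module (RGamma Q Λ γ) (CGamma Q Λ χ γ) :=
  Module.compHom _ (toCGamma Q Λ χ γ).toRingHom

/-- Concatenations of words for each of the blocks in a list. -/
def concatWords : List (Block I) → Finset (List (Option I))
  | [] => {[]}
  | b :: l => Finset.image₂ (· ++ ·) (wordsOf b.strands) (concatWords l)

/-- The horizontal composition `1 ⊗ ⋯ ⊗ x ⊗ ⋯ ⊗ 1`, with `x` in the block with number `p`, as an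
element of `R₀(Λ, α)`. -/
def slot (γ : SlopeDatum I) (α : Multiset I) (p : Fin γ.blocks.length) :
    BlockAlg Q Λ (γ.blocks.get p) →ₗ[𝕜] KLRWAlg Q Λ α :=
  ∑ u ∈ concatWords (γ.blocks.take p), ∑ v ∈ concatWords (γ.blocks.drop (p + 1)),
    proj Q Λ (withRed α) ∘ₗ
      (pad Q Λ u v).toLinearMap ∘ₗ incl Q Λ (γ.blocks.get p).strands

/-- Horizontal composition `R_γ → R₀(Λ, α)`: the product of the diagrams with one nontrivial block
each (which commute with each other). -/
def hcomp (γ : SlopeDatum I) (α : Multiset I) : RGamma Q Λ γ →ₗ[𝕜] KLRWAlg Q Λ α :=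
  PiTensorProduct.lift
    ((MultilinearMap.mkPiAlgebraFin 𝕜 γ.blocks.length (KLRWAlg Q Λ α)).compLinearMap
      (slot Q Λ γ α))

/-- Induction: the tensor product `R₀(Λ, α) ⊗ M` over `R_γ`, as the quotient of the tensor product
over `𝕜` by the relations `a r ⊗ m = a ⊗ r m`. -/
abbrev Induced (γ : SlopeDatum I) (α : Multiset I) (M : Type*) [AddCommGroup M] [Module 𝕜 M]
    [Module (RGamma Q Λ γ) M] :=
  (KLRWAlg Q Λ α ⊗[𝕜] M) ⧸ Submodule.span (KLRWAlg Q Λ α)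
    {t : KLRWAlg Q Λ α ⊗[𝕜] M | ∃ (a : KLRWAlg Q Λ α) (r : RGamma Q Λ γ) (m : M),
      t = (a * hcomp Q Λ γ α r) ⊗ₜ[𝕜] m - a ⊗ₜ[𝕜] (r • m)}

end Modules

end KLRW

end

open scoped TensorProduct DirectSum

noncomputable section

namespace KLRW

universe u v

section

/-! ## The braid monoid and shuffles -/

/-! Let `1_γ` denote the image of `1` under horizontal composition: the sum of the idempotents of
all concatenations of words for the blocks of `γ`. The proof combines an algebraic fact about `R₀(Λ,
α) 1_γ` with a convexity fact about words.

The algebraic fact is that `R₀(Λ, α) 1_γ` is a free right `R_γ`-module on the shuffles of the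
blocks. For spanning, each shuffle gets a canonical word in the crossings. Multiplying it by one
more crossing gives another shuffle, or a shuffle followed by a crossing inside a block, or a double
crossing. The first two cases are identities in the positive braid monoid, hence identities of
diagrams up to diagrams with fewer crossings, and the third case lowers the number of crossings
(`crossLT_le_shuffleLT`). For independence, diagrams act on a space whose basis consists of the
arrangements of distinguishable strands, with coefficients in a ring of fractions. There a shuffle
of blocks, above shuffles of single strands in each block, above dots, has a leading term: the
permuted arrangement, with the monomial of the dots as coefficient (`Idx.isLead`). These leading
terms are distinct (`Idx.eq_of_shuf_eq`), so that `fromCodes` is injective, and `R_γ` splits off as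
the summand of the trivial shuffle (`exists_retraction`).

For the convexity, say that a word for a block survives if its idempotent is not among those that
generate the ideal of the quotient algebra for this block. Survival means that the initial parts of
the word lie on the correct side of a line whose slope is that of the block (slope zero for the
central block). Four consequences are used. A shuffle of surviving words has slope datum at most `γ`
(`slopeDatum_shuf_le`). If such a shuffle is again a concatenation of words for the blocks, then it
is trivial (`sorted_of_shuf_eq_cat`). A concatenation with slope datum at most `γ` is made of
surviving words (`good_of_le`). A concatenation of surviving words has slope datum exactly `γ`
(`slopeDatum_cat`), and all words with slope datum `γ` are concatenations (`exists_isWords`).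

The first isomorphism needs only spanning. The induced module is spanned by shuffles of surviving
words, so the idempotents that vanish on the standard module vanish on it too; this gives a map from
the standard module. Conversely, on the standard module the kernel of `R_γ → C_γ` acts by zero,
since concatenations containing a killed word do not have slope datum at most `γ`. The maps exchange
`1 ⊗ 1` with the sum of the generators, so they are inverse to each other.

An endomorphism of the induced module is determined by the image of `1 ⊗ 1`. This image lies in the
part fixed by `1_γ`, which is the image of `C_γ` because only trivial shuffles have a concatenation
as their top. So right multiplication by `C_γ` gives all endomorphisms, and it is faithful because
of the retraction onto `R_γ`. -/

/-- The relations of the positive braid monoid. -/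
inductive BraidRel : FreeMonoid ℕ → FreeMonoid ℕ → Prop
  | comm (i j : ℕ) (h : i + 2 ≤ j) :
      BraidRel (FreeMonoid.of i * FreeMonoid.of j) (FreeMonoid.of j * FreeMonoid.of i)
  | braid (i : ℕ) :
      BraidRel (FreeMonoid.of i * FreeMonoid.of (i + 1) * FreeMonoid.of i)
        (FreeMonoid.of (i + 1) * FreeMonoid.of i * FreeMonoid.of (i + 1))

/-- The positive braid monoid on infinitely many strands. -/
abbrev BraidMonoid : Type := PresentedMonoid BraidRel

/-- The generators of the braid monoid. -/
def braidGen (i : ℕ) : BraidMonoid := PresentedMonoid.of BraidRel i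

/-- The element of the braid monoid given by a list of generators. -/
def braidOf (l : List ℕ) : BraidMonoid := PresentedMonoid.mk BraidRel (FreeMonoid.ofList l)

theorem braidOf_nil : braidOf [] = 1 := rfl

theorem braidOf_append (l l' : List ℕ) : braidOf (l ++ l') = braidOf l * braidOf l' := by
  simp [braidOf, FreeMonoid.ofList_append]

theorem braidOf_singleton (i : ℕ) : braidOf [i] = braidGen i := rfl

theorem braidOf_cons (i : ℕ) (l : List ℕ) : braidOf (i :: l) = braidGen i * braidOf l :=
  braidOf_append [i] l

theorem braidGen_comm {i j : ℕ} (h : i + 2 ≤ j) :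
    braidGen i * braidGen j = braidGen j * braidGen i :=
  (Con.eq _).2 (ConGen.Rel.of _ _ (BraidRel.comm i j h))

theorem braidGen_braid (i : ℕ) :
    braidGen i * braidGen (i + 1) * braidGen i =
      braidGen (i + 1) * braidGen i * braidGen (i + 1) :=
  (Con.eq _).2 (ConGen.Rel.of _ _ (BraidRel.braid i))

theorem conGen_of_braidOf_eq {l l' : List ℕ} (h : braidOf l = braidOf l') :
    ConGen.Rel BraidRel (FreeMonoid.ofList l) (FreeMonoid.ofList l') :=
  (Con.eq _).1 h

/-- Adding a strand on the left of a braid. -/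
def braidShift : BraidMonoid →* BraidMonoid :=
  PresentedMonoid.lift (fun i => braidGen (i + 1)) (by
    intro a b h
    cases h with
    | comm i j h => simpa using braidGen_comm (by omega)
    | braid i => simpa using braidGen_braid (i + 1))

theorem braidShift_gen (i : ℕ) : braidShift (braidGen i) = braidGen (i + 1) := by
  simp [braidShift, braidGen]

theorem braidShift_of (l : List ℕ) : braidShift (braidOf l) = braidOf (l.map (· + 1)) := by
  induction l with
  | nil => simp [braidOf_nil]
  | cons i l ih => rw [braidOf_cons, map_mul, ih, braidShift_gen, List.map_cons, braidOf_cons]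

/-- The braid in which the strand number `m` moves to the left end. -/
def toFront (m : ℕ) : BraidMonoid := braidOf (List.range m)

theorem toFront_succ (m : ℕ) : toFront (m + 1) = toFront m * braidGen m := by
  rw [toFront, List.range_succ, braidOf_append]; rfl

theorem toFront_succ' (m : ℕ) : toFront (m + 1) = braidGen 0 * braidShift (toFront m) := by
  rw [toFront, List.range_succ_eq_map, braidOf_cons, toFront, braidShift_of]

theorem braidGen_toFront_of_lt {m j : ℕ} (h : m < j) :
    braidGen j * toFront m = toFront m * braidGen j := by
  induction m with
  | zero => simp [toFront, braidOf_nil]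
  | succ m ih =>
    rw [toFront_succ, ← mul_assoc, ih (by omega), mul_assoc, mul_assoc,
      braidGen_comm (i := m) (j := j) (by omega)]

/-- The crossing slides through the strand that moves to the front. The crossed strands are pushed
one place to the right by that strand, which explains the shift of the index; when the moving strand
starts directly to the right of them, this is the braid relation. -/
theorem braidGen_succ_toFront {m j : ℕ} (h : j + 1 < m) :
    braidGen (j + 1) * toFront m = toFront m * braidGen j := by
  induction m with
  | zero => omega
  | succ m ih =>
    rcases Nat.lt_or_ge (j + 1) m with h' | h'
    · rw [toFront_succ, ← mul_assoc, ih h', mul_assoc, mul_assoc,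
        braidGen_comm (i := j) (j := m) (by omega)]
    · obtain rfl : m = j + 1 := by omega
      rw [toFront_succ, toFront_succ, ← mul_assoc, ← mul_assoc,
        braidGen_toFront_of_lt (by omega), mul_assoc, mul_assoc, mul_assoc, mul_assoc,
        ← mul_assoc (braidGen (j + 1)), ← braidGen_braid, mul_assoc]

theorem toFront_mul_toFront {m n : ℕ} (h : m ≤ n) :
    toFront (n + 1) * toFront m = braidShift (toFront m) * toFront (n + 1) := by
  induction m with
  | zero => simp [toFront, braidOf_nil]
  | succ m ih =>
    rw [toFront_succ m, ← mul_assoc, ih (by omega), map_mul, braidShift_gen, mul_assoc, mul_assoc,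
      braidGen_succ_toFront (by omega)]

/-- Both sides bring the strands `n + 1` and `m` to the front, in this order. The left side fetches
`m` first, then `n + 1` behind it, and crosses them at the end; the right side fetches `n + 1`
first. -/
theorem braidGen_zero_shift_toFront {m n : ℕ} (h : m ≤ n) :
    braidGen 0 * (braidShift (toFront n) * toFront m) =
      braidShift (toFront m) * toFront (n + 1) := by
  rw [← mul_assoc, ← toFront_succ', toFront_mul_toFront h]

/-- The position of the first strand of the block `p`. -/
def off (lens : ℕ → ℕ) (p : ℕ) : ℕ := ∑ q ∈ Finset.range p, lens q

/-- Removing one strand from the block `p`. -/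
def dec (lens : ℕ → ℕ) (p : ℕ) : ℕ → ℕ := Function.update lens p (lens p - 1)

/-- The strands `j` and `j + 1` belong to the same block. -/
def SameBlock (lens : ℕ → ℕ) (j : ℕ) : Prop := ∃ p, off lens p ≤ j ∧ j + 1 < off lens (p + 1)

/-- The shuffle with code `c` takes the strands for the positions from left to right from the
blocks listed in `c`.  This is a list of crossings (from top to bottom) for it. -/
def canon : List ℕ → (ℕ → ℕ) → List ℕ
  | [], _ => []
  | p :: c, lens => (canon c (dec lens p)).map (· + 1) ++ List.range (off lens p)

/-- Every block is used up by the shuffle with code `c`. -/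
def IsCode (c : List ℕ) (lens : ℕ → ℕ) : Prop := ∀ p, c.count p = lens p

theorem off_succ (lens : ℕ → ℕ) (p : ℕ) : off lens (p + 1) = off lens p + lens p :=
  Finset.sum_range_succ _ _

theorem off_mono (lens : ℕ → ℕ) : Monotone (off lens) :=
  monotone_nat_of_le_succ fun p => by rw [off_succ]; omega

theorem off_dec_of_le {lens : ℕ → ℕ} {p q : ℕ} (h : q ≤ p) : off (dec lens p) q = off lens q := by
  refine Finset.sum_congr rfl fun x hx => ?_
  rw [Finset.mem_range] at hx
  exact Function.update_of_ne (by omega) _ _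

theorem off_dec_of_lt {lens : ℕ → ℕ} {p q : ℕ} (h : p < q) (hp : 0 < lens p) :
    off (dec lens p) q + 1 = off lens q := by
  induction q with
  | zero => omega
  | succ q ih =>
    rw [off_succ, off_succ]
    rcases Nat.lt_or_ge p q with h' | h'
    · rw [← ih h', dec, Function.update_of_ne (by omega)]; omega
    · obtain rfl : p = q := by omega
      rw [off_dec_of_le le_rfl, dec, Function.update_self]; omega

theorem IsCode.pos {p : ℕ} {c : List ℕ} {lens : ℕ → ℕ} (h : IsCode (p :: c) lens) :
    0 < lens p := by
  rw [← h p]; simp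

theorem IsCode.tail {p : ℕ} {c : List ℕ} {lens : ℕ → ℕ} (h : IsCode (p :: c) lens) :
    IsCode c (dec lens p) := by
  intro q
  have := h q
  by_cases hq : q = p
  · subst hq
    simp only [List.count_cons_self] at this
    simp [dec, ← this]
  · rw [dec, Function.update_of_ne hq, ← this, List.count_cons_of_ne (Ne.symm hq)]

theorem IsCode.perm {c c' : List ℕ} {lens : ℕ → ℕ} (h : IsCode c lens) (hp : c'.Perm c) :
    IsCode c' lens := fun p => by rw [hp.count_eq, h p]

theorem IsCode.eq_perm {c c' : List ℕ} {lens : ℕ → ℕ} (h : IsCode c lens) (h' : IsCode c' lens) :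
    c.Perm c' := List.perm_iff_count.2 fun p => by rw [h p, h' p]

theorem dec_dec_comm (lens : ℕ → ℕ) (p q : ℕ) : dec (dec lens p) q = dec (dec lens q) p := by
  rcases eq_or_ne p q with rfl | h
  · rfl
  · rw [dec, dec, dec, dec, Function.update_of_ne h.symm, Function.update_of_ne h,
      Function.update_comm h]

theorem braidOf_canon_cons (p : ℕ) (c : List ℕ) (lens : ℕ → ℕ) :
    braidOf (canon (p :: c) lens) =
      braidShift (braidOf (canon c (dec lens p))) * toFront (off lens p) := by
  rw [canon, braidOf_append, braidShift_of]; rfl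

theorem braidGen_zero_shift_shift (l : List ℕ) :
    braidGen 0 * braidShift (braidShift (braidOf l)) =
      braidShift (braidShift (braidOf l)) * braidGen 0 := by
  induction l with
  | nil => simp [braidOf_nil]
  | cons i l ih =>
    simp only [braidOf_cons, map_mul, braidShift_gen]
    rw [← mul_assoc, braidGen_comm (by omega), mul_assoc, ih, mul_assoc]

/-- Strands from the blocks `p < q` that are adjacent at the top have not been crossed yet, so
crossing them gives the shuffle with the two entries exchanged. The equality already holds for
positive braids, and no statement about reduced words is needed. After the common initial part of
the code is removed, it is `braidGen_zero_shift_toFront`. -/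
theorem braidGen_mul_canon_of_lt {p q : ℕ} (hpq : p < q) (c₂ : List ℕ) :
    ∀ (c₁ : List ℕ) (lens : ℕ → ℕ), IsCode (c₁ ++ p :: q :: c₂) lens →
      braidGen c₁.length * braidOf (canon (c₁ ++ p :: q :: c₂) lens) =
        braidOf (canon (c₁ ++ q :: p :: c₂) lens)
  | [], lens, h => by
    have hp : 0 < lens p := h.pos
    have hq := off_dec_of_lt hpq hp
    have hm : off lens p ≤ off (dec lens p) q := by
      rw [← off_dec_of_le (lens := lens) (le_refl p)]
      exact off_mono _ hpq.le
    simp only [List.nil_append, List.length_nil, braidOf_canon_cons]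
    rw [dec_dec_comm, off_dec_of_le hpq.le, map_mul, mul_assoc, ← mul_assoc,
      braidGen_zero_shift_shift, mul_assoc, braidGen_zero_shift_toFront hm, hq, map_mul, mul_assoc]
  | r :: c₁, lens, h => by
    have ih := braidGen_mul_canon_of_lt hpq c₂ c₁ (dec lens r) h.tail
    rw [List.cons_append, braidOf_canon_cons, List.length_cons, ← braidShift_gen, ← mul_assoc,
      ← map_mul, ih, List.cons_append, braidOf_canon_cons]

/-- Two consecutive strands taken from the same block are neighbours at the bottom and run in
parallel through the shuffle. Hence a crossing on top of them slides down to the bottom, where it is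
a crossing inside a block. -/
theorem braidGen_mul_canon_of_eq {p : ℕ} (c₂ : List ℕ) :
    ∀ (c₁ : List ℕ) (lens : ℕ → ℕ), IsCode (c₁ ++ p :: p :: c₂) lens →
      ∃ j, SameBlock lens j ∧
        braidGen c₁.length * braidOf (canon (c₁ ++ p :: p :: c₂) lens) =
          braidOf (canon (c₁ ++ p :: p :: c₂) lens) * braidGen j
  | [], lens, h => by
    refine ⟨off lens p, ⟨p, le_rfl, ?_⟩, ?_⟩
    · rw [off_succ, ← h p]; simp
    · simp only [List.nil_append, List.length_nil, braidOf_canon_cons]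
      rw [off_dec_of_le le_rfl, map_mul, mul_assoc, ← mul_assoc,
        braidGen_zero_shift_shift, mul_assoc, braidGen_zero_shift_toFront le_rfl, toFront_succ]
      simp only [mul_assoc]
  | r :: c₁, lens, h => by
    obtain ⟨j, ⟨s, hs, hs'⟩, hj⟩ := braidGen_mul_canon_of_eq c₂ c₁ (dec lens r) h.tail
    have hr : 0 < lens r := h.pos
    have key : ∀ j', braidGen (j + 1) * toFront (off lens r) = toFront (off lens r) * braidGen j' →
        braidGen (r :: c₁).length * braidOf (canon (r :: c₁ ++ p :: p :: c₂) lens) =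
          braidOf (canon (r :: c₁ ++ p :: p :: c₂) lens) * braidGen j' := by
      intro j' hj'
      rw [List.cons_append, braidOf_canon_cons, List.length_cons, ← braidShift_gen, ← mul_assoc,
        ← map_mul, hj, map_mul, mul_assoc, braidShift_gen, hj', mul_assoc]
    -- Numbering at the bottom includes the strand taken from the block `r`. If the crossing lies in
    -- an earlier block, that strand passes across it and the shift by one is undone. Otherwise that
    -- strand stays on its left, and the position at the bottom is `j + 1`.
    rcases Nat.lt_or_ge s r with hsr | hsr
    · rw [off_dec_of_le (by omega)] at hs hs'
      refine ⟨j, ⟨s, hs, hs'⟩, key j (braidGen_succ_toFront ?_)⟩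
      exact hs'.trans_le (off_mono _ hsr)
    · have h1 : off lens r ≤ j := by
        rw [← off_dec_of_le (lens := lens) (le_refl r)]
        exact (off_mono _ hsr).trans hs
      have h2 := off_dec_of_lt (lens := lens) (p := r) (q := s + 1) (by omega) hr
      refine ⟨j + 1, ⟨s, ?_, by omega⟩, key (j + 1) (braidGen_toFront_of_lt (by omega))⟩
      rcases hsr.eq_or_lt with rfl | hsr
      · omega
      · have := off_dec_of_lt hsr hr
        omega

end

section

/-! ## Monomials in the generators, filtered by the number of crossings -/

section Swap

variable {X : Type*}

/-- Swapping the entries number `k` and `k + 1` of a list. -/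
def sw (w : List X) (k : ℕ) : List X :=
  match w.drop k with
  | a :: b :: v => w.take k ++ b :: a :: v
  | _ => w

/-- Applying a sequence of swaps, the last one of the list first. -/
def act (ks : List ℕ) (w : List X) : List X := ks.foldr (fun k w => sw w k) w

theorem sw_eq {w u v : List X} {a b : X} {k : ℕ} (h : w = u ++ a :: b :: v) (hk : k = u.length) :
    sw w k = u ++ b :: a :: v := by
  subst h hk; simp [sw]

theorem exists_eq_append_cons_cons {w : List X} {k : ℕ} (h : k + 1 < w.length) :
    ∃ u a b v, w = u ++ a :: b :: v ∧ k = u.length := by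
  refine ⟨w.take k, w[k], w[k + 1], w.drop (k + 2), ?_, by simp; omega⟩
  rw [← List.drop_eq_getElem_cons, ← List.drop_eq_getElem_cons, List.take_append_drop]

theorem sw_of_le {w : List X} {k : ℕ} (h : w.length ≤ k + 1) : sw w k = w := by
  unfold sw
  split
  · next a b v hv =>
    have := congrArg List.length hv
    simp at this; omega
  · rfl

theorem sw_perm (w : List X) (k : ℕ) : (sw w k).Perm w := by
  rcases Nat.lt_or_ge (k + 1) w.length with h | h
  · obtain ⟨u, a, b, v, rfl, rfl⟩ := exists_eq_append_cons_cons h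
    rw [sw_eq rfl rfl]
    exact (List.Perm.swap _ _ _).append_left _
  · rw [sw_of_le h]

@[simp] theorem act_nil (w : List X) : act [] w = w := rfl

@[simp] theorem act_cons (k : ℕ) (ks : List ℕ) (w : List X) : act (k :: ks) w = sw (act ks w) k :=
  rfl

theorem act_append (ks ks' : List ℕ) (w : List X) : act (ks ++ ks') w = act ks (act ks' w) := by
  simp [act]

theorem act_perm (ks : List ℕ) (w : List X) : (act ks w).Perm w := by
  induction ks with
  | nil => rfl
  | cons k ks ih => exact (sw_perm _ _).trans ih

@[simp] theorem length_act (ks : List ℕ) (w : List X) : (act ks w).length = w.length :=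
  (act_perm ks w).length_eq

theorem sw_map {Y : Type*} (f : X → Y) (w : List X) (k : ℕ) : sw (w.map f) k = (sw w k).map f := by
  rcases Nat.lt_or_ge (k + 1) w.length with h | h
  · obtain ⟨u, a, b, v, rfl, rfl⟩ := exists_eq_append_cons_cons h
    rw [sw_eq rfl rfl, sw_eq (u := u.map f) (a := f a) (b := f b) (v := v.map f) (by simp)
      (by simp)]
    simp
  · rw [sw_of_le h, sw_of_le (by simpa)]

theorem act_map {Y : Type*} (f : X → Y) (ks : List ℕ) (w : List X) :
    act ks (w.map f) = (act ks w).map f := by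
  induction ks with
  | nil => rfl
  | cons k ks ih => rw [act_cons, ih, sw_map, act_cons]

end Swap

variable {I : Type u} {𝕜 : Type v} [CommRing 𝕜] [DecidableEq I]
variable (Q : I → I → MvPolynomial (Fin 2) 𝕜) (Λ : I → ℕ)

/-- A dot, as an element of `Diagrams`. -/
def dDot (u : List (Option I)) (i : I) (v : List (Option I)) : Diagrams Q Λ :=
  RingQuot.mkAlgHom 𝕜 (Rel Q Λ) (fDot 𝕜 u i v)

/-- A crossing, as an element of `Diagrams`. -/
def dCross (u : List (Option I)) (a b : Option I) (v : List (Option I)) : Diagrams Q Λ :=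
  RingQuot.mkAlgHom 𝕜 (Rel Q Λ) (fCross 𝕜 u a b v)

theorem mk_rel {x y : FreeAlgebra 𝕜 (Gen I)} (h : Rel Q Λ x y) :
    RingQuot.mkAlgHom 𝕜 (Rel Q Λ) x = RingQuot.mkAlgHom 𝕜 (Rel Q Λ) y :=
  RingQuot.mkAlgHom_rel 𝕜 h

theorem dId_mul_dDot (u : List (Option I)) (i : I) (v : List (Option I)) :
    dId Q Λ (u ++ some i :: v) * dDot Q Λ u i v = dDot Q Λ u i v := by
  simpa [dId, dDot, Piece.tgt] using mk_rel Q Λ (Rel.tgt_mul u (.dot i) v)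

theorem dDot_mul_dId (u : List (Option I)) (i : I) (v : List (Option I)) :
    dDot Q Λ u i v * dId Q Λ (u ++ some i :: v) = dDot Q Λ u i v := by
  simpa [dId, dDot, Piece.src] using mk_rel Q Λ (Rel.mul_src u (.dot i) v)

theorem dId_mul_dCross (u : List (Option I)) (a b : Option I) (v : List (Option I)) :
    dId Q Λ (u ++ b :: a :: v) * dCross Q Λ u a b v = dCross Q Λ u a b v := by
  simpa [dId, dCross, Piece.tgt] using mk_rel Q Λ (Rel.tgt_mul u (.cross a b) v)

theorem dCross_mul_dId (u : List (Option I)) (a b : Option I) (v : List (Option I)) :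
    dCross Q Λ u a b v * dId Q Λ (u ++ a :: b :: v) = dCross Q Λ u a b v := by
  simpa [dId, dCross, Piece.src] using mk_rel Q Λ (Rel.mul_src u (.cross a b) v)

/-- Products of dots, and of crossings at positions in `P`, with bottom `w`.  The indices are the
number of crossings, the top and the product. -/
inductive Mon (P : ℕ → Prop) (w : List (Option I)) :
    ℕ → List (Option I) → Diagrams Q Λ → Prop
  | one : Mon P w 0 w (dId Q Λ w)
  | dot {l u i v x} (h : Mon P w l (u ++ some i :: v) x) :
      Mon P w l (u ++ some i :: v) (dDot Q Λ u i v * x)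
  | cross {l u a b v x} (hP : P u.length) (h : Mon P w l (u ++ a :: b :: v) x) :
      Mon P w (l + 1) (u ++ b :: a :: v) (dCross Q Λ u a b v * x)

/-- All linear combinations of diagrams with bottom `w` and less than `n` crossings. -/
def crossLT (w : List (Option I)) (n : ℕ) : Submodule 𝕜 (Diagrams Q Λ) :=
  Submodule.span 𝕜 {x | ∃ l < n, ∃ w', Mon Q Λ (fun _ => True) w l w' x}

variable {Q Λ}

theorem Mon.dId_mul {P w l w' x} (h : Mon Q Λ P w l w' x) : dId Q Λ w' * x = x := by
  cases h with
  | one => exact dId_mul_self Q Λ w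
  | dot h => rw [← mul_assoc, dId_mul_dDot]
  | cross hP h => rw [← mul_assoc, dId_mul_dCross]

theorem Mon.mul_dId {P w l w' x} (h : Mon Q Λ P w l w' x) : x * dId Q Λ w = x := by
  induction h with
  | one => exact dId_mul_self Q Λ w
  | dot h ih => rw [mul_assoc, ih]
  | cross hP h ih => rw [mul_assoc, ih]

theorem Mon.perm {P w l w' x} (h : Mon Q Λ P w l w' x) : w'.Perm w := by
  induction h with
  | one => rfl
  | dot h ih => exact ih
  | cross hP h ih => exact ((List.Perm.swap _ _ _).append_left _).trans ih

theorem Mon.mono {P P' : ℕ → Prop} (hP : ∀ k, P k → P' k) {w l w' x} (h : Mon Q Λ P w l w' x) :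
    Mon Q Λ P' w l w' x := by
  induction h with
  | one => exact .one
  | dot h ih => exact .dot ih
  | cross hk h ih => exact .cross (hP _ hk) ih

theorem Mon.trans {P w l w' x} (h : Mon Q Λ P w l w' x) {l' w'' y} (h' : Mon Q Λ P w' l' w'' y) :
    Mon Q Λ P w (l' + l) w'' (y * x) := by
  induction h' with
  | one => rw [h.dId_mul, zero_add]; exact h
  | dot h' ih => rw [mul_assoc]; exact .dot ih
  | cross hk h' ih => rw [mul_assoc, Nat.add_right_comm]; exact .cross hk ih

theorem dId_mul_of_ne {P w l w' x} (h : Mon Q Λ P w l w' x) {w₁} (hw : w₁ ≠ w') :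
    dId Q Λ w₁ * x = 0 := by
  rw [← h.dId_mul, ← mul_assoc, dId_mul_ne Q Λ hw, zero_mul]

theorem dDot_mul_of_ne {P w l w' x} (h : Mon Q Λ P w l w' x) {u i v} (hw : u ++ some i :: v ≠ w') :
    dDot Q Λ u i v * x = 0 := by
  rw [← dDot_mul_dId, mul_assoc, dId_mul_of_ne h hw, mul_zero]

theorem dCross_mul_of_ne {P w l w' x} (h : Mon Q Λ P w l w' x) {u a b v}
    (hw : u ++ a :: b :: v ≠ w') : dCross Q Λ u a b v * x = 0 := by
  rw [← dCross_mul_dId, mul_assoc, dId_mul_of_ne h hw, mul_zero]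

theorem Mon.mem_crossLT {P w l w' x} (h : Mon Q Λ P w l w' x) {n} (hn : l < n) :
    x ∈ crossLT Q Λ w n :=
  Submodule.subset_span ⟨l, hn, w', h.mono fun _ _ => trivial⟩

theorem dId_mem_crossLT (w : List (Option I)) {n} (hn : 0 < n) : dId Q Λ w ∈ crossLT Q Λ w n :=
  (Mon.one (P := fun _ => True)).mem_crossLT hn

theorem crossLT_mono (w : List (Option I)) {m n : ℕ} (h : m ≤ n) :
    crossLT Q Λ w m ≤ crossLT Q Λ w n :=
  Submodule.span_mono fun _ ⟨l, hl, w', hx⟩ => ⟨l, hl.trans_le h, w', hx⟩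

theorem mul_mem_of_span {R A : Type*} [CommRing R] [Ring A] [Algebra R A] {s : Set A}
    {N : Submodule R A} (y : A) (h : ∀ x ∈ s, y * x ∈ N) {x : A} (hx : x ∈ Submodule.span R s) :
    y * x ∈ N := by
  induction hx using Submodule.span_induction with
  | mem x hx => exact h x hx
  | zero => rw [mul_zero]; exact N.zero_mem
  | add x z _ _ hx hz => rw [mul_add]; exact N.add_mem hx hz
  | smul c x _ hx => rw [mul_smul_comm]; exact N.smul_mem c hx

theorem mul_mem_of_span' {R A : Type*} [CommRing R] [Ring A] [Algebra R A] {s : Set A}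
    {N : Submodule R A} (y : A) (h : ∀ x ∈ s, x * y ∈ N) {x : A} (hx : x ∈ Submodule.span R s) :
    x * y ∈ N := by
  induction hx using Submodule.span_induction with
  | mem x hx => exact h x hx
  | zero => rw [zero_mul]; exact N.zero_mem
  | add x z _ _ hx hz => rw [add_mul]; exact N.add_mem hx hz
  | smul c x _ hx => rw [smul_mul_assoc]; exact N.smul_mem c hx

theorem Mon.mul_crossLT {P w' l w'' y} (h : Mon Q Λ P w' l w'' y) {w n x}
    (hx : x ∈ crossLT Q Λ w n) : y * x ∈ crossLT Q Λ w (l + n) := by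
  refine mul_mem_of_span y ?_ hx
  rintro x ⟨l', hl', w₁, hx⟩
  by_cases hw : w' = w₁
  · subst hw
    exact (hx.trans (h.mono fun _ _ => trivial)).mem_crossLT (by omega)
  · rw [← h.mul_dId, mul_assoc, dId_mul_of_ne hx hw, mul_zero]
    exact Submodule.zero_mem _

theorem crossLT_mul {P w l w' x} (h : Mon Q Λ P w l w' x) {n y}
    (hy : y ∈ crossLT Q Λ w' n) : y * x ∈ crossLT Q Λ w (n + l) := by
  refine mul_mem_of_span' x ?_ hy
  rintro y ⟨l', hl', w₁, hy⟩
  exact ((h.mono fun _ _ => trivial).trans hy).mem_crossLT (by omega)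

theorem dDot_mul_crossLT {w n x u i v} (hx : x ∈ crossLT Q Λ w n) :
    dDot Q Λ u i v * x ∈ crossLT Q Λ w n := by
  have h : Mon Q Λ (fun _ => True) (u ++ some i :: v) 0 (u ++ some i :: v) (dDot Q Λ u i v) := by
    have := Mon.dot (Mon.one (Q := Q) (Λ := Λ) (P := fun _ => True) (w := u ++ some i :: v))
    rwa [dDot_mul_dId] at this
  simpa using h.mul_crossLT hx

theorem pow_mul_mem {A : Type*} [Ring A] [Algebra 𝕜 A] {N : Submodule 𝕜 A} {y : A}
    (h : ∀ x ∈ N, y * x ∈ N) (m : ℕ) : ∀ x ∈ N, y ^ m * x ∈ N := by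
  induction m with
  | zero => simp
  | succ m ih => intro x hx; rw [pow_succ, mul_assoc]; exact ih _ (h _ hx)

/-! ### The crossing at a given position, and sequences of crossings -/

variable (Q Λ)

/-- The crossing of the strands `k` and `k + 1` of `w`. -/
def cr (w : List (Option I)) (k : ℕ) : Diagrams Q Λ :=
  match w.drop k with
  | a :: b :: v => dCross Q Λ (w.take k) a b v
  | _ => 0

/-- A sequence of crossings, from top to bottom, with bottom `w`. -/
def path : List ℕ → List (Option I) → Diagrams Q Λ
  | [], w => dId Q Λ w
  | k :: ks, w => cr Q Λ (act ks w) k * path ks w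

variable {Q Λ}

theorem cr_eq {w u v : List (Option I)} {a b : Option I} {k : ℕ} (h : w = u ++ a :: b :: v)
    (hk : k = u.length) : cr Q Λ w k = dCross Q Λ u a b v := by
  subst h hk; simp [cr]

theorem Mon.cr_mul {P w l w' x k} (h : Mon Q Λ P w l w' x) (hk : k + 1 < w'.length) (hP : P k) :
    Mon Q Λ P w (l + 1) (sw w' k) (cr Q Λ w' k * x) := by
  obtain ⟨u, a, b, v, rfl, rfl⟩ := exists_eq_append_cons_cons hk
  rw [cr_eq rfl rfl, sw_eq rfl rfl]
  exact .cross hP h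

theorem cr_mul_dId {w : List (Option I)} {k : ℕ} (hk : k + 1 < w.length) :
    cr Q Λ w k * dId Q Λ w = cr Q Λ w k := by
  obtain ⟨u, a, b, v, rfl, rfl⟩ := exists_eq_append_cons_cons hk
  rw [cr_eq rfl rfl, dCross_mul_dId]

theorem path_mon {P : ℕ → Prop} (w : List (Option I)) {ks : List ℕ}
    (h : ∀ k ∈ ks, k + 1 < w.length ∧ P k) :
    Mon Q Λ P w ks.length (act ks w) (path Q Λ ks w) := by
  induction ks with
  | nil => exact .one
  | cons k ks ih =>
    exact (ih fun k hk => h k (List.mem_cons_of_mem _ hk)).cr_mul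
      (by simpa using (h k List.mem_cons_self).1) (h k List.mem_cons_self).2

theorem path_mon' (w : List (Option I)) {ks : List ℕ} (h : ∀ k ∈ ks, k + 1 < w.length) :
    Mon Q Λ (fun _ => True) w ks.length (act ks w) (path Q Λ ks w) :=
  path_mon w fun k hk => ⟨h k hk, trivial⟩

theorem path_append (ks ks' : List ℕ) {w : List (Option I)} (h : ∀ k ∈ ks', k + 1 < w.length) :
    path Q Λ (ks ++ ks') w = path Q Λ ks (act ks' w) * path Q Λ ks' w := by
  induction ks with
  | nil => exact ((path_mon' w h).dId_mul).symm
  | cons k ks ih => rw [List.cons_append, path, ih, act_append, path, mul_assoc]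

/-! ### The relations up to diagrams with fewer crossings -/

theorem dId_commute_dDot {w u v : List (Option I)} {i : I} (h : w = u ++ some i :: v) :
    dId Q Λ w * dDot Q Λ u i v = dDot Q Λ u i v * dId Q Λ w := by
  subst h; rw [dId_mul_dDot, dDot_mul_dId]

theorem commute_pow_pow {A : Type*} [Ring A] {e y z : A} (hy : e * y = y * e) (hz : e * z = z * e)
    (m n : ℕ) : e * (y ^ m * z ^ n) = y ^ m * (z ^ n * e) := by
  have h1 : Commute e (y ^ m) := Commute.pow_right hy m
  have h2 : Commute e (z ^ n) := Commute.pow_right hz n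
  rw [← mul_assoc, h1.eq, mul_assoc, h2.eq]

theorem dId_mul_divPow_mem {w : List (Option I)} {y z : Diagrams Q Λ}
    (hy : dId Q Λ w * y = y * dId Q Λ w) (hz : dId Q Λ w * z = z * dId Q Λ w)
    (hy' : ∀ x ∈ crossLT Q Λ w 1, y * x ∈ crossLT Q Λ w 1)
    (hz' : ∀ x ∈ crossLT Q Λ w 1, z * x ∈ crossLT Q Λ w 1) (p : ℕ) :
    dId Q Λ w * divPow p y z ∈ crossLT Q Λ w 1 := by
  rw [divPow, Finset.mul_sum]
  refine Submodule.sum_mem _ fun a _ => ?_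
  rw [commute_pow_pow hy hz]
  exact pow_mul_mem hy' _ _ (pow_mul_mem hz' _ _ (dId_mem_crossLT w one_pos))

theorem dId_mul_divDiff_mem {w : List (Option I)} {x y z : Diagrams Q Λ}
    (hx : dId Q Λ w * x = x * dId Q Λ w) (hy : dId Q Λ w * y = y * dId Q Λ w)
    (hz : dId Q Λ w * z = z * dId Q Λ w)
    (hx' : ∀ t ∈ crossLT Q Λ w 1, x * t ∈ crossLT Q Λ w 1)
    (hy' : ∀ t ∈ crossLT Q Λ w 1, y * t ∈ crossLT Q Λ w 1)
    (hz' : ∀ t ∈ crossLT Q Λ w 1, z * t ∈ crossLT Q Λ w 1) (R : MvPolynomial (Fin 2) 𝕜) :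
    dId Q Λ w * divDiff R x y z ∈ crossLT Q Λ w 1 := by
  rw [divDiff, Finset.mul_sum]
  refine Submodule.sum_mem _ fun m _ => ?_
  rw [mul_smul_comm, divPow, Finset.sum_mul, Finset.mul_sum]
  refine Submodule.smul_mem _ _ (Submodule.sum_mem _ fun a _ => ?_)
  have h1 : dId Q Λ w * y ^ m 1 = y ^ m 1 * dId Q Λ w := Commute.pow_right (show Commute _ _ from hy) _
  rw [← mul_assoc, commute_pow_pow hx hz, mul_assoc, mul_assoc, h1]
  exact pow_mul_mem hx' _ _ (pow_mul_mem hz' _ _ (pow_mul_mem hy' _ _ (dId_mem_crossLT w one_pos)))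

theorem dId_mul_eval₂_mem {w : List (Option I)} {y z : Diagrams Q Λ}
    (hy : dId Q Λ w * y = y * dId Q Λ w) (hz : dId Q Λ w * z = z * dId Q Λ w)
    (hy' : ∀ t ∈ crossLT Q Λ w 1, y * t ∈ crossLT Q Λ w 1)
    (hz' : ∀ t ∈ crossLT Q Λ w 1, z * t ∈ crossLT Q Λ w 1) (R : MvPolynomial (Fin 2) 𝕜) :
    dId Q Λ w * eval₂ R y z ∈ crossLT Q Λ w 1 := by
  rw [eval₂, Finset.mul_sum]
  refine Submodule.sum_mem _ fun m _ => ?_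
  rw [mul_smul_comm, commute_pow_pow hy hz]
  exact Submodule.smul_mem _ _ (pow_mul_mem hy' _ _ (pow_mul_mem hz' _ _
    (dId_mem_crossLT w one_pos)))

theorem map_divPow {A B : Type*} [Ring A] [Ring B] [Algebra 𝕜 A] [Algebra 𝕜 B] (f : A →ₐ[𝕜] B)
    (p : ℕ) (x z : A) : f (divPow p x z) = divPow p (f x) (f z) := by
  simp [divPow]

theorem map_divDiff {A B : Type*} [Ring A] [Ring B] [Algebra 𝕜 A] [Algebra 𝕜 B] (f : A →ₐ[𝕜] B)
    (R : MvPolynomial (Fin 2) 𝕜) (x y z : A) : f (divDiff R x y z) = divDiff R (f x) (f y) (f z) := by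
  simp [divDiff, map_divPow]

theorem map_eval₂ {A B : Type*} [Ring A] [Ring B] [Algebra 𝕜 A] [Algebra 𝕜 B] (f : A →ₐ[𝕜] B)
    (R : MvPolynomial (Fin 2) 𝕜) (y z : A) : f (eval₂ R y z) = eval₂ R (f y) (f z) := by
  simp [eval₂]

/-- In each case the defining relation replaces the double crossing by a polynomial in dots (or
zero), and the filtration does not count dots. -/
theorem dCross_dCross_mem (u : List (Option I)) (a b : Option I) (v : List (Option I)) :
    dCross Q Λ u b a v * dCross Q Λ u a b v ∈ crossLT Q Λ (u ++ a :: b :: v) 1 := by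
  by_cases hab : a = b
  · subst hab
    have := mk_rel Q Λ (Rel.bigon_eq u a v)
    rw [map_mul, map_zero] at this
    rw [dCross, this]; exact Submodule.zero_mem _
  rcases a with _ | i <;> rcases b with _ | j
  · exact absurd rfl hab
  · have := mk_rel Q Λ (Rel.bigon_red_left u j v)
    simp only [map_mul, map_pow] at this
    rw [dCross, dCross, this]
    have h1 := dId_commute_dDot (Q := Q) (Λ := Λ) (w := u ++ none :: some j :: v) (u := u ++ [none])
      (i := j) (v := v) (by simp)
    have h2 : dId Q Λ _ * dDot Q Λ _ j v ^ Λ j = dDot Q Λ _ j v ^ Λ j * dId Q Λ _ :=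
      Commute.pow_right (show Commute _ _ from h1) _
    change dId Q Λ _ * dDot Q Λ _ j v ^ Λ j ∈ _
    rw [h2]
    exact pow_mul_mem (fun x hx => dDot_mul_crossLT hx) _ _ (dId_mem_crossLT _ one_pos)
  · have := mk_rel Q Λ (Rel.bigon_red_right u i v)
    simp only [map_mul, map_pow] at this
    rw [dCross, dCross, this]
    have h1 := dId_commute_dDot (Q := Q) (Λ := Λ) (w := u ++ some i :: none :: v) (u := u)
      (i := i) (v := none :: v) (by simp)
    have h2 : dId Q Λ _ * dDot Q Λ _ i _ ^ Λ i = dDot Q Λ _ i _ ^ Λ i * dId Q Λ _ :=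
      Commute.pow_right (show Commute _ _ from h1) _
    change dId Q Λ _ * dDot Q Λ _ i _ ^ Λ i ∈ _
    rw [h2]
    exact pow_mul_mem (fun x hx => dDot_mul_crossLT hx) _ _ (dId_mem_crossLT _ one_pos)
  · have := mk_rel Q Λ (Rel.bigon_ne u i j v (by simpa using hab))
    simp only [map_mul, map_eval₂] at this
    rw [dCross, dCross, this]
    exact dId_mul_eval₂_mem (dId_commute_dDot (by simp)) (dId_commute_dDot (by simp))
      (fun x hx => dDot_mul_crossLT hx) (fun x hx => dDot_mul_crossLT hx) _

theorem triple_sub_mem (u : List (Option I)) (a b c : Option I) (v : List (Option I))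
    (h : (u ++ a :: b :: c :: v).count none ≤ 1) :
    dCross Q Λ u b c (a :: v) * dCross Q Λ (u ++ [b]) a c v * dCross Q Λ u a b (c :: v) -
      dCross Q Λ (u ++ [c]) a b v * dCross Q Λ u a c (b :: v) * dCross Q Λ (u ++ [a]) b c v ∈
      crossLT Q Λ (u ++ a :: b :: c :: v) 1 := by
  by_cases h0 : a ≠ c ∨ a = b
  · have := mk_rel Q Λ (Rel.triple_zero u a b c v h0)
    simp only [map_mul] at this
    rw [dCross, dCross, dCross, this, ← dCross, ← dCross, ← dCross, sub_self]
    exact Submodule.zero_mem _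
  push Not at h0
  obtain ⟨rfl, hab⟩ := h0
  rcases a with _ | i
  -- Two red outer strands with a black one between them satisfy no relation; they are excluded by
  -- the bound on red strands.
  · simp [List.count_cons] at h
    omega
  rcases b with _ | j
  · have := mk_rel Q Λ (Rel.triple_red u i v)
    simp only [map_mul, map_sub, map_divPow] at this
    rw [dCross, dCross, dCross, dCross, dCross, dCross, this]
    exact dId_mul_divPow_mem (dId_commute_dDot (by simp)) (dId_commute_dDot (by simp))
      (fun x hx => dDot_mul_crossLT hx) (fun x hx => dDot_mul_crossLT hx) _
  · have := mk_rel Q Λ (Rel.triple_black u i j v (by simpa using hab))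
    simp only [map_mul, map_sub, map_divDiff] at this
    rw [dCross, dCross, dCross, dCross, dCross, dCross, this]
    exact dId_mul_divDiff_mem (dId_commute_dDot (by simp)) (dId_commute_dDot (by simp))
      (dId_commute_dDot (by simp)) (fun x hx => dDot_mul_crossLT hx)
      (fun x hx => dDot_mul_crossLT hx) (fun x hx => dDot_mul_crossLT hx) _

theorem cr_sw_cr_mem (w : List (Option I)) {k : ℕ} (hk : k + 1 < w.length) :
    cr Q Λ (sw w k) k * cr Q Λ w k ∈ crossLT Q Λ w 1 := by
  obtain ⟨u, a, b, v, rfl, rfl⟩ := exists_eq_append_cons_cons hk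
  rw [cr_eq rfl rfl, sw_eq rfl rfl, cr_eq rfl rfl]
  exact dCross_dCross_mem u a b v

theorem exists_eq_append_cons_cons_cons {X : Type*} {w : List X} {k : ℕ} (h : k + 2 < w.length) :
    ∃ u a b c v, w = u ++ a :: b :: c :: v ∧ k = u.length := by
  refine ⟨w.take k, w[k], w[k + 1], w[k + 2], w.drop (k + 3), ?_, by simp; omega⟩
  rw [← List.drop_eq_getElem_cons, ← List.drop_eq_getElem_cons, ← List.drop_eq_getElem_cons,
    List.take_append_drop]

theorem path_braid (w : List (Option I)) (hw : w.count none ≤ 1) {k : ℕ} (hk : k + 2 < w.length) :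
    act [k, k + 1, k] w = act [k + 1, k, k + 1] w ∧
    path Q Λ [k, k + 1, k] w - path Q Λ [k + 1, k, k + 1] w ∈ crossLT Q Λ w 1 := by
  obtain ⟨u, a, b, c, v, rfl, rfl⟩ := exists_eq_append_cons_cons_cons hk
  have e1 : sw (u ++ a :: b :: c :: v) u.length = u ++ b :: a :: c :: v := sw_eq rfl rfl
  have e2 : sw (u ++ b :: a :: c :: v) (u.length + 1) = u ++ b :: c :: a :: v := by
    rw [sw_eq (u := u ++ [b]) (a := a) (b := c) (v := v) (by simp) (by simp)]; simp
  have e3 : sw (u ++ b :: c :: a :: v) u.length = u ++ c :: b :: a :: v := sw_eq rfl rfl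
  have e4 : sw (u ++ a :: b :: c :: v) (u.length + 1) = u ++ a :: c :: b :: v := by
    rw [sw_eq (u := u ++ [a]) (a := b) (b := c) (v := v) (by simp) (by simp)]; simp
  have e5 : sw (u ++ a :: c :: b :: v) u.length = u ++ c :: a :: b :: v := sw_eq rfl rfl
  have e6 : sw (u ++ c :: a :: b :: v) (u.length + 1) = u ++ c :: b :: a :: v := by
    rw [sw_eq (u := u ++ [c]) (a := a) (b := b) (v := v) (by simp) (by simp)]; simp
  constructor
  · simp only [act_cons, act_nil, e1, e2, e3, e4, e5, e6]
  · have := triple_sub_mem (Q := Q) (Λ := Λ) u a b c v hw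
    simp only [path, act_cons, act_nil, e1, e2, e4, e5]
    rw [cr_mul_dId (by simp), cr_mul_dId (by simp; omega),
      cr_eq (u := u) (a := b) (b := c) (v := a :: v) rfl rfl,
      cr_eq (u := u ++ [b]) (a := a) (b := c) (v := v) (by simp) (by simp),
      cr_eq (u := u) (a := a) (b := b) (v := c :: v) rfl rfl,
      cr_eq (u := u ++ [c]) (a := a) (b := b) (v := v) (by simp) (by simp),
      cr_eq (u := u) (a := a) (b := c) (v := b :: v) rfl rfl,
      cr_eq (u := u ++ [a]) (a := b) (b := c) (v := v) (by simp) (by simp)]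
    simpa only [mul_assoc] using this

theorem path_comm (w : List (Option I)) {k l : ℕ} (hkl : k + 2 ≤ l) (hl : l + 1 < w.length) :
    act [k, l] w = act [l, k] w ∧ path Q Λ [k, l] w = path Q Λ [l, k] w := by
  obtain ⟨u', c, d, v, rfl, rfl⟩ := exists_eq_append_cons_cons hl
  obtain ⟨u, a, b, x, rfl, rfl⟩ := exists_eq_append_cons_cons (w := u') (k := k) (by omega)
  have e1 : sw (u ++ a :: b :: x ++ c :: d :: v) (u ++ a :: b :: x).length =
    u ++ a :: b :: x ++ d :: c :: v := sw_eq rfl rfl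
  have e2 : sw (u ++ a :: b :: x ++ c :: d :: v) u.length = u ++ b :: a :: x ++ c :: d :: v :=
    (sw_eq (a := a) (b := b) (v := x ++ c :: d :: v) (by simp) rfl).trans (by simp)
  have e3 : sw (u ++ a :: b :: x ++ d :: c :: v) u.length = u ++ b :: a :: x ++ d :: c :: v :=
    (sw_eq (a := a) (b := b) (v := x ++ d :: c :: v) (by simp) rfl).trans (by simp)
  have e4 : sw (u ++ b :: a :: x ++ c :: d :: v) (u ++ a :: b :: x).length =
    u ++ b :: a :: x ++ d :: c :: v := sw_eq rfl (by simp)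
  constructor
  · simp only [act_cons, act_nil, e1, e2, e3, e4]
  · simp only [path, act_cons, act_nil, e1, e2]
    rw [cr_mul_dId (by simp; omega), cr_mul_dId (by simp),
      cr_eq (u := u) (a := a) (b := b) (v := x ++ d :: c :: v) (by simp) rfl,
      cr_eq (u := u ++ a :: b :: x) (a := c) (b := d) (v := v) (by simp) (by simp),
      cr_eq (u := u ++ b :: a :: x) (a := c) (b := d) (v := v) (by simp) (by simp),
      cr_eq (u := u) (a := a) (b := b) (v := x ++ c :: d :: v) (by simp) rfl]
    have := mk_rel Q Λ (Rel.isotopy u (.cross a b) x (.cross c d) v)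
    simpa [Piece.src, Piece.tgt, dCross] using this

/-- Modulo fewer crossings, the diagram of a word depends only on the positive braid. The claim is
proved along the generation of the congruence. The equality of the sets of letters is carried along
so that all positions stay within the slice in the transitive and multiplicative steps. -/
theorem path_braid_congr {a b : FreeMonoid ℕ} (h : ConGen.Rel BraidRel a b) :
    a.toList.length = b.toList.length ∧ (∀ k, k ∈ a.toList ↔ k ∈ b.toList) ∧
    ∀ w : List (Option I), w.count none ≤ 1 → (∀ k ∈ a.toList, k + 1 < w.length) →
      act a.toList w = act b.toList w ∧
      path Q Λ a.toList w - path Q Λ b.toList w ∈ crossLT Q Λ w a.toList.length := by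
  induction h with
  | of x y h =>
    cases h with
    | comm i j h =>
      refine ⟨rfl, fun k => by simp [FreeMonoid.toList_mul, or_comm], fun w hw hk => ?_⟩
      have := path_comm (Q := Q) (Λ := Λ) w h (hk j (by simp [FreeMonoid.toList_mul]))
      refine ⟨this.1, ?_⟩
      change path Q Λ [i, j] w - path Q Λ [j, i] w ∈ _
      rw [this.2, sub_self]; exact Submodule.zero_mem _
    | braid i =>
      refine ⟨rfl, fun k => by simp [FreeMonoid.toList_mul]; tauto, fun w hw hk => ?_⟩
      have := path_braid (Q := Q) (Λ := Λ) w hw (hk (i + 1) (by simp [FreeMonoid.toList_mul]))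
      exact ⟨this.1, crossLT_mono w (by simp [FreeMonoid.toList_mul]) this.2⟩
  | refl x => exact ⟨rfl, fun _ => Iff.rfl, fun w _ _ => ⟨rfl, by simp⟩⟩
  | symm h ih =>
    obtain ⟨h1, h2, h3⟩ := ih
    refine ⟨h1.symm, fun k => (h2 k).symm, fun w hw hk => ?_⟩
    obtain ⟨h4, h5⟩ := h3 w hw fun k hk' => hk k ((h2 k).1 hk')
    refine ⟨h4.symm, ?_⟩
    rw [← h1, ← neg_sub]; exact Submodule.neg_mem _ h5
  | trans h h' ih ih' =>
    obtain ⟨h1, h2, h3⟩ := ih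
    obtain ⟨h1', h2', h3'⟩ := ih'
    refine ⟨h1.trans h1', fun k => (h2 k).trans (h2' k), fun w hw hk => ?_⟩
    obtain ⟨h4, h5⟩ := h3 w hw hk
    obtain ⟨h4', h5'⟩ := h3' w hw fun k hk' => hk k ((h2 k).2 hk')
    refine ⟨h4.trans h4', ?_⟩
    rw [← h1] at h5'
    simpa using Submodule.add_mem _ h5 h5'
  | @mul a a' b b' h h' ih ih' =>
    obtain ⟨h1, h2, h3⟩ := ih
    obtain ⟨h1', h2', h3'⟩ := ih'
    refine ⟨by simp [FreeMonoid.toList_mul, h1, h1'],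
      fun k => by simp [FreeMonoid.toList_mul, h2, h2'], fun w hw hk => ?_⟩
    simp only [FreeMonoid.toList_mul, List.mem_append] at hk
    obtain ⟨h4', h5'⟩ := h3' w hw fun k hk' => hk k (.inr hk')
    obtain ⟨h4, h5⟩ := h3 (act b.toList w) (by rwa [(act_perm _ w).count_eq])
      (fun k hk' => by simpa using hk k (.inl hk'))
    have hb : ∀ k ∈ b.toList, k + 1 < w.length := fun k hk' => hk k (.inr hk')
    have ha : ∀ k ∈ a'.toList, k + 1 < (act b.toList w).length := fun k hk' => by
      simpa using hk k (.inl ((h2 k).2 hk'))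
    simp only [FreeMonoid.toList_mul, act_append, ← h4', ← h4, true_and]
    -- The difference of two products is split into two terms, each with one factor of lower order.
    -- The equality of intermediate slices makes the upper factors comparable.
    rw [path_append _ _ hb, path_append _ _ fun k hk' => hb k ((h2' k).2 hk'), ← h4',
      show ∀ p q r s : Diagrams Q Λ, p * q - r * s = (p - r) * q + r * (q - s) by
        intros; rw [sub_mul, mul_sub]; abel, List.length_append]
    refine Submodule.add_mem _ (crossLT_mul (path_mon' w hb) h5) ?_
    have := (path_mon' (Q := Q) (Λ := Λ) _ ha).mul_crossLT h5'
    rwa [← h1] at this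

theorem path_congr {l l' : List ℕ} (h : braidOf l = braidOf l') :
    l.length = l'.length ∧ (∀ k, k ∈ l ↔ k ∈ l') ∧
    ∀ w : List (Option I), w.count none ≤ 1 → (∀ k ∈ l, k + 1 < w.length) →
      act l w = act l' w ∧ path Q Λ l w - path Q Λ l' w ∈ crossLT Q Λ w l.length :=
  path_braid_congr (conGen_of_braidOf_eq h)

end

section

/-! ## Shuffles of blocks span -/

variable {I : Type u} {𝕜 : Type v} [CommRing 𝕜] [DecidableEq I]
variable {Q : I → I → MvPolynomial (Fin 2) 𝕜} {Λ : I → ℕ}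

/-- A dot away from the crossing passes by isotopy. A dot on one of the crossing strands slides
through with an error that is zero or, up to sign, a straight line diagram. -/
theorem dDot_cr_sub_mem {w : List (Option I)} {k : ℕ} (hk : k + 1 < w.length)
    {u' : List (Option I)} {i : I} {v' : List (Option I)} (h : sw w k = u' ++ some i :: v') :
    ∃ u'' v'', w = u'' ++ some i :: v'' ∧
      dDot Q Λ u' i v' * cr Q Λ w k - cr Q Λ w k * dDot Q Λ u'' i v'' ∈ crossLT Q Λ w 1 := by
  obtain ⟨u, a, b, v, rfl, rfl⟩ := exists_eq_append_cons_cons hk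
  rw [sw_eq rfl rfl] at h
  rw [cr_eq rfl rfl]
  have ite_mem : ∀ w' x, (c : Prop) → [Decidable c] → (c → w' = u ++ a :: b :: v) →
      x = RingQuot.mkAlgHom 𝕜 (Rel Q Λ) (if c then fId 𝕜 w' else 0) →
      x ∈ crossLT Q Λ (u ++ a :: b :: v) 1 := by
    intro w' x c _ hc hx
    rw [hx]
    split_ifs with h
    · rw [hc h]; exact dId_mem_crossLT _ one_pos
    · rw [map_zero]; exact Submodule.zero_mem _
  -- The cases are the positions of the dotted strand relative to the two crossing strands: on the
  -- left top strand (met twice, because of the overlap of the two alternatives), on the right one,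
  -- or outside.
  rcases List.append_eq_append_iff.1 h with ⟨x, rfl, hx⟩ | ⟨x, rfl, hx⟩
  · rcases x with _ | ⟨b', x⟩
    · obtain ⟨rfl, rfl⟩ : b = some i ∧ a :: v = v' := by simpa using hx
      refine ⟨u ++ [a], v, by simp, ?_⟩
      have := mk_rel Q Λ (Rel.dot_right u a i v)
      simp only [map_sub, map_mul] at this
      refine ite_mem (u ++ some i :: some i :: v) _ (a = some i) (fun h => by rw [h]) ?_
      simpa [dDot, dCross] using this
    rcases x with _ | ⟨a', x⟩
    · obtain ⟨rfl, rfl, rfl⟩ : b = b' ∧ a = some i ∧ v = v' := by simpa using hx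
      refine ⟨u, b :: v, by simp, ?_⟩
      have := mk_rel Q Λ (Rel.dot_left u i b v)
      simp only [map_sub, map_mul] at this
      rw [← Submodule.neg_mem_iff, neg_sub]
      refine ite_mem (u ++ some i :: some i :: v) _ (b = some i) (fun h => by rw [h]) ?_
      simpa [dDot, dCross] using this
    · obtain ⟨rfl, rfl, rfl⟩ : b = b' ∧ a = a' ∧ v = x ++ some i :: v' := by simpa using hx
      refine ⟨u ++ a :: b :: x, v', by simp, ?_⟩
      have := mk_rel Q Λ (Rel.isotopy u (.cross a b) x (.dot i) v')
      simp only [map_mul, Piece.src, Piece.tgt, List.cons_append, List.nil_append] at this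
      rw [dDot, dDot, dCross, ← this, sub_self]
      exact Submodule.zero_mem _
  · rcases x with _ | ⟨i', x⟩
    · obtain ⟨rfl, rfl⟩ : some i = b ∧ v' = a :: v := by simpa using hx
      refine ⟨u' ++ [a], v, by simp, ?_⟩
      have := mk_rel Q Λ (Rel.dot_right u' a i v)
      simp only [map_sub, map_mul] at this
      refine ite_mem (u' ++ some i :: some i :: v) _ (a = some i) (fun h => by simp [h]) ?_
      simpa [dDot, dCross] using this
    · obtain ⟨rfl, rfl⟩ : some i = i' ∧ v' = x ++ b :: a :: v :=
        List.cons.inj hx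
      refine ⟨u', x ++ a :: b :: v, by simp, ?_⟩
      have := mk_rel Q Λ (Rel.isotopy u' (.dot i) x (.cross a b) v)
      simp only [map_mul, Piece.src, Piece.tgt, List.cons_append, List.nil_append] at this
      rw [dDot, dDot, dCross, this, sub_self]
      exact Submodule.zero_mem _

theorem dDot_path_sub_mem {w : List (Option I)} {ks : List ℕ} (hk : ∀ k ∈ ks, k + 1 < w.length)
    {u' : List (Option I)} {i : I} {v' : List (Option I)} (h : act ks w = u' ++ some i :: v') :
    ∃ u'' v'', w = u'' ++ some i :: v'' ∧
      dDot Q Λ u' i v' * path Q Λ ks w - path Q Λ ks w * dDot Q Λ u'' i v'' ∈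
        crossLT Q Λ w ks.length := by
  induction ks generalizing u' v' with
  | nil =>
    rw [act_nil] at h
    exact ⟨u', v', h, by rw [path, dId_commute_dDot h, sub_self]; exact Submodule.zero_mem _⟩
  | cons k ks ih =>
    have hks : ∀ k ∈ ks, k + 1 < w.length := fun k hk' => hk k (List.mem_cons_of_mem _ hk')
    have hk1 : k + 1 < (act ks w).length := by simpa using hk k List.mem_cons_self
    obtain ⟨u₁, v₁, h₁, h₁'⟩ := dDot_cr_sub_mem (Q := Q) (Λ := Λ) hk1 h
    obtain ⟨u₂, v₂, h₂, h₂'⟩ := ih hks h₁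
    refine ⟨u₂, v₂, h₂, ?_⟩
    rw [path, show ∀ y c p y₁ y₂ : Diagrams Q Λ, y * (c * p) - c * p * y₂ =
      (y * c - c * y₁) * p + c * (y₁ * p - p * y₂) by
        intros; rw [sub_mul, mul_sub]; simp only [mul_assoc]; abel, List.length_cons, add_comm]
    refine Submodule.add_mem _ (crossLT_mul (path_mon' w hks) h₁') ?_
    have h3 := (Mon.one (Q := Q) (Λ := Λ) (P := fun _ => True) (w := act ks w)).cr_mul hk1 trivial
    rw [cr_mul_dId hk1] at h3
    simpa using h3.mul_crossLT h₂'

/-! ### Codes -/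

theorem off_le_length {c : List ℕ} {lens : ℕ → ℕ} (h : IsCode c lens) (p : ℕ) :
    off lens p ≤ c.length := by
  have : off lens p = (c.filter (· < p)).length := by
    rw [off, Finset.sum_congr rfl fun q _ => (h q).symm]
    clear h
    induction c with
    | nil => simp
    | cons a c ih =>
      simp only [List.count_cons, Finset.sum_add_distrib, ih, beq_iff_eq, List.filter_cons]
      by_cases ha : a < p
      · simp [ha]
      · simp [ha]
  rw [this]
  exact List.length_filter_le _ _

theorem canon_lt {c : List ℕ} {lens : ℕ → ℕ} (h : IsCode c lens) :
    ∀ k ∈ canon c lens, k + 1 < c.length := by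
  induction c generalizing lens with
  | nil => simp [canon]
  | cons p c ih =>
    intro k hk
    simp only [canon, List.mem_append, List.mem_map, List.mem_range] at hk
    rcases hk with ⟨k, hk, rfl⟩ | hk
    · have := ih h.tail k hk
      simp only [List.length_cons]; omega
    · have := off_le_length h (p + 1)
      have := h.pos
      rw [off_succ] at *; omega

theorem canon_of_sorted {c : List ℕ} {lens : ℕ → ℕ} (h : IsCode c lens) (hs : c.Pairwise (· ≤ ·)) :
    canon c lens = [] := by
  induction c generalizing lens with
  | nil => rfl
  | cons p c ih =>
    rw [List.pairwise_cons] at hs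
    have h0 : off lens p = 0 := Finset.sum_eq_zero fun q hq => by
      rw [← h q, List.count_eq_zero]
      intro hq'
      rw [Finset.mem_range] at hq
      rcases List.mem_cons.1 hq' with rfl | hq'
      · omega
      · have := hs.1 q hq'; omega
    rw [canon, ih h.tail hs.2, h0]; rfl

theorem SameBlock.lt {c : List ℕ} {lens : ℕ → ℕ} (h : IsCode c lens) {j : ℕ}
    (hj : SameBlock lens j) : j + 1 < c.length := by
  obtain ⟨p, _, hp⟩ := hj
  exact hp.trans_le (off_le_length h _)

/-! ### The spanning theorem -/

variable (Q Λ) in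
/-- The span of the products of a shuffle and a diagram without crossings of strands from
different blocks, with less than `n` crossings. -/
def shuffleLT (lens : ℕ → ℕ) (w : List (Option I)) (n : ℕ) : Submodule 𝕜 (Diagrams Q Λ) :=
  Submodule.span 𝕜 {z | ∃ c l w' h, IsCode c lens ∧ Mon Q Λ (SameBlock lens) w l w' h ∧
    (canon c lens).length + l < n ∧ z = path Q Λ (canon c lens) w' * h}

theorem shuffleLT_mono (lens : ℕ → ℕ) (w : List (Option I)) {m n : ℕ} (h : m ≤ n) :
    shuffleLT Q Λ lens w m ≤ shuffleLT Q Λ lens w n :=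
  Submodule.span_mono fun _ ⟨c, l, w', x, h1, h2, h3, h4⟩ =>
    ⟨c, l, w', x, h1, h2, h3.trans_le h, h4⟩

section

variable {lens : ℕ → ℕ} {w : List (Option I)}

/-- The dot slides through the shuffle to the lower factor, where dots are allowed. The error has
fewer crossings and is covered by the hypothesis `hn`, which is the induction hypothesis in the
spanning theorem. -/
theorem dDot_mul_shuffle {n : ℕ} (hn : crossLT Q Λ w n ≤ shuffleLT Q Λ lens w n)
    {u : List (Option I)} {i : I} {v : List (Option I)} (hlen : ∀ c, IsCode c lens → c.length = w.length)
    {x : Diagrams Q Λ} (hx : x ∈ shuffleLT Q Λ lens w (n + 1)) :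
    dDot Q Λ u i v * x ∈ shuffleLT Q Λ lens w (n + 1) := by
  refine mul_mem_of_span _ ?_ hx
  rintro x ⟨c, l, w', h, hc, hm, hl, rfl⟩
  have hw' : w'.length = w.length := hm.perm.length_eq
  have hcan : ∀ k ∈ canon c lens, k + 1 < w'.length := fun k hk => by
    rw [hw', ← hlen c hc]; exact canon_lt hc k hk
  have hpath := path_mon' (Q := Q) (Λ := Λ) w' hcan
  by_cases hw : u ++ some i :: v = act (canon c lens) w'
  · obtain ⟨u', v', rfl, h2⟩ := dDot_path_sub_mem (Q := Q) (Λ := Λ) hcan hw.symm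
    rw [← mul_assoc, ← sub_add_cancel (dDot Q Λ u i v * path Q Λ _ _)
      (path Q Λ (canon c lens) (u' ++ some i :: v') * dDot Q Λ u' i v'), add_mul, mul_assoc]
    refine Submodule.add_mem _ (shuffleLT_mono lens w n.le_succ (hn ?_))
      (Submodule.subset_span ⟨c, l, _, _, hc, hm.dot, hl, rfl⟩)
    exact crossLT_mono w (by omega) (crossLT_mul hm h2)
  · rw [← mul_assoc, dDot_mul_of_ne hpath hw, zero_mul]
    exact Submodule.zero_mem _

/-- The effect of one more crossing on top depends only on the two entries of the code at its
position: a longer shuffle, a crossing inside a block, or a double crossing. All errors have few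
enough crossings for the hypothesis `hn`. -/
theorem dCross_mul_shuffle {n : ℕ} (hn : crossLT Q Λ w n ≤ shuffleLT Q Λ lens w n)
    (hw0 : w.count none ≤ 1)
    {u : List (Option I)} {a b : Option I} {v : List (Option I)}
    (hlen : ∀ c, IsCode c lens → c.length = w.length)
    {x : Diagrams Q Λ} (hx : x ∈ shuffleLT Q Λ lens w n) :
    dCross Q Λ u a b v * x ∈ shuffleLT Q Λ lens w (n + 1) := by
  refine mul_mem_of_span _ ?_ hx
  rintro x ⟨c, l, w', h, hc, hm, hl, rfl⟩
  have hw' : w'.length = w.length := hm.perm.length_eq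
  have hcan : ∀ c, IsCode c lens → ∀ k ∈ canon c lens, k + 1 < w'.length := fun c hc k hk => by
    rw [hw', ← hlen c hc]; exact canon_lt hc k hk
  have hpath := path_mon' (Q := Q) (Λ := Λ) w' (hcan c hc)
  have hw0' : w'.count none ≤ 1 := by rwa [hm.perm.count_eq]
  by_cases hw : u ++ a :: b :: v = act (canon c lens) w'
  swap
  · rw [← mul_assoc, dCross_mul_of_ne hpath hw, zero_mul]
    exact Submodule.zero_mem _
  have hcr : ∀ c', act (canon c' lens) w' = u ++ a :: b :: v →
      dCross Q Λ u a b v * path Q Λ (canon c' lens) w' =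
        path Q Λ (u.length :: canon c' lens) w' := by
    intro c' h; rw [path, cr_eq h rfl]
  have hu : u.length + 1 < c.length := by
    have := congrArg List.length hw
    rw [length_act, hw', ← hlen c hc] at this
    simp only [List.length_append, List.length_cons] at this
    omega
  obtain ⟨c₁, p, q, c₂, rfl, hc₁⟩ := exists_eq_append_cons_cons hu
  have hperm : (c₁ ++ q :: p :: c₂).Perm (c₁ ++ p :: q :: c₂) :=
    (List.Perm.swap _ _ _).append_left _
  have hcsw := hc.perm hperm
  have error : ∀ {m y}, y ∈ crossLT Q Λ w' m → m + l ≤ n →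
      y * h ∈ shuffleLT Q Λ lens w (n + 1) := fun hy hm' =>
    shuffleLT_mono lens w n.le_succ (hn (crossLT_mono w hm' (crossLT_mul hm hy)))
  rw [← mul_assoc]
  rcases lt_trichotomy p q with hpq | rfl | hpq
  -- Entries in increasing order: up to lower terms, the result is the shuffle with these entries
  -- exchanged.
  · have e := braidGen_mul_canon_of_lt hpq c₂ c₁ lens hc
    rw [← braidOf_cons, ← hc₁] at e
    obtain ⟨h1, h2, h3⟩ := path_congr (Q := Q) (Λ := Λ) e
    have h4 := (h3 w' hw0' fun k hk => hcan _ hcsw k ((h2 k).1 hk)).2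
    rw [hcr _ hw.symm, ← sub_add_cancel (path Q Λ (u.length :: _) w')
      (path Q Λ (canon (c₁ ++ q :: p :: c₂) lens) w'), add_mul]
    rw [List.length_cons] at h1 h4
    exact Submodule.add_mem _ (error h4 (by omega))
      (Submodule.subset_span ⟨_, l, w', h, hcsw, hm, by omega, rfl⟩)
  -- Equal entries: the crossing passes through the shuffle and becomes part of the lower factor.
  · obtain ⟨j, hj, e⟩ := braidGen_mul_canon_of_eq c₂ c₁ lens hc
    rw [← braidOf_cons, ← hc₁, ← braidOf_singleton, ← braidOf_append] at e
    have hj' : j + 1 < w'.length := by rw [hw', ← hlen _ hc]; exact hj.lt hc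
    obtain ⟨h1, h2, h3⟩ := path_congr (Q := Q) (Λ := Λ) e
    have h4 := (h3 w' hw0' fun k hk => by
      rcases List.mem_append.1 ((h2 k).1 hk) with hk | hk
      · exact hcan _ hc k hk
      · rw [List.mem_singleton] at hk; rwa [hk]).2
    rw [hcr _ hw.symm, ← sub_add_cancel (path Q Λ (u.length :: _) w')
      (path Q Λ (canon (c₁ ++ p :: p :: c₂) lens ++ [j]) w'), add_mul]
    rw [List.length_cons] at h4
    refine Submodule.add_mem _ (error h4 (by omega)) ?_
    rw [path_append _ _ (by simpa using hj'), mul_assoc]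
    refine Submodule.subset_span ⟨_, l + 1, act [j] w', path Q Λ [j] w' * h, hc, ?_, by omega, rfl⟩
    rw [path, path, mul_assoc, hm.dId_mul]
    exact hm.cr_mul hj' hj
  -- Entries in decreasing order: up to lower terms, the shuffle is itself this crossing on top of
  -- the shuffle for the exchanged code. A double crossing arises, which loses both crossings, so
  -- everything is of lower order.
  · have e := braidGen_mul_canon_of_lt hpq c₂ c₁ lens hcsw
    rw [← braidOf_cons, ← hc₁] at e
    obtain ⟨h1, h2, h3⟩ := path_congr (Q := Q) (Λ := Λ) e
    have hb : ∀ k ∈ u.length :: canon (c₁ ++ q :: p :: c₂) lens, k + 1 < w'.length :=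
      fun k hk => hcan _ hc k ((h2 k).1 hk)
    obtain ⟨h4, h5⟩ := h3 w' hw0' hb
    have hpath' := path_mon' (Q := Q) (Λ := Λ) w' (hcan _ hcsw)
    rw [List.length_cons] at h1 h5
    have h6 : dCross Q Λ u a b v * path Q Λ (u.length :: canon (c₁ ++ q :: p :: c₂) lens) w' ∈
        crossLT Q Λ w' (canon (c₁ ++ p :: q :: c₂) lens).length := by
      have hu' : u.length + 1 < (act (canon (c₁ ++ q :: p :: c₂) lens) w').length := by
        simpa using hb _ List.mem_cons_self
      rw [path, ← mul_assoc, ← cr_eq (hw.trans h4.symm).symm rfl, act_cons]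
      exact crossLT_mono w' (by omega) (crossLT_mul hpath' (cr_sw_cr_mem _ hu'))
    have h7 := (Mon.one (Q := Q) (Λ := Λ) (P := fun _ => True) (w := u ++ a :: b :: v)).cross trivial
    rw [dCross_mul_dId] at h7
    rw [← sub_sub_cancel (path Q Λ (u.length :: canon (c₁ ++ q :: p :: c₂) lens) w')
      (path Q Λ (canon (c₁ ++ p :: q :: c₂) lens) w'), mul_sub, sub_mul]
    refine Submodule.sub_mem _ (error h6 (by omega)) (error (h7.mul_crossLT h5) (by omega))

/-- Every diagram with bottom `w` is a linear combination of products of a shuffle (on top) and a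
diagram without crossings of strands from different blocks. -/
theorem crossLT_le_shuffleLT {c₀ : List ℕ} (hc₀ : IsCode c₀ lens) (hs : c₀.Pairwise (· ≤ ·))
    (hlen : c₀.length = w.length) (hw : w.count none ≤ 1) (n : ℕ) :
    crossLT Q Λ w n ≤ shuffleLT Q Λ lens w n := by
  have hlen' : ∀ c, IsCode c lens → c.length = w.length := fun c hc => by
    rw [(hc.eq_perm hc₀).length_eq, hlen]
  induction n with
  | zero =>
    rw [crossLT, Submodule.span_le]
    rintro x ⟨l, hl, -⟩
    omega
  | succ n ih =>
    rw [crossLT, Submodule.span_le]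
    rintro x ⟨l, hl, w', hx⟩
    induction hx with
    | one =>
      refine Submodule.subset_span ⟨c₀, 0, w, dId Q Λ w, hc₀, .one, ?_, ?_⟩
      · rw [canon_of_sorted hc₀ hs]; simp
      · rw [canon_of_sorted hc₀ hs, path, dId_mul_self]
    | dot h ih' => exact dDot_mul_shuffle ih hlen' (ih' hl)
    | cross hP h ih' => exact dCross_mul_shuffle ih hw hlen' (ih (h.mem_crossLT (by omega)))

end

end

section

/-! ## The universal module

The space with basis the arrangements of distinguishable strands, on which crossings act by
`[… s s' …] ↦ a s s' • [… s' s …] + b s s' • [… s s' …]`. -/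

variable {I : Type u} {𝕜 : Type v} [CommRing 𝕜] [DecidableEq I]
variable (Q : I → I → MvPolynomial (Fin 2) 𝕜) (Λ : I → ℕ)

section Universal

variable {L : Type*} [CommRing L] [Algebra 𝕜 L]

/-- Conditions on the coefficients of the action of crossings. -/
structure IsCoeff (lab : ℕ → Option I) (x : ℕ → L) (a b : ℕ → ℕ → L) : Prop where
  stay_ne : ∀ s s', lab s ≠ lab s' → b s s' = 0
  stay : ∀ s s', s ≠ s' → lab s = lab s' → b s s' * (x s - x s') = 1
  swap_eq : ∀ s s', s ≠ s' → lab s = lab s' → a s s' * a s' s = - b s s' ^ 2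
  swap_ne : ∀ s s' i j, lab s = some i → lab s' = some j → i ≠ j →
    a s s' * a s' s = eval₂ (Q i j) (x s) (x s')
  swap_red : ∀ s s' i, lab s = some i → lab s' = none → a s s' * a s' s = x s ^ Λ i

/-- The arrangements of strands that are used: the strands are distinct, and at most one of them
is red. -/
def Proper (lab : ℕ → Option I) (t : List ℕ) : Prop := t.Nodup ∧ (t.map lab).count none ≤ 1

variable (L) in
/-- The space with basis the arrangements of strands. -/
abbrev Arr : Type _ := List ℕ →₀ L

/-- The basis element of an arrangement. -/
abbrev arr (t : List ℕ) : Arr L := Finsupp.single t 1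

/-- The endomorphism with given values on arrangements. -/
def opOf (f : List ℕ → Arr L) : Module.End L (Arr L) := Finsupp.linearCombination L f

@[simp] theorem opOf_arr (f : List ℕ → Arr L) (t : List ℕ) : opOf f (arr t) = f t := by
  simp [opOf]

theorem op_ext {f g : Module.End L (Arr L)} (h : ∀ t, f (arr t) = g (arr t)) : f = g :=
  Finsupp.lhom_ext' fun t => LinearMap.ext_ring (h t)

open Classical in
variable (L) in
/-- The projection to arrangements with labels `w`. -/
def projOp (lab : ℕ → Option I) (w : List (Option I)) : Module.End L (Arr L) :=
  opOf fun t => if Proper lab t ∧ t.map lab = w then arr t else 0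

/-- The dot at the position `k`. -/
def dotOp (x : ℕ → L) (k : ℕ) : Module.End L (Arr L) :=
  opOf fun t => x (t.getD k 0) • arr t

/-- The crossing at the position `k`. -/
def crossOp (a b : ℕ → ℕ → L) (k : ℕ) : Module.End L (Arr L) :=
  opOf fun t => a (t.getD k 0) (t.getD (k + 1) 0) • arr (sw t k) +
    b (t.getD k 0) (t.getD (k + 1) 0) • arr t

variable {lab : ℕ → Option I} {x : ℕ → L} {a b : ℕ → ℕ → L}

theorem projOp_of {t : List ℕ} {w : List (Option I)} (ht : Proper lab t) (h : t.map lab = w) :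
    projOp L lab w (arr t) = arr t := by
  simp [projOp, ht, h]

theorem projOp_of_not {t : List ℕ} {w : List (Option I)} (h : ¬(Proper lab t ∧ t.map lab = w)) :
    projOp L lab w (arr t) = 0 := by
  rw [projOp, opOf_arr, if_neg h]

theorem dotOp_arr {t t₁ t₂ : List ℕ} {s k : ℕ} (h : t = t₁ ++ s :: t₂) (hk : k = t₁.length) :
    dotOp x k (arr t) = x s • arr t := by
  subst h hk; simp [dotOp]

theorem crossOp_arr {t t₁ t₂ : List ℕ} {s s' k : ℕ} (h : t = t₁ ++ s :: s' :: t₂)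
    (hk : k = t₁.length) : crossOp a b k (arr t) =
      a s s' • arr (t₁ ++ s' :: s :: t₂) + b s s' • arr (t₁ ++ s :: s' :: t₂) := by
  rw [crossOp, opOf_arr, sw_eq h hk]
  subst h hk
  simp

variable (lab x a b) in
/-- The action of the generators. -/
def genOp : Gen I → Module.End L (Arr L)
  | .idm w => projOp L lab w
  | .put u (.dot i) v => dotOp x u.length * projOp L lab (u ++ some i :: v)
  | .put u (.cross c d) v => crossOp a b u.length * projOp L lab (u ++ c :: d :: v)

theorem Proper.perm {t t' : List ℕ} (h : Proper lab t) (hp : t'.Perm t) : Proper lab t' :=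
  ⟨hp.nodup_iff.2 h.1, by rw [(hp.map lab).count_eq]; exact h.2⟩

/-- The term in which the two strands stay in place has a nonzero coefficient only if their labels
agree, and then the top and bottom label words coincide. So this term is compatible with the
idempotent at the top of the crossing. -/
theorem projOp_smul_swap (hc : IsCoeff Q Λ lab x a b) {t t' t₁ t₂ : List ℕ} {s s' : ℕ}
    {w' : List (Option I)} (ht : Proper lab t) (ht' : t' = t₁ ++ s :: s' :: t₂)
    (hp : t'.Perm t) (hw : (t₁ ++ s' :: s :: t₂).map lab = w') :
    projOp L lab w' (b s s' • arr t') = b s s' • arr t' := by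
  subst ht'
  rw [map_smul]
  by_cases h : lab s = lab s'
  · rw [projOp_of (ht.perm hp)]
    rw [← hw]; simp [h]
  · rw [hc.stay_ne _ _ h, zero_smul, zero_smul]

theorem projOp_crossOp (hc : IsCoeff Q Λ lab x a b) {t t₁ t₂ : List ℕ} {s s' k : ℕ}
    {w : List (Option I)} (ht : Proper lab t) (h : t = t₁ ++ s :: s' :: t₂)
    (hk : k = t₁.length) (hw : (t₁ ++ s' :: s :: t₂).map lab = w) :
    projOp L lab w (crossOp a b k (arr t)) = crossOp a b k (arr t) := by
  rw [crossOp_arr h hk, map_add, map_smul,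
    projOp_of (ht.perm (h ▸ (List.Perm.swap _ _ _).append_left _)) hw,
    projOp_smul_swap Q Λ hc ht rfl (h ▸ List.Perm.refl _) hw]

theorem projOp_dotOp {w : List (Option I)} {k : ℕ} {t : List ℕ} :
    projOp L lab w (dotOp x k (arr t)) = dotOp x k (projOp L lab w (arr t)) := by
  by_cases h : Proper lab t ∧ t.map lab = w
  · rw [projOp_of h.1 h.2, dotOp, opOf_arr, map_smul, projOp_of h.1 h.2]
  · rw [projOp_of_not h, dotOp, opOf_arr, map_smul, projOp_of_not h, smul_zero, map_zero]

theorem map_eq_append_cons {t : List ℕ} {u v : List (Option I)} {c : Option I}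
    (h : t.map lab = u ++ c :: v) : ∃ t₁ s t₂, t = t₁ ++ s :: t₂ ∧ t₁.map lab = u ∧ lab s = c ∧
      t₂.map lab = v := by
  obtain ⟨t₁, t', rfl, h1, h2⟩ := List.map_eq_append_iff.1 h
  obtain ⟨s, t₂, rfl, h3, h4⟩ := List.map_eq_cons_iff.1 h2
  exact ⟨t₁, s, t₂, rfl, h1, h3, h4⟩

theorem map_eq_append_cons_cons {t : List ℕ} {u v : List (Option I)} {c d : Option I}
    (h : t.map lab = u ++ c :: d :: v) : ∃ t₁ s s' t₂, t = t₁ ++ s :: s' :: t₂ ∧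
      t₁.map lab = u ∧ lab s = c ∧ lab s' = d ∧ t₂.map lab = v := by
  obtain ⟨t₁, s, t', rfl, h1, h2, h3⟩ := map_eq_append_cons h
  obtain ⟨s', t₂, rfl, h4, h5⟩ := List.map_eq_cons_iff.1 h3
  exact ⟨t₁, s, s', t₂, rfl, h1, h2, h4, h5⟩

theorem Proper.ne {t t₁ t₂ t₃ : List ℕ} {s s' : ℕ} (ht : Proper lab t)
    (h : t = t₁ ++ s :: t₂ ++ s' :: t₃) : s ≠ s' := by
  have := ht.1
  rw [h] at this
  simp only [List.append_assoc, List.nodup_append, List.cons_append, List.nodup_cons] at this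
  rintro rfl
  simp at this

theorem IsCoeff.stay_symm (hc : IsCoeff Q Λ lab x a b) {s s' : ℕ} (h : s ≠ s') :
    b s' s = - b s s' := by
  by_cases hl : lab s = lab s'
  · have h1 := hc.stay s s' h hl
    have h2 := hc.stay s' s h.symm hl.symm
    linear_combination (-b s' s) * h1 - b s s' * h2
  · rw [hc.stay_ne _ _ hl, hc.stay_ne _ _ (Ne.symm hl), neg_zero]

theorem crossOp_crossOp (hc : IsCoeff Q Λ lab x a b) {t t₁ t₂ : List ℕ} {s s' k : ℕ}
    (h : t = t₁ ++ s :: s' :: t₂) (hk : k = t₁.length) (hs : s ≠ s') :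
    crossOp a b k (crossOp a b k (arr t)) = (a s s' * a s' s + b s s' ^ 2) • arr t := by
  rw [crossOp_arr h hk, map_add, map_smul, map_smul, crossOp_arr rfl hk, crossOp_arr rfl hk,
    hc.stay_symm Q Λ hs, h]
  module

/-- If all three labels agree, then `b s s'` is the inverse of `x s - x s'`, and this is a partial
fraction identity. Otherwise every term has a factor for two different labels, which is zero. -/
theorem IsCoeff.stay_mul (hc : IsCoeff Q Λ lab x a b) {s s' s'' : ℕ} (h : s ≠ s') (h' : s' ≠ s'')
    (h'' : s ≠ s'') : b s s' * b s s'' = b s s'' * b s'' s' + b s' s'' * b s s' := by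
  by_cases hl : lab s = lab s'
  · by_cases hl' : lab s' = lab s''
    · have h1 := hc.stay s s' h hl
      have h2 := hc.stay s' s'' h' hl'
      have h3 := hc.stay s s'' h'' (hl.trans hl')
      rw [hc.stay_symm Q Λ h']
      linear_combination (-(b s s' * b s s'')) * h2 + b s' s'' * b s s' * h3 -
        b s s'' * b s' s'' * h1
    · rw [hc.stay_ne _ _ hl', hc.stay_ne s s'' (by rwa [hl])]; ring
  · rw [hc.stay_ne _ _ hl]
    by_cases hl' : lab s = lab s''
    · rw [hc.stay_ne s'' s' (by rw [← hl']; exact hl)]; ring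
    · rw [hc.stay_ne _ _ hl']; ring

/-- All permuted arrangements cancel, some of them by partial fractions, and only a scalar remains.
Since `b r p` inverts `x r - x p` if the outer labels agree, this scalar produces the divided
differences in the triple point relations. -/
theorem crossOp_braid (hc : IsCoeff Q Λ lab x a b) {t t₁ t₂ : List ℕ} {r s p k : ℕ}
    (h : t = t₁ ++ r :: s :: p :: t₂) (hk : k = t₁.length) (hrs : r ≠ s) (hsp : s ≠ p)
    (hrp : r ≠ p) :
    crossOp a b k (crossOp a b (k + 1) (crossOp a b k (arr t))) -
      crossOp a b (k + 1) (crossOp a b k (crossOp a b (k + 1) (arr t))) =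
      (b r p * (a r s * a s r - a s p * a p s) + b r s * b s p * (b r s - b s p)) • arr t := by
  have e1 : ∀ r s p, crossOp a b k (arr (t₁ ++ r :: s :: p :: t₂)) =
      a r s • arr (t₁ ++ s :: r :: p :: t₂) + b r s • arr (t₁ ++ r :: s :: p :: t₂) :=
    fun r s p => crossOp_arr rfl hk
  have e2 : ∀ r s p, crossOp a b (k + 1) (arr (t₁ ++ r :: s :: p :: t₂)) =
      a s p • arr (t₁ ++ r :: p :: s :: t₂) + b s p • arr (t₁ ++ r :: s :: p :: t₂) :=
    fun r s p => by
      rw [crossOp_arr (t₁ := t₁ ++ [r]) (s := s) (s' := p) (t₂ := t₂) (by simp) (by simp [hk])]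
      simp
  subst h
  simp only [e1, e2, map_add, map_smul]
  have f1 := hc.stay_mul Q Λ hrs hsp hrp
  rw [hc.stay_symm Q Λ hsp] at f1 ⊢
  rw [hc.stay_symm Q Λ hrs]
  match_scalars
  all_goals first
    | ring1
    | linear_combination a s p * f1
    | linear_combination - a r s * f1

theorem pow_apply_of_eigen {f : Module.End L (Arr L)} {z : Arr L} {c : L} (h : f z = c • z) (n : ℕ) :
    (f ^ n) z = c ^ n • z := by
  induction n with
  | zero => simp
  | succ n ih => rw [pow_succ, Module.End.mul_apply, h, map_smul, ih, smul_smul, ← pow_succ']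

theorem pow_mul_pow_apply {f g : Module.End L (Arr L)} {z : Arr L} {c d : L} (hf : f z = c • z)
    (hg : g z = d • z) (m n : ℕ) : (f ^ m * g ^ n) z = (c ^ m * d ^ n) • z := by
  rw [Module.End.mul_apply, pow_apply_of_eigen hg, map_smul, pow_apply_of_eigen hf, smul_smul,
    mul_comm]

theorem divPow_apply {f g : Module.End L (Arr L)} {z : Arr L} {c d : L} (hf : f z = c • z)
    (hg : g z = d • z) (p : ℕ) : divPow p f g z = divPow p c d • z := by
  simp only [divPow, LinearMap.sum_apply, pow_mul_pow_apply hf hg, Finset.sum_smul]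

theorem eval₂_apply {f g : Module.End L (Arr L)} {z : Arr L} {c d : L} (hf : f z = c • z)
    (hg : g z = d • z) (R : MvPolynomial (Fin 2) 𝕜) : eval₂ R f g z = eval₂ R c d • z := by
  simp only [eval₂, LinearMap.sum_apply, LinearMap.smul_apply, pow_mul_pow_apply hf hg,
    Finset.sum_smul, smul_assoc]

theorem divDiff_apply {f g k : Module.End L (Arr L)} {z : Arr L} {c d e : L} (hf : f z = c • z)
    (hg : g z = d • z) (hk : k z = e • z) (R : MvPolynomial (Fin 2) 𝕜) :
    divDiff R f g k z = divDiff R c d e • z := by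
  simp only [divDiff, LinearMap.sum_apply, LinearMap.smul_apply, Module.End.mul_apply,
    pow_apply_of_eigen hg, map_smul, divPow_apply hf hk, Finset.sum_smul, smul_assoc, smul_smul]
  refine Finset.sum_congr rfl fun m _ => ?_
  rw [mul_comm]

theorem sub_mul_divPow (p : ℕ) (c d : L) : (c - d) * divPow p c d = c ^ p - d ^ p := by
  rw [divPow, mul_comm]
  exact (Commute.all c d).geom_sum₂_mul p

theorem sub_mul_divDiff (R : MvPolynomial (Fin 2) 𝕜) (c d e : L) :
    (c - e) * divDiff R c d e = eval₂ R c d - eval₂ R e d := by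
  simp only [divDiff, eval₂, Finset.mul_sum, ← Finset.sum_sub_distrib, mul_smul_comm, ← smul_sub]
  refine Finset.sum_congr rfl fun m _ => ?_
  rw [← mul_assoc, sub_mul_divPow, sub_mul]

variable (lab x a b) in
/-- The action of the free algebra. -/
def freeOp : FreeAlgebra 𝕜 (Gen I) →ₐ[𝕜] Module.End L (Arr L) :=
  FreeAlgebra.lift 𝕜 (genOp lab x a b)

theorem freeOp_fId (w : List (Option I)) :
    freeOp lab x a b (fId 𝕜 w) = projOp L lab w := by simp [freeOp, genOp]

theorem freeOp_fDot (u : List (Option I)) (i : I) (v : List (Option I)) :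
    freeOp lab x a b (fDot 𝕜 u i v) = dotOp x u.length * projOp L lab (u ++ some i :: v) := by
  simp [freeOp, genOp]

theorem freeOp_fCross (u : List (Option I)) (c d : Option I) (v : List (Option I)) :
    freeOp lab x a b (fCross 𝕜 u c d v) =
      crossOp a b u.length * projOp L lab (u ++ c :: d :: v) := by
  simp [freeOp, genOp]

theorem freeOp_fDot_apply {t t₁ t₂ : List ℕ} {s : ℕ} {i : I} {u v : List (Option I)}
    (ht : Proper lab t) (h : t = t₁ ++ s :: t₂) (hu : t₁.map lab = u) (hs : lab s = some i)
    (hv : t₂.map lab = v) :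
    freeOp lab x a b (fDot 𝕜 u i v) (arr t) = x s • arr t := by
  rw [freeOp_fDot, Module.End.mul_apply, projOp_of ht (by rw [h]; simp [hu, hs, hv]),
    dotOp_arr h (by simp [← hu])]

theorem freeOp_fDot_apply_of_not {t : List ℕ} {i : I} {u v : List (Option I)}
    (h : ¬(Proper lab t ∧ t.map lab = u ++ some i :: v)) :
    freeOp lab x a b (fDot 𝕜 u i v) (arr t) = 0 := by
  rw [freeOp_fDot, Module.End.mul_apply, projOp_of_not h, map_zero]

theorem freeOp_fCross_apply {t : List ℕ} {c d : Option I} {u v : List (Option I)}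
    (ht : Proper lab t) (h : t.map lab = u ++ c :: d :: v) :
    freeOp lab x a b (fCross 𝕜 u c d v) (arr t) = crossOp a b u.length (arr t) := by
  rw [freeOp_fCross, Module.End.mul_apply, projOp_of ht h]

theorem freeOp_fCross_apply_of_not {t : List ℕ} {c d : Option I} {u v : List (Option I)}
    (h : ¬(Proper lab t ∧ t.map lab = u ++ c :: d :: v)) :
    freeOp lab x a b (fCross 𝕜 u c d v) (arr t) = 0 := by
  rw [freeOp_fCross, Module.End.mul_apply, projOp_of_not h, map_zero]

theorem freeOp_fDot_eigen {u v : List (Option I)} {i : I} (t : List ℕ) :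
    ∃ c : L, freeOp lab x a b (fDot 𝕜 u i v) (arr t) = c • arr t := by
  by_cases h : Proper lab t ∧ t.map lab = u ++ some i :: v
  · obtain ⟨t₁, s, t₂, rfl, h1, h2, h3⟩ := map_eq_append_cons h.2
    exact ⟨x s, freeOp_fDot_apply h.1 rfl h1 h2 h3⟩
  · exact ⟨0, by rw [freeOp_fDot_apply_of_not h, zero_smul]⟩

/-- Composition of crossings: no projection is necessary in the middle. -/
theorem freeOp_fCross_crossOp (hc : IsCoeff Q Λ lab x a b) {t t₁ t₂ : List ℕ} {s s' k : ℕ}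
    {c d : Option I} {u v : List (Option I)} (ht : Proper lab t) (h : t = t₁ ++ s :: s' :: t₂)
    (hk : k = t₁.length) (hw : (t₁ ++ s' :: s :: t₂).map lab = u ++ c :: d :: v) :
    freeOp lab x a b (fCross 𝕜 u c d v) (crossOp a b k (arr t)) =
      crossOp a b u.length (crossOp a b k (arr t)) := by
  rw [freeOp_fCross, Module.End.mul_apply, projOp_crossOp Q Λ hc ht h hk hw]

end Universal

end

/-! ### The universal module satisfies the relations of diagrams -/

section

variable {I : Type u} {𝕜 : Type v} [CommRing 𝕜] [DecidableEq I]
variable (Q : I → I → MvPolynomial (Fin 2) 𝕜) (Λ : I → ℕ)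

section Universal

variable {L : Type*} [CommRing L] [Algebra 𝕜 L]
variable {lab : ℕ → Option I} {x : ℕ → L} {a b : ℕ → ℕ → L}

theorem crossOp_crossOp_comm {t t₁ t₂ t₃ : List ℕ} {s s' r r' k l : ℕ}
    (h : t = t₁ ++ s :: s' :: t₂ ++ r :: r' :: t₃) (hk : k = t₁.length)
    (hl : l = (t₁ ++ s :: s' :: t₂).length) :
    crossOp a b k (crossOp a b l (arr t)) = crossOp a b l (crossOp a b k (arr t)) := by
  have e1 : ∀ r r', crossOp a b k (arr (t₁ ++ s :: s' :: t₂ ++ r :: r' :: t₃)) =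
      a s s' • arr (t₁ ++ s' :: s :: t₂ ++ r :: r' :: t₃) +
        b s s' • arr (t₁ ++ s :: s' :: t₂ ++ r :: r' :: t₃) := fun r r' => by
    rw [crossOp_arr (t₁ := t₁) (s := s) (s' := s') (t₂ := t₂ ++ r :: r' :: t₃) (by simp) hk]
    simp
  have e2 : ∀ s s', crossOp a b l (arr (t₁ ++ s :: s' :: t₂ ++ r :: r' :: t₃)) =
      a r r' • arr (t₁ ++ s :: s' :: t₂ ++ r' :: r :: t₃) +
        b r r' • arr (t₁ ++ s :: s' :: t₂ ++ r :: r' :: t₃) := fun s s' =>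
    crossOp_arr rfl (by simp [hl])
  subst h
  simp only [e1, e2, map_add, map_smul]
  module

theorem isotopy_freeOp (hc : IsCoeff Q Λ lab x a b) (u : List (Option I)) (g : Piece I)
    (w : List (Option I)) (g' : Piece I) (v : List (Option I)) (t : List ℕ)
    (ht : Proper lab t) (h : t.map lab = u ++ (g.src ++ (w ++ (g'.src ++ v)))) :
    genOp lab x a b (.put u g (w ++ (g'.tgt ++ v)))
        (genOp lab x a b (.put (u ++ (g.src ++ w)) g' v) (arr t)) =
      genOp lab x a b (.put (u ++ (g.tgt ++ w)) g' v)
        (genOp lab x a b (.put u g (w ++ (g'.src ++ v))) (arr t)) := by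
  obtain ⟨t₁, t', rfl, h1, h'⟩ := List.map_eq_append_iff.1 h
  rcases g with i | ⟨c, d⟩ <;> rcases g' with j | ⟨c', d'⟩ <;>
    simp only [Piece.src, Piece.tgt, genOp, List.cons_append, List.nil_append,
      Module.End.mul_apply] at h' ⊢
  · obtain ⟨s, t'', rfl, h2, h''⟩ := List.map_eq_cons_iff.1 h'
    obtain ⟨t₂, r, t₃, rfl, h3, h4, h5⟩ := map_eq_append_cons h''
    have hw : (t₁ ++ s :: (t₂ ++ r :: t₃)).map lab = u ++ some i :: w ++ some j :: v := by
      simp [h1, h2, h3, h4, h5]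
    have e1 : ∀ k, k = u.length → dotOp x k (arr (t₁ ++ s :: (t₂ ++ r :: t₃))) =
      x s • arr (t₁ ++ s :: (t₂ ++ r :: t₃)) := fun k hk => dotOp_arr rfl (by simp [hk, ← h1])
    have e2 : ∀ k, k = (u ++ some i :: w).length → dotOp x k (arr (t₁ ++ s :: (t₂ ++ r :: t₃))) =
      x r • arr (t₁ ++ s :: (t₂ ++ r :: t₃)) := fun k hk =>
        dotOp_arr (t₁ := t₁ ++ s :: t₂) (t₂ := t₃) (by simp) (by simp [hk, ← h1, ← h3])
    have hw' : (t₁ ++ s :: (t₂ ++ r :: t₃)).map lab = u ++ some i :: (w ++ some j :: v) := by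
      simpa using hw
    simp only [projOp_of ht hw, projOp_of ht hw', e1 _ rfl, e2 _ rfl, map_smul]
    rw [smul_comm]
  · obtain ⟨s, t'', rfl, h2, h''⟩ := List.map_eq_cons_iff.1 h'
    obtain ⟨t₂, r, r', t₃, rfl, h3, h4, h4', h5⟩ := map_eq_append_cons_cons h''
    have hw : (t₁ ++ s :: (t₂ ++ r :: r' :: t₃)).map lab = u ++ some i :: w ++ c' :: d' :: v := by
      simp [h1, h2, h3, h4, h4', h5]
    have e1 : ∀ r r', dotOp x u.length (arr (t₁ ++ s :: (t₂ ++ r :: r' :: t₃))) =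
      x s • arr (t₁ ++ s :: (t₂ ++ r :: r' :: t₃)) := fun r r' => dotOp_arr rfl (by simp [← h1])
    have e2 : crossOp a b (u ++ some i :: w).length (arr (t₁ ++ s :: (t₂ ++ r :: r' :: t₃))) =
      a r r' • arr (t₁ ++ s :: (t₂ ++ r' :: r :: t₃)) +
        b r r' • arr (t₁ ++ s :: (t₂ ++ r :: r' :: t₃)) := by
      rw [crossOp_arr (t₁ := t₁ ++ s :: t₂) (s := r) (s' := r') (t₂ := t₃) (by simp)
        (by simp [← h1, ← h3])]
      simp
    rw [projOp_of ht hw, projOp_crossOp Q Λ hc ht (t₁ := t₁ ++ s :: t₂) (s := r) (s' := r')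
      (t₂ := t₃) (by simp) (by simp [← h1, ← h3]) (by simp [h1, h2, h3, h4, h4', h5]),
      projOp_of ht (by simpa using hw), e1, map_smul, projOp_of ht hw, map_smul, e2, map_add,
      map_smul, map_smul, e1, e1]
    module
  · obtain ⟨s, t'', rfl, h2, h''⟩ := List.map_eq_cons_iff.1 h'
    obtain ⟨s', t'', rfl, h2', h''⟩ := List.map_eq_cons_iff.1 h''
    obtain ⟨t₂, r, t₃, rfl, h3, h4, h5⟩ := map_eq_append_cons h''
    have hw : (t₁ ++ s :: s' :: (t₂ ++ r :: t₃)).map lab = u ++ c :: d :: w ++ some j :: v := by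
      simp [h1, h2, h2', h3, h4, h5]
    have e1 : ∀ s s' k, k = (u ++ c :: d :: w).length →
      dotOp x k (arr (t₁ ++ s :: s' :: (t₂ ++ r :: t₃))) =
      x r • arr (t₁ ++ s :: s' :: (t₂ ++ r :: t₃)) := fun s s' k hk =>
        dotOp_arr (t₁ := t₁ ++ s :: s' :: t₂) (t₂ := t₃) (by simp) (by simp [hk, ← h1, ← h3])
    have e2 : crossOp a b u.length (arr (t₁ ++ s :: s' :: (t₂ ++ r :: t₃))) =
      a s s' • arr (t₁ ++ s' :: s :: (t₂ ++ r :: t₃)) +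
        b s s' • arr (t₁ ++ s :: s' :: (t₂ ++ r :: t₃)) := crossOp_arr rfl (by simp [← h1])
    rw [projOp_of ht hw, projOp_of ht (by simpa using hw), projOp_crossOp Q Λ hc ht (t₁ := t₁)
      (s := s) (s' := s') (t₂ := t₂ ++ r :: t₃) (by simp) (by simp [← h1])
      (by simp [h1, h2, h2', h3, h4, h5]), e1 _ _ _ rfl, map_smul, map_smul,
      projOp_of ht (by simpa using hw), e2, map_add, map_smul, map_smul, e1 _ _ _ (by simp),
      e1 _ _ _ (by simp)]
    module
  · obtain ⟨s, t'', rfl, h2, h''⟩ := List.map_eq_cons_iff.1 h'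
    obtain ⟨s', t'', rfl, h2', h''⟩ := List.map_eq_cons_iff.1 h''
    obtain ⟨t₂, r, r', t₃, rfl, h3, h4, h4', h5⟩ := map_eq_append_cons_cons h''
    have hw : (t₁ ++ s :: s' :: (t₂ ++ r :: r' :: t₃)).map lab =
        u ++ c :: d :: w ++ c' :: d' :: v := by simp [h1, h2, h2', h3, h4, h4', h5]
    have p1 := projOp_crossOp Q Λ hc ht (k := u.length) (w := u ++ d :: c :: w ++ c' :: d' :: v)
      (t₁ := t₁) (s := s) (s' := s') (t₂ := t₂ ++ r :: r' :: t₃) (by simp) (by simp [← h1])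
      (by simp [h1, h2, h2', h3, h4, h4', h5])
    have p2 := projOp_crossOp Q Λ hc ht (k := (u ++ c :: d :: w).length)
      (w := u ++ c :: d :: (w ++ d' :: c' :: v))
      (t₁ := t₁ ++ s :: s' :: t₂) (s := r) (s' := r') (t₂ := t₃) (by simp) (by simp [← h1, ← h3])
      (by simp [h1, h2, h2', h3, h4, h4', h5])
    rw [projOp_of ht hw, projOp_of ht (by simpa using hw), p1, p2,
      crossOp_crossOp_comm (t₁ := t₁) (s := s) (s' := s') (t₂ := t₂) (r := r) (r' := r') (t₃ := t₃)
      (by simp) (by simp [← h1]) (by simp [← h1, ← h3])]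
    simp

theorem projOp_mul_crossOp (hc : IsCoeff Q Λ lab x a b) {w u v : List (Option I)} {c d : Option I}
    {k : ℕ} (h : w = u ++ c :: d :: v) (hk : k = u.length) :
    projOp L lab (u ++ d :: c :: v) * (crossOp a b k * projOp L lab w) =
      crossOp a b k * projOp L lab w := by
  refine op_ext fun t => ?_
  simp only [Module.End.mul_apply]
  by_cases ht : Proper lab t ∧ t.map lab = w
  · rw [projOp_of ht.1 ht.2]
    obtain ⟨t₁, s, s', t₂, rfl, h1, h2, h3, h4⟩ := map_eq_append_cons_cons (ht.2.trans h)
    exact projOp_crossOp Q Λ hc ht.1 rfl (by simp [hk, ← h1]) (by simp [h1, h2, h3, h4])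
  · rw [projOp_of_not ht, map_zero, map_zero]

/-- Each crossing operator maps arrangements with the labels at its bottom to arrangements with the
labels at its top. So the projections between the three crossings can be dropped, and
`crossOp_braid` applies. -/
theorem triple_freeOp (hc : IsCoeff Q Λ lab x a b) (u : List (Option I)) (c d e : Option I)
    (v : List (Option I)) {t t₁ t₂ : List ℕ} {r s p : ℕ} (ht : Proper lab t)
    (h : t = t₁ ++ r :: s :: p :: t₂) (hu : t₁.map lab = u) (hr : lab r = c) (hs : lab s = d)
    (hp : lab p = e) (hv : t₂.map lab = v) :
    freeOp lab x a b (fCross 𝕜 u d e (c :: v) * fCross 𝕜 (u ++ [d]) c e v *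
        fCross 𝕜 u c d (e :: v)) (arr t) -
      freeOp lab x a b (fCross 𝕜 (u ++ [e]) c d v * fCross 𝕜 u c e (d :: v) *
        fCross 𝕜 (u ++ [c]) d e v) (arr t) =
      (b r p * (a r s * a s r - a s p * a p s) + b r s * b s p * (b r s - b s p)) • arr t := by
  have hrs : r ≠ s := ht.ne (t₁ := t₁) (t₂ := []) (t₃ := p :: t₂) (by simp [h])
  have hsp : s ≠ p := ht.ne (t₁ := t₁ ++ [r]) (t₂ := []) (t₃ := t₂) (by simp [h])
  have hrp : r ≠ p := ht.ne (t₁ := t₁) (t₂ := [s]) (t₃ := t₂) (by simp [h])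
  rw [← crossOp_braid Q Λ hc h (k := u.length) (by simp [← hu]) hrs hsp hrp]
  subst h hu hr hs hp hv
  set u := t₁.map lab
  set v := t₂.map lab
  have e1 := projOp_mul_crossOp Q Λ hc (w := u ++ lab r :: lab s :: lab p :: v) (k := u.length)
    rfl rfl
  have e2 := projOp_mul_crossOp Q Λ hc (w := u ++ lab s :: lab r :: lab p :: v) (k := u.length + 1)
    (u := u ++ [lab s]) (c := lab r) (d := lab p) (v := v) (by simp) (by simp)
  have e3 := projOp_mul_crossOp Q Λ hc (w := u ++ lab r :: lab s :: lab p :: v) (k := u.length + 1)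
    (u := u ++ [lab r]) (c := lab s) (d := lab p) (v := v) (by simp) (by simp)
  have e4 := projOp_mul_crossOp Q Λ hc (w := u ++ lab r :: lab p :: lab s :: v) (k := u.length)
    rfl rfl
  simp only [List.append_assoc, List.cons_append, List.nil_append] at e1 e2 e3 e4
  have hw : (t₁ ++ r :: s :: p :: t₂).map lab = u ++ lab r :: lab s :: lab p :: v := by simp [u, v]
  have key : ∀ {f g h : Module.End L (Arr L)} {w₁ w₂ w₃ : List (Option I)},
      projOp L lab w₂ * (g * projOp L lab w₁) = g * projOp L lab w₁ →
      projOp L lab w₃ * (h * projOp L lab w₂) = h * projOp L lab w₂ →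
      (t₁ ++ r :: s :: p :: t₂).map lab = w₁ →
      (f * projOp L lab w₃ * (h * projOp L lab w₂) * (g * projOp L lab w₁))
        (arr (t₁ ++ r :: s :: p :: t₂)) = f (h (g (arr (t₁ ++ r :: s :: p :: t₂)))) := by
    intro f g h w₁ w₂ w₃ h1 h2 h3
    rw [mul_assoc f, h2, mul_assoc, mul_assoc, h1]
    simp only [Module.End.mul_apply, projOp_of ht h3]
  simp only [map_mul, freeOp_fCross, List.append_assoc, List.cons_append, List.nil_append,
    List.length_append, List.length_singleton]
  rw [key e1 e2 hw, key e3 e4 hw]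

theorem freeOp_eval₂ (R : MvPolynomial (Fin 2) 𝕜) (y z : FreeAlgebra 𝕜 (Gen I)) :
    freeOp lab x a b (eval₂ R y z) = eval₂ R (freeOp lab x a b y) (freeOp lab x a b z) := by
  simp [eval₂]

theorem freeOp_divPow (p : ℕ) (y z : FreeAlgebra 𝕜 (Gen I)) :
    freeOp lab x a b (divPow p y z) = divPow p (freeOp lab x a b y) (freeOp lab x a b z) := by
  simp [divPow]

theorem freeOp_divDiff (R : MvPolynomial (Fin 2) 𝕜) (y z w : FreeAlgebra 𝕜 (Gen I)) :
    freeOp lab x a b (divDiff R y z w) =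
      divDiff R (freeOp lab x a b y) (freeOp lab x a b z) (freeOp lab x a b w) := by
  simp [divDiff, freeOp_divPow]

/-- Both sides are compared on one arrangement at a time. If its labels match, the conditions in
`IsCoeff` are what is needed for the scalars to agree; otherwise both sides vanish. -/
theorem freeOp_rel (hc : IsCoeff Q Λ lab x a b) {y z : FreeAlgebra 𝕜 (Gen I)} (h : Rel Q Λ y z) :
    freeOp lab x a b y = freeOp lab x a b z := by
  -- These two facts settle the arrangements whose labels do not match the bottom of a diagram.
  have crossNot : ∀ {y : FreeAlgebra 𝕜 (Gen I)} {u c d v t},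
      ¬ (Proper lab t ∧ t.map lab = u ++ c :: d :: v) →
      freeOp lab x a b (y * fCross 𝕜 u c d v) (arr t) = 0 := by
    intro y u c d v t h
    rw [map_mul, Module.End.mul_apply, freeOp_fCross_apply_of_not h, map_zero]
  have dotNot : ∀ {y : FreeAlgebra 𝕜 (Gen I)} {u i v t},
      ¬ (Proper lab t ∧ t.map lab = u ++ some i :: v) →
      freeOp lab x a b (y * fDot 𝕜 u i v) (arr t) = 0 := by
    intro y u c d t h
    rw [map_mul, Module.End.mul_apply, freeOp_fDot_apply_of_not h, map_zero]
  refine op_ext fun t => ?_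
  cases h with
  | idm_mul_self w =>
    rw [map_mul, freeOp_fId, Module.End.mul_apply]
    by_cases h : Proper lab t ∧ t.map lab = w
    · rw [projOp_of h.1 h.2, projOp_of h.1 h.2]
    · rw [projOp_of_not h, map_zero]
  | idm_mul_ne w w' hw =>
    rw [map_mul, freeOp_fId, freeOp_fId, Module.End.mul_apply, map_zero, LinearMap.zero_apply]
    by_cases h : Proper lab t ∧ t.map lab = w'
    · rw [projOp_of h.1 h.2, projOp_of_not]
      rintro ⟨-, h'⟩
      exact hw (h'.symm.trans h.2)
    · rw [projOp_of_not h, map_zero]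
  | tgt_mul u g v =>
    rw [map_mul, freeOp_fId]
    rcases g with i | ⟨c, d⟩
    · simp only [Piece.tgt, List.cons_append, List.nil_append]
      rw [freeOp_fDot, Module.End.mul_apply, Module.End.mul_apply]
      by_cases h : Proper lab t ∧ t.map lab = u ++ some i :: v
      · rw [projOp_of h.1 h.2, projOp_dotOp, projOp_of h.1 h.2]
      · rw [projOp_of_not h, map_zero, map_zero]
    · simp only [Piece.tgt, List.cons_append, List.nil_append]
      rw [freeOp_fCross, projOp_mul_crossOp Q Λ hc rfl rfl]
  | mul_src u g v =>
    rw [map_mul, freeOp_fId]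
    rcases g with i | ⟨c, d⟩
    · simp only [Piece.src, List.cons_append, List.nil_append]
      rw [freeOp_fDot, Module.End.mul_apply, Module.End.mul_apply, Module.End.mul_apply]
      by_cases h : Proper lab t ∧ t.map lab = u ++ some i :: v
      · rw [projOp_of h.1 h.2, projOp_of h.1 h.2]
      · rw [projOp_of_not h, map_zero, map_zero]
    · simp only [Piece.src, List.cons_append, List.nil_append]
      rw [freeOp_fCross, Module.End.mul_apply, Module.End.mul_apply, Module.End.mul_apply]
      by_cases h : Proper lab t ∧ t.map lab = u ++ c :: d :: v
      · rw [projOp_of h.1 h.2, projOp_of h.1 h.2]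
      · rw [projOp_of_not h, map_zero, map_zero]
  | isotopy u g w g' v =>
    by_cases h : Proper lab t ∧ t.map lab = u ++ (g.src ++ (w ++ (g'.src ++ v)))
    · have := isotopy_freeOp Q Λ hc u g w g' v t h.1 h.2
      simpa [freeOp, Module.End.mul_apply] using this
    · rcases g with i | ⟨c, d⟩ <;> rcases g' with j | ⟨c', d'⟩ <;>
        simp only [Piece.src, Piece.tgt, List.cons_append, List.nil_append] at h ⊢
      · rw [dotNot (by simpa using h), dotNot (by simpa using h)]
      · rw [crossNot (by simpa using h), dotNot (by simpa using h)]
      · rw [crossNot (by simpa using h), dotNot (by simpa using h)]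
      · rw [crossNot (by simpa using h), crossNot (by simpa using h)]
  | dot_left u i c v =>
    by_cases h : Proper lab t ∧ t.map lab = u ++ some i :: c :: v
    · obtain ⟨t₁, s, s', t₂, rfl, h1, h2, h3, h4⟩ := map_eq_append_cons_cons h.2
      have hss : s ≠ s' := h.1.ne (t₁ := t₁) (t₂ := []) (t₃ := t₂) (by simp)
      have e : projOp L lab (u ++ c :: some i :: v) (b s s' • arr (t₁ ++ s :: s' :: t₂)) = _ :=
        projOp_smul_swap Q Λ hc h.1 rfl (List.Perm.refl _) (by simp [h1, h2, h3, h4])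
      rw [map_smul] at e
      simp only [map_sub, map_mul, LinearMap.sub_apply, Module.End.mul_apply]
      rw [freeOp_fDot_apply h.1 rfl h1 h2 (by simp [h3, h4]), map_smul,
        freeOp_fCross_apply h.1 h.2, crossOp_arr rfl (by simp [← h1]), map_add, map_smul, map_smul,
        freeOp_fDot_apply (t₁ := t₁ ++ [s']) (s := s) (t₂ := t₂) (h.1.perm
          ((List.Perm.swap _ _ _).append_left _)) (by simp) (by simp [h1, h3]) h2 h4]
      by_cases hl : c = some i
      · subst hl
        rw [if_pos rfl, freeOp_fId, projOp_of h.1 h.2,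
          freeOp_fDot_apply (t₁ := t₁ ++ [s]) (s := s') (t₂ := t₂) h.1 (by simp)
            (by simp [h1, h2]) h3 h4]
        have h0 := hc.stay s s' hss (h2.trans h3.symm)
        match_scalars
        · ring
        · linear_combination h0
      · rw [if_neg hl, map_zero, LinearMap.zero_apply, hc.stay_ne s s' (by rw [h2, h3]; exact fun h => hl h.symm)]
        module
    · have h' : freeOp lab x a b (if c = some i then fId 𝕜 (u ++ some i :: some i :: v) else 0)
          (arr t) = 0 := by
        split_ifs with hl
        · rw [freeOp_fId, projOp_of_not (by rwa [hl] at h)]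
        · rw [map_zero, LinearMap.zero_apply]
      rw [h', map_sub, LinearMap.sub_apply, dotNot h, crossNot h, sub_zero]
  | dot_right u c i v =>
    by_cases h : Proper lab t ∧ t.map lab = u ++ c :: some i :: v
    · obtain ⟨t₁, s, s', t₂, rfl, h1, h2, h3, h4⟩ := map_eq_append_cons_cons h.2
      have hss : s ≠ s' := h.1.ne (t₁ := t₁) (t₂ := []) (t₃ := t₂) (by simp)
      simp only [map_sub, map_mul, LinearMap.sub_apply, Module.End.mul_apply]
      rw [freeOp_fDot_apply (t₁ := t₁ ++ [s]) (s := s') (t₂ := t₂) h.1 (by simp) (by simp [h1, h2])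
        h3 h4, map_smul,
        freeOp_fCross_apply h.1 h.2, crossOp_arr rfl (by simp [← h1]), map_add, map_smul, map_smul,
        freeOp_fDot_apply (t₁ := t₁) (s := s') (t₂ := s :: t₂) (h.1.perm
          ((List.Perm.swap _ _ _).append_left _)) (by simp) h1 h3 (by simp [h2, h4])]
      by_cases hl : c = some i
      · subst hl
        rw [if_pos rfl, freeOp_fId, projOp_of h.1 h.2,
          freeOp_fDot_apply (t₁ := t₁) (s := s) (t₂ := s' :: t₂) h.1 rfl
            h1 h2 (by simp [h3, h4])]
        have h0 := hc.stay s s' hss (h2.trans h3.symm)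
        match_scalars
        · ring
        · linear_combination h0
      · rw [if_neg hl, map_zero, LinearMap.zero_apply, hc.stay_ne s s' (by rw [h2, h3]; exact hl)]
        module
    · have h' : freeOp lab x a b (if c = some i then fId 𝕜 (u ++ some i :: some i :: v) else 0)
          (arr t) = 0 := by
        split_ifs with hl
        · rw [freeOp_fId, projOp_of_not (by rwa [hl] at h)]
        · rw [map_zero, LinearMap.zero_apply]
      rw [h', map_sub, LinearMap.sub_apply, crossNot h, dotNot (by simpa using h), sub_zero]
  | bigon_eq u c v =>
    rw [map_zero, LinearMap.zero_apply]
    by_cases h : Proper lab t ∧ t.map lab = u ++ c :: c :: v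
    · obtain ⟨t₁, s, s', t₂, rfl, h1, h2, h3, h4⟩ := map_eq_append_cons_cons h.2
      have hss : s ≠ s' := h.1.ne (t₁ := t₁) (t₂ := []) (t₃ := t₂) (by simp)
      rw [map_mul, Module.End.mul_apply, freeOp_fCross_apply h.1 h.2,
        freeOp_fCross_crossOp Q Λ hc h.1 rfl (by simp [← h1]) (by simp [h1, h2, h3, h4]),
        crossOp_crossOp Q Λ hc rfl (by simp [← h1]) hss, hc.swap_eq s s' hss (h2.trans h3.symm)]
      simp
    · exact crossNot h
  | bigon_ne u i j v hij =>
    by_cases h : Proper lab t ∧ t.map lab = u ++ some i :: some j :: v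
    · obtain ⟨t₁, s, s', t₂, rfl, h1, h2, h3, h4⟩ := map_eq_append_cons_cons h.2
      have hss : s ≠ s' := h.1.ne (t₁ := t₁) (t₂ := []) (t₃ := t₂) (by simp)
      rw [map_mul, Module.End.mul_apply, freeOp_fCross_apply h.1 h.2,
        freeOp_fCross_crossOp Q Λ hc h.1 rfl (by simp [← h1]) (by simp [h1, h2, h3, h4]),
        crossOp_crossOp Q Λ hc rfl (by simp [← h1]) hss, hc.swap_ne s s' i j h2 h3 hij,
        hc.stay_ne s s' (by rw [h2, h3]; simpa using hij), map_mul, freeOp_eval₂, freeOp_fId,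
        Module.End.mul_apply, eval₂_apply (freeOp_fDot_apply h.1 rfl h1 h2 (by simp [h3, h4]))
        (freeOp_fDot_apply (t₁ := t₁ ++ [s]) (t₂ := t₂) h.1 (by simp) (by simp [h1, h2]) h3 h4),
        map_smul, projOp_of h.1 h.2]
      simp
    · obtain ⟨_, h1⟩ := freeOp_fDot_eigen (lab := lab) (x := x) (a := a) (b := b) (𝕜 := 𝕜)
        (u := u) (i := i) (v := some j :: v) t
      obtain ⟨_, h2⟩ := freeOp_fDot_eigen (lab := lab) (x := x) (a := a) (b := b) (𝕜 := 𝕜)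
        (u := u ++ [some i]) (i := j) (v := v) t
      rw [crossNot h, map_mul, freeOp_eval₂, freeOp_fId, Module.End.mul_apply, eval₂_apply h1 h2,
        map_smul, projOp_of_not h, smul_zero]
  | bigon_red_right u i v =>
    by_cases h : Proper lab t ∧ t.map lab = u ++ some i :: none :: v
    · obtain ⟨t₁, s, s', t₂, rfl, h1, h2, h3, h4⟩ := map_eq_append_cons_cons h.2
      have hss : s ≠ s' := h.1.ne (t₁ := t₁) (t₂ := []) (t₃ := t₂) (by simp)
      rw [map_mul, Module.End.mul_apply, freeOp_fCross_apply h.1 h.2,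
        freeOp_fCross_crossOp Q Λ hc h.1 rfl (by simp [← h1]) (by simp [h1, h2, h3, h4]),
        crossOp_crossOp Q Λ hc rfl (by simp [← h1]) hss, hc.swap_red s s' i h2 h3,
        hc.stay_ne s s' (by rw [h2, h3]; simp), map_mul, map_pow, freeOp_fId,
        Module.End.mul_apply,
        pow_apply_of_eigen (freeOp_fDot_apply h.1 rfl h1 h2 (by simp [h3, h4])),
        map_smul, projOp_of h.1 h.2]
      simp
    · obtain ⟨_, h1⟩ := freeOp_fDot_eigen (lab := lab) (x := x) (a := a) (b := b) (𝕜 := 𝕜)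
        (u := u) (i := i) (v := none :: v) t
      rw [crossNot h, map_mul, map_pow, freeOp_fId, Module.End.mul_apply, pow_apply_of_eigen h1,
        map_smul, projOp_of_not h, smul_zero]
  | bigon_red_left u i v =>
    by_cases h : Proper lab t ∧ t.map lab = u ++ none :: some i :: v
    · obtain ⟨t₁, s, s', t₂, rfl, h1, h2, h3, h4⟩ := map_eq_append_cons_cons h.2
      have hss : s ≠ s' := h.1.ne (t₁ := t₁) (t₂ := []) (t₃ := t₂) (by simp)
      rw [map_mul, Module.End.mul_apply, freeOp_fCross_apply h.1 h.2,
        freeOp_fCross_crossOp Q Λ hc h.1 rfl (by simp [← h1]) (by simp [h1, h2, h3, h4]),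
        crossOp_crossOp Q Λ hc rfl (by simp [← h1]) hss, mul_comm (a s s'),
        hc.swap_red s' s i h3 h2,
        hc.stay_ne s s' (by rw [h2, h3]; simp), map_mul, map_pow, freeOp_fId,
        Module.End.mul_apply,
        pow_apply_of_eigen (freeOp_fDot_apply (t₁ := t₁ ++ [s]) (t₂ := t₂) h.1 (by simp)
          (by simp [h1, h2]) h3 h4),
        map_smul, projOp_of h.1 h.2]
      simp
    · obtain ⟨_, h1⟩ := freeOp_fDot_eigen (lab := lab) (x := x) (a := a) (b := b) (𝕜 := 𝕜)
        (u := u ++ [none]) (i := i) (v := v) t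
      rw [crossNot h, map_mul, map_pow, freeOp_fId, Module.End.mul_apply, pow_apply_of_eigen h1,
        map_smul, projOp_of_not h, smul_zero]
  | triple_zero u c d e v hcd =>
    by_cases h : Proper lab t ∧ t.map lab = u ++ c :: d :: e :: v
    · obtain ⟨t₁, r, s, t', rfl, h1, h2, h3, h4⟩ := map_eq_append_cons_cons h.2
      obtain ⟨p, t₂, rfl, h4, h5⟩ := List.map_eq_cons_iff.1 h4
      have hrs : r ≠ s := h.1.ne (t₁ := t₁) (t₂ := []) (t₃ := p :: t₂) (by simp)
      have hsp : s ≠ p := h.1.ne (t₁ := t₁ ++ [r]) (t₂ := []) (t₃ := t₂) (by simp)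
      have hrp : r ≠ p := h.1.ne (t₁ := t₁) (t₂ := [s]) (t₃ := t₂) (by simp)
      rw [← sub_eq_zero, triple_freeOp Q Λ hc u c d e v h.1 rfl h1 h2 h3 h4 h5]
      -- If all labels agree, the product of `a`'s is `-b ^ 2`, and the scalar is a multiple of the
      -- partial fraction identity. If the outer labels differ, `b r p` vanishes, and so does `b r
      -- s` or `b s p`.
      have : b r p * (a r s * a s r - a s p * a p s) + b r s * b s p * (b r s - b s p) = 0 := by
        by_cases hce : c = e
        · subst hce
          obtain rfl : c = d := by simpa using hcd
          rw [hc.swap_eq r s hrs (h2.trans h3.symm), hc.swap_eq s p hsp (h3.trans h4.symm)]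
          have := hc.stay_mul Q Λ hrs hsp hrp
          rw [hc.stay_symm Q Λ hsp] at this
          linear_combination (b s p - b r s) * this
        · rw [hc.stay_ne r p (by rw [h2, h4]; exact hce)]
          by_cases hcd : c = d
          · rw [hc.stay_ne s p (by rw [h3, h4, ← hcd]; exact hce)]; ring
          · rw [hc.stay_ne r s (by rw [h2, h3]; exact hcd)]; ring
      rw [this, zero_smul]
    · rw [crossNot h, crossNot (by simpa using h)]
  | triple_black u i j v hij =>
    by_cases h : Proper lab t ∧ t.map lab = u ++ some i :: some j :: some i :: v
    · obtain ⟨t₁, r, s, t', rfl, h1, h2, h3, h4⟩ := map_eq_append_cons_cons h.2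
      obtain ⟨p, t₂, rfl, h4, h5⟩ := List.map_eq_cons_iff.1 h4
      have hrp : r ≠ p := h.1.ne (t₁ := t₁) (t₂ := [s]) (t₃ := t₂) (by simp)
      -- As the middle label differs, `b r s = 0`. The two values of `Q i j` differ by `x r - x p`
      -- times the divided difference, and `b r p` cancels this factor.
      rw [map_sub, LinearMap.sub_apply, triple_freeOp Q Λ hc u _ _ _ v h.1 rfl h1 h2 h3 h4 h5,
        hc.swap_ne r s i j h2 h3 hij, mul_comm (a s p), hc.swap_ne p s i j h4 h3 hij,
        hc.stay_ne r s (by rw [h2, h3]; simpa using hij), map_mul, freeOp_fId, freeOp_divDiff,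
        Module.End.mul_apply, divDiff_apply
          (freeOp_fDot_apply (t₁ := t₁) (t₂ := s :: p :: t₂) h.1 rfl h1 h2 (by simp [h3, h4, h5]))
          (freeOp_fDot_apply (t₁ := t₁ ++ [r]) (t₂ := p :: t₂) h.1 (by simp) (by simp [h1, h2]) h3
            (by simp [h4, h5]))
          (freeOp_fDot_apply (t₁ := t₁ ++ [r, s]) (t₂ := t₂) h.1 (by simp) (by simp [h1, h2, h3])
            h4 h5),
        map_smul, projOp_of h.1 h.2, ← sub_mul_divDiff, ← mul_assoc,
        hc.stay r p hrp (h2.trans h4.symm)]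
      simp
    · obtain ⟨_, h1⟩ := freeOp_fDot_eigen (lab := lab) (x := x) (a := a) (b := b) (𝕜 := 𝕜)
        (u := u) (i := i) (v := some j :: some i :: v) t
      obtain ⟨_, h2⟩ := freeOp_fDot_eigen (lab := lab) (x := x) (a := a) (b := b) (𝕜 := 𝕜)
        (u := u ++ [some i]) (i := j) (v := some i :: v) t
      obtain ⟨_, h3⟩ := freeOp_fDot_eigen (lab := lab) (x := x) (a := a) (b := b) (𝕜 := 𝕜)
        (u := u ++ [some i, some j]) (i := i) (v := v) t
      rw [map_sub, LinearMap.sub_apply, crossNot h, crossNot (by simpa using h), map_mul,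
        freeOp_divDiff, freeOp_fId, Module.End.mul_apply, divDiff_apply h1 h2 h3,
        map_smul, projOp_of_not h, smul_zero, sub_zero]
  | triple_red u i v =>
    by_cases h : Proper lab t ∧ t.map lab = u ++ some i :: none :: some i :: v
    · obtain ⟨t₁, r, s, t', rfl, h1, h2, h3, h4⟩ := map_eq_append_cons_cons h.2
      obtain ⟨p, t₂, rfl, h4, h5⟩ := List.map_eq_cons_iff.1 h4
      have hrp : r ≠ p := h.1.ne (t₁ := t₁) (t₂ := [s]) (t₃ := t₂) (by simp)
      rw [map_sub, LinearMap.sub_apply, triple_freeOp Q Λ hc u _ _ _ v h.1 rfl h1 h2 h3 h4 h5,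
        hc.swap_red r s i h2 h3, mul_comm (a s p), hc.swap_red p s i h4 h3,
        hc.stay_ne r s (by rw [h2, h3]; simp), map_mul, freeOp_fId, freeOp_divPow,
        Module.End.mul_apply, divPow_apply
          (freeOp_fDot_apply (t₁ := t₁) (t₂ := s :: p :: t₂) h.1 rfl h1 h2 (by simp [h3, h4, h5]))
          (freeOp_fDot_apply (t₁ := t₁ ++ [r, s]) (t₂ := t₂) h.1 (by simp) (by simp [h1, h2, h3])
            h4 h5),
        map_smul, projOp_of h.1 h.2, ← sub_mul_divPow, ← mul_assoc,
        hc.stay r p hrp (h2.trans h4.symm)]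
      simp
    · obtain ⟨_, h1⟩ := freeOp_fDot_eigen (lab := lab) (x := x) (a := a) (b := b) (𝕜 := 𝕜)
        (u := u) (i := i) (v := none :: some i :: v) t
      obtain ⟨_, h3⟩ := freeOp_fDot_eigen (lab := lab) (x := x) (a := a) (b := b) (𝕜 := 𝕜)
        (u := u ++ [some i, none]) (i := i) (v := v) t
      rw [map_sub, LinearMap.sub_apply, crossNot h, crossNot (by simpa using h), map_mul,
        freeOp_divPow, freeOp_fId, Module.End.mul_apply, divPow_apply h1 h3,
        map_smul, projOp_of_not h, smul_zero, sub_zero]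

/-- The action of diagrams on the universal module. -/
def diagOp (hc : IsCoeff Q Λ lab x a b) : Diagrams Q Λ →ₐ[𝕜] Module.End L (Arr L) :=
  RingQuot.liftAlgHom 𝕜 ⟨freeOp lab x a b, fun _ _ h => freeOp_rel Q Λ hc h⟩

theorem diagOp_mk (hc : IsCoeff Q Λ lab x a b) (y : FreeAlgebra 𝕜 (Gen I)) :
    diagOp Q Λ hc (RingQuot.mkAlgHom 𝕜 (Rel Q Λ) y) = freeOp lab x a b y :=
  RingQuot.liftAlgHom_mkAlgHom_apply 𝕜 _ _ _

end Universal

end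

section

variable {I : Type u} {𝕜 : Type v} [CommRing 𝕜] [DecidableEq I]
variable {Q : I → I → MvPolynomial (Fin 2) 𝕜} {Λ : I → ℕ}

/-! ### Existence of coefficients -/

theorem eval₂_eq_aeval {A : Type*} [CommRing A] [Algebra 𝕜 A] (P : MvPolynomial (Fin 2) 𝕜)
    (y z : A) : eval₂ P y z = MvPolynomial.aeval ![y, z] P := by
  rw [MvPolynomial.aeval_def, MvPolynomial.eval₂_eq', eval₂]
  refine Finset.sum_congr rfl fun m _ => ?_
  rw [Fin.prod_univ_two, Algebra.smul_def]
  rfl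

theorem eval₂_swap {A : Type*} [CommRing A] [Algebra 𝕜 A] (P : MvPolynomial (Fin 2) 𝕜) (y z : A) :
    eval₂ (MvPolynomial.rename (Equiv.swap 0 1) P) y z = eval₂ P z y := by
  rw [eval₂_eq_aeval, eval₂_eq_aeval, MvPolynomial.aeval_rename]
  congr 2
  funext i
  fin_cases i <;> simp

variable (𝕜) in
/-- The ring of coefficients of the universal module. -/
abbrev Frac : Type _ := FractionRing (MvPolynomial ℕ 𝕜)

variable (𝕜) in
/-- The eigenvalue of the dot on the strand `s`. -/
def fracX (s : ℕ) : Frac 𝕜 := algebraMap (MvPolynomial ℕ 𝕜) (Frac 𝕜) (MvPolynomial.X s)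

/-- The ring `𝕜` may have zero divisors, so it has to be shown that the difference of two variables
is not one in the polynomial ring. The substitution `e` is injective and turns the difference into a
single variable, and multiplication by a variable only shifts coefficients. -/
theorem isUnit_fracX_sub {s s' : ℕ} (h : s ≠ s') : IsUnit (fracX 𝕜 s - fracX 𝕜 s') := by
  rw [fracX, fracX, ← map_sub]
  refine IsLocalization.map_units (Frac 𝕜) (⟨_, ?_⟩ : nonZeroDivisors (MvPolynomial ℕ 𝕜))
  let e : MvPolynomial ℕ 𝕜 →ₐ[𝕜] MvPolynomial ℕ 𝕜 :=
    MvPolynomial.aeval fun r => if r = s then MvPolynomial.X s + MvPolynomial.X s'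
      else MvPolynomial.X r
  let e' : MvPolynomial ℕ 𝕜 →ₐ[𝕜] MvPolynomial ℕ 𝕜 :=
    MvPolynomial.aeval fun r => if r = s then MvPolynomial.X s - MvPolynomial.X s'
      else MvPolynomial.X r
  have he : ∀ p, e' (e p) = p := by
    intro p
    have : e'.comp e = AlgHom.id 𝕜 _ := MvPolynomial.algHom_ext fun r => by
      by_cases hr : r = s
      · subst hr; simp [e, e', h.symm]
      · simp [e, e', hr]
    exact DFunLike.congr_fun this p
  have hes : e (MvPolynomial.X s - MvPolynomial.X s') = MvPolynomial.X s := by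
    simp [e, h.symm]
  rw [mem_nonZeroDivisors_iff_right]
  intro p hp
  have := congrArg e hp
  rw [map_mul, hes, map_zero] at this
  have h0 : e p = 0 := by
    ext m
    have h1 := congrArg (MvPolynomial.coeff (m + Finsupp.single s 1)) this
    rwa [MvPolynomial.coeff_mul_X, MvPolynomial.coeff_zero] at h1
  rw [← he p, h0, map_zero]

/-- The relations prescribe only the products `a s s' * a s' s`. So one factor may be normalized to
`1`, namely the one that creates an inversion; this is what makes leading coefficients monic. The
symmetry of `Q` ensures that the prescribed product does not depend on the order of the two strands.
-/
theorem exists_isCoeff {C : CartanDatum I} (hQ : IsAdmissible C Q) (Λ : I → ℕ)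
    (lab : ℕ → Option I) : ∃ a b, IsCoeff Q Λ lab (fracX 𝕜) a b ∧ ∀ s s', s < s' → a s s' = 1 := by
  let b : ℕ → ℕ → Frac 𝕜 := fun s s' =>
    if lab s = lab s' then Ring.inverse (fracX 𝕜 s - fracX 𝕜 s') else 0
  let q : ℕ → ℕ → Frac 𝕜 := fun s s' =>
    match lab s, lab s' with
    | some i, some j => eval₂ (Q i j) (fracX 𝕜 s) (fracX 𝕜 s')
    | some i, none => fracX 𝕜 s ^ Λ i
    | none, some j => fracX 𝕜 s' ^ Λ j
    | none, none => 0
  let a : ℕ → ℕ → Frac 𝕜 := fun s s' =>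
    if s < s' then 1 else if lab s = lab s' then - b s' s ^ 2 else q s' s
  have hq : ∀ s s', lab s ≠ lab s' → q s s' = q s' s := by
    intro s s' h
    simp only [q]
    rcases hs : lab s with _ | i <;> rcases hs' : lab s' with _ | j
    · rfl
    · rfl
    · rfl
    · have hij : i ≠ j := by rintro rfl; exact h (hs.trans hs'.symm)
      simp only
      rw [hQ.symm i j hij, eval₂_swap]
  have hb : ∀ s s', b s' s ^ 2 = b s s' ^ 2 := by
    intro s s'
    simp only [b]
    by_cases h : lab s = lab s'
    · rw [if_pos h, if_pos h.symm, ← neg_sub, ← neg_sq]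
      congr 1
      by_cases h' : s = s'
      · subst h'; simp
      · obtain ⟨c, hc⟩ := isUnit_fracX_sub (𝕜 := 𝕜) (fun h => h' h)
        rw [← hc, ← Units.val_neg, Ring.inverse_unit, Ring.inverse_unit]
        simp
    · rw [if_neg h, if_neg (Ne.symm h)]
  have haa : ∀ s s', s ≠ s' → lab s = lab s' → a s s' * a s' s = - b s s' ^ 2 := by
    intro s s' h hl
    rcases lt_or_gt_of_ne h with h' | h'
    · simp only [a, if_pos h', if_neg h'.not_gt, if_pos hl.symm, one_mul]
    · simp only [a, if_pos h', if_neg h'.not_gt, if_pos hl, mul_one, hb]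
  have haq : ∀ s s', lab s ≠ lab s' → a s s' * a s' s = q s s' := by
    intro s s' hl
    have h : s ≠ s' := by rintro rfl; exact hl rfl
    rcases lt_or_gt_of_ne h with h' | h'
    · simp only [a, if_pos h', if_neg h'.not_gt, if_neg hl.symm, one_mul]
    · simp only [a, if_pos h', if_neg h'.not_gt, if_neg hl, mul_one]
      exact (hq s s' hl).symm
  refine ⟨a, b, ⟨fun s s' h => if_neg h, fun s s' h hl => ?_, haa, fun s s' i j hi hj hij => ?_,
    fun s s' i hi hn => ?_⟩, fun s s' h => if_pos h⟩
  · simp only [b, if_pos hl]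
    exact Ring.inverse_mul_cancel _ (isUnit_fracX_sub h)
  · rw [haq s s' (by rw [hi, hj]; simpa using hij)]
    simp only [q, hi, hj]
  · rw [haq s s' (by rw [hi, hn]; simp)]
    simp only [q, hi, hn]

/-! ### Inversions and leading terms -/

/-- The number of inversions. -/
def inv : List ℕ → ℕ
  | [] => 0
  | a :: t => t.countP (· < a) + inv t

theorem inv_swap {r s : ℕ} (h : r < s) (u v : List ℕ) :
    inv (u ++ s :: r :: v) = inv (u ++ r :: s :: v) + 1 := by
  induction u with
  | nil =>
    simp only [List.nil_append, inv, List.countP_cons, decide_eq_true_eq, if_pos h,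
      if_neg h.not_gt]
    omega
  | cons a u ih =>
    simp only [List.cons_append, inv, ih]
    rw [((List.Perm.swap r s v).append_left u).countP_eq]
    omega

theorem inv_swap_le (r s : ℕ) (u v : List ℕ) :
    inv (u ++ s :: r :: v) ≤ inv (u ++ r :: s :: v) + 1 := by
  rcases lt_trichotomy r s with h | rfl | h
  · exact (inv_swap h u v).le
  · omega
  · have := inv_swap h u v; omega

section Lead

variable {L : Type*} [CommRing L] [Algebra 𝕜 L]

variable (L) in
/-- Combinations of arrangements with less than `n` inversions. -/
def invLT (n : ℕ) : Submodule L (Arr L) := Finsupp.supported L L {t | inv t < n}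

/-- `f • [t]` is the leading term of `z`. -/
def IsLead (z : Arr L) (f : L) (t : List ℕ) : Prop := z - f • arr t ∈ invLT L (inv t)

theorem arr_mem_invLT {t : List ℕ} {n : ℕ} (h : inv t < n) : (arr t : Arr L) ∈ invLT L n :=
  Finsupp.single_mem_supported L _ h

theorem map_invLT {m n : ℕ} {f : Module.End L (Arr L)}
    (h : ∀ t, inv t < m → f (arr t) ∈ invLT L n) {z : Arr L} (hz : z ∈ invLT L m) :
    f z ∈ invLT L n := by
  rw [invLT, Finsupp.supported_eq_span_single] at hz
  induction hz using Submodule.span_induction with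
  | mem x hx => obtain ⟨t, ht, rfl⟩ := hx; exact h t ht
  | zero => rw [map_zero]; exact Submodule.zero_mem _
  | add x y _ _ hx hy => rw [map_add]; exact Submodule.add_mem _ hx hy
  | smul c x _ hx => rw [map_smul]; exact Submodule.smul_mem _ c hx

theorem IsLead.map {z : Arr L} {f g : L} {t t' : List ℕ} (h : IsLead z f t)
    {F : Module.End L (Arr L)}
    (h1 : ∀ s, inv s < inv t → F (arr s) ∈ invLT L (inv t'))
    (h2 : F (arr t) - g • arr t' ∈ invLT L (inv t')) : IsLead (F z) (g * f) t' := by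
  have h3 := map_invLT h1 h
  have h4 := Submodule.add_mem _ h3 (Submodule.smul_mem _ f h2)
  rw [map_sub, map_smul] at h4
  rw [IsLead]
  convert h4 using 1
  module

theorem isLead_arr (t : List ℕ) : IsLead (arr t : Arr L) 1 t := by
  rw [IsLead, one_smul, sub_self]; exact Submodule.zero_mem _

variable {lab : ℕ → Option I} {x : ℕ → L} {a b : ℕ → ℕ → L}

theorem diagOp_dDot_arr_mem (hc : IsCoeff Q Λ lab x a b) (u : List (Option I)) (i : I)
    (v : List (Option I)) {s : List ℕ} {n : ℕ} (hs : inv s < n) :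
    diagOp Q Λ hc (dDot Q Λ u i v) (arr s) ∈ invLT L n := by
  rw [dDot, diagOp_mk]
  obtain ⟨c, hc⟩ := freeOp_fDot_eigen (𝕜 := 𝕜) (lab := lab) (x := x) (a := a) (b := b) (u := u)
    (i := i) (v := v) s
  rw [hc]
  exact Submodule.smul_mem _ _ (arr_mem_invLT hs)

theorem diagOp_dCross_arr_mem (hc : IsCoeff Q Λ lab x a b) (u : List (Option I)) (c d : Option I)
    (v : List (Option I)) {s : List ℕ} {n : ℕ} (hs : inv s < n) :
    diagOp Q Λ hc (dCross Q Λ u c d v) (arr s) ∈ invLT L (n + 1) := by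
  rw [dCross, diagOp_mk]
  by_cases h : Proper lab s ∧ s.map lab = u ++ c :: d :: v
  · obtain ⟨t₁, r, r', t₂, rfl, h1, h2, h3, h4⟩ := map_eq_append_cons_cons h.2
    rw [freeOp_fCross_apply h.1 h.2, crossOp_arr rfl (by simp [← h1])]
    have := inv_swap_le r r' t₁ t₂
    exact Submodule.add_mem _ (Submodule.smul_mem _ _ (arr_mem_invLT (by omega)))
      (Submodule.smul_mem _ _ (arr_mem_invLT (by omega)))
  · rw [freeOp_fCross_apply_of_not h]
    exact Submodule.zero_mem _

theorem IsLead.dDot (hc : IsCoeff Q Λ lab x a b) {z : Arr L} {f : L} {t t₁ t₂ : List ℕ} {s : ℕ}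
    {i : I} {u v : List (Option I)} (h : IsLead z f t) (ht : Proper lab t) (h0 : t = t₁ ++ s :: t₂)
    (hu : t₁.map lab = u) (hs : lab s = some i) (hv : t₂.map lab = v) :
    IsLead (diagOp Q Λ hc (dDot Q Λ u i v) z) (x s * f) t := by
  refine h.map (fun s hs => diagOp_dDot_arr_mem hc u i v hs) ?_
  rw [KLRW.dDot, diagOp_mk, freeOp_fDot_apply ht h0 hu hs hv, sub_self]
  exact Submodule.zero_mem _

/-- The crossing raises the number of inversions of the leading arrangement, with coefficient `1`.
It raises the other numbers of inversions by at most one, and the term in which the strands stay in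
place also remains below the new leading term. -/
theorem IsLead.dCross (hc : IsCoeff Q Λ lab x a b) (ha : ∀ s s', s < s' → a s s' = 1)
    {z : Arr L} {f : L} {t t₁ t₂ : List ℕ} {r s : ℕ} {c d : Option I} {u v : List (Option I)}
    (h : IsLead z f t) (ht : Proper lab t) (h0 : t = t₁ ++ r :: s :: t₂) (hrs : r < s)
    (hu : t₁.map lab = u) (hr : lab r = c) (hs : lab s = d) (hv : t₂.map lab = v) :
    IsLead (diagOp Q Λ hc (dCross Q Λ u c d v) z) f (t₁ ++ s :: r :: t₂) := by
  rw [← one_mul f]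
  have hi := inv_swap hrs t₁ t₂
  refine h.map (fun s hs => ?_) ?_
  · rw [hi, ← h0]; exact diagOp_dCross_arr_mem hc u c d v hs
  · rw [KLRW.dCross, diagOp_mk, freeOp_fCross_apply ht (by simp [h0, hu, hr, hs, hv]),
      crossOp_arr h0 (by simp [← hu]), ha r s hrs, add_sub_cancel_left]
    exact Submodule.smul_mem _ _ (arr_mem_invLT (by omega))

/-- All swaps in the sequence create inversions. -/
def Ascending : List ℕ → List ℕ → Prop
  | [], _ => True
  | k :: ks, t => Ascending ks t ∧ ∃ t₁ r s t₂, act ks t = t₁ ++ r :: s :: t₂ ∧ k = t₁.length ∧ r < s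

theorem IsLead.path (hc : IsCoeff Q Λ lab x a b) (ha : ∀ s s', s < s' → a s s' = 1)
    {z : Arr L} {f : L} {t : List ℕ} (h : IsLead z f t) (hz : projOp L lab (t.map lab) z = z)
    (ht : Proper lab t) {ks : List ℕ} (hks : Ascending ks t) :
    IsLead (diagOp Q Λ hc (path Q Λ ks (t.map lab)) z) f (act ks t) := by
  induction ks with
  | nil =>
    rw [KLRW.path, dId, diagOp_mk, freeOp_fId, hz]
    exact h
  | cons k ks ih =>
    obtain ⟨h1, t₁, r, s, t₂, h2, h3, h4⟩ := hks
    rw [KLRW.path, map_mul, Module.End.mul_apply, act_map, h2, act_cons, sw_eq h2 h3,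
      cr_eq (u := t₁.map lab) (a := lab r) (b := lab s) (v := t₂.map lab) (by simp) (by simpa)]
    exact (ih h1).dCross hc ha (ht.perm (act_perm ks t)) h2 h4 rfl rfl rfl rfl

end Lead

/-- Elements with different leading terms are independent. -/
theorem eq_zero_of_isLead {ι : Type*} (z : ι → Arr (Frac 𝕜)) (t : ι → List ℕ) (m : ι → ℕ →₀ ℕ)
    (hz : ∀ i, IsLead (z i) (algebraMap (MvPolynomial ℕ 𝕜) (Frac 𝕜)
      (MvPolynomial.monomial (m i) 1)) (t i))
    (hinj : ∀ i j, t i = t j → m i = m j → i = j) (s : Finset ι) (c : ι → 𝕜)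
    (h : ∑ i ∈ s, c i • z i = 0) : ∀ i ∈ s, c i = 0 := by
  classical
  by_contra! hne
  obtain ⟨i₁, hi₁, hne₁⟩ := hne
  -- Among the indices with nonzero coefficient, take one whose leading arrangement has the most
  -- inversions. At this arrangement only the elements with the same leading arrangement have a
  -- nonzero coordinate.
  obtain ⟨i₀, hi₀, hmax⟩ := Finset.exists_max_image (s.filter fun i => c i ≠ 0) (fun i => inv (t i))
    ⟨i₁, Finset.mem_filter.2 ⟨hi₁, hne₁⟩⟩
  rw [Finset.mem_filter] at hi₀
  have coeff : ∀ i ∈ s, c i • z i (t i₀) = algebraMap (MvPolynomial ℕ 𝕜) (Frac 𝕜)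
      (if t i = t i₀ then c i • MvPolynomial.monomial (m i) 1 else 0) := by
    intro i hi
    by_cases hci : c i = 0
    · simp [hci]
    have hle := hmax i (Finset.mem_filter.2 ⟨hi, hci⟩)
    have h1 : ((z i - algebraMap (MvPolynomial ℕ 𝕜) (Frac 𝕜)
      (MvPolynomial.monomial (m i) 1) • arr (t i) : Arr (Frac 𝕜)) : List ℕ →₀ Frac 𝕜) (t i₀)
        = 0 := by
      by_contra hne
      have := (Finsupp.mem_supported (Frac 𝕜) _).1 (hz i) (Finsupp.mem_support_iff.2 hne)
      exact absurd this (not_lt.2 hle)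
    rw [Finsupp.sub_apply, sub_eq_zero, Finsupp.smul_apply, Finsupp.single_apply] at h1
    rw [h1]
    split_ifs
    · rw [smul_eq_mul, mul_one, Algebra.smul_def, Algebra.smul_def, map_mul,
        ← IsScalarTower.algebraMap_apply 𝕜 (MvPolynomial ℕ 𝕜) (Frac 𝕜)]
    · simp
  have h2 := DFunLike.congr_fun h (t i₀)
  rw [Finsupp.finsetSum_apply, Finset.sum_congr rfl fun i hi => (Finsupp.smul_apply _ _ _).trans
    (coeff i hi), ← map_sum, Finsupp.zero_apply] at h2
  have h3 := IsFractionRing.injective (MvPolynomial ℕ 𝕜) (Frac 𝕜) (h2.trans (map_zero _).symm)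
  -- The remaining indices share the arrangement, so by `hinj` their monomials are distinct.
  have h4 := congrArg (MvPolynomial.coeff (m i₀)) h3
  rw [MvPolynomial.coeff_sum, Finset.sum_eq_single i₀] at h4
  · simp at h4; exact hi₀.2 h4
  · intro i hi hne
    split_ifs with ht
    · rw [MvPolynomial.coeff_smul, MvPolynomial.coeff_monomial, if_neg, smul_zero]
      exact fun hm => hne (hinj i i₀ ht hm)
    · simp
  · exact fun h => absurd hi₀.1 h

end

section

/-! ## Shuffles of lists -/

section Shuffle

variable {X : Type*}

/-- The concatenation of the first `n` of the lists `ws`. -/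
def cat (ws : ℕ → List X) (n : ℕ) : List X := (List.range n).flatMap ws

/-- The lengths of the blocks. -/
abbrev lengths (ws : ℕ → List X) : ℕ → ℕ := fun p => (ws p).length

/-- Removing the first entry of the block `p`. -/
def pop (ws : ℕ → List X) (p : ℕ) : ℕ → List X := Function.update ws p (ws p).tail

/-- The shuffle of the lists `ws` with code `c`. -/
def shuf : List ℕ → (ℕ → List X) → List X
  | [], _ => []
  | p :: c, ws => (ws p).take 1 ++ shuf c (pop ws p)

theorem cat_zero (ws : ℕ → List X) : cat ws 0 = [] := rfl

theorem cat_succ (ws : ℕ → List X) (n : ℕ) : cat ws (n + 1) = cat ws n ++ ws n := by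
  simp [cat, List.range_succ]

theorem length_cat (ws : ℕ → List X) (n : ℕ) : (cat ws n).length = off (lengths ws) n := by
  induction n with
  | zero => simp [cat, off]
  | succ n ih => rw [cat_succ, List.length_append, ih, off_succ]

theorem cat_congr {ws ws' : ℕ → List X} {n : ℕ} (h : ∀ p < n, ws p = ws' p) :
    cat ws n = cat ws' n := by
  induction n with
  | zero => rfl
  | succ n ih => rw [cat_succ, cat_succ, ih fun p hp => h p (by omega), h n (by omega)]

theorem cat_map {Y : Type*} (f : X → Y) (ws : ℕ → List X) (n : ℕ) :
    cat (fun p => (ws p).map f) n = (cat ws n).map f := by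
  induction n with
  | zero => rfl
  | succ n ih => rw [cat_succ, cat_succ, ih, List.map_append]

theorem cat_add (ws : ℕ → List X) (m n : ℕ) :
    cat ws (m + n) = cat ws m ++ cat (fun p => ws (m + p)) n := by
  induction n with
  | zero => simp [cat_zero]
  | succ n ih => rw [← add_assoc, cat_succ, ih, cat_succ, List.append_assoc]

/-- Splitting off the block `p`. -/
theorem cat_split (ws : ℕ → List X) {p n : ℕ} (h : p < n) :
    cat ws n = cat ws p ++ (ws p ++ cat (fun q => ws (p + 1 + q)) (n - (p + 1))) := by
  obtain ⟨k, rfl⟩ := Nat.exists_eq_add_of_le (Nat.succ_le_of_lt h)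
  rw [Nat.succ_eq_add_one, cat_add, cat_succ, List.append_assoc, Nat.add_sub_cancel_left]

theorem cat_update_of_le (ws : ℕ → List X) {p n : ℕ} (h : n ≤ p) (l : List X) :
    cat (Function.update ws p l) n = cat ws n :=
  cat_congr fun q hq => Function.update_of_ne (by omega) _ _

theorem cat_update (ws : ℕ → List X) {p n : ℕ} (h : p < n) (l : List X) :
    cat (Function.update ws p l) n =
      cat ws p ++ (l ++ cat (fun q => ws (p + 1 + q)) (n - (p + 1))) := by
  rw [cat_split _ h, cat_update_of_le _ le_rfl, Function.update_self]
  congr 2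
  exact cat_congr fun q hq => Function.update_of_ne (by omega) _ _

theorem lengths_pop (ws : ℕ → List X) (p : ℕ) : lengths (pop ws p) = dec (lengths ws) p := by
  funext q
  by_cases h : q = p
  · subst h; simp [lengths, pop, dec]
  · simp [lengths, pop, dec, Function.update_of_ne h]

theorem act_range (u : List X) (a : X) (v : List X) :
    act (List.range u.length) (u ++ a :: v) = a :: (u ++ v) := by
  induction u using List.reverseRecOn generalizing v with
  | nil => rfl
  | append_singleton u b ih =>
    rw [List.length_append, List.length_singleton, List.range_succ, act_append, act_cons, act_nil,
      sw_eq (u := u) (a := b) (b := a) (v := v) (by simp) rfl, ih]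
    simp

theorem sw_cons_succ (a : X) (t : List X) (k : ℕ) : sw (a :: t) (k + 1) = a :: sw t k := by
  rcases Nat.lt_or_ge (k + 1) t.length with h | h
  · obtain ⟨u, b, c, v, rfl, rfl⟩ := exists_eq_append_cons_cons h
    rw [sw_eq rfl rfl, sw_eq (u := a :: u) (a := b) (b := c) (v := v) (by simp) (by simp)]
    simp
  · rw [sw_of_le h, sw_of_le (by simpa using h)]

theorem act_map_succ (a : X) (t : List X) (ks : List ℕ) :
    act (ks.map (· + 1)) (a :: t) = a :: act ks t := by
  induction ks with
  | nil => rfl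
  | cons k ks ih => rw [List.map_cons, act_cons, ih, sw_cons_succ, act_cons]

theorem exists_cons_of_isCode {p : ℕ} {c : List ℕ} {ws : ℕ → List X}
    (h : IsCode (p :: c) (lengths ws)) : ∃ a l, ws p = a :: l :=
  List.exists_cons_of_length_pos h.pos

/-- This links the canonical word of crossings with the combinatorial shuffle: after the first
strand of the block `p` is brought to the front, the rest is a concatenation of the popped blocks.
-/
theorem act_canon {c : List ℕ} {ws : ℕ → List X} {n : ℕ} (h : IsCode c (lengths ws))
    (hn : ∀ p, n ≤ p → ws p = []) : act (canon c (lengths ws)) (cat ws n) = shuf c ws := by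
  induction c generalizing ws with
  | nil =>
    have : cat ws n = [] := by
      rw [← List.length_eq_zero_iff, length_cat, off]
      exact Finset.sum_eq_zero fun p _ => by rw [← h p]; rfl
    rw [this]; rfl
  | cons p c ih =>
    obtain ⟨a, l, hal⟩ := exists_cons_of_isCode h
    have hp : p < n := by
      by_contra! hp
      rw [hn p hp] at hal; simp at hal
    have h1 : cat (pop ws p) n = cat ws p ++ (l ++ cat (fun q => ws (p + 1 + q)) (n - (p + 1))) := by
      rw [pop, hal, List.tail_cons, cat_update _ hp]
    rw [canon, act_append, ← length_cat, cat_split ws hp, hal, List.cons_append, act_range, ← h1,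
      act_map_succ, ← lengths_pop, ih (by rw [lengths_pop]; exact h.tail), shuf, hal]
    · rfl
    · intro q hq
      rw [pop, Function.update_of_ne (by omega), hn q hq]

/-- The shuffle has the strands from the block `p` at the positions of `p` in the code. -/
theorem shuf_append (c c' : List ℕ) (ws : ℕ → List X) :
    shuf (c ++ c') ws = shuf c ws ++ shuf c' (fun p => (ws p).drop (c.count p)) := by
  induction c generalizing ws with
  | nil => simp [shuf]
  | cons p c ih =>
    rw [List.cons_append, shuf, ih, shuf, List.append_assoc]
    congr 3
    funext q
    by_cases h : q = p
    · subst h; simp [pop]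
    · simp [pop, Function.update_of_ne h, List.count_cons_of_ne (Ne.symm h)]

/-- A code that takes only some of the strands takes initial parts of the blocks. Applied to parts
of a full code, this computes the pressure of initial and final parts of a shuffle. -/
theorem coe_shuf {c : List ℕ} {ws : ℕ → List X} {n : ℕ} (h : ∀ p, c.count p ≤ (ws p).length)
    (hn : ∀ p ∈ c, p < n) :
    (shuf c ws : Multiset X) = ∑ p ∈ Finset.range n, ((ws p).take (c.count p) : Multiset X) := by
  induction c generalizing ws with
  | nil => simp [shuf]
  | cons p c ih =>
    have hp : 0 < (ws p).length := lt_of_lt_of_le (by simp) (h p)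
    obtain ⟨a, l, hal⟩ := List.exists_cons_of_length_pos hp
    have hpn : p < n := hn p List.mem_cons_self
    rw [shuf, hal, ← Multiset.coe_add, ih]
    · rw [← Finset.add_sum_erase _ _ (Finset.mem_range.2 hpn),
        ← Finset.add_sum_erase (Finset.range n) (fun q => ((ws q).take ((p :: c).count q) :
          Multiset X)) (Finset.mem_range.2 hpn), ← add_assoc]
      congr 1
      · simp [pop, hal]
      · refine Finset.sum_congr rfl fun q hq => ?_
        have hq := Finset.ne_of_mem_erase hq
        rw [pop, Function.update_of_ne hq, List.count_cons_of_ne (Ne.symm hq)]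
    · intro q
      have := h q
      by_cases hq : q = p
      · subst hq; simp [pop] at this ⊢; omega
      · rw [List.count_cons_of_ne (Ne.symm hq)] at this
        rwa [pop, Function.update_of_ne hq]
    · exact fun q hq => hn q (List.mem_cons_of_mem _ hq)

theorem length_shuf {c : List ℕ} {ws : ℕ → List X} (h : ∀ p, c.count p ≤ (ws p).length) :
    (shuf c ws).length = c.length := by
  induction c generalizing ws with
  | nil => rfl
  | cons p c ih =>
    have hp : 0 < (ws p).length := lt_of_lt_of_le (by simp) (h p)
    rw [shuf, List.length_append, List.length_take, ih, List.length_cons]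
    · omega
    · intro q
      have := h q
      by_cases hq : q = p
      · subst hq; simp [pop] at this ⊢; omega
      · rw [List.count_cons_of_ne (Ne.symm hq)] at this
        rwa [pop, Function.update_of_ne hq]

end Shuffle

/-! ### Ascending sequences of swaps -/

theorem Ascending.append {ks ks' t} (h : Ascending ks (act ks' t)) (h' : Ascending ks' t) :
    Ascending (ks ++ ks') t := by
  induction ks with
  | nil => exact h'
  | cons k ks ih =>
    obtain ⟨h1, t₁, r, s, t₂, h2⟩ := h
    exact ⟨ih h1, t₁, r, s, t₂, by rwa [List.append_eq, act_append]⟩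

theorem Ascending.map_succ {ks t} (h : Ascending ks t) (a : ℕ) :
    Ascending (ks.map (· + 1)) (a :: t) := by
  induction ks with
  | nil => trivial
  | cons k ks ih =>
    obtain ⟨h1, t₁, r, s, t₂, h2, h3, h4⟩ := h
    exact ⟨ih h1, a :: t₁, r, s, t₂, by rw [act_map_succ, h2]; rfl, by simp [h3], h4⟩

theorem ascending_range {u : List ℕ} {a : ℕ} (h : ∀ b ∈ u, b < a) (v : List ℕ) :
    Ascending (List.range u.length) (u ++ a :: v) := by
  induction u using List.reverseRecOn generalizing v with
  | nil => trivial
  | append_singleton u b ih =>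
    rw [List.length_append, List.length_singleton, List.range_succ]
    refine Ascending.append ?_ ⟨trivial, u, b, a, v, by simp, rfl, h b (by simp)⟩
    rw [act_cons, act_nil, sw_eq (u := u) (a := b) (b := a) (v := v) (by simp) rfl]
    exact ih (fun b hb => h b (by simp [hb])) _

/-- Strands in earlier blocks are smaller. -/
def BlocksSorted (ts : ℕ → List ℕ) : Prop := ∀ p q, p < q → ∀ a ∈ ts p, ∀ b ∈ ts q, a < b

theorem BlocksSorted.mono {ts ts' : ℕ → List ℕ} (h : BlocksSorted ts) (h' : ∀ p, ts' p ⊆ ts p) :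
    BlocksSorted ts' := fun p q hpq a ha b hb => h p q hpq a (h' p ha) b (h' q hb)

theorem pop_subset {X : Type*} (ws : ℕ → List X) (p q : ℕ) : pop ws p q ⊆ ws q := by
  by_cases h : q = p
  · subst h
    rw [pop, Function.update_self]
    exact List.tail_subset _
  · rw [pop, Function.update_of_ne h]
    exact List.Subset.refl _

theorem mem_cat {X : Type*} {ws : ℕ → List X} {n : ℕ} {a : X} :
    a ∈ cat ws n ↔ ∃ p < n, a ∈ ws p := by
  simp [cat]

/-- A strand that is brought to the front passes exactly the remaining strands of earlier blocks,
and these have smaller numbers. Hence each swap creates an inversion. -/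
theorem ascending_canon {c : List ℕ} {ts : ℕ → List ℕ} {n : ℕ} (h : IsCode c (lengths ts))
    (hn : ∀ p, n ≤ p → ts p = []) (hs : BlocksSorted ts) :
    Ascending (canon c (lengths ts)) (cat ts n) := by
  induction c generalizing ts with
  | nil => trivial
  | cons p c ih =>
    obtain ⟨a, l, hal⟩ := exists_cons_of_isCode h
    have hp : p < n := by
      by_contra! hp
      rw [hn p hp] at hal; simp at hal
    have h1 : cat (pop ts p) n = cat ts p ++ (l ++ cat (fun q => ts (p + 1 + q)) (n - (p + 1))) := by
      rw [pop, hal, List.tail_cons, cat_update _ hp]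
    rw [canon, cat_split ts hp, hal, List.cons_append, ← length_cat]
    refine Ascending.append ?_ (ascending_range ?_ _)
    · rw [act_range, ← h1, ← lengths_pop]
      refine (ih (by rw [lengths_pop]; exact h.tail) ?_ (hs.mono (pop_subset ts p))).map_succ a
      intro q hq
      rw [pop, Function.update_of_ne (by omega), hn q hq]
    · intro b hb
      obtain ⟨q, hq, hb⟩ := mem_cat.1 hb
      exact hs q p hq b hb a (by rw [hal]; simp)

/-- The shuffle can be recovered from its result. -/
theorem shuf_injective {ts ts' : ℕ → List ℕ} (hs : ∀ p, (ts p).Perm (ts' p))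
    (hd : ∀ p q, p ≠ q → ∀ a ∈ ts p, a ∉ ts q) {c c' : List ℕ} (hc : IsCode c (lengths ts))
    (hc' : IsCode c' (lengths ts')) (h : shuf c ts = shuf c' ts') :
    c = c' ∧ ∀ p, ts p = ts' p := by
  induction c generalizing ts ts' c' with
  | nil =>
    have h0 : ∀ p, ts p = [] := fun p => List.length_eq_zero_iff.1 (hc p).symm
    have h0' : ∀ p, ts' p = [] := fun p => by
      have := hs p
      rw [h0 p] at this
      exact this.nil_eq.symm
    refine ⟨?_, fun p => by rw [h0, h0']⟩
    rcases c' with _ | ⟨p, c'⟩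
    · rfl
    · obtain ⟨a, l, hal⟩ := exists_cons_of_isCode hc'
      rw [h0' p] at hal; simp at hal
  | cons p c ih =>
    rcases c' with _ | ⟨p', c'⟩
    · obtain ⟨a, l, hal⟩ := exists_cons_of_isCode hc
      have : (ts' p).length = 0 := (hc' p).symm
      rw [← (hs p).length_eq, hal] at this
      simp at this
    obtain ⟨a, l, hal⟩ := exists_cons_of_isCode hc
    obtain ⟨a', l', hal'⟩ := exists_cons_of_isCode hc'
    rw [shuf, shuf, hal, hal'] at h
    obtain ⟨rfl, h0⟩ : a = a' ∧ shuf c (pop ts p) = shuf c' (pop ts' p') := by simpa using h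
    -- The first strand of the result lies in one block only, since the blocks are disjoint.
    obtain rfl : p = p' := by
      by_contra hne
      refine hd p p' hne a (by rw [hal]; simp) ?_
      rw [(hs p').mem_iff, hal']; simp
    have hpop : ∀ ts : ℕ → List ℕ, ∀ l, ts p = a :: l → ∀ q, ts q =
        if q = p then a :: pop ts p q else pop ts p q := by
      intro ts l hl q
      split_ifs with hq
      · subst hq; simp [pop, hl]
      · simp [pop, Function.update_of_ne hq]
    obtain ⟨rfl, h2⟩ := ih (ts := pop ts p) (ts' := pop ts' p) (fun q => by
        have := hs q
        rw [hpop ts l hal, hpop ts' l' hal'] at this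
        split_ifs at this with hq
        · exact this.cons_inv
        · exact this)
      (fun q q' hq b hb hb' => hd q q' hq b (pop_subset ts p q hb) (pop_subset ts p q' hb'))
      (by rw [lengths_pop]; exact hc.tail) (by rw [lengths_pop]; exact hc'.tail) h0
    refine ⟨rfl, fun q => ?_⟩
    rw [hpop ts l hal, hpop ts' l' hal', h2]

end

section

/-! ## Dots -/

variable {I : Type u} {𝕜 : Type v} [CommRing 𝕜] [DecidableEq I]
variable (Q : I → I → MvPolynomial (Fin 2) 𝕜) (Λ : I → ℕ)

/-- The strand number `k` of `w` is black. -/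
def BlackAt (w : List (Option I)) (k : ℕ) : Prop := ∃ u i v, w = u ++ some i :: v ∧ k = u.length

/-- The dot on the strand number `k` of `w`. -/
def dotAt (w : List (Option I)) (k : ℕ) : Diagrams Q Λ :=
  match w.drop k with
  | some i :: v => dDot Q Λ (w.take k) i v
  | _ => 0

/-- A product of dots on the strands of `w`. -/
def dots (w : List (Option I)) : List ℕ → Diagrams Q Λ
  | [] => dId Q Λ w
  | k :: l => dotAt Q Λ w k * dots w l

variable {Q Λ}

theorem dotAt_eq {w u v : List (Option I)} {i : I} {k : ℕ} (h : w = u ++ some i :: v)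
    (hk : k = u.length) : dotAt Q Λ w k = dDot Q Λ u i v := by
  subst h hk; simp [dotAt]

theorem dDot_comm {u v u' v' : List (Option I)} {i j : I}
    (h : u ++ some i :: v = u' ++ some j :: v') :
    dDot Q Λ u i v * dDot Q Λ u' j v' = dDot Q Λ u' j v' * dDot Q Λ u i v := by
  have key : ∀ (u x v : List (Option I)) (i j : I), dDot Q Λ u i (x ++ some j :: v) *
      dDot Q Λ (u ++ some i :: x) j v = dDot Q Λ (u ++ some i :: x) j v *
        dDot Q Λ u i (x ++ some j :: v) := by
    intro u x v i j
    have := mk_rel Q Λ (Rel.isotopy u (.dot i) x (.dot j) v)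
    simpa [dDot, Piece.src, Piece.tgt] using this
  rcases List.append_eq_append_iff.1 h with ⟨x, rfl, hx⟩ | ⟨x, rfl, hx⟩
  · rcases x with _ | ⟨_, x⟩
    · obtain ⟨rfl, rfl⟩ : i = j ∧ v = v' := by simpa using hx
      simp
    · obtain ⟨rfl, rfl⟩ := List.cons.inj hx
      exact key u x v' i j
  · rcases x with _ | ⟨_, x⟩
    · obtain ⟨rfl, rfl⟩ : j = i ∧ v' = v := by simpa using hx
      simp
    · obtain ⟨rfl, rfl⟩ := List.cons.inj hx
      exact (key u' x v j i).symm

theorem dotAt_comm {w : List (Option I)} {j k : ℕ} (hj : BlackAt w j) (hk : BlackAt w k) :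
    dotAt Q Λ w j * dotAt Q Λ w k = dotAt Q Λ w k * dotAt Q Λ w j := by
  obtain ⟨u, i, v, h, hj⟩ := hj
  obtain ⟨u', i', v', h', hk⟩ := hk
  rw [dotAt_eq h hj, dotAt_eq h' hk, dDot_comm (h.symm.trans h')]

theorem dots_perm {w : List (Option I)} {l l' : List ℕ} (hp : l.Perm l') (h : ∀ k ∈ l, BlackAt w k) :
    dots Q Λ w l = dots Q Λ w l' := by
  induction hp with
  | nil => rfl
  | cons k _ ih => rw [dots, dots, ih fun j hj => h j (List.mem_cons_of_mem _ hj)]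
  | swap j k l =>
    rw [dots, dots, dots, dots, ← mul_assoc, ← mul_assoc,
      dotAt_comm (h _ (by simp)) (h _ (by simp))]
  | trans h1 _ ih1 ih2 => rw [ih1 h, ih2 fun k hk => h k (h1.mem_iff.2 hk)]

theorem dots_mon (P : ℕ → Prop) {w : List (Option I)} {l : List ℕ} (h : ∀ k ∈ l, BlackAt w k) :
    Mon Q Λ P w 0 w (dots Q Λ w l) := by
  induction l with
  | nil => exact .one
  | cons k l ih =>
    obtain ⟨u, i, v, rfl, hk⟩ := h k List.mem_cons_self
    rw [dots, dotAt_eq rfl hk]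
    exact .dot (ih fun k hk => h k (List.mem_cons_of_mem _ hk))

theorem Mon.exists_dots {P : ℕ → Prop} {w w' : List (Option I)} {l : ℕ} {x : Diagrams Q Λ}
    (hm : Mon Q Λ P w l w' x) (hP : ∀ k, k + 1 < w.length → ¬ P k) :
    w' = w ∧ ∃ ks, (∀ k ∈ ks, BlackAt w k) ∧ x = dots Q Λ w ks := by
  induction hm with
  | one => exact ⟨rfl, [], by simp, rfl⟩
  | @dot l u i v x h ih =>
    obtain ⟨h1, ks, h2, rfl⟩ := ih
    exact ⟨h1, u.length :: ks, by simpa using ⟨⟨u, i, v, h1.symm, rfl⟩, h2⟩, by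
      rw [dots, dotAt_eq h1.symm rfl]⟩
  | @cross l u a b v x hk h ih =>
    refine absurd hk (hP _ ?_)
    rw [← h.perm.length_eq]; simp

/-- Blocks with one strand each. -/
def ones (n : ℕ) : ℕ → ℕ := fun p => if p < n then 1 else 0

theorem isCode_range (n : ℕ) : IsCode (List.range n) (ones n) := by
  intro p
  by_cases h : p < n
  · rw [ones, if_pos h]
    exact List.count_eq_one_of_mem List.nodup_range (List.mem_range.2 h)
  · rw [ones, if_neg h]
    exact List.count_eq_zero_of_not_mem (by simpa using h)

theorem not_sameBlock_ones (n j : ℕ) : ¬ SameBlock (ones n) j := by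
  rintro ⟨p, h1, h2⟩
  rw [off_succ, ones] at h2
  split_ifs at h2 <;> omega

/-- Shuffles of single strands with dots below them span. -/
theorem crossLT_le_span_dots {w : List (Option I)} (hw : w.count none ≤ 1) (n : ℕ) :
    crossLT Q Λ w n ≤ Submodule.span 𝕜 {x | ∃ (c : List ℕ) (M : Multiset ℕ),
      IsCode c (ones w.length) ∧ (∀ k ∈ M, BlackAt w k) ∧
      x = path Q Λ (canon c (ones w.length)) w * dots Q Λ w M.toList} := by
  -- With one strand in each block there is no crossing inside a block, so the lower factor in the
  -- spanning theorem consists of dots.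
  refine (crossLT_le_shuffleLT (isCode_range w.length) (List.pairwise_le_range) (by simp) hw
    n).trans (Submodule.span_mono ?_)
  rintro x ⟨c, l, w', h, hc, hm, -, rfl⟩
  obtain ⟨rfl, ks, hks, rfl⟩ := hm.exists_dots fun k _ => not_sameBlock_ones _ k
  refine ⟨c, ks, hc, hks, ?_⟩
  rw [dots_perm (Q := Q) (Λ := Λ) (Multiset.coe_eq_coe.1 (Multiset.coe_toList (ks : Multiset ℕ)))]
  intro k hk
  exact hks k (by simpa using hk)

/-! ### Adding strands -/

theorem pad_mk (p q : List (Option I)) (x : FreeAlgebra 𝕜 (Gen I)) :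
    pad Q Λ p q (RingQuot.mkAlgHom 𝕜 (Rel Q Λ) x) = RingQuot.mkAlgHom 𝕜 (Rel Q Λ) (fPad p q x) := by
  exact RingQuot.liftAlgHom_mkAlgHom_apply _ _ _ _

theorem pad_dId (p q w : List (Option I)) :
    pad Q Λ p q (dId Q Λ w) = dId Q Λ (p ++ (w ++ q)) := by
  rw [dId, pad_mk, fPad_idm, dId]

theorem pad_dDot (p q u : List (Option I)) (i : I) (v : List (Option I)) :
    pad Q Λ p q (dDot Q Λ u i v) = dDot Q Λ (p ++ u) i (v ++ q) := by
  rw [dDot, pad_mk, fPad_put, dDot]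

theorem pad_dCross (p q u : List (Option I)) (a b : Option I) (v : List (Option I)) :
    pad Q Λ p q (dCross Q Λ u a b v) = dCross Q Λ (p ++ u) a b (v ++ q) := by
  rw [dCross, pad_mk, fPad_put, dCross]

/-! ### Leading terms for a block -/

section Lead

variable {L : Type*} [CommRing L] [Algebra 𝕜 L]
variable {lab : ℕ → Option I} {x : ℕ → L} {a b : ℕ → ℕ → L}

variable (lab) in
/-- `f • [t]` is the leading term of `z`, and all arrangements in `z` have the labels of `t`. -/
structure LeadAt (z : Arr L) (f : L) (t : List ℕ) : Prop where
  lead : IsLead z f t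
  fixed : projOp L lab (t.map lab) z = z
  proper : Proper lab t

theorem leadAt_arr {t : List ℕ} (ht : Proper lab t) : LeadAt lab (arr t : Arr L) 1 t :=
  ⟨isLead_arr t, projOp_of ht rfl, ht⟩

theorem diagOp_dId (hc : IsCoeff Q Λ lab x a b) (w : List (Option I)) :
    diagOp Q Λ hc (dId Q Λ w) = projOp L lab w := by
  rw [dId, diagOp_mk, freeOp_fId]

theorem LeadAt.diagOp_mul_dId (hc : IsCoeff Q Λ lab x a b) {z : Arr L} {f : L} {t : List ℕ}
    (h : LeadAt lab z f t) {w : List (Option I)} (hw : t.map lab = w) (d : Diagrams Q Λ) :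
    diagOp Q Λ hc (d * dId Q Λ w) z = diagOp Q Λ hc d z := by
  rw [map_mul, Module.End.mul_apply, diagOp_dId, ← hw, h.fixed]

theorem LeadAt.pad_dots (hc : IsCoeff Q Λ lab x a b) {z : Arr L} {f : L} {t₁ s t₂ : List ℕ}
    (h : LeadAt lab z f (t₁ ++ (s ++ t₂))) {u w v : List (Option I)} (hu : t₁.map lab = u)
    (hw : s.map lab = w) (hv : t₂.map lab = v) {l : List ℕ} (hl : ∀ k ∈ l, BlackAt w k) :
    LeadAt lab (diagOp Q Λ hc (pad Q Λ u v (dots Q Λ w l)) z)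
      ((l.map fun k => x (s.getD k 0)).prod * f) (t₁ ++ (s ++ t₂)) := by
  induction l with
  | nil =>
    rw [dots, pad_dId, diagOp_dId, List.map_nil, List.prod_nil, one_mul]
    have : (t₁ ++ (s ++ t₂)).map lab = u ++ (w ++ v) := by simp [hu, hw, hv]
    rw [← this, h.fixed]
    exact h
  | cons k l ih =>
    obtain ⟨u', i, v', hw', rfl⟩ := hl k List.mem_cons_self
    have ih := ih fun k hk => hl k (List.mem_cons_of_mem _ hk)
    subst hw'
    obtain ⟨s₁, r, s₂, rfl, h1, h2, h3⟩ := map_eq_append_cons hw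
    rw [dots, dotAt_eq rfl rfl, map_mul, map_mul, Module.End.mul_apply, pad_dDot, List.map_cons,
      List.prod_cons, mul_assoc]
    refine ⟨?_, ?_, h.proper⟩
    · have e : (s₁ ++ r :: s₂).getD u'.length 0 = r := by rw [← h1]; simp
      rw [e]
      exact ih.lead.dDot hc h.proper (t₁ := t₁ ++ s₁) (s := r) (t₂ := s₂ ++ t₂) (by simp)
        (by simp [hu, h1]) h2 (by simp [h3, hv])
    · rw [← Module.End.mul_apply, ← diagOp_dId hc, ← map_mul]
      have : (t₁ ++ (s₁ ++ r :: s₂ ++ t₂)).map lab = (u ++ u') ++ some i :: (v' ++ v) := by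
        simp [hu, hv, h1, h2, h3]
      rw [this, dId_mul_dDot]

theorem LeadAt.pad_path (hc : IsCoeff Q Λ lab x a b) (ha : ∀ s s', s < s' → a s s' = 1)
    {z : Arr L} {f : L} {t₁ s t₂ : List ℕ}
    (h : LeadAt lab z f (t₁ ++ (s ++ t₂))) {u w v : List (Option I)} (hu : t₁.map lab = u)
    (hw : s.map lab = w) (hv : t₂.map lab = v) {ks : List ℕ} (hks : Ascending ks s) :
    LeadAt lab (diagOp Q Λ hc (pad Q Λ u v (path Q Λ ks w)) z) f (t₁ ++ (act ks s ++ t₂)) := by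
  induction ks with
  | nil =>
    rw [path, pad_dId, diagOp_dId, act_nil]
    have : (t₁ ++ (s ++ t₂)).map lab = u ++ (w ++ v) := by simp [hu, hw, hv]
    rw [← this, h.fixed]
    exact h
  | cons k ks ih =>
    obtain ⟨h1, s₁, r, r', s₂, h2, h3, h4⟩ := hks
    have ih := ih h1
    have hact : act ks w = s₁.map lab ++ lab r :: lab r' :: s₂.map lab := by
      rw [← hw, act_map, h2]; simp
    rw [path, cr_eq hact (by simpa using h3), map_mul, map_mul, Module.End.mul_apply, pad_dCross,
      act_cons, sw_eq h2 h3]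
    have hp : t₁ ++ (act ks s ++ t₂) = (t₁ ++ s₁) ++ r :: r' :: (s₂ ++ t₂) := by rw [h2]; simp
    have ht : Proper lab (t₁ ++ (s₁ ++ r' :: r :: s₂ ++ t₂)) := by
      refine ih.proper.perm ?_
      rw [hp]
      simpa using ((List.Perm.swap r r' (s₂ ++ t₂)).append_left s₁).append_left t₁
    refine ⟨?_, ?_, ht⟩
    · have := ih.lead.dCross hc ha ih.proper hp h4 (u := u ++ s₁.map lab) (c := lab r) (d := lab r')
        (v := s₂.map lab ++ v) (by simp [hu]) rfl rfl (by simp [hv])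
      simpa using this
    · rw [← Module.End.mul_apply, ← diagOp_dId hc, ← map_mul]
      have : (t₁ ++ (s₁ ++ r' :: r :: s₂ ++ t₂)).map lab =
          (u ++ s₁.map lab) ++ lab r' :: lab r :: (s₂.map lab ++ v) := by simp [hu, hv]
      rw [this, dId_mul_dCross]

end Lead

theorem prod_map_fracX (l : List ℕ) : (l.map (fracX 𝕜)).prod =
    algebraMap (MvPolynomial ℕ 𝕜) (Frac 𝕜)
      (MvPolynomial.monomial (Multiset.toFinsupp (l : Multiset ℕ)) 1) := by
  induction l with
  | nil => simp
  | cons k l ih =>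
    rw [List.map_cons, List.prod_cons, ih, ← Multiset.cons_coe, ← Multiset.singleton_add, map_add,
      fracX, ← map_mul, Multiset.toFinsupp_singleton, MvPolynomial.X, MvPolynomial.monomial_mul,
      one_mul]

end

section

/-! ## Slopes -/

section Slopes

variable {I : Type u} {χ : I → ℝ}

theorem pressure_add (β β' : Multiset I) : pressure χ (β + β') = pressure χ β + pressure χ β' := by
  simp [pressure]

theorem pressure_zero : pressure χ (0 : Multiset I) = 0 := by simp [pressure]

theorem pressure_append (i j : List I) :
    pressure χ ((i ++ j : List I) : Multiset I) = pressure χ (i : Multiset I) +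
      pressure χ (j : Multiset I) := by
  rw [← Multiset.coe_add, pressure_add]

theorem pressure_reverse (i : List I) :
    pressure χ (i.reverse : Multiset I) = pressure χ (i : Multiset I) := by
  rw [Multiset.coe_reverse]

theorem pressure_neg (β : Multiset I) : pressure (fun i => -χ i) β = -pressure χ β := by
  simp [pressure]

theorem slopeOf_neg (β : Multiset I) : slopeOf (fun i => -χ i) β = -slopeOf χ β := by
  rw [slopeOf, pressure_neg, neg_div, slopeOf]

theorem slopeOf_mul_card (β : Multiset I) : slopeOf χ β * Multiset.card β = pressure χ β := by
  by_cases h : Multiset.card β = 0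
  · rw [Multiset.card_eq_zero.1 h, pressure_zero]; simp
  · rw [slopeOf, div_mul_cancel₀]
    exact_mod_cast h

theorem pathFun_neg (l : List (Multiset I)) (x : ℝ) :
    pathFun (fun i => -χ i) l x = - pathFun χ l x := by
  induction l generalizing x with
  | nil => simp [pathFun]
  | cons β l ih =>
    rw [pathFun, pathFun, ih, slopeOf_neg, pressure_neg]
    split_ifs <;> ring

theorem pathFun_zero (l : List (Multiset I)) : pathFun χ l 0 = 0 := by
  cases l with
  | nil => rfl
  | cons β l => rw [pathFun, if_pos (Nat.cast_nonneg _), mul_zero]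

variable (χ) in
/-- The slopes are positive and decreasing. -/
def Descending (l : List (Multiset I)) : Prop :=
  (∀ β ∈ l, 0 < slopeOf χ β) ∧ l.Pairwise fun β β' => slopeOf χ β' < slopeOf χ β

theorem Descending.tail {β : Multiset I} {l : List (Multiset I)} (h : Descending χ (β :: l)) :
    Descending χ l :=
  ⟨fun β' h' => h.1 β' (List.mem_cons_of_mem _ h'), (List.pairwise_cons.1 h.2).2⟩

theorem pathFun_le_mul {l : List (Multiset I)} {s : ℝ} (hs : 0 ≤ s) (h : ∀ β ∈ l, slopeOf χ β ≤ s)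
    {x : ℝ} (hx : 0 ≤ x) : pathFun χ l x ≤ s * x := by
  induction l generalizing x with
  | nil => rw [pathFun]; positivity
  | cons β l ih =>
    have h1 := h β List.mem_cons_self
    rw [pathFun]
    split_ifs with hc
    · exact mul_le_mul_of_nonneg_right h1 hx
    · have h2 := ih (fun β' h' => h β' (List.mem_cons_of_mem _ h')) (sub_nonneg.2 (not_le.1 hc).le)
      have h3 := mul_le_mul_of_nonneg_right h1 (Nat.cast_nonneg (α := ℝ) (Multiset.card β))
      rw [slopeOf_mul_card] at h3
      linarith

/-- To the left of the origin, `pathFun` continues its first segment. This makes the formula as a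
minimum valid on all of `ℝ`. -/
theorem mul_le_pathFun {l : List (Multiset I)} {s : ℝ} (hs : 0 ≤ s) (h : ∀ β ∈ l, slopeOf χ β ≤ s)
    {x : ℝ} (hx : x ≤ 0) : s * x ≤ pathFun χ l x := by
  cases l with
  | nil => rw [pathFun]; exact mul_nonpos_of_nonneg_of_nonpos hs hx
  | cons β l =>
    rw [pathFun, if_pos (hx.trans (Nat.cast_nonneg _))]
    exact mul_le_mul_of_nonpos_right (h β List.mem_cons_self) hx

/-- With decreasing slopes the graph lies below the line through its first segment, and the shifted
rest takes over at the end of that segment. Since this holds for all real arguments, concavity,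
monotonicity and growth bounds follow by induction, without restrictions on the domain under
translation. -/
theorem pathFun_cons_eq_min {β : Multiset I} {l : List (Multiset I)} (h : Descending χ (β :: l))
    (x : ℝ) : pathFun χ (β :: l) x =
      min (slopeOf χ β * x) (pressure χ β + pathFun χ l (x - Multiset.card β)) := by
  have hs := (h.1 β List.mem_cons_self).le
  have hl : ∀ β' ∈ l, slopeOf χ β' ≤ slopeOf χ β := fun β' h' =>
    ((List.pairwise_cons.1 h.2).1 β' h').le
  have hm := slopeOf_mul_card (χ := χ) β
  rw [pathFun]
  split_ifs with hc
  · have := mul_le_pathFun hs hl (sub_nonpos.2 hc)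
    rw [min_eq_left]
    linarith
  · have := pathFun_le_mul hs hl (sub_nonneg.2 (not_le.1 hc).le)
    rw [min_eq_right]
    linarith

theorem concaveOn_pathFun {l : List (Multiset I)} (h : Descending χ l) :
    ConcaveOn ℝ Set.univ (pathFun χ l) := by
  induction l with
  | nil => exact concaveOn_const 0 convex_univ
  | cons β l ih =>
    have e : pathFun χ (β :: l) = (fun x => slopeOf χ β * x) ⊓
        fun x => pathFun χ l (-(Multiset.card β : ℝ) + x) + pressure χ β := by
      funext x
      rw [pathFun_cons_eq_min h, Pi.inf_apply, add_comm (pressure χ β), sub_eq_neg_add]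
    rw [e]
    refine ConcaveOn.inf ?_ ?_
    · exact (LinearMap.mulLeft ℝ (slopeOf χ β)).concaveOn convex_univ
    · have := ((ih h.tail).translate_right (-(Multiset.card β : ℝ))).add_const (pressure χ β)
      rw [Set.preimage_univ] at this
      exact this

theorem monotone_pathFun {l : List (Multiset I)} (h : Descending χ l) :
    Monotone (pathFun χ l) := by
  induction l with
  | nil => exact monotone_const
  | cons β l ih =>
    intro x y hxy
    rw [pathFun_cons_eq_min h, pathFun_cons_eq_min h]
    refine min_le_min (mul_le_mul_of_nonneg_left hxy (h.1 β List.mem_cons_self).le) ?_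
    have := ih h.tail (sub_le_sub_right hxy (Multiset.card β : ℝ))
    linarith

theorem pathFun_le_add_mul {l : List (Multiset I)} (h : Descending χ l) {s : ℝ} (hs : 0 ≤ s)
    (hl : ∀ β ∈ l, slopeOf χ β ≤ s) {x y : ℝ} (hxy : x ≤ y) :
    pathFun χ l y ≤ pathFun χ l x + s * (y - x) := by
  induction l generalizing x y with
  | nil =>
    rw [pathFun, pathFun, zero_add]
    exact mul_nonneg hs (sub_nonneg.2 hxy)
  | cons β l ih =>
    rw [pathFun_cons_eq_min h, pathFun_cons_eq_min h, ← min_add_add_right]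
    refine min_le_min ?_ ?_
    · have := mul_le_mul_of_nonneg_right (hl β List.mem_cons_self) (sub_nonneg.2 hxy)
      linarith
    · have := ih h.tail (fun β' h' => hl β' (List.mem_cons_of_mem _ h'))
        (sub_le_sub_right hxy (Multiset.card β : ℝ))
      rw [sub_sub_sub_cancel_right] at this
      linarith

/-- The function `pathFun` solves a knapsack problem. -/
theorem sum_slope_le_pathFun {l : List (Multiset I × ℕ)} (h : Descending χ (l.map Prod.fst))
    (hl : ∀ q ∈ l, q.2 ≤ Multiset.card q.1) {x : ℝ} (hx : ((l.map Prod.snd).sum : ℕ) ≤ x) :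
    (l.map fun q => slopeOf χ q.1 * q.2).sum ≤ pathFun χ (l.map Prod.fst) x := by
  induction l generalizing x with
  | nil => simp [pathFun]
  | cons q l ih =>
    rw [List.map_cons] at h
    have hs := (h.1 q.1 List.mem_cons_self).le
    have hle : ∀ β' ∈ l.map Prod.fst, slopeOf χ β' ≤ slopeOf χ q.1 := fun β' h' =>
      ((List.pairwise_cons.1 h.2).1 β' h').le
    have hm := slopeOf_mul_card (χ := χ) q.1
    have hq : (q.2 : ℝ) ≤ Multiset.card q.1 := by exact_mod_cast hl q List.mem_cons_self
    simp only [List.map_cons, List.sum_cons, Nat.cast_add] at hx ⊢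
    have h1 := ih h.tail (fun q' h' => hl q' (List.mem_cons_of_mem _ h')) (x := x - q.2)
      (by linarith)
    rw [pathFun_cons_eq_min h]
    refine le_min ?_ ?_
    · have h2 := pathFun_le_mul (x := x - q.2) hs hle (by
        have : (0 : ℝ) ≤ ((l.map Prod.snd).sum : ℕ) := Nat.cast_nonneg _
        linarith)
      linarith
    -- The unused part of the steepest block leaves room for later blocks, but these have at most
    -- its slope, so filling the steepest block completely is at least as good.
    · have h2 := pathFun_le_add_mul h.tail hs hle (x := x - Multiset.card q.1) (y := x - q.2)
        (by linarith)
      linarith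

/-- The function `pathFun` is bounded by each concave function above its break points. -/
theorem pathFun_le_of_concaveOn {g : ℝ → ℝ} (hg : ConcaveOn ℝ Set.univ g) (hm : Monotone g)
    {l : List (Multiset I)} (hpos : ∀ β ∈ l, 0 < Multiset.card β)
    (h : ∀ l₁ l₂, l = l₁ ++ l₂ → pressure χ l₁.sum ≤ g (Multiset.card l₁.sum)) {x : ℝ}
    (hx : 0 ≤ x) : pathFun χ l x ≤ g x := by
  induction l generalizing g x with
  | nil =>
    have := h [] [] rfl
    simp only [List.sum_nil, pressure_zero, Multiset.card_zero, Nat.cast_zero] at this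
    exact this.trans (hm hx)
  | cons β l ih =>
    have h0 := h [] _ rfl
    have h1 := h [β] l rfl
    simp only [List.sum_nil, pressure_zero, Multiset.card_zero, Nat.cast_zero, List.sum_singleton]
      at h0 h1
    have hc : (0 : ℝ) < Multiset.card β := by exact_mod_cast hpos β List.mem_cons_self
    rw [pathFun]
    split_ifs with hx'
    -- On the first segment, `g` lies above its chord from `0` to the first break point, and the
    -- values at both ends are bounded below.
    · have h2 := hg.2 (Set.mem_univ 0) (Set.mem_univ (Multiset.card β : ℝ))
        (show 0 ≤ 1 - x / (Multiset.card β : ℝ) by rw [sub_nonneg]; exact (div_le_one hc).2 hx')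
        (show 0 ≤ x / (Multiset.card β : ℝ) by positivity) (by ring)
      simp only [smul_eq_mul, mul_zero, zero_add] at h2
      rw [div_mul_cancel₀ _ hc.ne'] at h2
      refine le_trans ?_ h2
      have h3 : 0 ≤ (1 - x / Multiset.card β) * g 0 :=
        mul_nonneg (by rw [sub_nonneg]; exact (div_le_one hc).2 hx') h0
      have h4 : slopeOf χ β * x = x / Multiset.card β * pressure χ β := by
        rw [slopeOf]; ring
      have h5 : x / Multiset.card β * pressure χ β ≤ x / Multiset.card β * g (Multiset.card β) :=
        mul_le_mul_of_nonneg_left h1 (by positivity)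
      linarith
    -- Beyond the first break point, the origin is moved there for both functions.
    · have := ih (g := fun y => g (Multiset.card β + y) + -pressure χ β) ?_ ?_
        (fun β' h' => hpos β' (List.mem_cons_of_mem _ h')) ?_ (x := x - Multiset.card β)
        (sub_nonneg.2 (not_le.1 hx').le)
      · simp only [add_sub_cancel] at this
        linarith
      · have := (hg.translate_right (Multiset.card β : ℝ)).add_const (-pressure χ β)
        rw [Set.preimage_univ] at this
        exact this
      · intro y z hyz
        have := hm (add_le_add_right hyz (Multiset.card β : ℝ))
        simp only
        linarith
      · intro l₁ l₂ hl
        have := h (β :: l₁) l₂ (by rw [hl]; rfl)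
        rw [List.sum_cons, pressure_add, Multiset.card_add, Nat.cast_add] at this
        linarith

/-! ### The construction of the slope datum -/

/-- The greatest slope determines the ray, and the last point on it determines the index. So the
choice made in `breakUp` is harmless. -/
theorem IsBreak.unique {i : List I} {m m' : ℕ} (h : IsBreak χ i m) (h' : IsBreak χ i m') :
    m = m' := by
  obtain ⟨h1, h2, -, h3, h4⟩ := h
  obtain ⟨h1', h2', -, h3', h4'⟩ := h'
  rcases lt_trichotomy m m' with hm | hm | hm
  · exact absurd (h4 m' hm h2') (not_lt.2 (h3' m h1 h2))
  · exact hm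
  · exact absurd (h4' m hm h2) (not_lt.2 (h3 m' h1' h2'))

theorem breakUp_of_isBreak {i : List I} {m : ℕ} (h : IsBreak χ i m) :
    breakUp χ i = ((i.take m : Multiset I) :: (breakUp χ (i.drop m)).1,
      (breakUp χ (i.drop m)).2) := by
  have h' : ∃ m, IsBreak χ i m := ⟨m, h⟩
  rw [breakUp, dif_pos h', h'.choose_spec.unique h]

theorem breakUp_of_not {i : List I} (h : ¬ ∃ m, IsBreak χ i m) : breakUp χ i = ([], ↑i) := by
  rw [breakUp, dif_neg h]

theorem pressure_take {i : List I} {k : ℕ} (hk : k ≤ i.length) :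
    pressure χ (i.take k : Multiset I) = slopeOf χ (i.take k : Multiset I) * k := by
  rw [← slopeOf_mul_card]
  simp [hk]

variable (χ) in
/-- No initial part has positive pressure. -/
def Flat (i : List I) : Prop := ∀ k ≤ i.length, pressure χ (i.take k : Multiset I) ≤ 0

variable (χ) in
/-- The slopes of initial parts do not exceed the total slope. -/
def Slow (i : List I) : Prop :=
  ∀ k ≤ i.length, pressure χ (i.take k : Multiset I) ≤ slopeOf χ (i : Multiset I) * k

/-- Take the greatest slope of a nonempty initial part, and then the last index at which it is
attained; it is positive since some initial part has positive pressure. -/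
theorem exists_isBreak {i : List I} (h : ¬ Flat χ i) : ∃ m, IsBreak χ i m := by
  simp only [Flat, not_forall, not_le] at h
  obtain ⟨k₀, hk₀, hp⟩ := h
  have hk₀' : 0 < k₀ := by
    rcases Nat.eq_zero_or_pos k₀ with rfl | h
    · simp [pressure_zero] at hp
    · exact h
  have hs₀ : 0 < slopeOf χ (i.take k₀ : Multiset I) := by
    rw [pressure_take hk₀] at hp
    exact pos_of_mul_pos_left hp (Nat.cast_nonneg _)
  obtain ⟨m, hm, hmax⟩ := Finset.exists_max_image (Finset.Icc 1 i.length)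
    (fun k => slopeOf χ (i.take k : Multiset I)) ⟨k₀, Finset.mem_Icc.2 ⟨hk₀', hk₀⟩⟩
  obtain ⟨n, hn, hnmax⟩ := Finset.exists_max_image ((Finset.Icc 1 i.length).filter fun k =>
    slopeOf χ (i.take k : Multiset I) = slopeOf χ (i.take m : Multiset I)) id
    ⟨m, Finset.mem_filter.2 ⟨hm, rfl⟩⟩
  simp only [Finset.mem_filter, Finset.mem_Icc, id] at hn hnmax hmax
  refine ⟨n, hn.1.1, hn.1.2, ?_, fun k hk hk' => ?_, fun k hk hk' => ?_⟩
  · rw [hn.2]; exact hs₀.trans_le (hmax k₀ ⟨hk₀', hk₀⟩)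
  · rw [hn.2]; exact hmax k ⟨hk, hk'⟩
  · rw [hn.2]
    refine lt_of_le_of_ne (hmax k ⟨by omega, hk'⟩) fun he => ?_
    have := hnmax k ⟨⟨by omega, hk'⟩, he⟩
    omega

theorem breakUp_of_flat {i : List I} (h : Flat χ i) : breakUp χ i = ([], ↑i) := by
  refine breakUp_of_not ?_
  rintro ⟨m, h1, h2, h3, -⟩
  have := h m h2
  rw [pressure_take h2] at this
  have : 0 < slopeOf χ (i.take m : Multiset I) * m := mul_pos h3 (by exact_mod_cast h1)
  linarith

variable (χ) in
theorem exists_breakUp (i : List I) : ∃ (us : List (List I)) (i' : List I),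
    i = us.flatten ++ i' ∧ (breakUp χ i).1 = us.map Multiset.ofList ∧
      (breakUp χ i).2 = i' ∧ ∀ u ∈ us, u ≠ [] := by
  induction hn : i.length using Nat.strong_induction_on generalizing i with
  | _ n ih =>
    by_cases h : ∃ m, IsBreak χ i m
    · obtain ⟨m, hm⟩ := h
      obtain ⟨us, i', h1, h2, h3, h4⟩ := ih (i.drop m).length (by
        have := hm.1; have := hm.2.1; simp; omega) (i.drop m) rfl
      refine ⟨i.take m :: us, i', ?_, ?_, ?_, ?_⟩
      · rw [List.flatten_cons, List.append_assoc, ← h1, List.take_append_drop]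
      · rw [breakUp_of_isBreak hm, h2]; rfl
      · rw [breakUp_of_isBreak hm, h3]
      · intro u hu
        rcases List.mem_cons.1 hu with rfl | hu
        · have := hm.1; have := hm.2.1
          rw [← List.length_pos_iff]
          simp; omega
        · exact h4 u hu
    · exact ⟨[], i, rfl, by rw [breakUp_of_not h]; rfl, by rw [breakUp_of_not h], by simp⟩

theorem sum_map_coe (us : List (List I)) :
    (us.map Multiset.ofList).sum = us.flatten := by
  induction us with
  | nil => rfl
  | cons u us ih => rw [List.map_cons, List.sum_cons, ih, List.flatten_cons, Multiset.coe_add]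

/-- The path lies below its hull. -/
theorem pressure_le_pathFun_breakUp (i : List I) {k : ℕ} (hk : k ≤ i.length) :
    pressure χ (i.take k : Multiset I) ≤ pathFun χ (breakUp χ i).1 k := by
  induction hn : i.length using Nat.strong_induction_on generalizing i k with
  | _ n ih =>
    by_cases h : ∃ m, IsBreak χ i m
    · obtain ⟨m, hm⟩ := h
      have hml := hm.2.1
      have hc : Multiset.card (i.take m : Multiset I) = m := by simp [hml]
      rw [breakUp_of_isBreak hm, pathFun, hc]
      split_ifs with hkm
      · rw [pressure_take hk]
        rcases Nat.eq_zero_or_pos k with rfl | hk0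
        · simp
        · exact mul_le_mul_of_nonneg_right (hm.2.2.2.1 k hk0 hk) (Nat.cast_nonneg _)
      · have hkm : m < k := by exact_mod_cast not_le.1 hkm
        have := ih (i.drop m).length (by have := hm.1; simp; omega) (i.drop m) (k := k - m)
          (by simp; omega) rfl
        rw [Nat.cast_sub hkm.le] at this
        have e : i.take k = i.take m ++ (i.drop m).take (k - m) := by
          obtain ⟨d, rfl⟩ := Nat.exists_eq_add_of_lt hkm
          rw [add_assoc, Nat.add_sub_cancel_left, List.take_add]
        rw [e, pressure_append]
        linarith
    · rw [breakUp_of_not h, pathFun]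
      by_contra h'
      exact h (exists_isBreak fun hf => h' (hf k hk))

/-- The hull is the least concave monotone function above the path. -/
theorem pathFun_breakUp_le {i : List I} {l : List (Multiset I)} (hl : Descending χ l)
    (h : ∀ k ≤ i.length, pressure χ (i.take k : Multiset I) ≤ pathFun χ l k) {x : ℝ}
    (hx : 0 ≤ x) : pathFun χ (breakUp χ i).1 x ≤ pathFun χ l x := by
  obtain ⟨us, i', h1, h2, -, h4⟩ := exists_breakUp χ i
  rw [h2]
  refine pathFun_le_of_concaveOn (concaveOn_pathFun hl) (monotone_pathFun hl) ?_ ?_ hx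
  · intro β hβ
    obtain ⟨u, hu, rfl⟩ := List.mem_map.1 hβ
    simpa [List.length_pos_iff] using h4 u hu
  -- The break points of the hull are points of the path, where the bound is the hypothesis.
  · intro l₁ l₂ hus
    obtain ⟨us₁, us₂, rfl, rfl, rfl⟩ := List.map_eq_append_iff.1 hus
    rw [sum_map_coe, Multiset.coe_card]
    have := h us₁.flatten.length (by rw [h1]; simp)
    rwa [h1, List.flatten_append, List.append_assoc, List.take_left] at this

/-- The bounding function and the path both pass through the end points of the pieces. So the global
bound can be read on each piece separately, where the function is the chord, and after the last
piece, where it is constant. -/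
theorem slow_flat_of_le {us : List (List I)} {i : List I}
    (h : ∀ k ≤ (us.flatten ++ i).length, pressure χ ((us.flatten ++ i).take k : Multiset I) ≤
      pathFun χ (us.map Multiset.ofList) k) : (∀ u ∈ us, Slow χ u) ∧ Flat χ i := by
  induction us with
  | nil => exact ⟨by simp, fun k hk => by simpa [pathFun] using h k hk⟩
  | cons u us ih =>
    rw [List.forall_mem_cons, and_assoc]
    constructor
    · intro k hk
      have := h k (by simp; omega)
      rw [List.map_cons, pathFun, if_pos (by simpa using hk), List.flatten_cons, List.append_assoc,
        List.take_append_of_le_length hk] at this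
      exact this
    · refine ih fun k hk => ?_
      have := h (u.length + k) (by simp at hk ⊢; omega)
      rw [List.flatten_cons, List.append_assoc, List.take_length_add_append, pressure_append,
        List.map_cons, pathFun, Multiset.coe_card, Nat.cast_add, add_sub_cancel_left] at this
      -- At `k = 0` the argument is the common end point of two segments, which `pathFun` assigns to
      -- the first of them.
      split_ifs at this with hk0
      · obtain rfl : k = 0 := by
          have : (k : ℝ) ≤ 0 := by linarith
          exact Nat.le_zero.1 (by exact_mod_cast this)
        simp [pathFun_zero, pressure_zero]
      · linarith

/-- The end of `u` is a break. Inside `u` no initial part is steeper because `u` is slow, and beyond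
`u` the strict bound on `i` makes every ray strictly less steep. -/
theorem breakUp_append {u i : List I} (hu : u ≠ []) (hs : 0 < slopeOf χ (u : Multiset I))
    (hslow : Slow χ u) (h : ∀ k, 0 < k → k ≤ i.length →
      pressure χ (i.take k : Multiset I) < slopeOf χ (u : Multiset I) * k) :
    breakUp χ (u ++ i) = ((u : Multiset I) :: (breakUp χ i).1, (breakUp χ i).2) := by
  have hb : IsBreak χ (u ++ i) u.length := by
    have h1 : ∀ k, u.length < k → k ≤ (u ++ i).length →
        slopeOf χ ((u ++ i).take k : Multiset I) < slopeOf χ (u : Multiset I) := by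
      intro k hk hk'
      obtain ⟨d, rfl⟩ := Nat.exists_eq_add_of_lt hk
      rw [List.length_append, add_assoc] at hk'
      have h2 := h (d + 1) (by omega) (by omega)
      have h3 := slopeOf_mul_card (χ := χ) (u : Multiset I)
      rw [add_assoc, slopeOf, div_lt_iff₀ (by rw [Multiset.coe_card, Nat.cast_pos]; simp; omega), List.take_length_add_append,
        pressure_append, ← h3]
      simp only [Multiset.coe_card, List.length_append, List.length_take, Nat.cast_add,
        min_eq_left (show d + 1 ≤ i.length by omega)] at h2 ⊢
      linarith
    refine ⟨List.length_pos_iff.2 hu, by simp, by simpa using hs, fun k hk hk' => ?_,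
      fun k hk hk' => by simpa using h1 k hk hk'⟩
    rw [List.take_left]
    rcases Nat.lt_or_ge u.length k with hk2 | hk2
    · exact (h1 k hk2 hk').le
    · have := hslow k hk2
      rw [List.take_append_of_le_length hk2]
      rw [pressure_take hk2] at this
      exact le_of_mul_le_mul_right this (by exact_mod_cast hk)
  rw [breakUp_of_isBreak hb, List.take_left, List.drop_left]

theorem pressure_take_flatten_lt {us : List (List I)} {i : List I} {s : ℝ} (hs : 0 < s)
    (h : ∀ u ∈ us, Slow χ u ∧ slopeOf χ (u : Multiset I) < s) (hi : Flat χ i) {k : ℕ} (hk : 0 < k)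
    (hk' : k ≤ (us.flatten ++ i).length) :
    pressure χ ((us.flatten ++ i).take k : Multiset I) < s * k := by
  have hk0 : (0 : ℝ) < k := by exact_mod_cast hk
  induction us generalizing k with
  | nil =>
    have := hi k (by simpa using hk')
    exact lt_of_le_of_lt this (by positivity)
  | cons u us ih =>
    rw [List.forall_mem_cons] at h
    rw [List.flatten_cons, List.append_assoc] at hk' ⊢
    rcases Nat.lt_or_ge u.length k with hk2 | hk2
    · obtain ⟨d, rfl⟩ := Nat.exists_eq_add_of_lt hk2
      have h1 := ih h.2 (k := d + 1) (by omega) (by rw [List.length_append] at hk'; omega)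
        (by positivity)
      have h2 := slopeOf_mul_card (χ := χ) (u : Multiset I)
      have h3 := mul_le_mul_of_nonneg_right h.1.2.le (Nat.cast_nonneg (α := ℝ) u.length)
      rw [Multiset.coe_card] at h2
      rw [add_assoc, List.take_length_add_append, pressure_append]
      simp only [Nat.cast_add] at h1 ⊢
      linarith
    · rw [List.take_append_of_le_length hk2]
      exact lt_of_le_of_lt (h.1.1 k hk2) (mul_lt_mul_of_pos_right h.1.2 hk0)

/-- A path made of slow pieces with decreasing positive slopes and a flat end is its own
decomposition: each piece is split off by `breakUp_append`, since all later pieces are strictly less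
steep. -/
theorem breakUp_flatten {us : List (List I)} {i : List I} (hne : ∀ u ∈ us, u ≠ [])
    (hd : Descending χ (us.map Multiset.ofList)) (h : ∀ u ∈ us, Slow χ u)
    (hi : Flat χ i) : breakUp χ (us.flatten ++ i) = (us.map Multiset.ofList, ↑i) := by
  induction us with
  | nil => exact breakUp_of_flat hi
  | cons u us ih =>
    rw [List.forall_mem_cons] at h hne
    have hs := hd.1 u List.mem_cons_self
    have ih := ih hne.2 hd.tail h.2
    rw [List.flatten_cons, List.append_assoc, breakUp_append hne.1 hs h.1, ih]
    · rfl
    · intro k hk hk'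
      refine pressure_take_flatten_lt hs (fun u' hu' => ⟨h.2 u' hu', ?_⟩) hi hk hk'
      exact (List.pairwise_cons.1 hd.2).1 _ (List.mem_map_of_mem hu')

end Slopes

end

section

/-! ## Words for a list of blocks -/

section Words

variable {I : Type u}

/-- A family of words for the blocks. -/
structure IsWords (Bs : List (Block I)) (ws : ℕ → List (Option I)) : Prop where
  coe : ∀ p (h : p < Bs.length), (ws p : Multiset (Option I)) = Bs[p].strands
  nil : ∀ p, Bs.length ≤ p → ws p = []

/-- The numbers of strands of the blocks. -/
def blockLens (Bs : List (Block I)) (p : ℕ) : ℕ :=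
  if h : p < Bs.length then Multiset.card Bs[p].strands else 0

theorem IsWords.lengths {Bs : List (Block I)} {ws : ℕ → List (Option I)} (h : IsWords Bs ws) :
    lengths ws = blockLens Bs := by
  funext p
  rw [blockLens]
  split_ifs with hp
  · rw [← h.coe p hp, Multiset.coe_card]
  · rw [KLRW.lengths, h.nil p (not_lt.1 hp)]; rfl

theorem exists_eq_map_some {w : List (Option I)} (h : none ∉ w) : ∃ i : List I, w = i.map some := by
  induction w with
  | nil => exact ⟨[], rfl⟩
  | cons o w ih =>
    simp only [List.mem_cons, not_or] at h
    obtain ⟨i, rfl⟩ := ih h.2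
    cases o with
    | none => exact absurd rfl h.1
    | some j => exact ⟨j :: i, rfl⟩

theorem map_some_inj {i j : List I} (h : i.map some = j.map some) : i = j :=
  List.map_injective_iff.2 (Option.some_injective I) h

theorem coe_map_some_inj {i : List I} {β : Multiset I}
    (h : ((i.map some : List (Option I)) : Multiset (Option I)) = black β) : (i : Multiset I) = β :=
  Multiset.map_injective (Option.some_injective I) (by simpa [black] using h)

theorem exists_of_coe_eq_black {w : List (Option I)} {β : Multiset I}
    (h : (w : Multiset (Option I)) = black β) : ∃ i : List I, w = i.map some ∧ (i : Multiset I) = β := by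
  obtain ⟨i, rfl⟩ := exists_eq_map_some (w := w) (by
    intro hn
    have : none ∈ (w : Multiset (Option I)) := hn
    rw [h] at this
    simp at this)
  exact ⟨i, rfl, coe_map_some_inj h⟩

theorem coe_redWord (a b : List I) :
    (redWord a b : Multiset (Option I)) = withRed ((a : Multiset I) + (b : Multiset I)) := by
  rw [redWord, ← Multiset.coe_add, ← Multiset.cons_coe, ← Multiset.map_coe, ← Multiset.map_coe,
    Multiset.coe_reverse, Multiset.add_cons, withRed, Multiset.map_add]

theorem exists_of_coe_eq_withRed {w : List (Option I)} {β : Multiset I}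
    (h : (w : Multiset (Option I)) = withRed β) :
    ∃ a b : List I, w = redWord a b ∧ (a : Multiset I) + (b : Multiset I) = β := by
  have hmem : none ∈ w := by
    have : none ∈ (w : Multiset (Option I)) := by rw [h]; exact Multiset.mem_cons_self _ _
    exact this
  obtain ⟨u, v, rfl⟩ := List.append_of_mem hmem
  have h1 : ((u ++ v : List (Option I)) : Multiset (Option I)) = black β := by
    rw [← Multiset.cons_inj_right none]
    refine Eq.trans ?_ h
    rw [Multiset.cons_coe, Multiset.coe_eq_coe]
    exact List.perm_middle.symm
  obtain ⟨i, hi, rfl⟩ := exists_of_coe_eq_black h1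
  obtain ⟨a, b, rfl, rfl, rfl⟩ := List.append_eq_map_iff.1 hi
  exact ⟨a, b.reverse, by rw [redWord, List.reverse_reverse], by simp⟩

theorem redWord_inj {a b a' b' : List I} (h : redWord a b = redWord a' b') : a = a' ∧ b = b' := by
  induction a generalizing a' with
  | nil =>
    cases a' with
    | nil =>
      simp only [redWord, List.map_nil, List.nil_append, List.cons.injEq, true_and] at h
      exact ⟨rfl, List.reverse_injective (map_some_inj h)⟩
    | cons i a' => simp [redWord] at h
  | cons i a ih =>
    cases a' with
    | nil => simp [redWord] at h
    | cons j a' =>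
      simp only [redWord, List.map_cons, List.cons_append, List.cons.injEq, Option.some.injEq] at h
      obtain ⟨rfl, h⟩ := h
      obtain ⟨rfl, rfl⟩ := ih h
      exact ⟨rfl, rfl⟩

variable {χ : I → ℝ}

/-- The slope of a concatenation is the mean of the slopes of its parts, weighted by lengths. So
comparing the parts with each other is the same as comparing either of them with the whole. -/
theorem slope_cases {i j : List I} (hi : i ≠ []) (hj : j ≠ []) :
    (slopeOf χ (i : Multiset I) < slopeOf χ (j : Multiset I) ↔
      pressure χ (i : Multiset I) < slopeOf χ ((i ++ j : List I) : Multiset I) * i.length) ∧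
    (pressure χ (i : Multiset I) < slopeOf χ ((i ++ j : List I) : Multiset I) * i.length ↔
      slopeOf χ ((i ++ j : List I) : Multiset I) * j.length < pressure χ (j : Multiset I)) := by
  have hi' : (0 : ℝ) < i.length := by exact_mod_cast List.length_pos_iff.2 hi
  have hj' : (0 : ℝ) < j.length := by exact_mod_cast List.length_pos_iff.2 hj
  have hs := slopeOf_mul_card (χ := χ) ((i ++ j : List I) : Multiset I)
  have h1 := slopeOf_mul_card (χ := χ) (i : Multiset I)
  have h2 := slopeOf_mul_card (χ := χ) (j : Multiset I)
  rw [pressure_append] at hs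
  simp only [Multiset.coe_card, List.length_append, Nat.cast_add] at hs h1 h2
  set s := slopeOf χ ((i ++ j : List I) : Multiset I)
  set x := slopeOf χ (i : Multiset I)
  set y := slopeOf χ (j : Multiset I)
  rw [← h1, ← h2] at hs ⊢
  refine ⟨⟨fun h => ?_, fun h => ?_⟩, ⟨fun h => by linarith, fun h => by linarith⟩⟩
  · refine mul_lt_mul_of_pos_right ?_ hi'
    by_contra! h'
    have h3 := mul_le_mul_of_nonneg_right h' hi'.le
    have h4 := mul_lt_mul_of_pos_right (h'.trans_lt h) hj'
    linarith
  · have h3 := lt_of_mul_lt_mul_right h hi'.le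
    by_contra! h'
    have h4 := mul_lt_mul_of_pos_right (h'.trans_lt h3) hj'
    have h5 := mul_lt_mul_of_pos_right h3 hi'
    linarith

/-- The condition on slopes becomes a pair of linear bounds, which make sense and hold for empty
parts too. -/
theorem bounds_of_not_notSemicuspidal {i j : List I} (h : ¬ NotSemicuspidal χ ((i ++ j).map some)) :
    slopeOf χ ((i ++ j : List I) : Multiset I) * i.length ≤ pressure χ (i : Multiset I) ∧
      pressure χ (j : Multiset I) ≤ slopeOf χ ((i ++ j : List I) : Multiset I) * j.length := by
  rcases eq_or_ne i [] with rfl | hi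
  · simpa [pressure_zero] using (slopeOf_mul_card (χ := χ) (j : Multiset I)).ge
  rcases eq_or_ne j [] with rfl | hj
  · simpa [pressure_zero] using (slopeOf_mul_card (χ := χ) (i : Multiset I)).le
  obtain ⟨h1, h2⟩ := slope_cases (χ := χ) hi hj
  have h3 : ¬ slopeOf χ (i : Multiset I) < slopeOf χ (j : Multiset I) := fun h' =>
    h ⟨i, j, hi, hj, rfl, h'⟩
  exact ⟨not_lt.1 fun h' => h3 (h1.2 h'), not_lt.1 fun h' => h3 (h1.2 (h2.2 h'))⟩

/-- On the right of the red strand labels are read from right to left. Initial parts in this reading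
are final parts of the word, whose pressure is bounded above by semicuspidality. -/
theorem slow_reverse_iff {i : List I} :
    Slow χ i.reverse ↔ ¬ NotSemicuspidal χ (i.map some) := by
  constructor
  · rintro h ⟨u, v, hu, hv, he, hlt⟩
    obtain rfl := map_some_inj he
    have := h v.length (by simp)
    rw [List.reverse_append, List.take_left' (by simp), pressure_reverse, ← List.reverse_append,
      Multiset.coe_reverse] at this
    obtain ⟨h1, h2⟩ := slope_cases (χ := χ) hu hv
    exact absurd (h2.1 (h1.1 hlt)) (not_lt.2 this)
  · intro h k hk
    rw [List.length_reverse] at hk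
    have := (bounds_of_not_notSemicuspidal (χ := χ) (i := i.take (i.length - k))
      (j := i.drop (i.length - k)) (by rwa [List.take_append_drop])).2
    rw [List.take_append_drop, List.length_drop, Nat.sub_sub_self hk] at this
    rwa [List.take_reverse, pressure_reverse, Multiset.coe_reverse]

/-- On the left of the red strand labels are read in the order of the word. Semicuspidality bounds
the pressure of initial parts below, which is an upper bound for `-χ`. -/
theorem slow_neg_iff {i : List I} :
    Slow (fun j => -χ j) i ↔ ¬ NotSemicuspidal χ (i.map some) := by
  constructor
  · rintro h ⟨u, v, hu, hv, he, hlt⟩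
    obtain rfl := map_some_inj he
    have := h u.length (by simp)
    rw [List.take_left, pressure_neg, slopeOf_neg] at this
    obtain ⟨h1, -⟩ := slope_cases (χ := χ) hu hv
    have := h1.1 hlt
    linarith
  · intro h k hk
    have := (bounds_of_not_notSemicuspidal (χ := χ) (i := i.take k)
      (j := i.drop k) (by rwa [List.take_append_drop])).1
    rw [List.take_append_drop, List.length_take, min_eq_left hk] at this
    rw [pressure_neg, slopeOf_neg]
    linarith

theorem not_unsteady_iff {a b : List I} :
    ¬ Unsteady χ (redWord a b) ↔ Flat (fun j => -χ j) a ∧ Flat χ b := by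
  constructor
  · intro h
    refine ⟨fun k _ => ?_, fun k _ => ?_⟩
    · rw [pressure_neg]
      by_contra! h'
      exact h ⟨a, b, rfl, .inl ⟨k, by linarith⟩⟩
    · by_contra! h'
      exact h ⟨a, b, rfl, .inr ⟨k, h'⟩⟩
  · rintro ⟨ha, hb⟩ ⟨a', b', h, h'⟩
    obtain ⟨rfl, rfl⟩ := redWord_inj h
    rcases h' with ⟨m, hm⟩ | ⟨m, hm⟩
    · have := ha (min m a.length) (min_le_right _ _)
      rw [pressure_neg, ← List.take_eq_take_min] at this
      linarith
    · have := hb (min m b.length) (min_le_right _ _)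
      rw [← List.take_eq_take_min] at this
      linarith

/-! ### Words for a slope datum -/

variable {γ : SlopeDatum I}

theorem length_blocks (γ : SlopeDatum I) :
    γ.blocks.length = γ.left.length + 1 + γ.right.length := by
  simp [SlopeDatum.blocks]; omega

theorem blocks_left {p : ℕ} (h : p < γ.left.length) (h' : p < γ.blocks.length) :
    γ.blocks[p] = .plain γ.left[p] := by
  simp [SlopeDatum.blocks, List.getElem_append_left, h]

theorem blocks_mid (h' : γ.left.length < γ.blocks.length) :
    γ.blocks[γ.left.length] = .centre γ.mid := by
  simp [SlopeDatum.blocks]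

theorem blocks_right {j : ℕ} (h : j < γ.right.length)
    (h' : γ.left.length + 1 + j < γ.blocks.length) :
    γ.blocks[γ.left.length + 1 + j] = .plain γ.right[j] := by
  simp only [SlopeDatum.blocks]
  rw [List.getElem_append_right (by simp; omega)]
  simp [show γ.left.length + 1 + j - γ.left.length = j + 1 by omega]

/-- The words of the blocks of a slope datum. -/
structure WordData (γ : SlopeDatum I) (ws : ℕ → List (Option I)) (L R : ℕ → List I)
    (a b : List I) : Prop where
  left : ∀ p < γ.left.length, ws p = (L p).map some
  mid : ws γ.left.length = redWord a b
  right : ∀ j < γ.right.length, ws (γ.left.length + 1 + j) = (R j).map some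
  coe_left : (List.range γ.left.length).map (fun p => (L p : Multiset I)) = γ.left
  coe_mid : (a : Multiset I) + (b : Multiset I) = γ.mid
  coe_right : (List.range γ.right.length).map (fun j => (R j : Multiset I)) = γ.right

theorem IsWords.exists_wordData {ws : ℕ → List (Option I)} (h : IsWords γ.blocks ws) :
    ∃ L R a b, WordData γ ws L R a b := by
  have hN := length_blocks γ
  have hL : ∀ p : ℕ, ∃ i : List I, ∀ h : p < γ.left.length,
      ws p = i.map some ∧ (i : Multiset I) = γ.left[p] := fun p => by
    by_cases hp : p < γ.left.length
    · have := h.coe p (by omega)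
      rw [blocks_left hp] at this
      obtain ⟨i, hi⟩ := exists_of_coe_eq_black this
      exact ⟨i, fun _ => hi⟩
    · exact ⟨[], fun h => absurd h hp⟩
  have hR : ∀ j : ℕ, ∃ i : List I, ∀ h : j < γ.right.length,
      ws (γ.left.length + 1 + j) = i.map some ∧ (i : Multiset I) = γ.right[j] := fun j => by
    by_cases hj : j < γ.right.length
    · have := h.coe (γ.left.length + 1 + j) (by omega)
      rw [blocks_right hj] at this
      obtain ⟨i, hi⟩ := exists_of_coe_eq_black this
      exact ⟨i, fun _ => hi⟩
    · exact ⟨[], fun h => absurd h hj⟩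
  choose L hL using hL
  choose R hR using hR
  have hm := h.coe γ.left.length (by omega)
  rw [blocks_mid] at hm
  obtain ⟨a, b, hab, hab'⟩ := exists_of_coe_eq_withRed hm
  refine ⟨L, R, a, b, fun p hp => (hL p hp).1, hab, fun j hj => (hR j hj).1, ?_, hab', ?_⟩
  · exact List.ext_getElem (by simp) fun p h1 h2 => by simpa using (hL p h2).2
  · exact List.ext_getElem (by simp) fun p h1 h2 => by simpa using (hR p h2).2

namespace WordData

variable {ws : ℕ → List (Option I)} {L R : ℕ → List I} {a b : List I}

/-- Since `r` is read from right to left, the blocks on the right of the red strand contribute in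
reverse order, each with its word reversed; this matches the order in which `breakUp` finds them. -/
theorem cat_eq (h : WordData γ ws L R a b) :
    cat ws γ.blocks.length =
      redWord (((List.range γ.left.length).map L).flatten ++ a)
        ((((List.range γ.right.length).map fun j => (R j).reverse).reverse).flatten ++ b) := by
  have h1 : cat ws γ.left.length = (cat L γ.left.length).map some := by
    rw [← cat_map]; exact cat_congr h.left
  have h2 : cat (fun j => ws (γ.left.length + 1 + j)) γ.right.length =
      (cat R γ.right.length).map some := by
    rw [← cat_map]; exact cat_congr h.right
  have h3 : ((((List.range γ.right.length).map fun j => (R j).reverse).reverse).flatten).reverse =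
      cat R γ.right.length := by
    rw [List.reverse_flatten, List.map_reverse, List.reverse_reverse, List.map_map, cat,
      List.flatMap_def]
    simp [Function.comp_def]
  rw [length_blocks, cat_add, cat_succ, h1, h2, h.mid, redWord, redWord, List.reverse_append, h3,
    cat, List.flatMap_def]
  simp

theorem map_coe_left (h : WordData γ ws L R a b) :
    ((List.range γ.left.length).map L).map Multiset.ofList = γ.left := by
  rw [List.map_map]; exact h.coe_left

theorem map_coe_right (h : WordData γ ws L R a b) :
    (((List.range γ.right.length).map fun j => (R j).reverse).reverse).map Multiset.ofList =
      γ.right.reverse := by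
  rw [List.map_reverse, List.map_map, ← h.coe_right]
  simp [Function.comp_def]

/-- This translates survival of all block words into the conditions `Slow` and `Flat` on the pieces
of the two paths that determine the slope datum. -/
theorem good_iff (h : WordData γ ws L R a b) :
    (∀ p (hp : p < γ.blocks.length), ¬ γ.blocks[p].kill χ (ws p)) ↔
      ((∀ u ∈ (List.range γ.left.length).map L, Slow (fun j => -χ j) u) ∧
        Flat (fun j => -χ j) a) ∧
      ((∀ u ∈ ((List.range γ.right.length).map fun j => (R j).reverse).reverse, Slow χ u) ∧
        Flat χ b) := by
  have hN := length_blocks γ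
  constructor
  · intro hg
    have hm := hg γ.left.length (by omega)
    rw [blocks_mid, h.mid] at hm
    obtain ⟨h1, h2⟩ := not_unsteady_iff.1 hm
    refine ⟨⟨?_, h1⟩, ?_, h2⟩
    · intro u hu
      obtain ⟨p, hp, rfl⟩ := List.mem_map.1 hu
      rw [List.mem_range] at hp
      have := hg p (by omega)
      rw [blocks_left hp, h.left p hp] at this
      exact slow_neg_iff.2 this
    · intro u hu
      rw [List.mem_reverse] at hu
      obtain ⟨j, hj, rfl⟩ := List.mem_map.1 hu
      rw [List.mem_range] at hj
      have := hg (γ.left.length + 1 + j) (by omega)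
      rw [blocks_right hj, h.right j hj] at this
      exact slow_reverse_iff.2 this
  · rintro ⟨⟨h1, h2⟩, h3, h4⟩ p hp
    rcases lt_trichotomy p γ.left.length with hp' | rfl | hp'
    · rw [blocks_left hp', h.left p hp']
      exact slow_neg_iff.1 (h1 _ (List.mem_map_of_mem (List.mem_range.2 hp')))
    · rw [blocks_mid, h.mid]
      exact not_unsteady_iff.2 ⟨h2, h4⟩
    · obtain ⟨j, rfl⟩ := Nat.exists_eq_add_of_le (Nat.succ_le_of_lt hp')
      have hj : j < γ.right.length := by omega
      simp only [Nat.succ_eq_add_one] at hp ⊢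
      rw [blocks_right hj, h.right j hj]
      exact slow_reverse_iff.1 (h3 _ (List.mem_reverse.2
        (List.mem_map.2 ⟨j, List.mem_range.2 hj, rfl⟩)))

end WordData

theorem SlopeDatum.IsFor.descending_left {α : Multiset I} (hγ : γ.IsFor χ α) :
    Descending (fun j => -χ j) γ.left := by
  refine ⟨fun β hβ => ?_, hγ.left_lt.imp fun {β β'} h => ?_⟩
  · rw [slopeOf_neg]; exact neg_pos.2 (hγ.left_neg β hβ)
  · rw [slopeOf_neg, slopeOf_neg]; exact neg_lt_neg h

theorem SlopeDatum.IsFor.descending_right {α : Multiset I} (hγ : γ.IsFor χ α) :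
    Descending χ γ.right.reverse :=
  ⟨fun β hβ => hγ.right_pos β (List.mem_reverse.1 hβ), List.pairwise_reverse.2 hγ.right_lt⟩

theorem le_iff {γ' : SlopeDatum I} : γ'.LE χ γ ↔ ∀ x : ℝ, 0 ≤ x →
    pathFun χ γ'.right.reverse x ≤ pathFun χ γ.right.reverse x ∧
      pathFun (fun j => -χ j) γ'.left x ≤ pathFun (fun j => -χ j) γ.left x := by
  refine forall₂_congr fun x _ => ?_
  rw [pathFun_neg, pathFun_neg, neg_le_neg_iff]; rfl

/-- A concatenation of words whose slope datum is at most `γ` survives in the quotients. -/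
theorem good_of_le {ws : ℕ → List (Option I)} (hw : IsWords γ.blocks ws) {ℓ r : List I}
    (hc : cat ws γ.blocks.length = redWord ℓ r) (hle : (slopeDatum χ ℓ r).LE χ γ) :
    ∀ p (hp : p < γ.blocks.length), ¬ γ.blocks[p].kill χ (ws p) := by
  obtain ⟨L, R, a, b, hd⟩ := hw.exists_wordData
  rw [hd.cat_eq] at hc
  obtain ⟨rfl, rfl⟩ := redWord_inj hc
  rw [le_iff] at hle
  rw [hd.good_iff]
  constructor
  -- The path lies below its own hull, which lies below the function of `γ` by assumption. The
  -- concatenation passes through the break points of that function, so each piece satisfies its own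
  -- bound.
  · refine slow_flat_of_le fun k hk => ?_
    rw [hd.map_coe_left]
    exact (pressure_le_pathFun_breakUp _ hk).trans (hle k (Nat.cast_nonneg _)).2
  · refine slow_flat_of_le fun k hk => ?_
    rw [hd.map_coe_right]
    have := (hle k (Nat.cast_nonneg _)).1
    rw [slopeDatum, List.reverse_reverse] at this
    exact (pressure_le_pathFun_breakUp _ hk).trans this

theorem ne_nil_of_descending {χ : I → ℝ} {us : List (List I)}
    (h : Descending χ (us.map Multiset.ofList)) : ∀ u ∈ us, u ≠ [] := by
  rintro u hu rfl
  have := h.1 _ (List.mem_map_of_mem hu)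
  simp [slopeOf, pressure] at this

/-- A concatenation of words that survive in the quotients has the slope datum `γ`. -/
theorem slopeDatum_cat {α : Multiset I} (hγ : γ.IsFor χ α) {ws : ℕ → List (Option I)}
    (hw : IsWords γ.blocks ws)
    (hg : ∀ p (hp : p < γ.blocks.length), ¬ γ.blocks[p].kill χ (ws p)) {ℓ r : List I}
    (hc : cat ws γ.blocks.length = redWord ℓ r) : slopeDatum χ ℓ r = γ := by
  obtain ⟨L, R, a, b, hd⟩ := hw.exists_wordData
  rw [hd.cat_eq] at hc
  obtain ⟨rfl, rfl⟩ := redWord_inj hc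
  rw [hd.good_iff] at hg
  have h1 := hγ.descending_left
  rw [← hd.map_coe_left] at h1
  have h2 := hγ.descending_right
  rw [← hd.map_coe_right] at h2
  rw [slopeDatum, breakUp_flatten (ne_nil_of_descending h1) h1 hg.1.1 hg.1.2,
    breakUp_flatten (ne_nil_of_descending h2) h2 hg.2.1 hg.2.2, hd.map_coe_left, hd.map_coe_right,
    List.reverse_reverse, hd.coe_mid]

/-- A word with slope datum `γ` is a concatenation of words for the blocks of `γ`. -/
theorem exists_isWords {ℓ r : List I} (h : slopeDatum χ ℓ r = γ) :
    ∃ ws, IsWords γ.blocks ws ∧ cat ws γ.blocks.length = redWord ℓ r := by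
  obtain ⟨us, a, rfl, h1, h2, -⟩ := exists_breakUp (fun j => -χ j) ℓ
  obtain ⟨vs, b, rfl, h3, h4, -⟩ := exists_breakUp χ r
  have hl : γ.left = us.map Multiset.ofList := by rw [← h, ← h1]; rfl
  have hm : γ.mid = (a : Multiset I) + (b : Multiset I) := by rw [← h, ← h2, ← h4]; rfl
  have hr : γ.right = (vs.map Multiset.ofList).reverse := by rw [← h, ← h3]; rfl
  let l : List (List (Option I)) := us.map (List.map some) ++
    redWord a b :: vs.reverse.map fun v => v.reverse.map some
  have hll : l.length = γ.blocks.length := by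
    rw [length_blocks, hl, hr]; simp [l]; omega
  have hcat : ∀ (l : List (List (Option I))) n, n = l.length → cat (fun p => l.getD p []) n = l.flatten := by
    rintro l _ rfl
    rw [cat, List.flatMap_def]
    congr 1
    exact List.ext_getElem (by simp) fun p h1 h2 => by simp [h2]
  refine ⟨fun p => l.getD p [], ⟨fun p hp => ?_, fun p hp => ?_⟩, ?_⟩
  · have hl2 : l.map Multiset.ofList = γ.blocks.map Block.strands := by
      simp only [l, SlopeDatum.blocks, hl, hm, hr, List.map_append, List.map_map, List.map_cons,
        coe_redWord, Block.strands]
      simp [Function.comp_def, Block.strands]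
    have := congrArg (fun l => l[p]?) hl2
    simpa [hp, hll] using this
  · exact List.getD_eq_default _ _ (by rw [hll]; exact hp)
  · rw [hcat l _ hll.symm]
    simp only [l, redWord, List.flatten_append, List.flatten_cons, List.map_append,
      List.reverse_append, List.append_assoc, List.cons_append]
    congr 1
    · rw [List.map_flatten]
    · congr 3
      rw [List.reverse_flatten, List.map_flatten, List.map_reverse, List.map_reverse, List.map_map]
      rfl

end Words

end

section

/-! ### Shuffles and slope data -/

section

variable {I : Type u} {χ : I → ℝ} {γ : SlopeDatum I}

variable (χ) in
/-- The pressure of strands; the red strand does not contribute. -/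
abbrev strandPressure (o : Option I) : ℝ := o.elim 0 χ

variable (χ) in
/-- The slope of a block, which is zero for the central block. -/
def Block.slope : Block I → ℝ
  | .plain β => slopeOf χ β
  | .centre _ => 0

theorem pressure_strand (i : List I) :
    pressure (strandPressure χ) ((i.map some : List (Option I)) : Multiset (Option I)) =
      pressure χ (i : Multiset I) := by
  rw [pressure, pressure, Multiset.map_coe, Multiset.map_coe, List.map_map]; rfl

theorem pressure_sum {X ι : Type*} (f : X → ℝ) (s : Finset ι) (m : ι → Multiset X) :
    pressure f (∑ p ∈ s, m p) = ∑ p ∈ s, pressure f (m p) := by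
  classical
  induction s using Finset.induction_on with
  | empty => simp [pressure_zero]
  | insert p s hp ih => rw [Finset.sum_insert hp, Finset.sum_insert hp, pressure_add, ih]

/-- For a plain block these are the semicuspidal bounds. For the central block the slope is zero,
and only a part that does not contain the red strand is an initial part of `ℓ` or of `r` and can be
controlled by steadiness. -/
theorem block_bounds {B : Block I} {x y : List (Option I)}
    (h : ((x ++ y : List (Option I)) : Multiset (Option I)) = B.strands)
    (hg : ¬ B.kill χ (x ++ y)) :
    (none ∉ x → B.slope χ * x.length ≤ pressure (strandPressure χ) (x : Multiset (Option I))) ∧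
      (none ∉ y → pressure (strandPressure χ) (y : Multiset (Option I)) ≤
        B.slope χ * y.length) := by
  cases B with
  | plain β =>
    obtain ⟨i, hi, rfl⟩ := exists_of_coe_eq_black h
    obtain ⟨i, j, rfl, rfl, rfl⟩ := List.append_eq_map_iff.1 hi
    rw [← List.map_append] at hg
    have := bounds_of_not_notSemicuspidal hg
    simp only [pressure_strand, List.length_map, Block.slope]
    exact ⟨fun _ => this.1, fun _ => this.2⟩
  | centre β =>
    obtain ⟨a, b, hab, rfl⟩ := exists_of_coe_eq_withRed h
    rw [hab] at hg
    obtain ⟨ha, hb⟩ := not_unsteady_iff.1 hg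
    rw [redWord] at hab
    simp only [Block.slope, zero_mul]
    constructor
    · intro hx
      rcases List.append_eq_append_iff.1 hab with ⟨z, hz, -⟩ | ⟨z, rfl, hz⟩
      · obtain ⟨a₁, a₂, rfl, rfl, rfl⟩ := List.map_eq_append_iff.1 hz
        rw [pressure_strand]
        have := ha a₁.length (by simp)
        rw [List.take_left, pressure_neg] at this
        linarith
      · cases z with
        | nil =>
          rw [List.append_nil, pressure_strand]
          have := ha a.length le_rfl
          rw [List.take_length, pressure_neg] at this
          linarith
        | cons o z =>
          obtain ⟨rfl, -⟩ := List.cons.inj hz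
          simp at hx
    · intro hy
      rcases List.append_eq_append_iff.1 hab with ⟨z, hz, rfl⟩ | ⟨z, rfl, hz⟩
      · simp at hy
      · cases z with
        | nil =>
          rw [List.nil_append] at hz
          rw [← hz] at hy
          simp at hy
        | cons o z =>
          obtain ⟨-, hz⟩ := List.cons.inj hz
          obtain ⟨b₁, b₂, hb', rfl, rfl⟩ := List.map_eq_append_iff.1 hz
          rw [pressure_strand, ← pressure_reverse]
          have := hb b₂.reverse.length (by
            have := congrArg List.length hb'
            simp at this ⊢; omega)
          rwa [show b = b₂.reverse ++ b₁.reverse by rw [← List.reverse_append, ← hb',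
            List.reverse_reverse], List.take_left] at this

variable (χ) in
/-- The slope of the block with number `p`. -/
def blockSlope (Bs : List (Block I)) (p : ℕ) : ℝ := if h : p < Bs.length then Bs[p].slope χ else 0

section Sums

variable {Bs : List (Block I)} {ws : ℕ → List (Option I)}

theorem lt_of_mem_code (hw : IsWords Bs ws) {c : List ℕ} (hc : IsCode c (lengths ws)) :
    ∀ p ∈ c, p < Bs.length := by
  intro p hp
  by_contra! h
  have h1 := hc p
  rw [lengths, hw.nil p h, List.length_nil, List.count_eq_zero] at h1
  exact h1 hp

theorem count_add_count {c₁ c₂ : List ℕ} (hc : IsCode (c₁ ++ c₂) (lengths ws)) (p : ℕ) :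
    c₁.count p + c₂.count p = (ws p).length := by
  rw [← List.count_append]; exact hc p

/-- The part of the shuffle to the left of a cut consists of initial parts of the blocks, so the
bounds for the single blocks add up. -/
theorem sum_le_pressure_shuf (hw : IsWords Bs ws)
    (hg : ∀ p (hp : p < Bs.length), ¬ Bs[p].kill χ (ws p)) {c₁ c₂ : List ℕ}
    (hc : IsCode (c₁ ++ c₂) (lengths ws)) (hn : none ∉ shuf c₁ ws) :
    ∑ p ∈ Finset.range Bs.length, blockSlope χ Bs p * c₁.count p ≤
      pressure (strandPressure χ) (shuf c₁ ws : Multiset (Option I)) := by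
  have hle : ∀ p, c₁.count p ≤ (ws p).length := fun p => by
    have := count_add_count hc p; omega
  have e := coe_shuf hle fun p hp => lt_of_mem_code hw hc p (by simp [hp])
  rw [e, pressure_sum]
  refine Finset.sum_le_sum fun p hp => ?_
  have hp' := Finset.mem_range.1 hp
  have h1 := block_bounds (χ := χ) (B := Bs[p]) (x := (ws p).take (c₁.count p))
    (y := (ws p).drop (c₁.count p)) (by rw [List.take_append_drop]; exact hw.coe p hp')
    (by rw [List.take_append_drop]; exact hg p hp')
  have h2 := h1.1 (by
    intro h
    have h3 : none ∈ (shuf c₁ ws : Multiset (Option I)) := by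
      rw [e, Multiset.mem_sum]
      exact ⟨p, hp, h⟩
    exact hn h3)
  rw [List.length_take, min_eq_left (hle p)] at h2
  rwa [blockSlope, dif_pos hp']

theorem pressure_shuf_le_sum (hw : IsWords Bs ws)
    (hg : ∀ p (hp : p < Bs.length), ¬ Bs[p].kill χ (ws p)) {c₁ c₂ : List ℕ}
    (hc : IsCode (c₁ ++ c₂) (lengths ws))
    (hn : none ∉ shuf c₂ (fun p => (ws p).drop (c₁.count p))) :
    pressure (strandPressure χ)
        (shuf c₂ (fun p => (ws p).drop (c₁.count p)) : Multiset (Option I)) ≤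
      ∑ p ∈ Finset.range Bs.length, blockSlope χ Bs p * c₂.count p := by
  have hle : ∀ p, c₂.count p = ((ws p).drop (c₁.count p)).length := fun p => by
    have := count_add_count hc p
    rw [List.length_drop]; omega
  have e := coe_shuf (fun p => (hle p).le) fun p hp => lt_of_mem_code hw hc p (by simp [hp])
  rw [e, pressure_sum]
  refine Finset.sum_le_sum fun p hp => ?_
  have hp' := Finset.mem_range.1 hp
  have h1 := block_bounds (χ := χ) (B := Bs[p]) (x := (ws p).take (c₁.count p))
    (y := (ws p).drop (c₁.count p)) (by rw [List.take_append_drop]; exact hw.coe p hp')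
    (by rw [List.take_append_drop]; exact hg p hp')
  rw [hle p, List.take_length] at *
  have h2 := h1.2 (by
    intro h
    have h3 : none ∈ (shuf c₂ (fun p => (ws p).drop (c₁.count p)) : Multiset (Option I)) := by
      rw [e, Multiset.mem_sum]
      exact ⟨p, hp, by rw [hle p, List.take_length]; exact h⟩
    exact hn h3)
  rwa [blockSlope, dif_pos hp']

end Sums

theorem sum_blockSlope (γ : SlopeDatum I) (n : ℕ → ℕ) :
    ∑ p ∈ Finset.range γ.blocks.length, blockSlope χ γ.blocks p * n p =
      ∑ p ∈ Finset.range γ.left.length, slopeOf χ (γ.left.getD p 0) * n p +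
        ∑ j ∈ Finset.range γ.right.length,
          slopeOf χ (γ.right.getD j 0) * n (γ.left.length + 1 + j) := by
  have hN := length_blocks γ
  rw [hN, Finset.sum_range_add, Finset.sum_range_succ]
  have h0 : blockSlope χ γ.blocks γ.left.length = 0 := by
    rw [blockSlope, dif_pos (by omega), blocks_mid]; rfl
  rw [h0, zero_mul, add_zero]
  congr 1
  · refine Finset.sum_congr rfl fun p hp => ?_
    rw [Finset.mem_range] at hp
    rw [blockSlope, dif_pos (by omega), blocks_left hp, Block.slope,
      List.getD_eq_getElem _ _ hp]
  · refine Finset.sum_congr rfl fun j hj => ?_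
    rw [Finset.mem_range] at hj
    rw [blockSlope, dif_pos (by omega), blocks_right hj, Block.slope,
      List.getD_eq_getElem _ _ hj]

theorem map_range_getD {X : Type*} (l : List X) (d : X) :
    (List.range l.length).map (fun p => l.getD p d) = l :=
  List.ext_getElem (by simp) fun p h1 h2 => by simp [h2]

theorem sum_map_range (n : ℕ) (f : ℕ → ℝ) :
    ((List.range n).map f).sum = ∑ p ∈ Finset.range n, f p := rfl

theorem count_le_card_left {ws : ℕ → List (Option I)} (hw : IsWords γ.blocks ws) {p : ℕ}
    (hp : p < γ.left.length) : (ws p).length = Multiset.card (γ.left.getD p 0) := by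
  have hN := length_blocks γ
  have := congrArg Multiset.card (hw.coe p (by omega))
  rw [blocks_left hp] at this
  rw [List.getD_eq_getElem _ _ hp]
  simpa [Block.strands] using this

theorem count_le_card_right {ws : ℕ → List (Option I)} (hw : IsWords γ.blocks ws) {j : ℕ}
    (hj : j < γ.right.length) :
    (ws (γ.left.length + 1 + j)).length = Multiset.card (γ.right.getD j 0) := by
  have hN := length_blocks γ
  have := congrArg Multiset.card (hw.coe (γ.left.length + 1 + j) (by omega))
  rw [blocks_right hj] at this
  rw [List.getD_eq_getElem _ _ hj]
  simpa [Block.strands] using this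

theorem sum_count_range (c : List ℕ) {n : ℕ} (h : ∀ p ∈ c, p < n) :
    ∑ p ∈ Finset.range n, c.count p = c.length := by
  rw [← Multiset.coe_card c, ← Multiset.sum_count_eq_card (s := Finset.range n)]
  · exact Finset.sum_congr rfl fun p _ => (Multiset.coe_count p c).symm
  · intro p hp
    exact Finset.mem_range.2 (h p hp)

/-- The slope datum of a shuffle of words that survive in the quotients is at most `γ`. -/
theorem slopeDatum_shuf_le {α : Multiset I} (hγ : γ.IsFor χ α) {ws : ℕ → List (Option I)}
    (hw : IsWords γ.blocks ws)
    (hg : ∀ p (hp : p < γ.blocks.length), ¬ γ.blocks[p].kill χ (ws p)) {c : List ℕ}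
    (hc : IsCode c (lengths ws)) {ℓ r : List I} (hs : shuf c ws = redWord ℓ r) :
    (slopeDatum χ ℓ r).LE χ γ := by
  have hN := length_blocks γ
  have hlen : (shuf c ws).length = c.length := length_shuf fun p => (hc p).le
  have hlr : c.length = ℓ.length + 1 + r.length := by
    rw [← hlen, hs, redWord]; simp; omega
  rw [le_iff]
  intro x hx
  constructor
  · rw [slopeDatum, List.reverse_reverse]
    -- It suffices to bound the pressure of the first `k` labels of `r`. These are the last `k`
    -- strands of the shuffle, hence final parts of the blocks. Their pressure is at most the sum of
    -- slopes times counts, which is a knapsack problem with capacity `k`.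
    refine pathFun_breakUp_le hγ.descending_right (fun k hk => ?_) hx
    set c₁ := c.take (c.length - k) with hc₁
    set c₂ := c.drop (c.length - k) with hc₂
    have hcc : c₁ ++ c₂ = c := List.take_append_drop _ _
    have hk2 : c₂.length = k := by rw [hc₂, List.length_drop]; omega
    have hc' : IsCode (c₁ ++ c₂) (lengths ws) := by rwa [hcc]
    have h1 := shuf_append c₁ c₂ ws
    have h2 : shuf c₂ (fun p => (ws p).drop (c₁.count p)) = (r.take k).reverse.map some := by
      rw [hcc, hs, redWord] at h1
      have h3 : (shuf c₁ ws).length = ℓ.length + 1 + (r.length - k) := by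
        rw [length_shuf fun p => by have := count_add_count hc' p; omega, hc₁, List.length_take]
        omega
      have h4 := congrArg (List.drop (ℓ.length + 1 + (r.length - k))) h1
      rw [List.drop_left' h3] at h4
      rw [← h4, ← List.singleton_append, ← List.append_assoc, ← List.drop_drop,
        List.drop_left' (by simp), ← List.map_drop, List.reverse_take]
    have h3 := pressure_shuf_le_sum (χ := χ) hw hg hc' (by
      rw [h2, List.mem_map]; rintro ⟨i, -, h⟩; cases h)
    rw [h2, pressure_strand, Multiset.coe_reverse, sum_blockSlope] at h3
    refine h3.trans (le_trans (add_le_of_nonpos_left (Finset.sum_nonpos fun p hp => ?_)) ?_)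
    -- Blocks with negative slope can only lower the bound; the central block has already dropped
    -- out.
    · rw [Finset.mem_range] at hp
      refine mul_nonpos_of_nonpos_of_nonneg (hγ.left_neg _ ?_).le (Nat.cast_nonneg _)
      rw [List.getD_eq_getElem _ _ hp]
      exact List.getElem_mem hp
    · let l := ((List.range γ.right.length).map fun j =>
        (γ.right.getD j 0, c₂.count (γ.left.length + 1 + j))).reverse
      have hl : l.map Prod.fst = γ.right.reverse := by
        rw [List.map_reverse, List.map_map]
        exact congrArg _ (map_range_getD _ _)
      have h4 := sum_slope_le_pathFun (χ := χ) (l := l) (x := k) (by rw [hl]; exact hγ.descending_right)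
        ?_ ?_
      · rw [hl] at h4
        refine le_trans (le_of_eq ?_) h4
        rw [List.map_reverse, List.sum_reverse, List.map_map, ← sum_map_range]
        rfl
      · intro q hq
        rw [List.mem_reverse] at hq
        obtain ⟨j, hj, rfl⟩ := List.mem_map.1 hq
        rw [List.mem_range] at hj
        change c₂.count (γ.left.length + 1 + j) ≤ _
        have := count_add_count hc' (γ.left.length + 1 + j)
        rw [← count_le_card_right hw hj]
        omega
      · have h5 := sum_count_range c₂ (n := γ.blocks.length) fun p hp =>
          lt_of_mem_code hw hc' p (by simp [hp])
        rw [hN, Finset.sum_range_add, hk2] at h5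
        have h6 : (l.map Prod.snd).sum = ∑ j ∈ Finset.range γ.right.length,
            c₂.count (γ.left.length + 1 + j) := by
          rw [List.map_reverse, List.sum_reverse, List.map_map]; rfl
        rw [h6]
        exact_mod_cast (by omega : _ ≤ k)
  · rw [slopeDatum]
    -- On the left the roles of initial and final parts and all signs are reversed: the first `k`
    -- strands are initial parts of the blocks, and blocks with positive slope are dropped.
    refine pathFun_breakUp_le hγ.descending_left (fun k hk => ?_) hx
    set c₁ := c.take k with hc₁
    set c₂ := c.drop k with hc₂
    have hcc : c₁ ++ c₂ = c := List.take_append_drop _ _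
    have hk2 : c₁.length = k := by rw [hc₁, List.length_take]; omega
    have hc' : IsCode (c₁ ++ c₂) (lengths ws) := by rwa [hcc]
    have h1 := shuf_append c₁ c₂ ws
    have h2 : shuf c₁ ws = (ℓ.take k).map some := by
      rw [hcc, hs, redWord] at h1
      have h3 : (shuf c₁ ws).length = k := by
        rw [length_shuf fun p => by have := count_add_count hc' p; omega, hk2]
      have h4 := congrArg (List.take k) h1
      rw [List.take_left' h3] at h4
      rw [← h4, List.take_append_of_le_length (by simpa), List.map_take]
    have h3 := sum_le_pressure_shuf (χ := χ) hw hg hc' (by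
      rw [h2, List.mem_map]; rintro ⟨i, -, h⟩; cases h)
    rw [h2, pressure_strand, sum_blockSlope] at h3
    have h0 : 0 ≤ ∑ j ∈ Finset.range γ.right.length,
        slopeOf χ (γ.right.getD j 0) * c₁.count (γ.left.length + 1 + j) := by
      refine Finset.sum_nonneg fun j hj => ?_
      rw [Finset.mem_range] at hj
      refine mul_nonneg (hγ.right_pos _ ?_).le (Nat.cast_nonneg _)
      rw [List.getD_eq_getElem _ _ hj]
      exact List.getElem_mem hj
    let l := (List.range γ.left.length).map fun p => (γ.left.getD p 0, c₁.count p)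
    have hl : l.map Prod.fst = γ.left := by
      rw [List.map_map]
      exact map_range_getD _ _
    have h4 := sum_slope_le_pathFun (χ := fun j => -χ j) (l := l) (x := k)
      (by rw [hl]; exact hγ.descending_left) ?_ ?_
    · rw [hl] at h4
      refine le_trans ?_ h4
      have h5 : (l.map fun q => slopeOf (fun j => -χ j) q.1 * (q.2 : ℝ)).sum =
          - ∑ p ∈ Finset.range γ.left.length, slopeOf χ (γ.left.getD p 0) * c₁.count p := by
        rw [List.map_map, ← Finset.sum_neg_distrib, ← sum_map_range]
        simp only [Function.comp_def, slopeOf_neg, neg_mul]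
      rw [h5, pressure_neg]
      linarith
    · intro q hq
      obtain ⟨p, hp, rfl⟩ := List.mem_map.1 hq
      rw [List.mem_range] at hp
      change c₁.count p ≤ _
      have := count_add_count hc' p
      rw [← count_le_card_left hw hp]
      omega
    · have h5 := sum_count_range c₁ (n := γ.blocks.length) fun p hp =>
          lt_of_mem_code hw hc' p (by simp [hp])
      rw [hN, Finset.sum_range_add, Finset.sum_range_succ, hk2] at h5
      have h6 : (l.map Prod.snd).sum = ∑ p ∈ Finset.range γ.left.length, c₁.count p := by
        rw [List.map_map]; rfl
      rw [h6]
      exact_mod_cast (by omega : _ ≤ k)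

/-! ### Shuffles that are concatenations -/

/-- The exchange argument. -/
theorem eq_zero_of_exchange {N q : ℕ} {σ : ℕ → ℝ} {m n : ℕ → ℕ}
    (hσ : ∀ p p', p < p' → p' < N → σ p < σ p') (hn : ∀ p, n p ≤ m p) (hq : q < N)
    (hsum : ∑ p ∈ Finset.range N, n p = ∑ p ∈ Finset.Ico q N, m p)
    (hle : ∑ p ∈ Finset.Ico q N, σ p * m p ≤ ∑ p ∈ Finset.range N, σ p * n p) :
    ∀ p < q, n p = 0 := by
  have hsum' : ∑ p ∈ Finset.range N, (n p : ℝ) = ∑ p ∈ Finset.Ico q N, (m p : ℝ) := by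
    exact_mod_cast hsum
  rw [← Finset.sum_range_add_sum_Ico _ hq.le] at hle hsum'
  -- All slopes are measured relative to `σ q`. Then the blocks from `q` on contribute
  -- nonnegatively, and most if they are used completely, while the earlier blocks contribute
  -- negatively. As the totals of `n` and `m` agree, the shift does not affect the comparison.
  have h1 : ∑ p ∈ Finset.Ico q N, (σ p - σ q) * n p ≤ ∑ p ∈ Finset.Ico q N, (σ p - σ q) * m p := by
    refine Finset.sum_le_sum fun p hp => ?_
    rw [Finset.mem_Ico] at hp
    refine mul_le_mul_of_nonneg_left (by exact_mod_cast hn p) (sub_nonneg.2 ?_)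
    rcases hp.1.eq_or_lt with rfl | h
    · exact le_rfl
    · exact (hσ _ _ h hp.2).le
  have h2 : 0 ≤ ∑ p ∈ Finset.range q, (σ p - σ q) * n p := by
    simp only [sub_mul, Finset.sum_sub_distrib, ← Finset.mul_sum] at h1 ⊢
    have h3 : σ q * ∑ p ∈ Finset.Ico q N, (m p : ℝ) = σ q * ∑ p ∈ Finset.range q, (n p : ℝ) +
      σ q * ∑ p ∈ Finset.Ico q N, (n p : ℝ) := by rw [← hsum', mul_add]
    linarith
  have h3 : ∀ p ∈ Finset.range q, (σ p - σ q) * n p ≤ 0 := fun p hp =>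
    mul_nonpos_of_nonpos_of_nonneg (sub_nonpos.2 (hσ p q (Finset.mem_range.1 hp) hq).le)
      (Nat.cast_nonneg _)
  intro p hp
  have h4 := (Finset.sum_eq_zero_iff_of_nonpos h3).1 (le_antisymm (Finset.sum_nonpos h3) h2) p
    (Finset.mem_range.2 hp)
  rcases mul_eq_zero.1 h4 with h5 | h5
  · exact absurd h5 (sub_neg.2 (hσ p q hp hq)).ne
  · exact_mod_cast h5

theorem blockSlope_lt {α : Multiset I} (hγ : γ.IsFor χ α) :
    ∀ p p', p < p' → p' < γ.blocks.length → blockSlope χ γ.blocks p < blockSlope χ γ.blocks p' := by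
  have hpw : γ.blocks.Pairwise fun B B' => B.slope χ < B'.slope χ := by
    rw [SlopeDatum.blocks, List.pairwise_append]
    refine ⟨List.pairwise_map.2 hγ.left_lt, List.pairwise_cons.2 ⟨?_, List.pairwise_map.2 hγ.right_lt⟩,
      ?_⟩
    · intro B hB
      obtain ⟨β, hβ, rfl⟩ := List.mem_map.1 hB
      exact hγ.right_pos β hβ
    · intro B hB B' hB'
      obtain ⟨β, hβ, rfl⟩ := List.mem_map.1 hB
      rcases List.mem_cons.1 hB' with rfl | hB'
      · exact hγ.left_neg β hβ
      · obtain ⟨β', hβ', rfl⟩ := List.mem_map.1 hB'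
        exact (hγ.left_neg β hβ).trans (hγ.right_pos β' hβ')
  intro p p' h h'
  rw [blockSlope, blockSlope, dif_pos h', dif_pos (h.trans h')]
  exact List.pairwise_iff_getElem.1 hpw p p' _ _ h

theorem coe_cat (ws : ℕ → List (Option I)) (n : ℕ) :
    (cat ws n : Multiset (Option I)) = ∑ p ∈ Finset.range n, (ws p : Multiset (Option I)) := by
  induction n with
  | zero => rfl
  | succ n ih => rw [cat_succ, Finset.sum_range_succ, ← ih, Multiset.coe_add]

theorem pressure_plain {ws : ℕ → List (Option I)} (hw : IsWords γ.blocks ws) {p : ℕ}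
    (hp : p < γ.blocks.length) (hs : none ∉ ws p) :
    pressure (strandPressure χ) (ws p : Multiset (Option I)) =
      blockSlope χ γ.blocks p * (ws p).length := by
  have h := hw.coe p hp
  rw [blockSlope, dif_pos hp]
  generalize γ.blocks[p] = B at h
  cases B with
  | plain β =>
    obtain ⟨i, hi, rfl⟩ := exists_of_coe_eq_black h
    rw [hi, pressure_strand, Block.slope, List.length_map, ← Multiset.coe_card, slopeOf_mul_card]
  | centre β =>
    obtain ⟨a, b, hi, -⟩ := exists_of_coe_eq_withRed h
    rw [hi, redWord] at hs
    simp at hs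

theorem none_notMem_of_ne {ws : ℕ → List (Option I)} (hw : IsWords γ.blocks ws) {p : ℕ}
    (hp : p ≠ γ.left.length) : none ∉ ws p := by
  have hN := length_blocks γ
  rcases Nat.lt_or_ge p γ.blocks.length with h | h
  · have h1 := hw.coe p h
    intro hn
    have h2 : none ∈ (ws p : Multiset (Option I)) := hn
    rw [h1] at h2
    rcases lt_or_gt_of_ne hp with h3 | h3
    · rw [blocks_left h3] at h2
      simp [Block.strands] at h2
    · obtain ⟨j, rfl⟩ := Nat.exists_eq_add_of_le (Nat.succ_le_of_lt h3)
      simp only [Nat.succ_eq_add_one] at h2 h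
      rw [blocks_right (by omega)] at h2
      simp [Block.strands] at h2
  · rw [hw.nil p h]; simp

/-- If a shuffle of words that survive in the quotients is a concatenation of words for the
blocks, then it is the trivial shuffle. -/
theorem sorted_of_shuf_eq_cat {α : Multiset I} (hγ : γ.IsFor χ α) {ws ws' : ℕ → List (Option I)}
    (hw : IsWords γ.blocks ws) (hw' : IsWords γ.blocks ws')
    (hg : ∀ p (hp : p < γ.blocks.length), ¬ γ.blocks[p].kill χ (ws p)) {c : List ℕ}
    (hc : IsCode c (lengths ws)) (hs : shuf c ws = cat ws' γ.blocks.length) :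
    c.Pairwise (· ≤ ·) := by
  have hN := length_blocks γ
  set N := γ.blocks.length with hNdef
  have hll : lengths ws' = lengths ws := by rw [hw.lengths, hw'.lengths]
  have hcl : c.length = off (lengths ws) N := by
    rw [← length_shuf fun p => (hc p).le, hs, length_cat, hll]
  -- the two parts of the code
  have key : ∀ q < N, ∀ p < q, (c.drop (off (lengths ws) q)).count p = 0 := by
    intro q hq
    set c₁ := c.take (off (lengths ws) q) with hc₁
    set c₂ := c.drop (off (lengths ws) q) with hc₂
    have hcc : c₁ ++ c₂ = c := List.take_append_drop _ _
    have hc' : IsCode (c₁ ++ c₂) (lengths ws) := by rwa [hcc]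
    have hoff : off (lengths ws) q ≤ off (lengths ws) N := off_mono _ hq.le
    have hl₁ : (shuf c₁ ws).length = (cat ws' q).length := by
      rw [length_shuf fun p => by have := count_add_count hc' p; omega, length_cat, hll, hc₁,
        List.length_take]
      omega
    have h1 : shuf c₁ ws ++ shuf c₂ (fun p => (ws p).drop (c₁.count p)) =
        cat ws' q ++ cat (fun j => ws' (q + j)) (N - q) := by
      rw [← shuf_append, hcc, hs, ← cat_add, Nat.add_sub_cancel' hq.le]
    obtain ⟨h2, h3⟩ := List.append_inj h1 hl₁
    have hcat2 : ((cat (fun j => ws' (q + j)) (N - q) : List (Option I)) : Multiset (Option I)) =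
        ∑ p ∈ Finset.Ico q N, (ws' p : Multiset (Option I)) := by
      rw [coe_cat, Finset.sum_Ico_eq_sum_range]
    have hsplit : ∀ f : ℕ → ℝ, ∑ p ∈ Finset.range N, f p * c₁.count p +
        ∑ p ∈ Finset.range N, f p * c₂.count p =
        ∑ p ∈ Finset.range q, f p * (ws' p).length +
          ∑ p ∈ Finset.Ico q N, f p * (ws' p).length := by
      intro f
      rw [Finset.sum_range_add_sum_Ico _ hq.le, ← Finset.sum_add_distrib]
      refine Finset.sum_congr rfl fun p _ => ?_
      rw [← mul_add, ← Nat.cast_add, count_add_count hc' p]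
      exact congrArg (fun n : ℕ => f p * (n : ℝ)) (congrFun hll p).symm
    refine eq_zero_of_exchange (σ := blockSlope χ γ.blocks) (m := fun p => (ws' p).length)
      (blockSlope_lt hγ) (fun p => ?_) hq ?_ ?_
    · have := count_add_count hc' p
      have : (ws' p).length = (ws p).length := congrFun hll p
      omega
    · rw [sum_count_range c₂ fun p hp => lt_of_mem_code hw hc' p (by simp [hp]), hc₂,
        List.length_drop, hcl, ← hll, off, off, ← Finset.sum_range_add_sum_Ico _ hq.le,
        Nat.add_sub_cancel_left]
    -- Bounds on pressure are available only for a part without the red strand. If the cut is to the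
    -- right of the central block, this is the second part; otherwise it is the first part, and the
    -- inequality is transferred by comparing the totals.
    · rcases Nat.lt_or_ge γ.left.length q with hq' | hq'
      · have h4 := pressure_shuf_le_sum (χ := χ) hw hg hc' (by
          rw [h3, mem_cat]
          rintro ⟨j, hj, h⟩
          exact none_notMem_of_ne hw' (by omega) h)
        rw [h3, hcat2, pressure_sum] at h4
        refine le_trans (Finset.sum_le_sum fun p hp => ?_) h4
        rw [Finset.mem_Ico] at hp
        exact (pressure_plain hw' hp.2 (none_notMem_of_ne hw' (by omega))).ge
      · have h4 := sum_le_pressure_shuf (χ := χ) hw hg hc' (by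
          rw [h2, mem_cat]
          rintro ⟨j, hj, h⟩
          exact none_notMem_of_ne hw' (by omega) h)
        rw [h2, coe_cat, pressure_sum] at h4
        have h5 : ∑ p ∈ Finset.range q, pressure (strandPressure χ) (ws' p : Multiset (Option I)) =
            ∑ p ∈ Finset.range q, blockSlope χ γ.blocks p * (ws' p).length :=
          Finset.sum_congr rfl fun p hp => by
            rw [Finset.mem_range] at hp
            exact pressure_plain hw' (by omega) (none_notMem_of_ne hw' (by omega))
        have h6 := hsplit (blockSlope χ γ.blocks)
        linarith
  -- By `key`, all strands of the blocks before `q` occur in the first part of the code. They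
  -- already fill it, so nothing else occurs there.
  have key2 : ∀ q < N, ∀ p ∈ c.take (off (lengths ws) q), p < q := by
    intro q hq p hp
    set c₁ := c.take (off (lengths ws) q) with hc₁
    set c₂ := c.drop (off (lengths ws) q) with hc₂
    have hcc : c₁ ++ c₂ = c := List.take_append_drop _ _
    have hc' : IsCode (c₁ ++ c₂) (lengths ws) := by rwa [hcc]
    have hoff : off (lengths ws) q ≤ off (lengths ws) N := off_mono _ hq.le
    have h1 := sum_count_range c₁ (n := N) fun p hp => lt_of_mem_code hw hc' p (by simp [hp])
    have h2 : ∑ p ∈ Finset.range q, c₁.count p = off (lengths ws) q :=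
      Finset.sum_congr rfl fun p hp => by
        have h3 := key q hq p (Finset.mem_range.1 hp)
        rw [← hc' p, List.count_append, h3, add_zero]
    rw [← Finset.sum_range_add_sum_Ico _ hq.le, h2, hc₁, List.length_take,
      min_eq_left (by omega), Nat.add_eq_left, Finset.sum_eq_zero_iff, ← hc₁] at h1
    by_contra! hpq
    have := h1 p (Finset.mem_Ico.2 ⟨hpq, lt_of_mem_code hw hc p (List.mem_of_mem_take hp)⟩)
    exact List.count_eq_zero.1 this hp
  -- If an entry `q` precedes a smaller entry, then either `q` lies in the first part for the cut at
  -- `q`, contrary to `key2`, or the smaller entry lies in the second part, contrary to `key`.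
  rw [List.pairwise_iff_getElem]
  intro i j hi hj hij
  by_contra! hlt
  have hq := lt_of_mem_code hw hc (c)[i] (List.getElem_mem hi)
  rcases Nat.lt_or_ge i (off (lengths ws) (c)[i]) with h | h
  · have := key2 _ hq (c)[i] (by
      rw [List.mem_iff_getElem]
      exact ⟨i, by simp; omega, by simp⟩)
    omega
  · have := key _ hq (c)[j] hlt
    rw [List.count_eq_zero] at this
    refine this ?_
    rw [List.mem_iff_getElem]
    exact ⟨j - off (lengths ws) (c)[i], by simp; omega, by
      simp only [List.getElem_drop]; congr 1; omega⟩

end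

end

section

variable {I : Type u} {𝕜 : Type v} [CommRing 𝕜] [DecidableEq I]
variable {Q : I → I → MvPolynomial (Fin 2) 𝕜} {Λ : I → ℕ}

/-! ## Horizontal composition -/

variable (Q Λ) in
/-- A diagram with one elementary piece. -/
def dPut (u : List (Option I)) (g : Piece I) (v : List (Option I)) : Diagrams Q Λ :=
  RingQuot.mkAlgHom 𝕜 (Rel Q Λ) (FreeAlgebra.ι 𝕜 (Gen.put u g v))

theorem dId_mul_dPut (u : List (Option I)) (g : Piece I) (v : List (Option I)) :
    dId Q Λ (u ++ (g.tgt ++ v)) * dPut Q Λ u g v = dPut Q Λ u g v := by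
  rw [dId, dPut, ← map_mul]; exact mk_rel Q Λ (Rel.tgt_mul u g v)

theorem dPut_mul_dId (u : List (Option I)) (g : Piece I) (v : List (Option I)) :
    dPut Q Λ u g v * dId Q Λ (u ++ (g.src ++ v)) = dPut Q Λ u g v := by
  rw [dId, dPut, ← map_mul]; exact mk_rel Q Λ (Rel.mul_src u g v)

theorem pad_dPut (p q u : List (Option I)) (g : Piece I) (v : List (Option I)) :
    pad Q Λ p q (dPut Q Λ u g v) = dPut Q Λ (p ++ u) g (v ++ q) := by
  rw [dPut, pad_mk, fPad_put, dPut]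

theorem dPut_isotopy (u : List (Option I)) (g : Piece I) (x : List (Option I)) (g' : Piece I)
    (v : List (Option I)) :
    dPut Q Λ u g (x ++ (g'.tgt ++ v)) * dPut Q Λ (u ++ (g.src ++ x)) g' v =
      dPut Q Λ (u ++ (g.tgt ++ x)) g' v * dPut Q Λ u g (x ++ (g'.src ++ v)) := by
  simp only [dPut, ← map_mul]; exact mk_rel Q Λ (Rel.isotopy u g x g' v)

variable (Q Λ) in
/-- Diagrams with bottom `w` and top `w'`. -/
abbrev Dia (w w' : List (Option I)) (x : Diagrams Q Λ) : Prop :=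
  ∃ l, Mon Q Λ (fun _ => True) w l w' x

theorem Dia.one (w : List (Option I)) : Dia Q Λ w w (dId Q Λ w) := ⟨0, .one⟩

theorem Dia.put {w u v : List (Option I)} {g : Piece I} {x : Diagrams Q Λ}
    (h : Dia Q Λ w (u ++ (g.src ++ v)) x) :
    Dia Q Λ w (u ++ (g.tgt ++ v)) (dPut Q Λ u g v * x) := by
  obtain ⟨l, h⟩ := h
  cases g with
  | dot i => exact ⟨l, .dot h⟩
  | cross a b => exact ⟨l + 1, .cross trivial h⟩

theorem Dia.induction {w : List (Option I)} {motive : List (Option I) → Diagrams Q Λ → Prop}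
    (one : motive w (dId Q Λ w))
    (put : ∀ u g v x, Dia Q Λ w (u ++ (g.src ++ v)) x → motive (u ++ (g.src ++ v)) x →
      motive (u ++ (g.tgt ++ v)) (dPut Q Λ u g v * x)) {w' : List (Option I)} {x : Diagrams Q Λ}
    (h : Dia Q Λ w w' x) : motive w' x := by
  obtain ⟨l, h⟩ := h
  induction h with
  | one => exact one
  | @dot l u i v x h ih => exact put u (.dot i) v x ⟨l, h⟩ ih
  | @cross l u a b v x _ h ih => exact put u (.cross a b) v x ⟨l, h⟩ ih

theorem Dia.dId_mul {w w' : List (Option I)} {x : Diagrams Q Λ} (h : Dia Q Λ w w' x) :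
    dId Q Λ w' * x = x := h.choose_spec.dId_mul

theorem Dia.mul_dId {w w' : List (Option I)} {x : Diagrams Q Λ} (h : Dia Q Λ w w' x) :
    x * dId Q Λ w = x := h.choose_spec.mul_dId

theorem Dia.perm {w w' : List (Option I)} {x : Diagrams Q Λ} (h : Dia Q Λ w w' x) :
    w'.Perm w := h.choose_spec.perm

theorem Dia.trans {w w' w'' : List (Option I)} {x y : Diagrams Q Λ} (h : Dia Q Λ w w' x)
    (h' : Dia Q Λ w' w'' y) : Dia Q Λ w w'' (y * x) :=
  ⟨_, h.choose_spec.trans h'.choose_spec⟩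

theorem Dia.of_put {u v : List (Option I)} {g : Piece I} :
    Dia Q Λ (u ++ (g.src ++ v)) (u ++ (g.tgt ++ v)) (dPut Q Λ u g v) := by
  have := (Dia.one (Q := Q) (Λ := Λ) (u ++ (g.src ++ v))).put
  rwa [dPut_mul_dId] at this

/-- Diagrams span. -/
theorem mul_dId_mem_span (x : Diagrams Q Λ) (w : List (Option I)) :
    x * dId Q Λ w ∈ Submodule.span 𝕜 {y | ∃ w', Dia Q Λ w w' y} := by
  obtain ⟨a, rfl⟩ := RingQuot.mkAlgHom_surjective 𝕜 (Rel Q Λ) x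
  induction a using FreeAlgebra.induction generalizing w with
  | grade0 r =>
    rw [AlgHom.commutes, ← Algebra.smul_def]
    exact Submodule.smul_mem _ _ (Submodule.subset_span ⟨w, .one w⟩)
  | grade1 g =>
    cases g with
    | idm w' =>
      by_cases h : w' = w
      · subst h
        refine Submodule.subset_span ⟨w', ?_⟩
        change Dia Q Λ w' w' (dId Q Λ w' * dId Q Λ w')
        rw [dId_mul_self]
        exact .one w'
      · change dId Q Λ w' * dId Q Λ w ∈ _
        rw [dId_mul_ne Q Λ h]
        exact Submodule.zero_mem _
    | put u g v =>
      change dPut Q Λ u g v * dId Q Λ w ∈ _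
      by_cases h : u ++ (g.src ++ v) = w
      · subst h
        rw [dPut_mul_dId]
        exact Submodule.subset_span ⟨_, .of_put⟩
      · rw [← dPut_mul_dId, mul_assoc, dId_mul_ne Q Λ h, mul_zero]
        exact Submodule.zero_mem _
  | mul a b ha hb =>
    rw [map_mul, mul_assoc]
    refine mul_mem_of_span _ ?_ (hb w)
    rintro y ⟨w', hy⟩
    rw [← hy.dId_mul, ← mul_assoc]
    refine mul_mem_of_span' _ ?_ (ha w')
    rintro z ⟨w'', hz⟩
    exact Submodule.subset_span ⟨w'', hy.trans hz⟩
  | add a b ha hb =>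
    rw [map_add, add_mul]
    exact Submodule.add_mem _ (ha w) (hb w)

theorem dPut_pad_comm (u : List (Option I)) (g : Piece I) (m v : List (Option I))
    {z z' : List (Option I)} {y : Diagrams Q Λ} (hy : Dia Q Λ z z' y) :
    dPut Q Λ u g (m ++ (z' ++ v)) * pad Q Λ (u ++ (g.src ++ m)) v y =
      pad Q Λ (u ++ (g.tgt ++ m)) v y * dPut Q Λ u g (m ++ (z ++ v)) := by
  refine Dia.induction (motive := fun z' y =>
    dPut Q Λ u g (m ++ (z' ++ v)) * pad Q Λ (u ++ (g.src ++ m)) v y =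
      pad Q Λ (u ++ (g.tgt ++ m)) v y * dPut Q Λ u g (m ++ (z ++ v))) ?_ ?_ hy
  · have h1 := dPut_mul_dId (Q := Q) (Λ := Λ) u g (m ++ (z ++ v))
    have h2 := dId_mul_dPut (Q := Q) (Λ := Λ) u g (m ++ (z ++ v))
    rw [pad_dId, pad_dId, List.append_assoc, List.append_assoc, List.append_assoc,
      List.append_assoc, h1, h2]
  · intro u₂ g₂ v₂ y _ ih
    have := dPut_isotopy (Q := Q) (Λ := Λ) u g (m ++ u₂) g₂ (v₂ ++ v)
    simp only [List.append_assoc] at this ih ⊢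
    rw [map_mul, map_mul, pad_dPut, pad_dPut]
    simp only [List.append_assoc]
    rw [← mul_assoc, this, mul_assoc, ih, mul_assoc]

/-- The interchange law. -/
theorem pad_pad_comm (u m v : List (Option I)) {w w' z z' : List (Option I)}
    {x y : Diagrams Q Λ} (hx : Dia Q Λ w w' x) (hy : Dia Q Λ z z' y) :
    pad Q Λ u (m ++ (z' ++ v)) x * pad Q Λ (u ++ (w ++ m)) v y =
      pad Q Λ (u ++ (w' ++ m)) v y * pad Q Λ u (m ++ (z ++ v)) x := by
  refine Dia.induction (motive := fun w' x =>
    pad Q Λ u (m ++ (z' ++ v)) x * pad Q Λ (u ++ (w ++ m)) v y =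
      pad Q Λ (u ++ (w' ++ m)) v y * pad Q Λ u (m ++ (z ++ v)) x) ?_ ?_ hx
  · have h1 := congrArg (pad Q Λ (u ++ (w ++ m)) v) hy.dId_mul
    have h2 := congrArg (pad Q Λ (u ++ (w ++ m)) v) hy.mul_dId
    rw [map_mul, pad_dId] at h1 h2
    simp only [List.append_assoc] at h1 h2
    rw [pad_dId, pad_dId, h1, h2]
  · intro u₁ g v₁ x _ ih
    have := dPut_pad_comm (Q := Q) (Λ := Λ) (u ++ u₁) g (v₁ ++ m) v hy
    simp only [List.append_assoc] at this ih ⊢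
    rw [map_mul, map_mul, pad_dPut, pad_dPut, mul_assoc, ih, ← mul_assoc, this, mul_assoc]

/-! ### The idempotents -/

theorem mem_wordsOf {S : Multiset (Option I)} {w : List (Option I)} :
    w ∈ wordsOf S ↔ (w : Multiset (Option I)) = S := by
  rw [wordsOf, Multiset.mem_toFinset, Multiset.mem_lists_iff, eq_comm]; rfl

theorem total_mul_dId {S : Multiset (Option I)} {w : List (Option I)}
    (h : (w : Multiset (Option I)) = S) : total Q Λ S * dId Q Λ w = dId Q Λ w := by
  rw [total, Finset.sum_mul, Finset.sum_eq_single w, dId_mul_self]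
  · exact fun w' _ hne => dId_mul_ne Q Λ hne
  · exact fun hw => absurd (mem_wordsOf.2 h) hw

theorem dId_mul_total {S : Multiset (Option I)} {w : List (Option I)}
    (h : (w : Multiset (Option I)) = S) : dId Q Λ w * total Q Λ S = dId Q Λ w := by
  rw [total, Finset.mul_sum, Finset.sum_eq_single w, dId_mul_self]
  · exact fun w' _ hne => dId_mul_ne Q Λ (Ne.symm hne)
  · exact fun hw => absurd (mem_wordsOf.2 h) hw

namespace StrandAlg

variable {S : Multiset (Option I)}

theorem val_injective : Function.Injective (val : StrandAlg Q Λ S → Diagrams Q Λ) :=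
  Subtype.val_injective

theorem val_mul (x y : StrandAlg Q Λ S) : (x * y).val = x.val * y.val := rfl

theorem val_smul (c : 𝕜) (x : StrandAlg Q Λ S) : (c • x).val = c • x.val := rfl

theorem val_zero : (0 : StrandAlg Q Λ S).val = 0 := rfl

theorem val_one : (1 : StrandAlg Q Λ S).val = total Q Λ S := rfl

theorem val_sum {ι : Type*} (s : Finset ι) (f : ι → StrandAlg Q Λ S) :
    (∑ i ∈ s, f i).val = ∑ i ∈ s, (f i).val := map_sum (incl Q Λ S) f s

theorem val_proj (x : Diagrams Q Λ) :
    (proj Q Λ S x).val = total Q Λ S * x * total Q Λ S := rfl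

theorem total_mul_val (x : StrandAlg Q Λ S) : total Q Λ S * x.val = x.val := by
  rw [← val_one, ← val_mul, one_mul]

theorem val_mul_total (x : StrandAlg Q Λ S) : x.val * total Q Λ S = x.val := by
  rw [← val_one, ← val_mul, mul_one]

theorem val_proj_of {x : Diagrams Q Λ} (h : total Q Λ S * x = x) (h' : x * total Q Λ S = x) :
    (proj Q Λ S x).val = x := by
  rw [val_proj, h, h']

theorem proj_val (x : StrandAlg Q Λ S) : proj Q Λ S x.val = x :=
  val_injective (val_proj_of x.total_mul_val x.val_mul_total)

theorem val_idem {w : List (Option I)} (h : (w : Multiset (Option I)) = S) :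
    (idem Q Λ S w).val = dId Q Λ w :=
  val_proj_of (total_mul_dId h) (dId_mul_total h)

theorem sum_idem : ∑ w ∈ wordsOf S, idem Q Λ S w = 1 := by
  refine val_injective ?_
  rw [val_sum, val_one, total]
  exact Finset.sum_congr rfl fun w hw => val_idem (mem_wordsOf.1 hw)

end StrandAlg

theorem Dia.total_mul {S : Multiset (Option I)} {w w' : List (Option I)} {x : Diagrams Q Λ}
    (h : Dia Q Λ w w' x) (hS : (w : Multiset (Option I)) = S) : total Q Λ S * x = x := by
  rw [← h.dId_mul, ← mul_assoc, total_mul_dId]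
  rw [← hS]; exact Multiset.coe_eq_coe.2 h.perm

theorem Dia.mul_total {S : Multiset (Option I)} {w w' : List (Option I)} {x : Diagrams Q Λ}
    (h : Dia Q Λ w w' x) (hS : (w : Multiset (Option I)) = S) : x * total Q Λ S = x := by
  rw [← h.mul_dId, mul_assoc, dId_mul_total hS]

theorem Dia.val_proj {S : Multiset (Option I)} {w w' : List (Option I)} {x : Diagrams Q Λ}
    (h : Dia Q Λ w w' x) (hS : (w : Multiset (Option I)) = S) : (proj Q Λ S x).val = x :=
  StrandAlg.val_proj_of (h.total_mul hS) (h.mul_total hS)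

/-- Diagrams span the corners. -/
theorem StrandAlg.val_mem_span {S : Multiset (Option I)} (x : StrandAlg Q Λ S) :
    x.val ∈ Submodule.span 𝕜 {y | ∃ w w' : List (Option I), (w : Multiset (Option I)) = S ∧ Dia Q Λ w w' y} := by
  rw [← x.val_mul_total, total, Finset.mul_sum]
  refine Submodule.sum_mem _ fun w hw => ?_
  refine Submodule.span_mono ?_ (mul_dId_mem_span x.val w)
  rintro y ⟨w', hy⟩
  exact ⟨w, w', mem_wordsOf.1 hw, hy⟩

/-! ### Concatenations of words -/

theorem mem_concatWords_append {l l' : List (Block I)} {w : List (Option I)} :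
    w ∈ concatWords (l ++ l') ↔ ∃ u ∈ concatWords l, ∃ v ∈ concatWords l', w = u ++ v := by
  induction l generalizing w with
  | nil => simp [concatWords]
  | cons b l ih =>
    simp only [List.cons_append, concatWords, Finset.mem_image₂]
    constructor
    · rintro ⟨a, ha, z, hz, rfl⟩
      obtain ⟨u, hu, v, hv, rfl⟩ := ih.1 hz
      exact ⟨a ++ u, ⟨a, ha, u, hu, rfl⟩, v, hv, by simp⟩
    · rintro ⟨_, ⟨a, ha, u, hu, rfl⟩, v, hv, rfl⟩
      exact ⟨a, ha, u ++ v, ih.2 ⟨u, hu, v, hv, rfl⟩, by simp⟩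

theorem mem_concatWords_cons {b : Block I} {l : List (Block I)} {w : List (Option I)} :
    w ∈ concatWords (b :: l) ↔ ∃ u : List (Option I), (u : Multiset (Option I)) = b.strands ∧
      ∃ v ∈ concatWords l, w = u ++ v := by
  simp only [concatWords, Finset.mem_image₂, mem_wordsOf]
  exact exists_congr fun u => and_congr_right fun _ => exists_congr fun v =>
    and_congr_right fun _ => eq_comm

theorem coe_of_mem_concatWords {l : List (Block I)} {w : List (Option I)} (h : w ∈ concatWords l) :
    (w : Multiset (Option I)) = (l.map Block.strands).sum := by
  induction l generalizing w with
  | nil =>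
    obtain rfl : w = [] := by simpa [concatWords] using h
    rfl
  | cons b l ih =>
    obtain ⟨u, hu, v, hv, rfl⟩ := mem_concatWords_cons.1 h
    rw [← Multiset.coe_add, hu, ih hv, List.map_cons, List.sum_cons]

theorem length_eq_of_mem_concatWords {l : List (Block I)} {w w' : List (Option I)}
    (h : w ∈ concatWords l) (h' : w' ∈ concatWords l) : w.length = w'.length := by
  have := congrArg Multiset.card ((coe_of_mem_concatWords h).trans (coe_of_mem_concatWords h').symm)
  simpa using this

variable (Q Λ) in
/-- The sum of all diagrams obtained from `x` by adding words for the blocks in `l` on the left and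
words for the blocks in `l'` on the right. -/
def spread (l l' : List (Block I)) (x : Diagrams Q Λ) : Diagrams Q Λ :=
  ∑ u ∈ concatWords l, ∑ v ∈ concatWords l', pad Q Λ u v x

theorem spread_add (l l' : List (Block I)) (x y : Diagrams Q Λ) :
    spread Q Λ l l' (x + y) = spread Q Λ l l' x + spread Q Λ l l' y := by
  simp only [spread, map_add, Finset.sum_add_distrib]

theorem spread_zero (l l' : List (Block I)) : spread Q Λ l l' 0 = 0 := by
  simp only [spread, map_zero, Finset.sum_const_zero]

theorem spread_smul (l l' : List (Block I)) (c : 𝕜) (x : Diagrams Q Λ) :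
    spread Q Λ l l' (c • x) = c • spread Q Λ l l' x := by
  simp only [spread, map_smul, Finset.smul_sum]

section Spread

variable {l l' : List (Block I)} {b : Block I}

/-- All words for the block in the middle have the same length, as do the words added on the left.
So the slices where the two diagrams meet can agree only if the added words agree. -/
theorem pad_mul_pad_of_ne {x y : Diagrams Q Λ} (hx : x * total Q Λ b.strands = x)
    (hy : total Q Λ b.strands * y = y) {u v u' v' : List (Option I)} (hu : u.length = u'.length)
    (h : ¬(u = u' ∧ v = v')) : pad Q Λ u v x * pad Q Λ u' v' y = 0 := by
  rw [← hx, ← hy, map_mul, map_mul]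
  suffices pad Q Λ u v (total Q Λ b.strands) * pad Q Λ u' v' (total Q Λ b.strands) = 0 by
    rw [mul_assoc, ← mul_assoc (pad Q Λ u v (total Q Λ b.strands)), this, zero_mul, mul_zero]
  rw [total, map_sum, map_sum, Finset.sum_mul_sum]
  refine Finset.sum_eq_zero fun w hw => Finset.sum_eq_zero fun w' hw' => ?_
  rw [pad_dId, pad_dId, dId_mul_ne]
  intro he
  obtain ⟨h1, h2⟩ := List.append_inj he hu
  rw [mem_wordsOf] at hw hw'
  exact h ⟨h1, (List.append_inj h2 (by simpa using congrArg Multiset.card (hw.trans hw'.symm))).2⟩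

theorem spread_mul {x y : Diagrams Q Λ} (hx : x * total Q Λ b.strands = x)
    (hy : total Q Λ b.strands * y = y) :
    spread Q Λ l l' x * spread Q Λ l l' y = spread Q Λ l l' (x * y) := by
  simp only [spread, Finset.sum_mul_sum, map_mul]
  refine Finset.sum_congr rfl fun u hu => ?_
  rw [Finset.sum_eq_single u]
  · refine Finset.sum_congr rfl fun v hv => ?_
    rw [Finset.sum_eq_single v]
    · exact fun v' _ hne => pad_mul_pad_of_ne hx hy rfl fun h => hne h.2.symm
    · exact fun h => absurd hv h
  · exact fun u' hu' hne => Finset.sum_eq_zero fun v _ => Finset.sum_eq_zero fun v' _ =>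
      pad_mul_pad_of_ne hx hy (length_eq_of_mem_concatWords hu hu') fun h => hne h.1.symm
  · exact fun h => absurd hu h

theorem spread_mul_dId {x : Diagrams Q Λ} (hx : x * total Q Λ b.strands = x)
    {u w v : List (Option I)} (hu : u ∈ concatWords l) (hw : (w : Multiset (Option I)) = b.strands)
    (hv : v ∈ concatWords l') :
    spread Q Λ l l' x * dId Q Λ (u ++ (w ++ v)) = pad Q Λ u v (x * dId Q Λ w) := by
  have hy : total Q Λ b.strands * dId Q Λ w = dId Q Λ w := total_mul_dId hw
  rw [spread, Finset.sum_mul, Finset.sum_eq_single u, Finset.sum_mul, Finset.sum_eq_single v,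
    ← pad_dId, map_mul]
  · intro v' _ hne
    rw [← pad_dId, pad_mul_pad_of_ne hx hy rfl fun h => hne h.2]
  · exact fun h => absurd hv h
  · intro u' hu' hne
    rw [Finset.sum_mul]
    refine Finset.sum_eq_zero fun v' _ => ?_
    rw [← pad_dId, pad_mul_pad_of_ne hx hy (length_eq_of_mem_concatWords hu' hu) fun h => hne h.1]
  · exact fun h => absurd hu h

theorem spread_mul_eq {x : Diagrams Q Λ} (hx : x * total Q Λ b.strands = x)
    {u w v : List (Option I)} (hu : u ∈ concatWords l) (hw : (w : Multiset (Option I)) = b.strands)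
    (hv : v ∈ concatWords l') {y : Diagrams Q Λ} (hy : dId Q Λ (u ++ (w ++ v)) * y = y) :
    spread Q Λ l l' x * y = pad Q Λ u v (x * dId Q Λ w) * y := by
  rw [← spread_mul_dId hx hu hw hv, mul_assoc, hy]

variable (Q Λ) in
/-- The sum of the straight line diagrams for all concatenations. -/
def concatTotal (l : List (Block I)) : Diagrams Q Λ := ∑ w ∈ concatWords l, dId Q Λ w

theorem dId_mul_concatTotal {w : List (Option I)} (h : w ∈ concatWords l) :
    dId Q Λ w * concatTotal Q Λ l = dId Q Λ w := by
  rw [concatTotal, Finset.mul_sum, Finset.sum_eq_single w, dId_mul_self]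
  · exact fun w' _ hne => dId_mul_ne Q Λ (Ne.symm hne)
  · exact fun h' => absurd h h'

theorem concatTotal_mul_dId {w : List (Option I)} (h : w ∈ concatWords l) :
    concatTotal Q Λ l * dId Q Λ w = dId Q Λ w := by
  rw [concatTotal, Finset.sum_mul, Finset.sum_eq_single w, dId_mul_self]
  · exact fun w' _ hne => dId_mul_ne Q Λ hne
  · exact fun h' => absurd h h'

theorem eq_of_mul_dId {z z' : Diagrams Q Λ} (hz : z * concatTotal Q Λ l = z)
    (hz' : z' * concatTotal Q Λ l = z')
    (h : ∀ w ∈ concatWords l, z * dId Q Λ w = z' * dId Q Λ w) : z = z' := by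
  rw [← hz, ← hz', concatTotal, Finset.mul_sum, Finset.mul_sum]
  exact Finset.sum_congr rfl h

theorem mem_concatWords_middle {w : List (Option I)} :
    w ∈ concatWords (l ++ b :: l') ↔ ∃ u ∈ concatWords l, ∃ m : List (Option I),
      (m : Multiset (Option I)) = b.strands ∧ ∃ v ∈ concatWords l', w = u ++ (m ++ v) := by
  simp only [mem_concatWords_append, mem_concatWords_cons]
  constructor
  · rintro ⟨u, hu, _, ⟨m, hm, v, hv, rfl⟩, rfl⟩
    exact ⟨u, hu, m, hm, v, hv, rfl⟩
  · rintro ⟨u, hu, m, hm, v, hv, rfl⟩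
    exact ⟨u, hu, _, ⟨m, hm, v, hv, rfl⟩, rfl⟩

theorem pad_mul_concatTotal {x : Diagrams Q Λ} (hx : x * total Q Λ b.strands = x)
    {u v : List (Option I)} (hu : u ∈ concatWords l) (hv : v ∈ concatWords l') :
    pad Q Λ u v x * concatTotal Q Λ (l ++ b :: l') = pad Q Λ u v x := by
  rw [← hx, total, Finset.mul_sum, map_sum, Finset.sum_mul]
  refine Finset.sum_congr rfl fun w hw => ?_
  rw [map_mul, pad_dId, mul_assoc, dId_mul_concatTotal]
  exact mem_concatWords_middle.2 ⟨u, hu, w, mem_wordsOf.1 hw, v, hv, rfl⟩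

theorem concatTotal_mul_pad {x : Diagrams Q Λ} (hx : total Q Λ b.strands * x = x)
    {u v : List (Option I)} (hu : u ∈ concatWords l) (hv : v ∈ concatWords l') :
    concatTotal Q Λ (l ++ b :: l') * pad Q Λ u v x = pad Q Λ u v x := by
  rw [← hx, total, Finset.sum_mul, map_sum, Finset.mul_sum]
  refine Finset.sum_congr rfl fun w hw => ?_
  rw [map_mul, pad_dId, ← mul_assoc, concatTotal_mul_dId]
  exact mem_concatWords_middle.2 ⟨u, hu, w, mem_wordsOf.1 hw, v, hv, rfl⟩

theorem spread_mul_concatTotal {x : Diagrams Q Λ} (hx : x * total Q Λ b.strands = x) :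
    spread Q Λ l l' x * concatTotal Q Λ (l ++ b :: l') = spread Q Λ l l' x := by
  rw [spread, Finset.sum_mul]
  refine Finset.sum_congr rfl fun u hu => ?_
  rw [Finset.sum_mul]
  exact Finset.sum_congr rfl fun v hv => pad_mul_concatTotal hx hu hv

theorem total_idem_eq (S : Multiset (Option I)) :
    total Q Λ S * total Q Λ S = total Q Λ S := total_idem Q Λ S

theorem spread_total : spread Q Λ l l' (total Q Λ b.strands) = concatTotal Q Λ (l ++ b :: l') := by
  refine eq_of_mul_dId (l := l ++ b :: l') (spread_mul_concatTotal (total_idem_eq _)) ?_ ?_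
  · rw [concatTotal, Finset.sum_mul]
    exact Finset.sum_congr rfl fun w hw => dId_mul_concatTotal hw
  · intro w hw
    rw [concatTotal_mul_dId hw]
    obtain ⟨u, hu, m, hm, v, hv, rfl⟩ := mem_concatWords_middle.1 hw
    rw [spread_mul_dId (total_idem_eq _) hu hm hv, total_mul_dId hm, pad_dId]

/-- Diagrams in different blocks commute. -/
theorem spread_comm {b' : Block I} {l₂ : List (Block I)} {x y : Diagrams Q Λ}
    (hx : x ∈ Submodule.span 𝕜 {y | ∃ w w' : List (Option I), (w : Multiset (Option I)) = b.strands ∧ Dia Q Λ w w' y})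
    (hy : y ∈ Submodule.span 𝕜
      {y | ∃ w w' : List (Option I), (w : Multiset (Option I)) = b'.strands ∧ Dia Q Λ w w' y}) :
    spread Q Λ l (l₂ ++ b' :: l') x * spread Q Λ (l ++ b :: l₂) l' y =
      spread Q Λ (l ++ b :: l₂) l' y * spread Q Λ l (l₂ ++ b' :: l') x := by
  induction hx using Submodule.span_induction with
  | zero => simp only [spread_zero, zero_mul, mul_zero]
  | add x x' _ _ h h' => simp only [spread_add, add_mul, mul_add, h, h']
  | smul c x _ h => simp only [spread_smul, smul_mul_assoc, mul_smul_comm, h]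
  | mem x hx =>
    induction hy using Submodule.span_induction with
    | zero => simp only [spread_zero, zero_mul, mul_zero]
    | add x x' _ _ h h' => simp only [spread_add, add_mul, mul_add, h, h']
    | smul c x _ h => simp only [spread_smul, smul_mul_assoc, mul_smul_comm, h]
    | mem y hy =>
      obtain ⟨w, w', hw, hx⟩ := hx
      obtain ⟨z, z', hz, hy⟩ := hy
      have hw' : (w' : Multiset (Option I)) = b.strands := by
        rw [← hw]; exact Multiset.coe_eq_coe.2 hx.perm
      have hz' : (z' : Multiset (Option I)) = b'.strands := by
        rw [← hz]; exact Multiset.coe_eq_coe.2 hy.perm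
      have hxt := hx.mul_total hw
      have hyt := hy.mul_total hz
      have e : l ++ b :: (l₂ ++ b' :: l') = (l ++ b :: l₂) ++ b' :: l' := by simp
      -- The products are compared on each bottom slice `t`, which is cut into words for the blocks.
      -- If the word for one of the two blocks is not the bottom of the diagram in that block, both
      -- products vanish; otherwise only one summand survives on each side, and the interchange law
      -- applies.
      refine eq_of_mul_dId (l := (l ++ b :: l₂) ++ b' :: l') ?_ ?_ ?_
      · rw [mul_assoc, spread_mul_concatTotal hyt]
      · rw [mul_assoc, ← e, spread_mul_concatTotal hxt]
      · intro t ht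
        obtain ⟨_, hs, z₁, hz₁, v, hv, rfl⟩ := mem_concatWords_middle.1 ht
        obtain ⟨u, hu, w₁, hw₁, m, hm, rfl⟩ := mem_concatWords_middle.1 hs
        have hl : ∀ {a : List (Option I)}, (a : Multiset (Option I)) = b.strands →
            u ++ (a ++ m) ∈ concatWords (l ++ b :: l₂) := fun ha =>
          mem_concatWords_middle.2 ⟨u, hu, _, ha, m, hm, rfl⟩
        have hr : ∀ {a : List (Option I)}, (a : Multiset (Option I)) = b'.strands →
            m ++ (a ++ v) ∈ concatWords (l₂ ++ b' :: l') := fun ha =>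
          mem_concatWords_middle.2 ⟨m, hm, _, ha, v, hv, rfl⟩
        have hassoc : ∀ a c : List (Option I), u ++ (a ++ m) ++ (c ++ v) =
            u ++ (a ++ (m ++ (c ++ v))) := fun a c => by simp
        have htop : ∀ {w w' p q : List (Option I)} {x : Diagrams Q Λ}, Dia Q Λ w w' x →
            dId Q Λ (p ++ (w' ++ q)) * pad Q Λ p q x = pad Q Λ p q x := fun h => by
          rw [← pad_dId, ← map_mul, h.dId_mul]
        rw [mul_assoc, mul_assoc, spread_mul_dId hyt (hl hw₁) hz₁ hv, hassoc,
          spread_mul_dId hxt hu hw₁ (hr hz₁)]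
        have hbx : ∀ {w₂}, w ≠ w₂ → x * dId Q Λ w₂ = 0 := fun hne => by
          rw [← hx.mul_dId, mul_assoc, dId_mul_ne Q Λ hne, mul_zero]
        have hby : ∀ {w₂}, z ≠ w₂ → y * dId Q Λ w₂ = 0 := fun hne => by
          rw [← hy.mul_dId, mul_assoc, dId_mul_ne Q Λ hne, mul_zero]
        by_cases hzz : z = z₁
        swap
        · rw [hby hzz, map_zero, mul_zero]
          by_cases hww : w = w₁
          · subst hww
            rw [hx.mul_dId, spread_mul_eq hyt (hl hw') hz₁ hv (by rw [hassoc]; exact htop hx),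
              hby hzz, map_zero, zero_mul]
          · rw [hbx hww, map_zero, mul_zero]
        subst hzz
        rw [hy.mul_dId]
        by_cases hww : w = w₁
        swap
        · rw [hbx hww, map_zero, mul_zero,
            spread_mul_eq hxt hu hw₁ (hr hz') (by rw [← hassoc]; exact htop hy),
            hbx hww, map_zero, zero_mul]
        subst hww
        rw [hx.mul_dId, spread_mul_eq hxt hu hw₁ (hr hz') (by rw [← hassoc]; exact htop hy),
          spread_mul_eq hyt (hl hw') hz₁ hv (by rw [hassoc]; exact htop hx), hx.mul_dId,
          hy.mul_dId, pad_pad_comm u m v hx hy]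

end Spread

end

section

variable {I : Type u} {𝕜 : Type v} [CommRing 𝕜] [DecidableEq I]
variable {Q : I → I → MvPolynomial (Fin 2) 𝕜} {Λ : I → ℕ}

/-! ### Products over the blocks -/

section Products

variable {A : Type*} [Monoid A]

theorem prod_ofFn_mul {n : ℕ} (a b : Fin n → A) (h : ∀ p q, p ≠ q → Commute (a p) (b q)) :
    (List.ofFn a).prod * (List.ofFn b).prod = (List.ofFn fun p => a p * b p).prod := by
  induction n with
  | zero => simp
  | succ n ih =>
    simp only [List.ofFn_succ, List.prod_cons]
    rw [← ih (fun p => a p.succ) (fun p => b p.succ)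
      fun p q hpq => h _ _ fun he => hpq (Fin.succ_injective _ he)]
    have : Commute (List.ofFn fun p : Fin n => a p.succ).prod (b 0) := by
      refine Commute.list_prod_left _ _ fun x hx => ?_
      obtain ⟨p, rfl⟩ := List.mem_ofFn.1 hx
      exact h _ _ (Fin.succ_ne_zero p)
    rw [mul_assoc, ← mul_assoc _ (b 0), this.eq]
    simp only [mul_assoc]

theorem prod_ofFn_const {n : ℕ} {e : A} (he : e * e = e) (hn : 0 < n) :
    (List.ofFn fun _ : Fin n => e).prod = e := by
  rw [List.ofFn_const, List.prod_replicate]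
  exact IsIdempotentElem.pow_eq he hn.ne'

theorem prod_ofFn_update {n : ℕ} {e a : A} (he : e * e = e) (ha : e * a = a) (ha' : a * e = a)
    (p : Fin n) : (List.ofFn (Function.update (fun _ => e) p a)).prod = a := by
  induction n with
  | zero => exact p.elim0
  | succ n ih =>
    rw [List.ofFn_succ, List.prod_cons]
    refine Fin.cases ?_ (fun p => ?_) p
    · rw [Function.update_self]
      have : (fun i : Fin n => Function.update (fun _ : Fin (n + 1) => e) 0 a i.succ) =
          fun _ => e := funext fun i => Function.update_of_ne (Fin.succ_ne_zero i) _ _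
      rw [this]
      rcases Nat.eq_zero_or_pos n with rfl | hn
      · simp
      · rw [prod_ofFn_const he hn, ha']
    · have : (fun i : Fin n => Function.update (fun _ : Fin (n + 1) => e) p.succ a i.succ) =
          Function.update (fun _ => e) p a := by
        funext i
        by_cases h : i = p
        · subst h; simp
        · rw [Function.update_of_ne h, Function.update_of_ne fun h' => h (Fin.succ_injective _ h')]
      rw [this, ih, Function.update_of_ne (Fin.succ_ne_zero p).symm, ha]

open Classical in
theorem prod_ofFn_mul_eq_ite {A : Type*} [MonoidWithZero A] {n : ℕ} (f : Fin n → A)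
    (P : Fin n → Prop) {e : A}
    (h : ∀ p, f p * e = if P p then e else 0) :
    (List.ofFn f).prod * e = if ∀ p, P p then e else 0 := by
  induction n with
  | zero => simp
  | succ n ih =>
    rw [List.ofFn_succ, List.prod_cons, mul_assoc, ih _ (fun p => P p.succ) fun p => h p.succ]
    simp only [Fin.forall_fin_succ (P := P)]
    split_ifs with h1 h2 h2
    · rw [h, if_pos h2.1]
    · rw [h, if_neg fun h3 => h2 ⟨h3, h1⟩]
    · exact absurd h2.2 h1
    · rw [mul_zero]

end Products

theorem exists_split {X : Type*} (l : List X) {p q : ℕ} (hpq : p < q) (hq : q < l.length) :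
    ∃ m, l.drop (p + 1) = m ++ l[q] :: l.drop (q + 1) ∧ l.take q = l.take p ++ l[p] :: m := by
  refine ⟨(l.take q).drop (p + 1), ?_, ?_⟩
  · conv_lhs => rw [← List.take_append_drop q l]
    rw [List.drop_append_of_le_length (by simp; omega), List.drop_eq_getElem_cons hq]
  · conv_lhs => rw [← List.take_append_drop p (l.take q)]
    rw [List.take_take, min_eq_left hpq.le, List.drop_eq_getElem_cons (by simp; omega)]
    simp

theorem take_cons_drop {X : Type*} (l : List X) {p : ℕ} (hp : p < l.length) :
    l.take p ++ l[p] :: l.drop (p + 1) = l := by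
  rw [← List.drop_eq_getElem_cons hp, List.take_append_drop]

/-! ### Words for all blocks -/

theorem mem_concatWords_iff {Bs : List (Block I)} {w : List (Option I)} :
    w ∈ concatWords Bs ↔ ∃ ws, IsWords Bs ws ∧ w = cat ws Bs.length := by
  induction Bs using List.reverseRecOn generalizing w with
  | nil =>
    simp only [concatWords, Finset.mem_singleton]
    exact ⟨fun h => ⟨fun _ => [], ⟨fun p hp => absurd hp (by simp), fun _ _ => rfl⟩, h⟩,
      fun ⟨ws, _, h⟩ => h⟩
  | append_singleton Bs b ih =>
    rw [mem_concatWords_append]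
    constructor
    · rintro ⟨u, hu, v, hv, rfl⟩
      obtain ⟨ws, hws, rfl⟩ := ih.1 hu
      obtain ⟨v, hvb, t, ht, rfl⟩ := mem_concatWords_cons.1 hv
      obtain rfl : t = [] := by simpa [concatWords] using ht
      refine ⟨Function.update ws Bs.length v, ⟨fun p hp => ?_, fun p hp => ?_⟩, ?_⟩
      · rw [List.length_append, List.length_singleton] at hp
        rcases Nat.lt_succ_iff_lt_or_eq.1 hp with hp | rfl
        · rw [Function.update_of_ne hp.ne, List.getElem_append_left hp, hws.coe]
        · rw [Function.update_self]; simpa using hvb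
      · rw [List.length_append, List.length_singleton] at hp
        rw [Function.update_of_ne (by omega), hws.nil p (by omega)]
      · rw [List.length_append, List.length_singleton, cat_succ, Function.update_self,
          cat_update_of_le _ le_rfl, List.append_nil]
    · rintro ⟨ws, hws, rfl⟩
      refine ⟨cat ws Bs.length, ih.2 ⟨fun p => if p < Bs.length then ws p else [],
        ⟨fun p hp => ?_, fun p hp => if_neg (by omega)⟩, cat_congr fun p hp => (if_pos hp).symm⟩,
        ws Bs.length, ?_, ?_⟩
      · rw [if_pos hp, hws.coe p (by simp; omega), List.getElem_append_left hp]
      · rw [mem_concatWords_cons]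
        refine ⟨ws Bs.length, ?_, [], by simp [concatWords], by simp⟩
        rw [hws.coe Bs.length (by simp)]; simp
      · rw [List.length_append, List.length_singleton, cat_succ]

theorem IsWords.split {Bs : List (Block I)} {ws : ℕ → List (Option I)} (h : IsWords Bs ws) {p : ℕ}
    (hp : p < Bs.length) : cat ws p ∈ concatWords (Bs.take p) ∧
      cat (fun q => ws (p + 1 + q)) (Bs.length - (p + 1)) ∈ concatWords (Bs.drop (p + 1)) := by
  constructor
  · rw [mem_concatWords_iff]
    have hl : (Bs.take p).length = p := by simp; omega
    refine ⟨fun q => if q < p then ws q else [], ⟨fun q hq => ?_, fun q hq => if_neg (by omega)⟩, ?_⟩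
    · rw [hl] at hq
      rw [if_pos hq, h.coe q (by omega), List.getElem_take]
    · rw [hl]; exact cat_congr fun q hq => (if_pos hq).symm
  · rw [mem_concatWords_iff]
    refine ⟨fun q => ws (p + 1 + q), ⟨fun q hq => ?_, fun q hq => h.nil _ ?_⟩, ?_⟩
    · rw [List.length_drop] at hq
      rw [h.coe _ (by omega), List.getElem_drop]
    · rw [List.length_drop] at hq; omega
    · rw [List.length_drop]

theorem IsWords.cat_mem {Bs : List (Block I)} {ws : ℕ → List (Option I)} (h : IsWords Bs ws) :
    cat ws Bs.length ∈ concatWords Bs := mem_concatWords_iff.2 ⟨ws, h, rfl⟩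

theorem IsWords.update {Bs : List (Block I)} {ws : ℕ → List (Option I)} (h : IsWords Bs ws) {p : ℕ}
    (hp : p < Bs.length) {w : List (Option I)} (hw : (w : Multiset (Option I)) = Bs[p].strands) :
    IsWords Bs (Function.update ws p w) := by
  constructor
  · intro q hq
    by_cases h' : q = p
    · subst h'; rw [Function.update_self, hw]
    · rw [Function.update_of_ne h', h.coe q hq]
  · intro q hq
    rw [Function.update_of_ne (by omega), h.nil q hq]

theorem cat_ext {X : Type*} {ws ws' : ℕ → List X} {n : ℕ} (hl : lengths ws = lengths ws')
    (he : cat ws n = cat ws' n) {p : ℕ} (hp : p < n) : ws p = ws' p := by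
  rw [cat_split ws hp, cat_split ws' hp] at he
  have e : (cat ws p).length = (cat ws' p).length := by rw [length_cat, length_cat, hl]
  exact (List.append_inj (List.append_inj he e).2 (congrFun hl p)).1

theorem cat_inj {Bs : List (Block I)} {ws ws' : ℕ → List (Option I)} (h : IsWords Bs ws)
    (h' : IsWords Bs ws') (he : cat ws Bs.length = cat ws' Bs.length) : ws = ws' := by
  funext p
  by_cases hp : p < Bs.length
  · exact cat_ext (h.lengths.trans h'.lengths.symm) he hp
  · rw [h.nil p (not_lt.1 hp), h'.nil p (not_lt.1 hp)]

/-- Every part of a slice that lies within one block. -/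
theorem exists_block {X : Type*} {ws : ℕ → List X} {n : ℕ} {u s v : List X} (hs : s ≠ [])
    (h : u ++ (s ++ v) = cat ws n) {p : ℕ} (h1 : off (lengths ws) p ≤ u.length)
    (h2 : u.length + s.length ≤ off (lengths ws) (p + 1)) :
    p < n ∧ ∃ u' v', ws p = u' ++ (s ++ v') ∧ u = cat ws p ++ u' ∧
      v = v' ++ cat (fun q => ws (p + 1 + q)) (n - (p + 1)) := by
  have hs := List.length_pos_of_ne_nil hs
  have hp : p < n := by
    by_contra! hp
    have := off_mono (lengths ws) hp
    have := congrArg List.length h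
    rw [length_cat, List.length_append, List.length_append] at this
    omega
  refine ⟨hp, ?_⟩
  rw [cat_split ws hp] at h
  have hu : u = cat ws p ++ u.drop (off (lengths ws) p) := by
    have := congrArg (List.take (off (lengths ws) p)) h
    rw [List.take_append_of_le_length h1, ← length_cat, List.take_left] at this
    rw [← length_cat]
    conv_lhs => rw [← List.take_append_drop (cat ws p).length u, this]
  obtain ⟨u', rfl⟩ : ∃ u', u = cat ws p ++ u' := ⟨_, hu⟩
  rw [List.append_assoc, List.append_cancel_left_eq] at h
  rw [List.length_append, length_cat, off_succ] at h2
  have hle : (u' ++ s).length ≤ (ws p).length := by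
    rw [List.length_append]; change _ ≤ lengths ws p; omega
  rw [← List.append_assoc] at h
  have hw := congrArg (List.take (u' ++ s).length) h
  rw [List.take_left, List.take_append_of_le_length hle] at hw
  refine ⟨u', (ws p).drop (u' ++ s).length, ?_, rfl, ?_⟩
  · rw [← List.append_assoc]
    conv_rhs => enter [1]; rw [hw]
    rw [List.take_append_drop]
  · have := congrArg (List.drop (u' ++ s).length) h
    rwa [List.drop_left, List.drop_append_of_le_length hle] at this

theorem exists_off {lens : ℕ → ℕ} {n k : ℕ} (h : k < off lens n) :
    ∃ p, off lens p ≤ k ∧ k < off lens (p + 1) := by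
  induction n with
  | zero => simp [off] at h
  | succ n ih =>
    by_cases h' : k < off lens n
    · exact ih h'
    · exact ⟨n, not_lt.1 h', h⟩

end

/-! ### Horizontal composition as a non-unital homomorphism from `R_γ` -/

section

variable {I : Type u} {𝕜 : Type v} [CommRing 𝕜] [DecidableEq I]
variable {Q : I → I → MvPolynomial (Fin 2) 𝕜} {Λ : I → ℕ}
variable {γ : SlopeDatum I} {α : Multiset I}

theorem blocks_pos (γ : SlopeDatum I) : 0 < γ.blocks.length := by
  rw [length_blocks]; omega

/-- The strands of the blocks of `γ` are the strands of `R₀(Λ, α)`. -/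
def Fits (γ : SlopeDatum I) (α : Multiset I) : Prop := (γ.blocks.map Block.strands).sum = withRed α

theorem SlopeDatum.IsFor.fits {χ : I → ℝ} (h : γ.IsFor χ α) : Fits γ α := by
  have hs : ∀ l : List (Multiset I), ((l.map Block.plain).map Block.strands).sum = black l.sum := by
    intro l
    induction l with
    | nil => rfl
    | cons b l ih =>
      rw [List.map_cons, List.map_cons, List.sum_cons, ih, List.sum_cons]
      exact (Multiset.map_add some b l.sum).symm
  rw [Fits, SlopeDatum.blocks, List.map_append, List.map_cons, List.sum_append, List.sum_cons, hs,
    hs, ← h.sum_eq, withRed, Multiset.map_add, Multiset.map_add]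
  change _ + ((none ::ₘ γ.mid.map some) + _) = _
  rw [Multiset.cons_add, Multiset.add_cons, add_assoc]

theorem Fits.coe (h : Fits γ α) {w : List (Option I)} (hw : w ∈ concatWords γ.blocks) :
    (w : Multiset (Option I)) = withRed α := (coe_of_mem_concatWords hw).trans h

theorem blocks_split (p : Fin γ.blocks.length) :
    γ.blocks.take p ++ γ.blocks.get p :: γ.blocks.drop (p + 1) = γ.blocks :=
  take_cons_drop _ p.2

theorem total_mul_concatTotal (h : Fits γ α) :
    total Q Λ (withRed α) * concatTotal Q Λ γ.blocks = concatTotal Q Λ γ.blocks := by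
  rw [concatTotal, Finset.mul_sum]
  exact Finset.sum_congr rfl fun w hw => total_mul_dId (h.coe hw)

theorem concatTotal_mul_total (h : Fits γ α) :
    concatTotal Q Λ γ.blocks * total Q Λ (withRed α) = concatTotal Q Λ γ.blocks := by
  rw [concatTotal, Finset.sum_mul]
  exact Finset.sum_congr rfl fun w hw => dId_mul_total (h.coe hw)

section Slot

variable (h : Fits γ α) (p : Fin γ.blocks.length)

include h

theorem val_slot (x : BlockAlg Q Λ (γ.blocks.get p)) :
    (slot Q Λ γ α p x).val = spread Q Λ (γ.blocks.take p) (γ.blocks.drop (p + 1)) x.val := by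
  rw [slot, LinearMap.sum_apply, StrandAlg.val_sum, spread]
  refine Finset.sum_congr rfl fun u hu => ?_
  rw [LinearMap.sum_apply, StrandAlg.val_sum]
  refine Finset.sum_congr rfl fun v hv => ?_
  change (proj Q Λ (withRed α) (pad Q Λ u v x.val)).val = pad Q Λ u v x.val
  refine StrandAlg.val_proj_of ?_ ?_
  · rw [← concatTotal_mul_pad (b := γ.blocks.get p) x.total_mul_val hu hv, ← mul_assoc, blocks_split,
      total_mul_concatTotal h]
  · rw [← pad_mul_concatTotal (b := γ.blocks.get p) x.val_mul_total hu hv, mul_assoc, blocks_split,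
      concatTotal_mul_total h]

theorem slot_mul (x y : BlockAlg Q Λ (γ.blocks.get p)) :
    slot Q Λ γ α p (x * y) = slot Q Λ γ α p x * slot Q Λ γ α p y := by
  refine StrandAlg.val_injective ?_
  rw [StrandAlg.val_mul, val_slot h, val_slot h, val_slot h, StrandAlg.val_mul,
    spread_mul x.val_mul_total y.total_mul_val]

theorem slot_comm_of_lt {p q : Fin γ.blocks.length} (hpq : p < q)
    (x : BlockAlg Q Λ (γ.blocks.get p)) (y : BlockAlg Q Λ (γ.blocks.get q)) :
    Commute (slot Q Λ γ α p x) (slot Q Λ γ α q y) := by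
  refine StrandAlg.val_injective ?_
  rw [StrandAlg.val_mul, StrandAlg.val_mul, val_slot h, val_slot h]
  obtain ⟨m, h1, h2⟩ := exists_split γ.blocks (p := p) (q := q) hpq q.2
  rw [h1, h2]
  exact spread_comm x.val_mem_span y.val_mem_span

theorem slot_comm {p q : Fin γ.blocks.length} (hpq : p ≠ q)
    (x : BlockAlg Q Λ (γ.blocks.get p)) (y : BlockAlg Q Λ (γ.blocks.get q)) :
    Commute (slot Q Λ γ α p x) (slot Q Λ γ α q y) := by
  rcases lt_or_gt_of_ne hpq with h' | h'
  · exact slot_comm_of_lt h h' x y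
  · exact (slot_comm_of_lt h h' y x).symm

theorem val_slot_one : (slot Q Λ γ α p 1).val = concatTotal Q Λ γ.blocks := by
  rw [val_slot h, StrandAlg.val_one, spread_total, blocks_split]

end Slot

variable (Q Λ γ) in
/-- Pure tensors in `R_γ`. -/
def rTprod : MultilinearMap 𝕜 (fun p : Fin γ.blocks.length => BlockAlg Q Λ (γ.blocks.get p))
    (RGamma Q Λ γ) := PiTensorProduct.tprod 𝕜

theorem rTprod_mul (x y : ∀ p : Fin γ.blocks.length, BlockAlg Q Λ (γ.blocks.get p)) :
    rTprod Q Λ γ (x * y) = rTprod Q Λ γ x * rTprod Q Λ γ y :=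
  (PiTensorProduct.tprod_mul_tprod x y).symm

theorem rTprod_one : rTprod Q Λ γ 1 = 1 := rfl

theorem span_rTprod : Submodule.span 𝕜 (Set.range (rTprod Q Λ γ)) = ⊤ :=
  PiTensorProduct.span_tprod_eq_top

theorem RGamma.induction {motive : RGamma Q Λ γ → Prop} (r : RGamma Q Λ γ)
    (tprod : ∀ x, motive (rTprod Q Λ γ x)) (zero : motive 0)
    (add : ∀ r s, motive r → motive s → motive (r + s))
    (smul : ∀ (c : 𝕜) r, motive r → motive (c • r)) : motive r := by
  have hr : r ∈ Submodule.span 𝕜 (Set.range (rTprod Q Λ γ)) := by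
    rw [span_rTprod]; exact Submodule.mem_top
  induction hr using Submodule.span_induction with
  | mem x hx => obtain ⟨y, rfl⟩ := hx; exact tprod y
  | zero => exact zero
  | add r s _ _ hr hs => exact add r s hr hs
  | smul c r _ hr => exact smul c r hr

theorem hcomp_rTprod (x : ∀ p : Fin γ.blocks.length, BlockAlg Q Λ (γ.blocks.get p)) :
    hcomp Q Λ γ α (rTprod Q Λ γ x) = (List.ofFn fun p => slot Q Λ γ α p (x p)).prod := by
  rw [hcomp, rTprod]
  erw [PiTensorProduct.lift.tprod]
  rw [MultilinearMap.compLinearMap_apply, MultilinearMap.mkPiAlgebraFin_apply]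

theorem hcomp_mul (h : Fits γ α) (r s : RGamma Q Λ γ) :
    hcomp Q Λ γ α (r * s) = hcomp Q Λ γ α r * hcomp Q Λ γ α s := by
  induction r using RGamma.induction with
  | zero => rw [zero_mul, map_zero, zero_mul]
  | add r r' hr hr' => rw [add_mul, map_add, map_add, add_mul, hr, hr']
  | smul c r hr => rw [smul_mul_assoc, map_smul, map_smul, smul_mul_assoc, hr]
  | tprod x =>
    induction s using RGamma.induction with
    | zero => rw [mul_zero, map_zero, mul_zero]
    | add r r' hr hr' => rw [mul_add, map_add, map_add, mul_add, hr, hr']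
    | smul c r hr => rw [mul_smul_comm, map_smul, map_smul, mul_smul_comm, hr]
    | tprod y =>
      rw [← rTprod_mul, hcomp_rTprod, hcomp_rTprod, hcomp_rTprod,
        prod_ofFn_mul _ _ fun p q hpq => slot_comm h hpq _ _]
      congr 1
      exact congrArg _ (funext fun p => slot_mul h p _ _)

/-- The unit of each block gives the same idempotent, so the product over the blocks is a power of
it. The exponent is positive because there is always the central block. -/
theorem val_hcomp_one (h : Fits γ α) : (hcomp Q Λ γ α 1).val = concatTotal Q Λ γ.blocks := by
  have e : (fun p => slot Q Λ γ α p 1) = fun _ => slot Q Λ γ α ⟨0, blocks_pos γ⟩ 1 := by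
    funext p
    refine StrandAlg.val_injective ?_
    rw [val_slot_one h, val_slot_one h]
  rw [← rTprod_one, hcomp_rTprod]
  simp only [Pi.one_apply]
  rw [e, prod_ofFn_const _ (blocks_pos γ), val_slot_one h]
  rw [← slot_mul h, one_mul]

/-- The element of `R_γ` with `x` in the block `p`. -/
def single (p : Fin γ.blocks.length) (x : BlockAlg Q Λ (γ.blocks.get p)) : RGamma Q Λ γ :=
  rTprod Q Λ γ (Function.update (fun q => (1 : BlockAlg Q Λ (γ.blocks.get q))) p x)

theorem hcomp_single (h : Fits γ α) (p : Fin γ.blocks.length)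
    (x : BlockAlg Q Λ (γ.blocks.get p)) : hcomp Q Λ γ α (single p x) = slot Q Λ γ α p x := by
  rw [single, hcomp_rTprod]
  have e : (fun q => slot Q Λ γ α q (Function.update (fun q => (1 : BlockAlg Q Λ (γ.blocks.get q))) p x q)) =
      Function.update (fun _ => slot Q Λ γ α p 1) p (slot Q Λ γ α p x) := by
    funext q
    by_cases hq : q = p
    · subst hq; rw [Function.update_self, Function.update_self]
    · rw [Function.update_of_ne hq, Function.update_of_ne hq]
      refine StrandAlg.val_injective ?_
      rw [val_slot_one h, val_slot_one h]
  rw [e, prod_ofFn_update]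
  · rw [← slot_mul h, one_mul]
  · rw [← slot_mul h, one_mul]
  · rw [← slot_mul h, mul_one]

/-- The idempotent of `R_γ` for a family of words. -/
def idemR (Q : I → I → MvPolynomial (Fin 2) 𝕜) (Λ : I → ℕ) (γ : SlopeDatum I)
    (ws : ℕ → List (Option I)) : RGamma Q Λ γ :=
  rTprod Q Λ γ fun p => idem Q Λ _ (ws p)

theorem slot_mul_cat (h : Fits γ α) {ws : ℕ → List (Option I)} (hw : IsWords γ.blocks ws)
    (p : Fin γ.blocks.length) (x : BlockAlg Q Λ (γ.blocks.get p)) {y : Diagrams Q Λ}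
    (hy : dId Q Λ (cat ws γ.blocks.length) * y = y) :
    (slot Q Λ γ α p x).val * y =
      pad Q Λ (cat ws p) (cat (fun q => ws (p + 1 + q)) (γ.blocks.length - (p + 1)))
        (x.val * dId Q Λ (ws p)) * y := by
  rw [val_slot h, spread_mul_eq x.val_mul_total (hw.split p.2).1 (hw.coe p p.2) (hw.split p.2).2]
  rw [← cat_split ws p.2, hy]

open Classical in
theorem val_hcomp_idemR (h : Fits γ α) {ws : ℕ → List (Option I)} (hw : IsWords γ.blocks ws) :
    (hcomp Q Λ γ α (idemR Q Λ γ ws)).val = dId Q Λ (cat ws γ.blocks.length) := by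
  refine eq_of_mul_dId (l := γ.blocks) ?_ (dId_mul_concatTotal hw.cat_mem) ?_
  · rw [← val_hcomp_one h, ← StrandAlg.val_mul, ← hcomp_mul h, mul_one]
  · intro w' hw'
    obtain ⟨ws', hws', rfl⟩ := mem_concatWords_iff.1 hw'
    have hv := StrandAlg.val_idem (Q := Q) (Λ := Λ) (h.coe hw')
    rw [← hv, ← StrandAlg.val_mul, idemR, hcomp_rTprod]
    rw [prod_ofFn_mul_eq_ite _ (fun p => ws p = ws' p)]
    · by_cases he : ws = ws'
      · subst he
        rw [if_pos fun _ => rfl, hv, dId_mul_self]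
      · rw [if_neg, hv, dId_mul_ne, StrandAlg.val_zero]
        · exact fun h' => he (cat_inj hw hws' h')
        · intro h'
          refine he (funext fun p => ?_)
          by_cases hp : p < γ.blocks.length
          · exact h' ⟨p, hp⟩
          · rw [hw.nil p (not_lt.1 hp), hws'.nil p (not_lt.1 hp)]
    · intro p
      refine StrandAlg.val_injective ?_
      rw [StrandAlg.val_mul, slot_mul_cat h hws' p _ (by rw [hv, dId_mul_self]),
        StrandAlg.val_idem (S := (γ.blocks.get p).strands) (hw.coe p p.2)]
      split_ifs with he
      · rw [he, dId_mul_self, pad_dId, ← cat_split ws' p.2, hv, dId_mul_self]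
      · rw [dId_mul_ne Q Λ he, map_zero, zero_mul, StrandAlg.val_zero]

/-- A diagram without crossings of strands from different blocks is a horizontal composition. -/
theorem exists_hcomp_of_mon (h : Fits γ α) {ws : ℕ → List (Option I)} (hw : IsWords γ.blocks ws)
    {l : ℕ} {w' : List (Option I)} {x : Diagrams Q Λ}
    (hx : Mon Q Λ (SameBlock (blockLens γ.blocks)) (cat ws γ.blocks.length) l w' x) :
    ∃ ws', IsWords γ.blocks ws' ∧ w' = cat ws' γ.blocks.length ∧
      ∃ r : RGamma Q Λ γ, (hcomp Q Λ γ α r).val = x := by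
  -- A piece whose strands lie in the block `p` acts on the given slice as the diagram of `R_γ` with
  -- this piece in the block `p` and `1` elsewhere. The top remains a concatenation, with the word
  -- for the block `p` changed.
  have step : ∀ (u : List (Option I)) (g : Piece I) (v : List (Option I)) {x : Diagrams Q Λ}
      (p : ℕ), off (blockLens γ.blocks) p ≤ u.length →
      u.length + g.src.length ≤ off (blockLens γ.blocks) (p + 1) → g.src ≠ [] →
      dId Q Λ (u ++ (g.src ++ v)) * x = x →
      (∃ ws', IsWords γ.blocks ws' ∧ u ++ (g.src ++ v) = cat ws' γ.blocks.length ∧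
        ∃ r : RGamma Q Λ γ, (hcomp Q Λ γ α r).val = x) →
      ∃ ws', IsWords γ.blocks ws' ∧ u ++ (g.tgt ++ v) = cat ws' γ.blocks.length ∧
        ∃ r : RGamma Q Λ γ, (hcomp Q Λ γ α r).val = dPut Q Λ u g v * x := by
    rintro u g v x p h1 h2 hs hx ⟨ws', hws', hc, r, hr⟩
    rw [← hws'.lengths] at h1 h2
    obtain ⟨hp, u', v', e, rfl, rfl⟩ := exists_block hs hc h1 h2
    have hperm : (u' ++ (g.tgt ++ v')).Perm (ws' p) := by
      rw [e]
      refine List.Perm.append_left _ (List.Perm.append_right _ ?_)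
      cases g with
      | dot i => rfl
      | cross a b => exact List.Perm.swap _ _ _
    have hco : ((u' ++ (g.tgt ++ v') : List (Option I)) : Multiset (Option I)) =
        γ.blocks[p].strands := by
      rw [← hws'.coe p hp]; exact Multiset.coe_eq_coe.2 hperm
    have hci : ((u' ++ (g.src ++ v') : List (Option I)) : Multiset (Option I)) =
        γ.blocks[p].strands := by rw [← e, hws'.coe p hp]
    refine ⟨Function.update ws' p (u' ++ (g.tgt ++ v')), hws'.update hp hco, ?_,
      single (⟨p, hp⟩ : Fin γ.blocks.length) (proj Q Λ _ (dPut Q Λ u' g v')) * r, ?_⟩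
    · rw [cat_update _ hp]; simp only [List.append_assoc]
    · rw [hcomp_mul h, hcomp_single h, StrandAlg.val_mul, hr,
        slot_mul_cat h hws' _ _ (by rw [← hc, hx])]
      have hv : (proj Q Λ γ.blocks[p].strands (dPut Q Λ u' g v')).val = dPut Q Λ u' g v' :=
        Dia.of_put.val_proj hci
      change pad Q Λ _ _ ((proj Q Λ γ.blocks[p].strands (dPut Q Λ u' g v')).val *
        dId Q Λ (ws' p)) * x = _
      rw [hv, e, dPut_mul_dId, pad_dPut]
  induction hx with
  | one => exact ⟨ws, hw, rfl, idemR Q Λ γ ws, val_hcomp_idemR h hw⟩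
  | @dot l u i v x hx ih =>
    obtain ⟨ws', hws', hc, -⟩ := id ih
    obtain ⟨p, h1, h2⟩ := exists_off (lens := blockLens γ.blocks) (n := γ.blocks.length)
      (k := u.length) (by
        rw [← hws'.lengths, ← length_cat, ← hc]; simp)
    exact step u (.dot i) v p h1 h2 (by simp [Piece.src]) hx.dId_mul ih
  | @cross l u a b v x hP hx ih =>
    obtain ⟨p, h1, h2⟩ := hP
    exact step u (.cross a b) v p h1 h2 (by simp [Piece.src]) hx.dId_mul ih

end

section

variable {I : Type u} {𝕜 : Type v} [CommRing 𝕜] [DecidableEq I]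
variable {Q : I → I → MvPolynomial (Fin 2) 𝕜} {Λ : I → ℕ}
variable {γ : SlopeDatum I} {α : Multiset I}

/-! ### Shuffles of single strands -/

/-- The blocks with one strand each. -/
def singles (o n : ℕ) : ℕ → List ℕ := fun q => if q < n then [o + q] else []

theorem lengths_singles (o n : ℕ) : lengths (singles o n) = ones n := by
  funext q
  rw [lengths, singles, ones]
  split_ifs <;> rfl

theorem cat_singles (o n : ℕ) : cat (singles o n) n = List.range' o n := by
  have : ∀ m ≤ n, cat (singles o n) m = List.range' o m := by
    intro m
    induction m with
    | zero => intro _; rfl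
    | succ m ih =>
      intro h
      rw [cat_succ, ih (by omega), List.range'_concat, singles, if_pos (by omega), one_mul]
  exact this n le_rfl

theorem singles_nil (o n p : ℕ) (h : n ≤ p) : singles o n p = [] := if_neg (by omega)

theorem act_canon_ones {o n : ℕ} {c : List ℕ} (hc : IsCode c (ones n)) :
    act (canon c (ones n)) (List.range' o n) = shuf c (singles o n) := by
  rw [← lengths_singles o] at hc ⊢
  rw [← cat_singles, act_canon hc (singles_nil o n)]

theorem act_canon_ones_injective {o n : ℕ} {c c' : List ℕ} (hc : IsCode c (ones n))
    (hc' : IsCode c' (ones n))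
    (h : act (canon c (ones n)) (List.range' o n) = act (canon c' (ones n)) (List.range' o n)) :
    c = c' := by
  rw [act_canon_ones hc, act_canon_ones hc'] at h
  rw [← lengths_singles o] at hc hc'
  refine (shuf_injective (fun _ => List.Perm.refl _) (fun p q hpq a ha ha' => ?_) hc hc' h).1
  rw [singles] at ha ha'
  split_ifs at ha ha' <;> simp at ha ha'
  omega

theorem ascending_canon_ones {o n : ℕ} {c : List ℕ} (hc : IsCode c (ones n)) :
    Ascending (canon c (ones n)) (List.range' o n) := by
  rw [← lengths_singles o] at hc ⊢
  rw [← cat_singles]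
  refine ascending_canon hc (singles_nil o n) fun p q hpq a ha b hb => ?_
  rw [singles] at ha hb
  split_ifs at ha hb <;> simp at ha hb
  omega

theorem count_none_black (β : Multiset I) : (black β).count none = 0 := by
  rw [Multiset.count_eq_zero]; simp

theorem count_none_withRed (β : Multiset I) : (withRed β).count none = 1 := by
  have := count_none_black β
  rw [withRed, Multiset.count_cons_self, this]

theorem count_none_strands (b : Block I) : b.strands.count none ≤ 1 := by
  cases b with
  | plain β => exact (count_none_black β).le.trans zero_le_one
  | centre β => exact (count_none_withRed β).le

theorem BlackAt.lt {w : List (Option I)} {k : ℕ} (h : BlackAt w k) : k < w.length := by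
  obtain ⟨u, i, v, rfl, rfl⟩ := h
  simp

/-! ### A spanning family of `R_γ` -/

variable (Q Λ) in
/-- A shuffle of single strands with dots below it. -/
def blockElt (S : Multiset (Option I)) (w : List (Option I)) (c : List ℕ) (M : Multiset ℕ) :
    StrandAlg Q Λ S :=
  proj Q Λ S (path Q Λ (canon c (ones w.length)) w * dots Q Λ w M.toList)

theorem val_blockElt {S : Multiset (Option I)} {w : List (Option I)}
    (hw : (w : Multiset (Option I)) = S) {c : List ℕ} (hc : IsCode c (ones w.length))
    {M : Multiset ℕ} (hM : ∀ k ∈ M, BlackAt w k) : (blockElt Q Λ S w c M).val =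
      path Q Λ (canon c (ones w.length)) w * dots Q Λ w M.toList := by
  have hl : c.length = w.length := by
    have := (length_shuf (c := c) (ws := singles 0 w.length) fun p => by
      rw [hc p, ← lengths_singles 0]).symm
    rw [this, ← act_canon_ones hc, length_act, List.length_range']
  have h1 := dots_mon (Q := Q) (Λ := Λ) (fun _ => True) (w := w) (l := M.toList)
    fun k hk => hM k (by simpa using hk)
  have h2 := path_mon' (Q := Q) (Λ := Λ) w (ks := canon c (ones w.length))
    fun k hk => hl ▸ canon_lt hc k hk
  exact Dia.val_proj ⟨_, h1.trans h2⟩ hw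

theorem blockElt_mem_span {S : Multiset (Option I)} (hS : S.count none ≤ 1) (x : StrandAlg Q Λ S) :
    x ∈ Submodule.span 𝕜 {y | ∃ (w : List (Option I)) (c : List ℕ) (M : Multiset ℕ),
      (w : Multiset (Option I)) = S ∧ IsCode c (ones w.length) ∧ (∀ k ∈ M, BlackAt w k) ∧
      y = blockElt Q Λ S w c M} := by
  have h1 : x.val ∈ Submodule.span 𝕜 {y | ∃ (w : List (Option I)) (c : List ℕ) (M : Multiset ℕ),
      (w : Multiset (Option I)) = S ∧ IsCode c (ones w.length) ∧ (∀ k ∈ M, BlackAt w k) ∧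
      y = path Q Λ (canon c (ones w.length)) w * dots Q Λ w M.toList} := by
    refine Submodule.span_le.2 ?_ x.val_mem_span
    rintro y ⟨w, w', hw, l, hl⟩
    have hc : w.count none ≤ 1 := by
      rw [← hw, Multiset.coe_count] at hS
      convert hS
    refine Submodule.span_mono ?_ (crossLT_le_span_dots hc _ (hl.mem_crossLT (Nat.lt_succ_self l)))
    rintro z ⟨c, M, hc, hM, rfl⟩
    exact ⟨w, c, M, hw, hc, hM, rfl⟩
  have h2 := Submodule.mem_map_of_mem (f := proj Q Λ S) h1
  rw [StrandAlg.proj_val, Submodule.map_span] at h2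
  refine Submodule.span_mono ?_ h2
  rintro _ ⟨_, ⟨w, c, M, hw, hc, hM, rfl⟩, rfl⟩
  exact ⟨w, c, M, hw, hc, hM, rfl⟩

/-- The entries are expanded one after another; the finite set `s` in the induction contains the
coordinates that are not expanded yet. -/
theorem multilinear_mem_span {R ι M : Type*} [CommRing R] [Fintype ι] [DecidableEq ι] {N : ι → Type*}
    [∀ i, AddCommGroup (N i)] [∀ i, Module R (N i)] [AddCommGroup M] [Module R M]
    (f : MultilinearMap R N M) (S : ∀ i, Set (N i)) (x : ∀ i, N i)
    (hx : ∀ i, x i ∈ Submodule.span R (S i)) :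
    f x ∈ Submodule.span R {y | ∃ z, (∀ i, z i ∈ S i) ∧ y = f z} := by
  have key : ∀ (s : Finset ι) (x : ∀ i, N i), (∀ i, x i ∈ Submodule.span R (S i)) →
      (∀ i ∉ s, x i ∈ S i) → f x ∈ Submodule.span R {y | ∃ z, (∀ i, z i ∈ S i) ∧ y = f z} := by
    intro s
    induction s using Finset.induction_on with
    | empty => exact fun x _ h => Submodule.subset_span ⟨x, fun i => h i (by simp), rfl⟩
    | insert p s hp ih =>
      intro x hx h
      have : ∀ y ∈ Submodule.span R (S p), f (Function.update x p y) ∈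
          Submodule.span R {y | ∃ z, (∀ i, z i ∈ S i) ∧ y = f z} := by
        intro y hy
        induction hy using Submodule.span_induction with
        | mem y hy =>
          refine ih _ (fun i => ?_) fun i hi => ?_
          · by_cases hip : i = p
            · subst hip; rw [Function.update_self]; exact Submodule.subset_span hy
            · rw [Function.update_of_ne hip]; exact hx i
          · by_cases hip : i = p
            · subst hip; rwa [Function.update_self]
            · rw [Function.update_of_ne hip]; exact h i (by simp [hip, hi])
        | zero => rw [f.map_update_zero]; exact Submodule.zero_mem _
        | add y z _ _ hy hz => rw [f.map_update_add]; exact Submodule.add_mem _ hy hz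
        | smul c y _ hy => rw [f.map_update_smul]; exact Submodule.smul_mem _ c hy
      simpa using this (x p) (hx p)
  exact key Finset.univ x hx fun i hi => absurd (Finset.mem_univ i) hi

/-- The index set of a basis of `R₀(Λ, α) 1_γ`. -/
@[ext]
structure Idx (γ : SlopeDatum I) where
  c : List ℕ
  ws : ℕ → List (Option I)
  cs : ℕ → List ℕ
  Ms : ℕ → Multiset ℕ
  isWords : IsWords γ.blocks ws
  code : IsCode c (blockLens γ.blocks)
  codes : ∀ p, IsCode (cs p) (ones (ws p).length)
  blackAt : ∀ p, ∀ k ∈ Ms p, BlackAt (ws p) k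

variable (Q Λ) in
/-- The part of a basis element in `R_γ`. -/
def Idx.elt (i : Idx γ) : RGamma Q Λ γ :=
  rTprod Q Λ γ fun p => blockElt Q Λ _ (i.ws p) (i.cs p) (i.Ms p)

theorem mem_span_elt {c : List ℕ} (hc : IsCode c (blockLens γ.blocks)) (r : RGamma Q Λ γ) :
    r ∈ Submodule.span 𝕜 {y | ∃ i : Idx γ, i.c = c ∧ y = i.elt Q Λ} := by
  induction r using RGamma.induction with
  | zero => exact Submodule.zero_mem _
  | add r s hr hs => exact Submodule.add_mem _ hr hs
  | smul a r hr => exact Submodule.smul_mem _ a hr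
  | tprod x =>
    refine Submodule.span_mono ?_ (multilinear_mem_span (rTprod Q Λ γ) _ x fun p =>
      blockElt_mem_span (count_none_strands _) (x p))
    rintro _ ⟨z, hz, rfl⟩
    choose ws cs Ms h1 h2 h3 h4 using hz
    -- The data of `Idx` are indexed by all natural numbers, so the families over the blocks are
    -- extended by trivial values. There are two versions because words and codes live in different
    -- universes.
    let ext : ∀ {X : Type u}, X → (Fin γ.blocks.length → X) → ℕ → X := fun d f p =>
      if h : p < γ.blocks.length then f ⟨p, h⟩ else d
    let ext₀ : ∀ {X : Type}, X → (Fin γ.blocks.length → X) → ℕ → X := fun d f p =>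
      if h : p < γ.blocks.length then f ⟨p, h⟩ else d
    have hext : ∀ {X : Type u} (d : X) (f : Fin γ.blocks.length → X) (p : Fin γ.blocks.length),
        ext d f p = f p := fun d f p => dif_pos p.2
    have hext₀ : ∀ {X : Type} (d : X) (f : Fin γ.blocks.length → X) (p : Fin γ.blocks.length),
        ext₀ d f p = f p := fun d f p => dif_pos p.2
    refine ⟨⟨c, ext [] ws, ext₀ [] cs, ext₀ 0 Ms, ⟨fun p hp => ?_, fun p hp => ?_⟩, hc, fun p => ?_,
      fun p => ?_⟩, rfl, ?_⟩
    · rw [hext [] ws ⟨p, hp⟩]; exact h1 ⟨p, hp⟩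
    · exact dif_neg (not_lt.2 hp)
    · by_cases hp : p < γ.blocks.length
      · rw [hext [] ws ⟨p, hp⟩, hext₀ [] cs ⟨p, hp⟩]; exact h2 ⟨p, hp⟩
      · simp only [ext, ext₀, dif_neg hp]
        exact fun q => by simp [ones]
    · by_cases hp : p < γ.blocks.length
      · rw [hext [] ws ⟨p, hp⟩, hext₀ 0 Ms ⟨p, hp⟩]; exact h3 ⟨p, hp⟩
      · simp [ext₀, dif_neg hp]
    · rw [Idx.elt]
      congr 1
      funext p
      rw [h4 p]
      simp only [hext, hext₀]

/-! ### Leading terms -/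

section Lead

variable {L : Type*} [CommRing L] [Algebra 𝕜 L]
variable {lab : ℕ → Option I} {x : ℕ → L} {a b : ℕ → ℕ → L}

/-- The dots multiply the leading coefficient by the variables of the strands that carry them, and
then the shuffle of single strands permutes the block `p`. Its swaps are ascending because the
strands of this block are still in their original increasing order, by `ho`. -/
theorem LeadAt.map_slot (h : Fits γ α) (hc : IsCoeff Q Λ lab x a b)
    (ha : ∀ s s', s < s' → a s s' = 1) {z : Arr L} {f : L} {ts : ℕ → List ℕ}
    (hz : LeadAt lab z f (cat ts γ.blocks.length))
    (hw : IsWords γ.blocks fun p => (ts p).map lab) (p : Fin γ.blocks.length) {o : ℕ}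
    (ho : ts p = List.range' o (ts p).length) {c : List ℕ} (hcode : IsCode c (ones (ts p).length))
    {M : Multiset ℕ} (hM : ∀ k ∈ M, BlackAt ((ts p).map lab) k) :
    LeadAt lab (diagOp Q Λ hc (slot Q Λ γ α p (blockElt Q Λ _ ((ts p).map lab) c M)).val z)
      ((M.toList.map fun k => x ((ts p).getD k 0)).prod * f)
      (cat (Function.update ts p (act (canon c (ones (ts p).length)) (ts p))) γ.blocks.length) := by
  have e := cat_split ts p.2
  have e' : (cat ts γ.blocks.length).map lab = cat (fun p => (ts p).map lab) γ.blocks.length :=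
    (cat_map lab ts _).symm
  have hz' := hz
  rw [e] at hz'
  have hv : (blockElt Q Λ (γ.blocks.get p).strands ((ts p).map lab) c M).val = _ :=
    val_blockElt (hw.coe p p.2) (by rwa [List.length_map]) hM
  rw [List.length_map] at hv
  have hd : dots Q Λ ((ts p).map lab) M.toList * dId Q Λ ((ts p).map lab) =
      dots Q Λ ((ts p).map lab) M.toList :=
    (dots_mon (Q := Q) (Λ := Λ) (fun _ => True) fun k hk => hM k (by simpa using hk)).mul_dId
  have h1 := slot_mul_cat (Q := Q) (Λ := Λ) h hw p
    (blockElt Q Λ (γ.blocks.get p).strands ((ts p).map lab) c M) (dId_mul_self Q Λ _)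
  rw [hv, mul_assoc, hd] at h1
  have h2 := hz.diagOp_mul_dId hc e' (slot Q Λ γ α p (blockElt Q Λ _ ((ts p).map lab) c M)).val
  rw [← h2, h1, hz.diagOp_mul_dId hc e', map_mul, map_mul, Module.End.mul_apply, cat_update _ p.2]
  refine LeadAt.pad_path hc ha (LeadAt.pad_dots hc hz' ?_ rfl ?_ fun k hk => hM k (by simpa using hk))
    ?_ rfl ?_ ?_
  · exact (cat_map lab ts _).symm
  · exact (cat_map lab (fun q => ts (p + 1 + q)) _).symm
  · exact (cat_map lab ts _).symm
  · exact (cat_map lab (fun q => ts (p + 1 + q)) _).symm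
  · conv => enter [2]; rw [ho]
    exact ascending_canon_ones hcode

end Lead

end

section

variable {I : Type u} {𝕜 : Type v} [CommRing 𝕜] [DecidableEq I]
variable {Q : I → I → MvPolynomial (Fin 2) 𝕜} {Λ : I → ℕ}
variable {γ : SlopeDatum I} {α : Multiset I}

/-! ### Shuffles of blocks -/

theorem length_code {Bs : List (Block I)} {ws : ℕ → List (Option I)} (hw : IsWords Bs ws)
    {c : List ℕ} (hc : IsCode c (blockLens Bs)) : c.length = (cat ws Bs.length).length := by
  rw [← hw.lengths] at hc
  rw [← length_shuf (c := c) (ws := ws) fun p => (hc p).le, ← act_canon hc hw.nil, length_act]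

theorem path_dia {ws : ℕ → List (Option I)} (hw : IsWords γ.blocks ws)
    {c : List ℕ} (hc : IsCode c (blockLens γ.blocks)) :
    Dia Q Λ (cat ws γ.blocks.length) (shuf c ws)
      (path Q Λ (canon c (blockLens γ.blocks)) (cat ws γ.blocks.length)) := by
  refine ⟨(canon c (blockLens γ.blocks)).length, ?_⟩
  rw [← act_canon (hw.lengths ▸ hc) hw.nil, hw.lengths]
  exact path_mon' _ fun k hk => length_code hw hc ▸ canon_lt hc k hk

variable (Q Λ γ α) in
/-- The sum of the shuffles with code `c` over all words for the blocks. -/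
def shuffle (c : List ℕ) : KLRWAlg Q Λ α :=
  proj Q Λ (withRed α) (∑ z ∈ concatWords γ.blocks, path Q Λ (canon c (blockLens γ.blocks)) z)

theorem val_shuffle (h : Fits γ α) {c : List ℕ} (hc : IsCode c (blockLens γ.blocks)) :
    (shuffle Q Λ γ α c).val =
      ∑ z ∈ concatWords γ.blocks, path Q Λ (canon c (blockLens γ.blocks)) z := by
  refine StrandAlg.val_proj_of ?_ ?_
  · rw [Finset.mul_sum]
    refine Finset.sum_congr rfl fun z hz => ?_
    obtain ⟨ws, hws, rfl⟩ := mem_concatWords_iff.1 hz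
    exact (path_dia hws hc).total_mul (h.coe hz)
  · rw [Finset.sum_mul]
    refine Finset.sum_congr rfl fun z hz => ?_
    obtain ⟨ws, hws, rfl⟩ := mem_concatWords_iff.1 hz
    exact (path_dia hws hc).mul_total (h.coe hz)

theorem shuffle_mul_dId (h : Fits γ α) {c : List ℕ} (hc : IsCode c (blockLens γ.blocks))
    {ws : ℕ → List (Option I)} (hw : IsWords γ.blocks ws) :
    (shuffle Q Λ γ α c).val * dId Q Λ (cat ws γ.blocks.length) =
      path Q Λ (canon c (blockLens γ.blocks)) (cat ws γ.blocks.length) := by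
  rw [val_shuffle h hc, Finset.sum_mul, Finset.sum_eq_single (cat ws γ.blocks.length)]
  · exact (path_dia hw hc).mul_dId
  · intro z hz hne
    obtain ⟨ws', hws', rfl⟩ := mem_concatWords_iff.1 hz
    rw [← (path_dia hws' hc).mul_dId, mul_assoc, dId_mul_ne Q Λ hne, mul_zero]
  · exact fun h' => absurd hw.cat_mem h'

theorem shuffle_of_sorted (h : Fits γ α) {c : List ℕ} (hc : IsCode c (blockLens γ.blocks))
    (hs : c.Pairwise (· ≤ ·)) : shuffle Q Λ γ α c = hcomp Q Λ γ α 1 := by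
  refine StrandAlg.val_injective ?_
  rw [val_shuffle h hc, canon_of_sorted hc hs, val_hcomp_one h, concatTotal]
  rfl

variable (γ) in
/-- The code of the trivial shuffle. -/
def trivialCode : List ℕ := cat (fun p => List.replicate (blockLens γ.blocks p) p) γ.blocks.length

theorem isCode_trivialCode : IsCode (trivialCode γ) (blockLens γ.blocks) := by
  intro p
  have key : ∀ n, (cat (fun p => List.replicate (blockLens γ.blocks p) p) n).count p =
      if p < n then blockLens γ.blocks p else 0 := by
    intro n
    induction n with
    | zero => simp [cat_zero]
    | succ n ih =>
      rw [cat_succ, List.count_append, ih, List.count_replicate]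
      rcases lt_trichotomy p n with h | rfl | h
      · rw [if_pos h, if_neg (by simp; omega), if_pos (by omega), add_zero]
      · simp
      · rw [if_neg (by omega), if_neg (by simp; omega), if_neg (by omega)]
  rw [trivialCode, key]
  split_ifs with h
  · rfl
  · rw [blockLens, dif_neg h]

theorem sorted_trivialCode : (trivialCode γ).Pairwise (· ≤ ·) := by
  have key : ∀ n, (cat (fun p => List.replicate (blockLens γ.blocks p) p) n).Pairwise (· ≤ ·) := by
    intro n
    induction n with
    | zero => exact List.Pairwise.nil
    | succ n ih =>
      rw [cat_succ, List.pairwise_append]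
      refine ⟨ih, List.pairwise_replicate.2 (Or.inr le_rfl), fun a ha b hb => ?_⟩
      obtain ⟨p, hp, ha⟩ := mem_cat.1 ha
      rw [List.eq_of_mem_replicate ha, List.eq_of_mem_replicate hb]
      exact hp.le
  exact key _

/-- Shuffles generate `R₀(Λ, α) 1_γ` over `R_γ`. -/
theorem mul_hcomp_one_mem (h : Fits γ α) (x : KLRWAlg Q Λ α) : x * hcomp Q Λ γ α 1 ∈
    Submodule.span 𝕜 {y | ∃ (c : List ℕ) (ws : ℕ → List (Option I)) (r : RGamma Q Λ γ),
      IsCode c (blockLens γ.blocks) ∧ IsWords γ.blocks ws ∧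
      y = idem Q Λ _ (shuf c ws) * (shuffle Q Λ γ α c * hcomp Q Λ γ α (idemR Q Λ γ ws * r))} := by
  have h1 : (x * hcomp Q Λ γ α 1).val ∈ Submodule.span 𝕜 {y | ∃ (c : List ℕ)
      (ws : ℕ → List (Option I)) (r : RGamma Q Λ γ),
      IsCode c (blockLens γ.blocks) ∧ IsWords γ.blocks ws ∧ y = (idem Q Λ (withRed α) (shuf c ws) *
        (shuffle Q Λ γ α c * hcomp Q Λ γ α (idemR Q Λ γ ws * r))).val} := by
    rw [StrandAlg.val_mul, val_hcomp_one h, concatTotal, Finset.mul_sum]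
    refine Submodule.sum_mem _ fun w hw => ?_
    obtain ⟨ws, hws, rfl⟩ := mem_concatWords_iff.1 hw
    have hred : (cat ws γ.blocks.length).count none ≤ 1 := by
      have := count_none_withRed α
      rw [← h.coe hw, Multiset.coe_count] at this
      convert Nat.le_of_eq this
    refine Submodule.span_le.2 ?_ (mul_dId_mem_span x.val _)
    rintro y ⟨w', l, hy⟩
    -- The lower factors provided by the spanning theorem have no crossings of different blocks, so
    -- they come from `R_γ`.
    refine Submodule.span_mono ?_ (crossLT_le_shuffleLT (isCode_trivialCode (γ := γ))
      sorted_trivialCode (length_code hws isCode_trivialCode) hred _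
      (hy.mem_crossLT (Nat.lt_succ_self l)))
    rintro z ⟨c, l', w'', g, hc, hg, -, rfl⟩
    obtain ⟨ws', hws', rfl, r, rfl⟩ := exists_hcomp_of_mon h hws hg
    refine ⟨c, ws', r, hc, hws', ?_⟩
    have hd := path_dia (Q := Q) (Λ := Λ) hws' hc
    have hS : ((shuf c ws' : List (Option I)) : Multiset (Option I)) = withRed α := by
      rw [← h.coe hws'.cat_mem]; exact Multiset.coe_eq_coe.2 hd.perm
    rw [hcomp_mul h, StrandAlg.val_mul, StrandAlg.val_mul, StrandAlg.val_mul, StrandAlg.val_idem hS,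
      val_hcomp_idemR h hws', ← mul_assoc, ← mul_assoc, mul_assoc (dId Q Λ _),
      shuffle_mul_dId h hc hws', hd.dId_mul]
  have h2 := Submodule.mem_map_of_mem (f := proj Q Λ (withRed α)) h1
  rw [StrandAlg.proj_val, Submodule.map_span] at h2
  refine Submodule.span_mono ?_ h2
  rintro _ ⟨_, ⟨c, ws, r, hc, hw, rfl⟩, rfl⟩
  exact ⟨c, ws, r, hc, hw, StrandAlg.proj_val _⟩

/-! ### Leading terms of the basis elements -/

namespace Idx

variable (γ) in
/-- The strands of the block `p`, at the bottom. -/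
def bot (p : ℕ) : List ℕ :=
  List.range' (off (blockLens γ.blocks) p) (blockLens γ.blocks p)

/-- The strands of the block `p`, above the shuffle of single strands. -/
def top (i : Idx γ) (p : ℕ) : List ℕ := act (canon (i.cs p) (ones (i.ws p).length)) (bot γ p)

theorem length_ws (i : Idx γ) (p : ℕ) : (i.ws p).length = blockLens γ.blocks p :=
  congrFun i.isWords.lengths p

theorem top_perm (i : Idx γ) (p : ℕ) : (i.top p).Perm (bot γ p) := act_perm _ _

theorem lengths_bot : lengths (bot γ) = blockLens γ.blocks := by
  funext p; rw [lengths, bot, List.length_range']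

theorem lengths_top (i : Idx γ) : lengths i.top = blockLens γ.blocks := by
  rw [← lengths_bot]; funext p; exact (i.top_perm p).length_eq

theorem cat_bot (n : ℕ) : cat (bot γ) n = List.range (off (blockLens γ.blocks) n) := by
  rw [List.range_eq_range']
  induction n with
  | zero => rfl
  | succ n ih =>
    rw [cat_succ, ih, off_succ, bot]
    have := List.range'_append (s := 0) (m := off (blockLens γ.blocks) n)
      (n := blockLens γ.blocks n) (step := 1)
    rwa [one_mul, zero_add] at this

theorem isWords_of_perm (i : Idx γ) {lab : ℕ → Option I} (hlab : ∀ p, (bot γ p).map lab = i.ws p)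
    {ts : ℕ → List ℕ} (h : ∀ p, (ts p).Perm (bot γ p)) :
    IsWords γ.blocks fun p => (ts p).map lab := by
  constructor
  · intro p hp
    rw [← i.isWords.coe p hp, ← hlab]
    exact Multiset.coe_eq_coe.2 ((h p).map lab)
  · intro p hp
    have := i.isWords.nil p hp
    rw [← hlab] at this
    exact (((h p).map lab).trans (List.Perm.of_eq this)).eq_nil

section Lead

variable {L : Type*} [CommRing L] [Algebra 𝕜 L]
variable {lab : ℕ → Option I} {x : ℕ → L} {a b : ℕ → ℕ → L}

/-- The blocks are treated one at a time. Since the list has no repetitions, a block that is about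
to be treated still has its bottom arrangement, as `LeadAt.map_slot` requires. -/
theorem lead_prod (h : Fits γ α) (hc : IsCoeff Q Λ lab x a b) (ha : ∀ s s', s < s' → a s s' = 1)
    (i : Idx γ) (hlab : ∀ p, (bot γ p).map lab = i.ws p) (l : List (Fin γ.blocks.length))
    (hl : l.Nodup) :
    LeadAt lab (diagOp Q Λ hc (l.map fun p => slot Q Λ γ α p
        (blockElt Q Λ _ (i.ws p) (i.cs p) (i.Ms p))).prod.val (arr (cat (bot γ) γ.blocks.length)))
      (l.map fun p : Fin γ.blocks.length => ((i.Ms p).toList.map fun k => x ((bot γ p).getD k 0)).prod).prod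
      (cat (fun q => if q ∈ l.map Fin.val then i.top q else bot γ q) γ.blocks.length) := by
  have hw := i.isWords_of_perm hlab (ts := bot γ) fun p => List.Perm.refl _
  have hm := h.coe hw.cat_mem
  induction l with
  | nil =>
    simp only [List.map_nil, List.prod_nil, List.not_mem_nil, if_false]
    have hp : Proper lab (cat (bot γ) γ.blocks.length) := by
      constructor
      · rw [cat_bot]; exact List.nodup_range
      · have := count_none_withRed α
        rw [← cat_map]
        rw [← hm, Multiset.coe_count] at this
        convert Nat.le_of_eq this
    have h1 := leadAt_arr (L := L) hp
    have h2 := h1.diagOp_mul_dId hc (cat_map lab (bot γ) _).symm (total Q Λ (withRed α))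
    rw [total_mul_dId hm, diagOp_dId, cat_map, h1.fixed] at h2
    rw [StrandAlg.val_one, ← h2]
    exact h1
  | cons p l ih =>
    rw [List.nodup_cons] at hl
    have ih := ih hl.2
    have hpl : (p : ℕ) ∉ l.map Fin.val := fun hp => by
      obtain ⟨q, hq, he⟩ := List.mem_map.1 hp
      exact hl.1 (Fin.ext he ▸ hq)
    rw [List.map_cons, List.map_cons, List.prod_cons, List.prod_cons, StrandAlg.val_mul, map_mul,
      Module.End.mul_apply]
    set ts : ℕ → List ℕ := fun q => if q ∈ l.map Fin.val then i.top q else bot γ q with hts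
    have htp : ts p = bot γ p := if_neg hpl
    have hperm : ∀ q, (ts q).Perm (bot γ q) := fun q => by
      simp only [hts]
      split_ifs
      · exact i.top_perm q
      · rfl
    have hlen : (ts p).length = (i.ws p).length := by
      rw [htp, bot, List.length_range', i.length_ws]
    have key := ih.map_slot h hc ha (i.isWords_of_perm hlab hperm) p
      (o := off (blockLens γ.blocks) p) (c := i.cs p) (M := i.Ms p) (by
        rw [htp, bot, List.length_range']) (hlen ▸ i.codes p) (by
        rw [htp, hlab]; exact i.blackAt p)
    rw [hlen, htp, hlab] at key
    convert key using 2
    funext q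
    by_cases hq : q = p
    · subst hq
      rw [Function.update_self, if_pos (by simp), top]
    · rw [Function.update_of_ne hq]
      have : (q ∈ (p :: l).map Fin.val) ↔ q ∈ l.map Fin.val := by
        rw [List.map_cons, List.mem_cons, or_iff_right hq]
      simp only [hts, this]

/-- The diagrams in the blocks permute strands only within blocks, so strands of earlier blocks
still have smaller numbers. Hence the swaps of the shuffle of blocks are ascending too, and they
keep the leading coefficient. -/
theorem isLead (h : Fits γ α) (hc : IsCoeff Q Λ lab x a b) (ha : ∀ s s', s < s' → a s s' = 1)
    (i : Idx γ) (hlab : ∀ p, (bot γ p).map lab = i.ws p) :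
    IsLead (diagOp Q Λ hc (shuffle Q Λ γ α i.c * hcomp Q Λ γ α (i.elt Q Λ)).val
        (arr (cat (bot γ) γ.blocks.length)))
      ((List.finRange γ.blocks.length).map fun p : Fin γ.blocks.length =>
        ((i.Ms p).toList.map fun k => x ((bot γ p).getD k 0)).prod).prod (shuf i.c i.top) := by
  have h1 := lead_prod h hc ha i hlab (List.finRange _) (List.nodup_finRange _)
  have e : cat (fun q => if q ∈ (List.finRange γ.blocks.length).map Fin.val then i.top q
      else bot γ q) γ.blocks.length = cat i.top γ.blocks.length :=
    cat_congr fun p hp => if_pos (List.mem_map.2 ⟨⟨p, hp⟩, List.mem_finRange _, rfl⟩)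
  rw [e, ← List.ofFn_eq_map] at h1
  have hw := i.isWords_of_perm hlab i.top_perm
  have hcode := i.code
  rw [StrandAlg.val_mul, map_mul, Module.End.mul_apply, elt, hcomp_rTprod,
    ← h1.diagOp_mul_dId hc (cat_map lab i.top _).symm, shuffle_mul_dId h i.code hw, cat_map]
  have h2 := h1.lead.path hc ha (ks := canon i.c (blockLens γ.blocks)) h1.fixed h1.proper
  rw [← i.lengths_top] at h2 hcode ⊢
  have hnil : ∀ p, γ.blocks.length ≤ p → i.top p = [] := fun p hp =>
    List.map_eq_nil_iff.1 (hw.nil p hp)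
  rw [act_canon hcode hnil] at h2
  refine h2 (ascending_canon hcode hnil fun p q hpq s hs s' hs' => ?_)
  rw [(i.top_perm p).mem_iff, bot, List.mem_range'_1] at hs
  rw [(i.top_perm q).mem_iff, bot, List.mem_range'_1] at hs'
  have := off_mono (blockLens γ.blocks) (Nat.succ_le_of_lt hpq)
  rw [Nat.succ_eq_add_one, off_succ] at this
  omega

end Lead

end Idx

end

/-! ### Independence of the basis elements and freeness over `R_γ` -/

section

variable {I : Type u} {𝕜 : Type v} [CommRing 𝕜] [DecidableEq I]
variable {Q : I → I → MvPolynomial (Fin 2) 𝕜} {Λ : I → ℕ}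
variable {γ : SlopeDatum I} {α : Multiset I}

namespace Idx

/-- The exponents of the dots, for the strands at the bottom. -/
def expo (i : Idx γ) : ℕ →₀ ℕ :=
  ∑ p : Fin γ.blocks.length, Multiset.toFinsupp ((i.Ms p).map fun k => (bot γ p).getD k 0)

theorem getD_bot {p k : ℕ} (hk : k < blockLens γ.blocks p) :
    (bot γ p).getD k 0 = off (blockLens γ.blocks) p + k := by
  rw [bot, List.getD_eq_getElem _ _ (by rwa [List.length_range']), List.getElem_range', one_mul]

theorem expo_apply (i : Idx γ) (p : Fin γ.blocks.length) {k : ℕ}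
    (hk : k < blockLens γ.blocks p) :
    i.expo (off (blockLens γ.blocks) p + k) = (i.Ms p).count k := by
  have hb : ∀ q, ∀ l ∈ i.Ms q, l < blockLens γ.blocks q := fun q l hl => by
    rw [← i.length_ws]; exact (i.blackAt q l hl).lt
  rw [expo, Finsupp.finsetSum_apply, Finset.sum_eq_single p]
  · rw [Multiset.toFinsupp_apply, Multiset.map_congr rfl fun l hl => getD_bot (hb p l hl),
      Multiset.count_map_eq_count' _ _ fun x y h => by simpa using h]
  · intro q _ hq
    rw [Multiset.toFinsupp_apply, Multiset.count_eq_zero, Multiset.mem_map]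
    rintro ⟨l, hl, he⟩
    have hl := hb q l hl
    rw [getD_bot hl] at he
    rcases lt_or_gt_of_ne hq with h | h
    · have := off_mono (blockLens γ.blocks) (Nat.succ_le_of_lt (Fin.lt_def.1 h))
      rw [Nat.succ_eq_add_one, off_succ] at this
      omega
    · have := off_mono (blockLens γ.blocks) (Nat.succ_le_of_lt (Fin.lt_def.1 h))
      rw [Nat.succ_eq_add_one, off_succ] at this
      omega
  · exact fun h => absurd (Finset.mem_univ p) h

/-- The leading arrangement determines the code of the block shuffle and the arrangement of each
block, hence the codes in the blocks. The exponents determine the dots, since the strands of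
different blocks have different numbers. -/
theorem eq_of_shuf_eq {i j : Idx γ} (hw : i.ws = j.ws) (hs : shuf i.c i.top = shuf j.c j.top)
    (he : i.expo = j.expo) : i = j := by
  have hperm : ∀ p, (i.top p).Perm (j.top p) := fun p => (i.top_perm p).trans (j.top_perm p).symm
  obtain ⟨h1, h2⟩ := shuf_injective hperm (fun p q hpq s hs hs' => by
      rw [(i.top_perm p).mem_iff, bot, List.mem_range'_1] at hs
      rw [(i.top_perm q).mem_iff, bot, List.mem_range'_1] at hs'
      rcases lt_or_gt_of_ne hpq with h | h
      · have := off_mono (blockLens γ.blocks) (Nat.succ_le_of_lt h)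
        rw [Nat.succ_eq_add_one, off_succ] at this
        omega
      · have := off_mono (blockLens γ.blocks) (Nat.succ_le_of_lt h)
        rw [Nat.succ_eq_add_one, off_succ] at this
        omega) (i.lengths_top ▸ i.code) (j.lengths_top ▸ j.code) hs
  refine Idx.ext h1 hw (funext fun p => ?_) (funext fun p => ?_)
  · have h3 := h2 p
    have hi := i.codes p
    have hj := j.codes p
    rw [top, top, bot, i.length_ws, j.length_ws] at h3
    rw [length_ws] at hi hj
    exact act_canon_ones_injective hi hj h3
  · by_cases hp : p < γ.blocks.length
    · ext k
      by_cases hk : k < blockLens γ.blocks p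
      · rw [← i.expo_apply ⟨p, hp⟩ hk, ← j.expo_apply ⟨p, hp⟩ hk, he]
      · rw [Multiset.count_eq_zero.2 fun h => hk (i.length_ws p ▸ (i.blackAt p k h).lt),
          Multiset.count_eq_zero.2 fun h => hk (j.length_ws p ▸ (j.blackAt p k h).lt)]
    · have : ∀ i : Idx γ, i.Ms p = 0 := fun i => Multiset.eq_zero_of_forall_notMem fun k hk => by
        have := (i.blackAt p k hk).lt
        rw [i.isWords.nil p (not_lt.1 hp)] at this
        exact absurd this (by simp)
      rw [this, this]

/-- The labels are chosen such that the arrangement in the natural order reads the given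
concatenation, and `F` is the action on this arrangement. It separates the basis elements with this
bottom word and kills diagrams with any other bottom. -/
theorem isLead_frac {C : CartanDatum I} (hQ : IsAdmissible C Q) (h : Fits γ α)
    {ws : ℕ → List (Option I)} (hw : IsWords γ.blocks ws) :
    ∃ F : Diagrams Q Λ →ₗ[𝕜] Arr (Frac 𝕜),
      (∀ w, w ≠ cat ws γ.blocks.length → ∀ d, F (d * dId Q Λ w) = 0) ∧
      ∀ i : Idx γ, i.ws = ws →
        IsLead (F (shuffle Q Λ γ α i.c * hcomp Q Λ γ α (i.elt Q Λ)).val)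
          (algebraMap (MvPolynomial ℕ 𝕜) (Frac 𝕜) (MvPolynomial.monomial i.expo 1))
          (shuf i.c i.top) := by
  let lab : ℕ → Option I := fun j => (cat ws γ.blocks.length).getD j none
  have hcat : (cat (bot γ) γ.blocks.length).map lab = cat ws γ.blocks.length := by
    rw [cat_bot, ← hw.lengths, ← length_cat]
    exact map_range_getD _ _
  have hlab : ∀ p, (bot γ p).map lab = ws p := by
    intro p
    by_cases hp : p < γ.blocks.length
    · rw [← cat_map] at hcat
      refine cat_ext (ws := fun p => (bot γ p).map lab) ?_ hcat hp
      funext q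
      rw [lengths, List.length_map, bot, List.length_range', ← hw.lengths]
    · rw [hw.nil p (not_lt.1 hp), bot, blockLens, dif_neg hp]; rfl
  obtain ⟨a, b, hc, ha⟩ := exists_isCoeff hQ Λ lab
  refine ⟨(LinearMap.applyₗ (arr (cat (bot γ) γ.blocks.length))).restrictScalars 𝕜 ∘ₗ
    (diagOp Q Λ hc).toLinearMap, fun w hne d => ?_, fun i hi => ?_⟩
  · change diagOp Q Λ hc (d * dId Q Λ w) (arr (cat (bot γ) γ.blocks.length)) = 0
    rw [map_mul, Module.End.mul_apply, diagOp_dId, projOp_of_not, map_zero]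
    rw [hcat]
    exact fun h => hne h.2.symm
  · have h1 := i.isLead h hc ha fun p => (hlab p).trans (congrFun hi.symm p)
    have e : ((List.finRange γ.blocks.length).map fun p : Fin γ.blocks.length =>
        ((i.Ms p).toList.map fun k => fracX 𝕜 ((bot γ p).getD k 0)).prod).prod =
        algebraMap (MvPolynomial ℕ 𝕜) (Frac 𝕜) (MvPolynomial.monomial i.expo 1) := by
      rw [expo, MvPolynomial.monomial_sum_one, map_prod, ← List.ofFn_eq_map, List.prod_ofFn]
      refine Finset.prod_congr rfl fun p _ => ?_
      have := prod_map_fracX (𝕜 := 𝕜) ((i.Ms p).toList.map fun k => (bot γ p).getD k 0)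
      rw [← Multiset.map_coe, Multiset.coe_toList, List.map_map] at this
      exact this
    rw [← e]
    exact h1

end Idx

variable (Q Λ γ α) in
/-- The space `R₀(Λ, α) 1_γ` as a free module over `R_γ`. -/
def fromCodes : ({c : List ℕ // IsCode c (blockLens γ.blocks)} →₀ RGamma Q Λ γ) →ₗ[𝕜]
    KLRWAlg Q Λ α :=
  Finsupp.lsum 𝕜 fun c => LinearMap.mulLeft 𝕜 (shuffle Q Λ γ α c.1) ∘ₗ hcomp Q Λ γ α

theorem fromCodes_single (c : {c : List ℕ // IsCode c (blockLens γ.blocks)}) (r : RGamma Q Λ γ) :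
    fromCodes Q Λ γ α (Finsupp.single c r) = shuffle Q Λ γ α c.1 * hcomp Q Λ γ α r := by
  rw [fromCodes, Finsupp.lsum_single]; rfl

/-- The source is spanned by the elements for `Idx γ`, so it suffices that the images of these are
linearly independent. This follows from their distinct leading terms, separately for each bottom
word. -/
theorem fromCodes_injective {C : CartanDatum I} (hQ : IsAdmissible C Q) (h : Fits γ α) :
    Function.Injective (fromCodes Q Λ γ α) := by
  classical
  have hspan : Submodule.span 𝕜 (Set.range fun i : Idx γ =>
      (Finsupp.single ⟨i.c, i.code⟩ (i.elt Q Λ) :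
        {c : List ℕ // IsCode c (blockLens γ.blocks)} →₀ RGamma Q Λ γ)) = ⊤ := by
    rw [eq_top_iff]
    rintro f -
    induction f using Finsupp.induction_linear with
    | zero => exact Submodule.zero_mem _
    | add f g hf hg => exact Submodule.add_mem _ hf hg
    | single c r =>
      have := Submodule.mem_map_of_mem (f := Finsupp.lsingle (R := 𝕜) c) (mem_span_elt c.2 r)
      rw [Submodule.map_span] at this
      refine Submodule.span_mono ?_ this
      rintro _ ⟨_, ⟨i, hi, rfl⟩, rfl⟩
      refine ⟨i, ?_⟩
      obtain ⟨c, hc⟩ := c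
      subst hi
      rfl
  rw [injective_iff_map_eq_zero]
  intro f hf
  have hmem : f ∈ Submodule.span 𝕜 (Set.range fun i : Idx γ =>
      (Finsupp.single ⟨i.c, i.code⟩ (i.elt Q Λ) :
        {c : List ℕ // IsCode c (blockLens γ.blocks)} →₀ RGamma Q Λ γ)) := by
    rw [hspan]; exact Submodule.mem_top
  obtain ⟨c, rfl⟩ := Finsupp.mem_span_range_iff_exists_finsupp.1 hmem
  suffices hc : ∀ i ∈ c.support, c i = 0 by
    exact Finset.sum_eq_zero fun i hi => by
      change c i • _ = _; rw [hc i hi, zero_smul]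
  rw [Finsupp.sum, map_sum] at hf
  simp only [map_smul, fromCodes_single] at hf
  intro i₀ hi₀
  -- The coefficient of `i₀` is tested with the map for the words of `i₀`; elements with other words
  -- at the bottom disappear.
  obtain ⟨F, hF, hlead⟩ := Idx.isLead_frac (Λ := Λ) hQ h i₀.isWords
  have h1 := congrArg (fun x => F x.val) hf
  simp only [StrandAlg.val_sum, map_sum, StrandAlg.val_smul, map_smul, StrandAlg.val_zero,
    map_zero] at h1
  have hz : ∀ i : Idx γ, i.ws ≠ i₀.ws →
      F (shuffle Q Λ γ α i.c * hcomp Q Λ γ α (i.elt Q Λ)).val = 0 := by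
    intro i hne
    have e : (i.elt Q Λ : RGamma Q Λ γ) = i.elt Q Λ * idemR Q Λ γ i.ws := by
      rw [Idx.elt, idemR, ← rTprod_mul]
      congr 1
      funext p
      refine StrandAlg.val_injective ?_
      have hb := val_blockElt (Q := Q) (Λ := Λ) (i.isWords.coe p p.2) (i.codes p) (i.blackAt p)
      have hid := StrandAlg.val_idem (Q := Q) (Λ := Λ) (i.isWords.coe p p.2)
      have hd := (dots_mon (Q := Q) (Λ := Λ) (fun _ => True) (w := i.ws p)
        (l := (i.Ms p).toList) fun k hk => i.blackAt p k (by simpa using hk)).mul_dId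
      rw [Pi.mul_apply, StrandAlg.val_mul]
      erw [hb, hid]
      rw [mul_assoc, hd]
    rw [e, hcomp_mul h, ← mul_assoc, StrandAlg.val_mul, val_hcomp_idemR h i.isWords]
    exact hF _ (fun he => hne (cat_inj i.isWords i₀.isWords he)) _
  have h2 : ∑ i ∈ c.support.subtype fun i => i.ws = i₀.ws,
      c i.1 • F (shuffle Q Λ γ α i.1.c * hcomp Q Λ γ α (i.1.elt Q Λ)).val = 0 := by
    rw [← h1, Finset.sum_subtype_eq_sum_filter
      (f := fun i : Idx γ => c i • F (shuffle Q Λ γ α i.c * hcomp Q Λ γ α (i.elt Q Λ)).val),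
      Finset.sum_filter]
    refine Finset.sum_congr rfl fun i _ => ?_
    split_ifs with hi
    · rfl
    · rw [hz i hi, smul_zero]
  have h3 := eq_zero_of_isLead (ι := {i : Idx γ // i.ws = i₀.ws}) _ (fun i => shuf i.1.c i.1.top)
    (fun i => i.1.expo) (fun i => hlead i.1 i.2)
    (fun i j hs he => Subtype.ext (Idx.eq_of_shuf_eq (i.2.trans j.2.symm) hs he)) _
    (fun i => c i.1) h2
  exact h3 ⟨i₀, rfl⟩ (Finset.mem_subtype.2 hi₀)

theorem idem_mul_shuffle (h : Fits γ α) {c : List ℕ} (hc : IsCode c (blockLens γ.blocks))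
    {ws : ℕ → List (Option I)} (hw : IsWords γ.blocks ws) (r : RGamma Q Λ γ) :
    idem Q Λ _ (shuf c ws) * (shuffle Q Λ γ α c * hcomp Q Λ γ α (idemR Q Λ γ ws * r)) =
      shuffle Q Λ γ α c * hcomp Q Λ γ α (idemR Q Λ γ ws * r) := by
  refine StrandAlg.val_injective ?_
  have hd := path_dia (Q := Q) (Λ := Λ) hw hc
  have hS : ((shuf c ws : List (Option I)) : Multiset (Option I)) = withRed α := by
    rw [← h.coe hw.cat_mem]; exact Multiset.coe_eq_coe.2 hd.perm
  rw [hcomp_mul h]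
  simp only [StrandAlg.val_mul]
  rw [StrandAlg.val_idem hS, val_hcomp_idemR h hw, ← mul_assoc (shuffle Q Λ γ α c).val,
    shuffle_mul_dId h hc hw, ← mul_assoc, hd.dId_mul]

theorem mul_hcomp_one_mem_range (h : Fits γ α) (x : KLRWAlg Q Λ α) :
    x * hcomp Q Λ γ α 1 ∈ LinearMap.range (fromCodes Q Λ γ α) := by
  refine Submodule.span_le.2 ?_ (mul_hcomp_one_mem h x)
  rintro _ ⟨c, ws, r, hc, hw, rfl⟩
  refine ⟨Finsupp.single ⟨c, hc⟩ (idemR Q Λ γ ws * r), ?_⟩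
  rw [fromCodes_single]
  rw [idem_mul_shuffle h hc hw]

/-- The projection of `R₀(Λ, α) 1_γ` to the summand `R_γ`. -/
theorem exists_retraction {C : CartanDatum I} (hQ : IsAdmissible C Q) (Λ : I → ℕ)
    (h : Fits γ α) : ∃ f : KLRWAlg Q Λ α →ₗ[𝕜] RGamma Q Λ γ, f 1 = 1 ∧
      ∀ x r, f (x * hcomp Q Λ γ α r) = f x * r := by
  let e := LinearEquiv.ofInjective (fromCodes Q Λ γ α) (fromCodes_injective hQ h)
  let g : KLRWAlg Q Λ α →ₗ[𝕜] LinearMap.range (fromCodes Q Λ γ α) :=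
    (LinearMap.mulRight 𝕜 (hcomp Q Λ γ α 1)).codRestrict _ (mul_hcomp_one_mem_range h)
  -- The retraction takes the coordinate of `x * 1_γ` at the trivial shuffle. It is right linear
  -- because right multiplication by `R_γ` acts on all coordinates in the same way.
  let c₀ : {c : List ℕ // IsCode c (blockLens γ.blocks)} := ⟨trivialCode γ, isCode_trivialCode⟩
  have hg : ∀ x f, fromCodes Q Λ γ α f = x * hcomp Q Λ γ α 1 → e.symm (g x) = f := fun x f hf => by
    rw [LinearEquiv.symm_apply_eq]
    exact Subtype.ext hf.symm
  refine ⟨Finsupp.lapply c₀ ∘ₗ e.symm.toLinearMap ∘ₗ g, ?_, fun x r => ?_⟩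
  · change e.symm (g 1) c₀ = 1
    rw [hg 1 (Finsupp.single c₀ 1), Finsupp.single_eq_same]
    rw [fromCodes_single, shuffle_of_sorted h isCode_trivialCode sorted_trivialCode, ← hcomp_mul h,
      one_mul, one_mul]
  · change e.symm (g (x * hcomp Q Λ γ α r)) c₀ = e.symm (g x) c₀ * r
    have hx : fromCodes Q Λ γ α (e.symm (g x)) = x * hcomp Q Λ γ α 1 :=
      congrArg Subtype.val (e.apply_symm_apply (g x))
    rw [hg (x * hcomp Q Λ γ α r)
      ((e.symm (g x)).mapRange (· * r) (zero_mul r)), Finsupp.mapRange_apply]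
    have key : ∀ f : {c : List ℕ // IsCode c (blockLens γ.blocks)} →₀ RGamma Q Λ γ,
        fromCodes Q Λ γ α (f.mapRange (· * r) (zero_mul r)) =
          fromCodes Q Λ γ α f * hcomp Q Λ γ α r := by
      intro f
      induction f using Finsupp.induction_linear with
      | zero => rw [Finsupp.mapRange_zero, map_zero, zero_mul]
      | add f g hf hg =>
        rw [Finsupp.mapRange_add (add_mul · · r), map_add, map_add, add_mul, hf, hg]
      | single c s =>
        rw [Finsupp.mapRange_single, fromCodes_single, fromCodes_single, hcomp_mul h, mul_assoc]
    rw [key, hx, mul_assoc, mul_assoc, ← hcomp_mul h, ← hcomp_mul h, one_mul, mul_one]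

end

section

variable {I : Type u} {𝕜 : Type v} [CommRing 𝕜] [DecidableEq I]
variable {Q : I → I → MvPolynomial (Fin 2) 𝕜} {Λ : I → ℕ} {χ : I → ℝ}
variable {γ : SlopeDatum I} {α : Multiset I}

/-! ## The quotient `C_γ` of `R_γ` -/

section Cut

variable {S : Multiset (Option I)} {kill : List (Option I) → Prop}

theorem toCut_surjective : Function.Surjective (toCut Q Λ S kill) :=
  RingQuot.mkAlgHom_surjective 𝕜 _

theorem toCut_idem {w : List (Option I)} (hw : (w : Multiset (Option I)) = S) (hk : kill w) :
    toCut Q Λ S kill (idem Q Λ S w) = 0 :=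
  (RingQuot.mkAlgHom_rel 𝕜 ⟨⟨w, hw, hk, rfl⟩, rfl⟩).trans (map_zero _)

/-- The universal property of a quotient by idempotents. -/
def Cut.lift {B : Type*} [Ring B] [Algebra 𝕜 B] (f : StrandAlg Q Λ S →ₐ[𝕜] B)
    (hf : ∀ w : List (Option I), (w : Multiset (Option I)) = S → kill w → f (idem Q Λ S w) = 0) :
    Cut Q Λ S kill →ₐ[𝕜] B :=
  RingQuot.liftAlgHom 𝕜 ⟨f, by
    rintro x y ⟨⟨w, hw, hk, rfl⟩, rfl⟩
    rw [hf w hw hk, map_zero]⟩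

theorem Cut.lift_toCut {B : Type*} [Ring B] [Algebra 𝕜 B] (f : StrandAlg Q Λ S →ₐ[𝕜] B)
    (hf : ∀ w : List (Option I), (w : Multiset (Option I)) = S → kill w → f (idem Q Λ S w) = 0)
    (x : StrandAlg Q Λ S) : Cut.lift f hf (toCut Q Λ S kill x) = f x :=
  RingQuot.liftAlgHom_mkAlgHom_apply 𝕜 _ _ _

end Cut

variable (Q Λ χ γ) in
/-- Pure tensors in `C_γ`. -/
def cTprod : MultilinearMap 𝕜 (fun p : Fin γ.blocks.length => BlockQuot Q Λ χ (γ.blocks.get p))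
    (CGamma Q Λ χ γ) := PiTensorProduct.tprod 𝕜

theorem toCGamma_rTprod (x : ∀ p : Fin γ.blocks.length, BlockAlg Q Λ (γ.blocks.get p)) :
    toCGamma Q Λ χ γ (rTprod Q Λ γ x) = cTprod Q Λ χ γ fun p => toCut Q Λ _ _ (x p) :=
  PiTensorProduct.lift.tprod (E := ⨂[𝕜] p : Fin γ.blocks.length, BlockQuot Q Λ χ (γ.blocks.get p)) _

theorem toCGamma_surjective : Function.Surjective (toCGamma Q Λ χ γ) := by
  intro c
  have hc : c ∈ Submodule.span 𝕜 (Set.range (cTprod Q Λ χ γ)) := by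
    have : Submodule.span 𝕜 (Set.range (cTprod Q Λ χ γ)) = ⊤ := PiTensorProduct.span_tprod_eq_top
    rw [this]; exact Submodule.mem_top
  suffices h : c ∈ LinearMap.range (toCGamma Q Λ χ γ).toLinearMap by exact h
  refine Submodule.span_le.2 ?_ hc
  rintro _ ⟨x, rfl⟩
  choose y hy using fun p => toCut_surjective (x p)
  exact ⟨rTprod Q Λ γ y, (toCGamma_rTprod y).trans (congrArg _ (funext hy))⟩

theorem toCGamma_idemR_eq_zero {ws : ℕ → List (Option I)} (hw : IsWords γ.blocks ws)
    {p : ℕ} (hp : p < γ.blocks.length) (hk : γ.blocks[p].kill χ (ws p)) :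
    toCGamma Q Λ χ γ (idemR Q Λ γ ws) = 0 := by
  rw [idemR, toCGamma_rTprod]
  exact MultilinearMap.map_coord_zero _ (⟨p, hp⟩ : Fin γ.blocks.length)
    (toCut_idem (hw.coe p hp) hk)

theorem prod_single (x : ∀ p : Fin γ.blocks.length, BlockAlg Q Λ (γ.blocks.get p)) :
    (List.ofFn fun p => (single p (x p) : RGamma Q Λ γ)).prod = rTprod Q Λ γ x := by
  let m : (∀ p : Fin γ.blocks.length, BlockAlg Q Λ (γ.blocks.get p)) →* RGamma Q Λ γ :=
    PiTensorProduct.tprodMonoidHom 𝕜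
  have hm : ∀ y, m y = rTprod Q Λ γ y := fun _ => rfl
  have e : (fun p => (single p (x p) : RGamma Q Λ γ)) =
      fun p => m (Function.update (fun q => (1 : BlockAlg Q Λ (γ.blocks.get q))) p (x p)) := rfl
  rw [e, ← Function.comp_def m, ← List.map_ofFn, ← map_list_prod, hm]
  congr 1
  funext q
  have h := map_list_prod (Pi.evalMonoidHom (fun p : Fin γ.blocks.length =>
    BlockAlg Q Λ (γ.blocks.get p)) q) (List.ofFn fun p =>
      Function.update (fun q => (1 : BlockAlg Q Λ (γ.blocks.get q))) p (x p))
  rw [List.map_ofFn] at h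
  refine h.trans ?_
  have e' : (Pi.evalMonoidHom (fun p : Fin γ.blocks.length => BlockAlg Q Λ (γ.blocks.get p)) q ∘
      fun p => Function.update (fun q => (1 : BlockAlg Q Λ (γ.blocks.get q))) p (x p)) =
      Function.update (fun _ => 1) q (x q) := by
    funext p
    by_cases hp : q = p
    · subst hp; simp
    · rw [Function.comp_apply, Pi.evalMonoidHom_apply, Function.update_of_ne hp,
        Function.update_of_ne (Ne.symm hp)]
  rw [e', prod_ofFn_update (one_mul _) (one_mul _) (mul_one _)]

/-- The kernel of `R_γ → C_γ` is generated by idempotents. -/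
theorem mem_of_toCGamma_eq_zero (K : Ideal (RGamma Q Λ γ)) [K.IsTwoSided]
    (hK : ∀ (p : Fin γ.blocks.length) (w : List (Option I)),
      (w : Multiset (Option I)) = (γ.blocks.get p).strands → (γ.blocks.get p).kill χ w →
      single p (idem Q Λ _ w) ∈ K) {r : RGamma Q Λ γ} (hr : toCGamma Q Λ χ γ r = 0) : r ∈ K := by
  -- Each `C_{γ_p}` maps to `R_γ / K` by its universal property. The ordered product of these maps
  -- is a linear map `F` on `C_γ`, and its composition with `R_γ → C_γ` is the quotient map modulo
  -- `K`. So elements of the kernel lie in `K`.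
  let e : ∀ p : Fin γ.blocks.length, BlockAlg Q Λ (γ.blocks.get p) →ₐ[𝕜] RGamma Q Λ γ :=
    fun p => PiTensorProduct.singleAlgHom (R := 𝕜)
      (A := fun p : Fin γ.blocks.length => BlockAlg Q Λ (γ.blocks.get p)) p
  let f : ∀ p : Fin γ.blocks.length, BlockAlg Q Λ (γ.blocks.get p) →ₐ[𝕜] RGamma Q Λ γ ⧸ K :=
    fun p => (Ideal.Quotient.mkₐ 𝕜 K).comp (e p)
  have hf : ∀ p x, f p x = Ideal.Quotient.mk K (single p x) := fun p x => rfl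
  let g : ∀ p : Fin γ.blocks.length, BlockQuot Q Λ χ (γ.blocks.get p) →ₐ[𝕜] RGamma Q Λ γ ⧸ K :=
    fun p => Cut.lift (f p) fun w hw hk => by
      rw [hf]; exact Ideal.Quotient.eq_zero_iff_mem.2 (hK p w hw hk)
  let F : CGamma Q Λ χ γ →ₗ[𝕜] RGamma Q Λ γ ⧸ K := PiTensorProduct.lift
    ((MultilinearMap.mkPiAlgebraFin 𝕜 γ.blocks.length (RGamma Q Λ γ ⧸ K)).compLinearMap
      fun p => (g p).toLinearMap)
  have hF : ∀ s, F (toCGamma Q Λ χ γ s) = Ideal.Quotient.mk K s := by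
    intro s
    induction s using RGamma.induction with
    | zero => rw [map_zero, map_zero, map_zero]
    | add s s' h h' => rw [map_add, map_add, map_add, h, h']
    | smul a s h =>
      rw [map_smul, map_smul, h]; rfl
    | tprod x =>
      rw [toCGamma_rTprod]
      refine (PiTensorProduct.lift.tprod _).trans ?_
      rw [MultilinearMap.compLinearMap_apply, MultilinearMap.mkPiAlgebraFin_apply, ← prod_single,
        map_list_prod, List.map_ofFn]
      congr 2
      funext p
      exact (Cut.lift_toCut _ _ _).trans (hf p (x p))
  rw [← Ideal.Quotient.eq_zero_iff_mem, ← hF, hr, map_zero]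

end

section

variable {I : Type u} {𝕜 : Type v} [CommRing 𝕜] [DecidableEq I]
variable {Q : I → I → MvPolynomial (Fin 2) 𝕜} {Λ : I → ℕ} {χ : I → ℝ}
variable {γ : SlopeDatum I} {α : Multiset I}

/-! ## The induced module -/

variable (Q Λ χ γ α) in
/-- The module `R₀(Λ, α) ⊗ C_γ`. -/
abbrev IndC : Type (max u v) := Induced Q Λ γ α (CGamma Q Λ χ γ)

variable (χ) in
/-- Pure tensors in the induced module. -/
def tmk (a : KLRWAlg Q Λ α) (c : CGamma Q Λ χ γ) : IndC Q Λ χ γ α :=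
  Submodule.Quotient.mk (a ⊗ₜ[𝕜] c)

variable (Q Λ χ γ α) in
/-- The generator `1 ⊗ 1`. -/
def gen : IndC Q Λ χ γ α := tmk χ 1 1

theorem smul_tmk (b a : KLRWAlg Q Λ α) (c : CGamma Q Λ χ γ) : b • tmk χ a c = tmk χ (b * a) c := rfl

theorem tmk_mul_hcomp (a : KLRWAlg Q Λ α) (r : RGamma Q Λ γ) (c : CGamma Q Λ χ γ) :
    tmk χ (a * hcomp Q Λ γ α r) c = tmk χ a (toCGamma Q Λ χ γ r * c) := by
  rw [tmk, tmk, Submodule.Quotient.eq]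
  exact Submodule.subset_span ⟨a, r, c, rfl⟩

theorem hcomp_smul_gen (r : RGamma Q Λ γ) :
    hcomp Q Λ γ α r • gen Q Λ χ γ α = tmk χ 1 (toCGamma Q Λ χ γ r) := by
  rw [gen, smul_tmk, mul_one, ← one_mul (hcomp Q Λ γ α r), tmk_mul_hcomp, mul_one]

theorem hcomp_one_smul_gen : hcomp Q Λ γ α 1 • gen Q Λ χ γ α = gen Q Λ χ γ α := by
  rw [hcomp_smul_gen, map_one, gen]

theorem hcomp_smul_gen_of_eq_zero {r : RGamma Q Λ γ} (hr : toCGamma Q Λ χ γ r = 0) :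
    hcomp Q Λ γ α r • gen Q Λ χ γ α = 0 := by
  rw [hcomp_smul_gen, hr, tmk, TensorProduct.tmul_zero, Submodule.Quotient.mk_zero]

theorem tmk_toCGamma (a : KLRWAlg Q Λ α) (r : RGamma Q Λ γ) :
    tmk χ a (toCGamma Q Λ χ γ r) = (a * hcomp Q Λ γ α r) • gen Q Λ χ γ α := by
  rw [mul_smul, hcomp_smul_gen, smul_tmk, mul_one]

theorem span_gen : Submodule.span (KLRWAlg Q Λ α) {gen Q Λ χ γ α} = ⊤ := by
  rw [eq_top_iff]
  rintro x -
  obtain ⟨x, rfl⟩ := Submodule.Quotient.mk_surjective _ x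
  induction x using TensorProduct.induction_on with
  | zero => rw [Submodule.Quotient.mk_zero]; exact Submodule.zero_mem _
  | add x y hx hy => rw [Submodule.Quotient.mk_add]; exact Submodule.add_mem _ hx hy
  | tmul a c =>
    obtain ⟨r, rfl⟩ := toCGamma_surjective c
    change tmk χ a _ ∈ _
    rw [tmk_toCGamma]
    exact Submodule.smul_mem _ _ (Submodule.mem_span_singleton_self _)

theorem exists_smul_gen (x : IndC Q Λ χ γ α) : ∃ a : KLRWAlg Q Λ α, a • gen Q Λ χ γ α = x := by
  rw [← Submodule.mem_span_singleton, span_gen]; exact Submodule.mem_top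

theorem indC_hom_ext {M : Type*} [AddCommGroup M] [Module (KLRWAlg Q Λ α) M]
    {f g : IndC Q Λ χ γ α →ₗ[KLRWAlg Q Λ α] M} (h : f (gen Q Λ χ γ α) = g (gen Q Λ χ γ α)) :
    f = g :=
  LinearMap.ext fun x => by
    obtain ⟨a, rfl⟩ := exists_smul_gen x
    rw [map_smul, map_smul, h]

/-- The map `C_γ → R₀(Λ, α) ⊗ C_γ` is injective. -/
theorem toCGamma_eq_zero {C : CartanDatum I} (hQ : IsAdmissible C Q) (h : Fits γ α)
    {r : RGamma Q Λ γ} (hr : hcomp Q Λ γ α r • gen Q Λ χ γ α = 0) : toCGamma Q Λ χ γ r = 0 := by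
  obtain ⟨f, hf1, hf⟩ := exists_retraction hQ Λ h
  -- The retraction `f` gives a map `a ⊗ c ↦ [f a] c`, which respects the relations of the induced
  -- module by right linearity and sends `1 ⊗ c` to `c`.
  let D : KLRWAlg Q Λ α ⊗[𝕜] CGamma Q Λ χ γ →ₗ[𝕜] CGamma Q Λ χ γ :=
    TensorProduct.lift (LinearMap.mul 𝕜 (CGamma Q Λ χ γ) ∘ₗ (toCGamma Q Λ χ γ).toLinearMap ∘ₗ f)
  have hD : ∀ a c, D (a ⊗ₜ c) = toCGamma Q Λ χ γ (f a) * c := fun a c => rfl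
  rw [hcomp_smul_gen, tmk, Submodule.Quotient.mk_eq_zero] at hr
  -- The relations generate a submodule over `R₀(Λ, α)`, whereas `D` is only `𝕜`-linear. Therefore
  -- the claim is proved for all left multiples `b • x`.
  have key : ∀ x ∈ Submodule.span (KLRWAlg Q Λ α) {t : KLRWAlg Q Λ α ⊗[𝕜] CGamma Q Λ χ γ |
      ∃ (a : KLRWAlg Q Λ α) (r : RGamma Q Λ γ) (m : CGamma Q Λ χ γ),
        t = (a * hcomp Q Λ γ α r) ⊗ₜ[𝕜] m - a ⊗ₜ[𝕜] (r • m)}, ∀ b : KLRWAlg Q Λ α,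
      D (b • x) = 0 := by
    intro x hx
    induction hx using Submodule.span_induction with
    | zero => intro b; rw [smul_zero, map_zero]
    | add x y _ _ hx hy => intro b; rw [smul_add, map_add, hx, hy, add_zero]
    | smul a x _ hx => intro b; rw [smul_smul]; exact hx _
    | mem x hx =>
      obtain ⟨a, r, m, rfl⟩ := hx
      intro b
      rw [smul_sub, map_sub, TensorProduct.smul_tmul', TensorProduct.smul_tmul', hD, hD, smul_eq_mul,
        smul_eq_mul, ← mul_assoc, hf, map_mul, mul_assoc, sub_eq_zero]
      rfl
  have := key _ hr 1
  rwa [one_smul, hD, hf1, map_one, one_mul] at this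

section Words

variable (hγ : γ.IsFor χ α)

include hγ

theorem idem_mul_hcomp_one {w : List (Option I)} (hw : w ∉ concatWords γ.blocks)
    (hS : (w : Multiset (Option I)) = withRed α) :
    idem Q Λ (withRed α) w * hcomp Q Λ γ α 1 = 0 := by
  refine StrandAlg.val_injective ?_
  rw [StrandAlg.val_mul, StrandAlg.val_idem hS, val_hcomp_one hγ.fits, concatTotal, Finset.mul_sum]
  exact Finset.sum_eq_zero fun w' hw' => dId_mul_ne Q Λ fun h => hw (h ▸ hw')

theorem idem_cat {ws : ℕ → List (Option I)} (hw : IsWords γ.blocks ws) :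
    idem Q Λ (withRed α) (cat ws γ.blocks.length) = hcomp Q Λ γ α (idemR Q Λ γ ws) := by
  refine StrandAlg.val_injective ?_
  rw [StrandAlg.val_idem (hγ.fits.coe hw.cat_mem), val_hcomp_idemR hγ.fits hw]

theorem idem_cat_mul_hcomp_one {ws : ℕ → List (Option I)} (hw : IsWords γ.blocks ws) :
    idem Q Λ (withRed α) (cat ws γ.blocks.length) * hcomp Q Λ γ α 1 =
      hcomp Q Λ γ α (idemR Q Λ γ ws) := by
  rw [idem_cat hγ hw, ← hcomp_mul hγ.fits, mul_one]

theorem hcomp_one_mul_idem_cat {ws : ℕ → List (Option I)} (hw : IsWords γ.blocks ws) :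
    hcomp Q Λ γ α 1 * idem Q Λ (withRed α) (cat ws γ.blocks.length) =
      idem Q Λ (withRed α) (cat ws γ.blocks.length) := by
  rw [idem_cat hγ hw, ← hcomp_mul hγ.fits, one_mul]

theorem coe_shuf_eq {ws : ℕ → List (Option I)} (hw : IsWords γ.blocks ws) {c : List ℕ}
    (hc : IsCode c (blockLens γ.blocks)) :
    ((shuf c ws : List (Option I)) : Multiset (Option I)) = withRed α := by
  rw [← hγ.fits.coe hw.cat_mem]
  exact Multiset.coe_eq_coe.2 (path_dia (𝕜 := ℤ) (Q := fun _ _ => 0) (Λ := fun _ => 0) hw hc).perm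

/-- The induced module is spanned by shuffles of words that are not killed. -/
theorem smul_gen_induction {P : IndC Q Λ χ γ α → Prop} (zero : P 0)
    (add : ∀ x y, P x → P y → P (x + y))
    (shuffle : ∀ (c : List ℕ) (ws : ℕ → List (Option I)) (r : RGamma Q Λ γ),
      IsCode c (blockLens γ.blocks) → IsWords γ.blocks ws →
      (∀ p (hp : p < γ.blocks.length), ¬ γ.blocks[p].kill χ (ws p)) →
      P ((idem Q Λ (withRed α) (shuf c ws) *
        (shuffle Q Λ γ α c * hcomp Q Λ γ α (idemR Q Λ γ ws * r))) • gen Q Λ χ γ α))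
    (x : IndC Q Λ χ γ α) : P x := by
  obtain ⟨a, rfl⟩ := exists_smul_gen x
  rw [← hcomp_one_smul_gen, smul_smul]
  have h1 := mul_hcomp_one_mem hγ.fits a
  -- The property is only assumed to be additive, so scalars are carried along until they can be
  -- absorbed into the factor from `R_γ`.
  suffices key : ∀ k : 𝕜, P ((k • (a * hcomp Q Λ γ α 1)) • gen Q Λ χ γ α) by
    simpa only [one_smul] using key 1
  generalize a * hcomp Q Λ γ α 1 = z at h1
  induction h1 using Submodule.span_induction with
  | zero => intro k; rwa [smul_zero, zero_smul]
  | add y z _ _ hy hz => intro k; rw [smul_add, add_smul]; exact add _ _ (hy k) (hz k)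
  | smul l y _ hy => intro k; rw [smul_smul]; exact hy _
  | mem y hy =>
    obtain ⟨c, ws, r, hc, hw, rfl⟩ := hy
    intro k
    rw [← mul_smul_comm, ← mul_smul_comm, ← map_smul, ← mul_smul_comm]
    by_cases hg : ∀ p (hp : p < γ.blocks.length), ¬ γ.blocks[p].kill χ (ws p)
    · exact shuffle c ws _ hc hw hg
    · push Not at hg
      obtain ⟨p, hp, hk⟩ := hg
      rw [← mul_assoc, mul_smul, hcomp_smul_gen_of_eq_zero, smul_zero]
      · exact zero
      · rw [map_mul, toCGamma_idemR_eq_zero hw hp hk, zero_mul]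

/-- A shuffle of surviving words has slope datum at most `γ`, by `slopeDatum_shuf_le`. So the
idempotent does not match the top of any element of the spanning set. -/
theorem idem_smul_eq_zero {ℓ r : List I} (hlr : (ℓ : Multiset I) + (r : Multiset I) = α)
    (hle : ¬ (slopeDatum χ ℓ r).LE χ γ) (x : IndC Q Λ χ γ α) : idemLR Q Λ α ℓ r • x = 0 := by
  induction x using smul_gen_induction hγ with
  | zero => rw [smul_zero]
  | add x y hx hy => rw [smul_add, hx, hy, add_zero]
  | shuffle c ws s hc hw hg =>
    have hne : redWord ℓ r ≠ shuf c ws := fun he =>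
      hle (slopeDatum_shuf_le hγ hw hg (hw.lengths ▸ hc) he.symm)
    have h0 : idemLR Q Λ α ℓ r * idem Q Λ (withRed α) (shuf c ws) = 0 := by
      refine StrandAlg.val_injective ?_
      rw [StrandAlg.val_mul, StrandAlg.val_idem (by rw [coe_redWord, hlr]),
        StrandAlg.val_idem (coe_shuf_eq hγ hw hc), dId_mul_ne Q Λ hne, StrandAlg.val_zero]
    rw [smul_smul, ← mul_assoc, h0, zero_mul, zero_smul]

/-- The idempotent `1_γ` kills all shuffles whose top is not a concatenation. By
`sorted_of_shuf_eq_cat` the others are trivial, and contribute only elements that come from `R_γ`.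
-/
theorem exists_hcomp_one_smul_eq (x : IndC Q Λ χ γ α) :
    ∃ r : RGamma Q Λ γ, hcomp Q Λ γ α 1 • x = hcomp Q Λ γ α r • gen Q Λ χ γ α := by
  induction x using smul_gen_induction hγ with
  | zero => exact ⟨0, by rw [smul_zero, map_zero, zero_smul]⟩
  | add x y hx hy =>
    obtain ⟨r, hr⟩ := hx
    obtain ⟨s, hs⟩ := hy
    exact ⟨r + s, by rw [smul_add, hr, hs, map_add, add_smul]⟩
  | shuffle c ws s hc hw hg =>
    by_cases hm : shuf c ws ∈ concatWords γ.blocks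
    · obtain ⟨ws', hw', he⟩ := mem_concatWords_iff.1 hm
      have hs := sorted_of_shuf_eq_cat hγ hw hw' hg (hw.lengths ▸ hc) he
      refine ⟨idemR Q Λ γ ws * s, ?_⟩
      rw [idem_mul_shuffle hγ.fits hc hw, shuffle_of_sorted hγ.fits hc hs, smul_smul,
        ← hcomp_mul hγ.fits, ← hcomp_mul hγ.fits, one_mul, one_mul]
    · refine ⟨0, ?_⟩
      have h0 : hcomp Q Λ γ α 1 * idem Q Λ (withRed α) (shuf c ws) = 0 := by
        refine StrandAlg.val_injective ?_
        rw [StrandAlg.val_mul, StrandAlg.val_idem (coe_shuf_eq hγ hw hc), val_hcomp_one hγ.fits,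
          concatTotal, Finset.sum_mul]
        exact Finset.sum_eq_zero fun w' hw' => dId_mul_ne Q Λ fun h => hm (h ▸ hw')
      rw [smul_smul, ← mul_assoc, h0, zero_mul, zero_smul, map_zero, zero_smul]

/-- A word that is not a concatenation is killed by `1_γ`. A concatenation with another slope datum
contains a killed word, by `slopeDatum_cat`, and its idempotent goes to zero in `C_γ`. -/
theorem idem_smul_gen_eq_zero {ℓ r : List I} (hlr : (ℓ : Multiset I) + (r : Multiset I) = α)
    (hne : slopeDatum χ ℓ r ≠ γ) : idemLR Q Λ α ℓ r • gen Q Λ χ γ α = 0 := by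
  have hS : (redWord ℓ r : Multiset (Option I)) = withRed α := by rw [coe_redWord, hlr]
  rw [← hcomp_one_smul_gen, smul_smul]
  by_cases hm : redWord ℓ r ∈ concatWords γ.blocks
  · obtain ⟨ws, hw, he⟩ := mem_concatWords_iff.1 hm
    rw [idemLR, he, idem_cat_mul_hcomp_one hγ hw]
    by_cases hg : ∀ p (hp : p < γ.blocks.length), ¬ γ.blocks[p].kill χ (ws p)
    · exact absurd (slopeDatum_cat hγ hw hg he.symm) hne
    · push Not at hg
      obtain ⟨p, hp, hk⟩ := hg
      exact hcomp_smul_gen_of_eq_zero (toCGamma_idemR_eq_zero hw hp hk)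
  · rw [idemLR, idem_mul_hcomp_one hγ hm hS, zero_smul]

end Words

/-! ### Endomorphisms of the induced module -/

variable (α) in
/-- Right multiplication on the induced module. -/
def rightMul (c : CGamma Q Λ χ γ) : Module.End (KLRWAlg Q Λ α) (IndC Q Λ χ γ α) :=
  Submodule.mapQ _ _ (TensorProduct.AlgebraTensorModule.lTensor (KLRWAlg Q Λ α) (KLRWAlg Q Λ α)
    (LinearMap.mulRight 𝕜 c)) (by
      refine Submodule.span_le.2 ?_
      rintro _ ⟨a, r, m, rfl⟩
      refine Submodule.subset_span ⟨a, r, m * c, ?_⟩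
      rw [map_sub]
      change _ - a ⊗ₜ[𝕜] ((toCGamma Q Λ χ γ r * m) * c) = _ - a ⊗ₜ[𝕜] (toCGamma Q Λ χ γ r * (m * c))
      rw [mul_assoc]
      rfl)

theorem rightMul_tmk (c : CGamma Q Λ χ γ) (a : KLRWAlg Q Λ α) (d : CGamma Q Λ χ γ) :
    rightMul α c (tmk χ a d) = tmk χ a (d * c) := rfl

theorem rightMul_gen (c : CGamma Q Λ χ γ) : rightMul α c (gen Q Λ χ γ α) = tmk χ 1 c := by
  rw [gen, rightMul_tmk, one_mul]

theorem tmk_add (a : KLRWAlg Q Λ α) (c d : CGamma Q Λ χ γ) :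
    tmk χ a (c + d) = tmk χ a c + tmk χ a d := by
  rw [tmk, TensorProduct.tmul_add]; rfl

theorem tmk_smul (k : 𝕜) (a : KLRWAlg Q Λ α) (c : CGamma Q Λ χ γ) :
    tmk χ a (k • c) = k • tmk χ a c := by
  rw [tmk, TensorProduct.tmul_smul]; rfl

variable (Q Λ χ γ α) in
/-- The action of `C_γ` on the induced module by endomorphisms. -/
def toEnd : CGamma Q Λ χ γ →ₐ[𝕜] (Module.End (KLRWAlg Q Λ α) (IndC Q Λ χ γ α))ᵐᵒᵖ :=
  AlgHom.ofLinearMap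
    { toFun := fun c => MulOpposite.op (rightMul α c)
      map_add' := fun c d => MulOpposite.unop_injective (indC_hom_ext (by
        rw [MulOpposite.unop_add, LinearMap.add_apply, MulOpposite.unop_op, MulOpposite.unop_op,
          MulOpposite.unop_op, rightMul_gen, rightMul_gen, rightMul_gen, tmk_add]))
      map_smul' := fun k c => MulOpposite.unop_injective (indC_hom_ext (by
        rw [MulOpposite.unop_smul, LinearMap.smul_apply, MulOpposite.unop_op, MulOpposite.unop_op,
          rightMul_gen, rightMul_gen, tmk_smul]; rfl)) }
    (MulOpposite.unop_injective (indC_hom_ext (by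
      change rightMul α 1 (gen Q Λ χ γ α) = gen Q Λ χ γ α
      rw [rightMul_gen, gen])))
    (fun c d => MulOpposite.unop_injective (indC_hom_ext (by
      change rightMul α (c * d) (gen Q Λ χ γ α) = rightMul α d (rightMul α c (gen Q Λ χ γ α))
      rw [rightMul_gen, rightMul_gen, rightMul_tmk])))

/-- An endomorphism is determined by the image of the generator. This image is fixed by `1_γ`, so it
comes from `C_γ`; conversely an element of `C_γ` that annihilates the generator is zero by the
retraction. -/
theorem toEnd_bijective {C : CartanDatum I} (hQ : IsAdmissible C Q) (hγ : γ.IsFor χ α) :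
    Function.Bijective (toEnd Q Λ χ γ α) := by
  constructor
  · rw [injective_iff_map_eq_zero]
    intro c hc
    obtain ⟨r, rfl⟩ := toCGamma_surjective c
    refine toCGamma_eq_zero hQ hγ.fits (α := α) ?_
    rw [hcomp_smul_gen, ← rightMul_gen]
    exact DFunLike.congr_fun (congrArg MulOpposite.unop hc) (gen Q Λ χ γ α)
  · intro f
    obtain ⟨r, hr⟩ := exists_hcomp_one_smul_eq hγ (f.unop (gen Q Λ χ γ α))
    refine ⟨toCGamma Q Λ χ γ r, MulOpposite.unop_injective (indC_hom_ext ?_)⟩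
    rw [← map_smul, hcomp_one_smul_gen] at hr
    rw [hr, hcomp_smul_gen]
    exact rightMul_gen _

end

section

variable {I : Type u} {𝕜 : Type v} [CommRing 𝕜] [DecidableEq I]
variable {Q : I → I → MvPolynomial (Fin 2) 𝕜} {Λ : I → ℕ} {χ : I → ℝ}
variable {γ : SlopeDatum I} {α : Multiset I}

/-! ## The standard module -/

theorem coe_redWord_wordsWith (p : WordsWith χ α γ) :
    (redWord p.1.1 p.1.2 : Multiset (Option I)) = withRed α := by
  rw [coe_redWord, p.2.1]

theorem redWord_injective :
    Function.Injective fun p : WordsWith χ α γ => redWord p.1.1 p.1.2 := fun p q h => by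
  obtain ⟨h1, h2⟩ := redWord_inj h
  exact Subtype.ext (Prod.ext h1 h2)

instance : Finite (WordsWith χ α γ) :=
  Finite.of_injective (β := {w // w ∈ wordsOf (withRed α)})
    (fun p => ⟨redWord p.1.1 p.1.2, mem_wordsOf.2 (coe_redWord_wordsWith p)⟩)
    fun _ _ h => redWord_injective (congrArg Subtype.val h)

theorem idemLR_mul_self (p : WordsWith χ α γ) :
    idemLR Q Λ α p.1.1 p.1.2 * idemLR Q Λ α p.1.1 p.1.2 = idemLR Q Λ α p.1.1 p.1.2 := by
  refine StrandAlg.val_injective ?_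
  rw [StrandAlg.val_mul, StrandAlg.val_idem (coe_redWord_wordsWith p), dId_mul_self]

theorem idemLR_mul_of_ne {p q : WordsWith χ α γ} (h : p ≠ q) :
    idemLR Q Λ α p.1.1 p.1.2 * idemLR Q Λ α q.1.1 q.1.2 = 0 := by
  refine StrandAlg.val_injective ?_
  rw [StrandAlg.val_mul, StrandAlg.val_idem (coe_redWord_wordsWith p),
    StrandAlg.val_idem (coe_redWord_wordsWith q),
    dId_mul_ne Q Λ fun he => h (redWord_injective he), StrandAlg.val_zero]

variable (Q Λ) in
/-- The generator of a summand of the standard module. -/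
def stdGen (p : WordsWith χ α γ) : Standard Q Λ χ α γ :=
  DirectSum.lof (KLRWAlg Q Λ α) _ (fun p : WordsWith χ α γ => StandardLR Q Λ χ α p.1.1 p.1.2) p
    (Submodule.Quotient.mk ⟨idemLR Q Λ α p.1.1 p.1.2, Submodule.mem_span_singleton_self _⟩)

theorem smul_stdGen_eq_zero {p : WordsWith χ α γ} {a : KLRWAlg Q Λ α}
    (h : a * idemLR Q Λ α p.1.1 p.1.2 ∈ Submodule.span (KLRWAlg Q Λ α)
      {x | ∃ (ℓ' r' : List I) (a : KLRWAlg Q Λ α), (ℓ' : Multiset I) + (r' : Multiset I) = α ∧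
        ¬ (slopeDatum χ ℓ' r').LE χ (slopeDatum χ p.1.1 p.1.2) ∧
        x = idemLR Q Λ α ℓ' r' * a * idemLR Q Λ α p.1.1 p.1.2}) : a • stdGen Q Λ p = 0 := by
  rw [stdGen, ← map_smul, ← Submodule.Quotient.mk_smul, (Submodule.Quotient.mk_eq_zero _).2,
    map_zero]
  exact h

theorem idemLR_smul_stdGen_of_ne {p q : WordsWith χ α γ} (h : p ≠ q) :
    idemLR Q Λ α p.1.1 p.1.2 • stdGen Q Λ q = 0 :=
  smul_stdGen_eq_zero (by rw [idemLR_mul_of_ne h]; exact Submodule.zero_mem _)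

theorem idemLR_smul_stdGen (p : WordsWith χ α γ) :
    idemLR Q Λ α p.1.1 p.1.2 • stdGen Q Λ p = stdGen Q Λ p := by
  rw [stdGen, ← map_smul, ← Submodule.Quotient.mk_smul]
  congr 2
  exact Subtype.ext (idemLR_mul_self p)

theorem standard_induction {P : Standard Q Λ χ α γ → Prop} (zero : P 0)
    (add : ∀ x y, P x → P y → P (x + y))
    (smul : ∀ (a : KLRWAlg Q Λ α) p, P (a • stdGen Q Λ p)) (x : Standard Q Λ χ α γ) : P x := by
  induction x using DirectSum.induction_on with
  | zero => exact zero
  | add x y hx hy => exact add x y hx hy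
  | of p y =>
    obtain ⟨⟨z, hz⟩, rfl⟩ := Submodule.Quotient.mk_surjective _ y
    obtain ⟨a, rfl⟩ := Submodule.mem_span_singleton.1 hz
    have := smul a p
    rwa [stdGen, ← map_smul, ← Submodule.Quotient.mk_smul] at this

theorem standard_hom_ext {M : Type*} [AddCommMonoid M] [Module (KLRWAlg Q Λ α) M]
    {f g : Standard Q Λ χ α γ →ₗ[KLRWAlg Q Λ α] M}
    (h : ∀ p, f (stdGen Q Λ p) = g (stdGen Q Λ p)) : f = g :=
  LinearMap.ext fun x => by
    induction x using standard_induction with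
    | zero => rw [map_zero, map_zero]
    | add x y hx hy => rw [map_add, map_add, hx, hy]
    | smul a p => rw [map_smul, map_smul, h]

theorem idemLR_smul_standard_eq_zero {ℓ r : List I} (hlr : (ℓ : Multiset I) + (r : Multiset I) = α)
    (hle : ¬ (slopeDatum χ ℓ r).LE χ γ) (x : Standard Q Λ χ α γ) : idemLR Q Λ α ℓ r • x = 0 := by
  induction x using standard_induction with
  | zero => rw [smul_zero]
  | add x y hx hy => rw [smul_add, hx, hy, add_zero]
  | smul a p =>
    rw [smul_smul]
    exact smul_stdGen_eq_zero (Submodule.subset_span ⟨ℓ, r, a, hlr, by rwa [p.2.2], rfl⟩)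

section Iso

variable (hγ : γ.IsFor χ α)

include hγ

/-- The elements of `R_γ` that annihilate the standard module form a two-sided ideal, so it is
enough to consider killed idempotents in one block. These are sums of idempotents of concatenations
that contain a killed word, to which `good_of_le` applies. -/
theorem hcomp_smul_standard_eq_zero {r : RGamma Q Λ γ} (hr : toCGamma Q Λ χ γ r = 0)
    (x : Standard Q Λ χ α γ) : hcomp Q Λ γ α r • x = 0 := by
  let K : Ideal (RGamma Q Λ γ) :=
    { carrier := {r | ∀ x : Standard Q Λ χ α γ, hcomp Q Λ γ α r • x = 0}
      add_mem' := fun {r s} hr hs x => by rw [map_add, add_smul, hr x, hs x, add_zero]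
      zero_mem' := fun x => by rw [map_zero, zero_smul]
      smul_mem' := fun s r hr x => by
        rw [smul_eq_mul, hcomp_mul hγ.fits, mul_smul, hr x, smul_zero] }
  have : K.IsTwoSided := ⟨fun {r} s hr x => by
    rw [hcomp_mul hγ.fits, mul_smul]; exact hr _⟩
  refine mem_of_toCGamma_eq_zero K (fun p w hw hk x => ?_) hr x
  have key : hcomp Q Λ γ α (single p (idem Q Λ _ w)) =
      ∑ z ∈ concatWords γ.blocks, hcomp Q Λ γ α (single p (idem Q Λ _ w)) * idem Q Λ _ z := by
    rw [← Finset.mul_sum]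
    have : ∑ z ∈ concatWords γ.blocks, idem Q Λ (withRed α) z = hcomp Q Λ γ α 1 := by
      refine StrandAlg.val_injective ?_
      rw [StrandAlg.val_sum, val_hcomp_one hγ.fits, concatTotal]
      exact Finset.sum_congr rfl fun z hz => StrandAlg.val_idem (hγ.fits.coe hz)
    rw [this, ← hcomp_mul hγ.fits, mul_one]
  rw [key, Finset.sum_smul]
  refine Finset.sum_eq_zero fun z hz => ?_
  obtain ⟨ws, hws, rfl⟩ := mem_concatWords_iff.1 hz
  rw [mul_smul]
  -- If the word at `p` is the killed one, the concatenation does not have slope datum at most `γ`,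
  -- so its idempotent annihilates the standard module; otherwise the two idempotents are
  -- orthogonal.
  by_cases he : w = ws p
  · obtain ⟨ℓ, r, hlr, hs⟩ := exists_of_coe_eq_withRed (hγ.fits.coe hz)
    rw [hlr, idemLR_smul_standard_eq_zero hs fun hle => ?_, smul_zero]
    exact good_of_le hws hlr hle p p.2 (he ▸ hk)
  · rw [smul_smul]
    have : hcomp Q Λ γ α (single p (idem Q Λ _ w)) *
        idem Q Λ (withRed α) (cat ws γ.blocks.length) = 0 := by
      refine StrandAlg.val_injective ?_
      have hv := StrandAlg.val_idem (Q := Q) (Λ := Λ) (hγ.fits.coe hz)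
      rw [StrandAlg.val_mul, hcomp_single hγ.fits,
        slot_mul_cat hγ.fits hws p _ (by rw [hv, dId_mul_self]), StrandAlg.val_idem hw,
        dId_mul_ne Q Λ he, map_zero, zero_mul, StrandAlg.val_zero]
    rw [this, zero_smul]

omit hγ in
variable (Q Λ χ γ α) in
/-- The element of the standard module corresponding to `1 ⊗ 1`. -/
def stdSum : Standard Q Λ χ α γ :=
  haveI := Fintype.ofFinite (WordsWith χ α γ)
  ∑ p, stdGen Q Λ p

omit hγ in
theorem idemLR_smul_stdSum (p : WordsWith χ α γ) :
    idemLR Q Λ α p.1.1 p.1.2 • stdSum Q Λ χ γ α = stdGen Q Λ p := by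
  let := Fintype.ofFinite (WordsWith χ α γ)
  rw [stdSum, Finset.smul_sum, Finset.sum_eq_single p]
  · exact idemLR_smul_stdGen p
  · exact fun q _ hq => idemLR_smul_stdGen_of_ne hq.symm
  · exact fun h => absurd (Finset.mem_univ p) h

theorem hcomp_one_smul_stdSum : hcomp Q Λ γ α 1 • stdSum Q Λ χ γ α = stdSum Q Λ χ γ α := by
  let := Fintype.ofFinite (WordsWith χ α γ)
  rw [stdSum, Finset.smul_sum]
  refine Finset.sum_congr rfl fun p _ => ?_
  obtain ⟨ws, hw, he⟩ := exists_isWords p.2.2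
  rw [← idemLR_smul_stdGen p, smul_smul, idemLR, ← he, hcomp_one_mul_idem_cat hγ hw]

/-- The map from the standard module to the induced module. -/
def toIndC : Standard Q Λ χ α γ →ₗ[KLRWAlg Q Λ α] IndC Q Λ χ γ α :=
  DirectSum.toModule _ _ _ fun p : WordsWith χ α γ => (upper Q Λ χ α p.1.1 p.1.2).liftQ
    (LinearMap.toSpanSingleton (KLRWAlg Q Λ α) (IndC Q Λ χ γ α) (gen Q Λ χ γ α) ∘ₗ
      (projective Q Λ α p.1.1 p.1.2).subtype) (by
    intro x hx
    have h : Submodule.span (KLRWAlg Q Λ α) {x | ∃ (ℓ' r' : List I) (a : KLRWAlg Q Λ α),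
        (ℓ' : Multiset I) + (r' : Multiset I) = α ∧
        ¬ (slopeDatum χ ℓ' r').LE χ (slopeDatum χ p.1.1 p.1.2) ∧
        x = idemLR Q Λ α ℓ' r' * a * idemLR Q Λ α p.1.1 p.1.2} ≤
        LinearMap.ker (LinearMap.toSpanSingleton (KLRWAlg Q Λ α) (IndC Q Λ χ γ α)
          (gen Q Λ χ γ α)) := by
      refine Submodule.span_le.2 ?_
      rintro _ ⟨ℓ, r, a, hlr, hle, rfl⟩
      change (idemLR Q Λ α ℓ r * a * idemLR Q Λ α p.1.1 p.1.2) • gen Q Λ χ γ α = 0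
      rw [mul_assoc, mul_smul]
      rw [p.2.2] at hle
      exact idem_smul_eq_zero hγ hlr hle _
    exact h hx)

theorem toIndC_stdGen (p : WordsWith χ α γ) :
    toIndC hγ (stdGen Q Λ p) = idemLR Q Λ α p.1.1 p.1.2 • gen Q Λ χ γ α := by
  rw [toIndC, stdGen, DirectSum.toModule_lof]; rfl

/-- The unit is the sum of the idempotents of all words, and those with a slope datum other than `γ`
annihilate the generator. -/
theorem toIndC_stdSum : toIndC hγ (stdSum Q Λ χ γ α) = gen Q Λ χ γ α := by
  let := Fintype.ofFinite (WordsWith χ α γ)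
  rw [stdSum, map_sum]
  simp only [toIndC_stdGen]
  conv_rhs => rw [← one_smul (KLRWAlg Q Λ α) (gen Q Λ χ γ α), ← StrandAlg.sum_idem,
    Finset.sum_smul]
  rw [← Finset.sum_image (s := Finset.univ) (g := fun p : WordsWith χ α γ => redWord p.1.1 p.1.2)
    (f := fun w => idem Q Λ (withRed α) w • gen Q Λ χ γ α) fun p _ q _ h => redWord_injective h]
  refine Finset.sum_subset (fun w hw => ?_) fun w hw hn => ?_
  · obtain ⟨p, -, rfl⟩ := Finset.mem_image.1 hw
    exact mem_wordsOf.2 (coe_redWord_wordsWith p)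
  · obtain ⟨ℓ, r, rfl, hlr⟩ := exists_of_coe_eq_withRed (mem_wordsOf.1 hw)
    refine idem_smul_gen_eq_zero hγ hlr fun h => hn ?_
    exact Finset.mem_image.2 ⟨⟨(ℓ, r), hlr, h⟩, Finset.mem_univ _, rfl⟩

/-- This is the universal property of the induced module: the action of `R_γ` on `m` factors through
`C_γ`, and the fact that `1_γ` fixes `m` ensures that `1 ⊗ 1` goes to `m`. -/
theorem exists_ofIndC {M : Type*} [AddCommGroup M] [Module (KLRWAlg Q Λ α) M] [Module 𝕜 M]
    [IsScalarTower 𝕜 (KLRWAlg Q Λ α) M] {m : M} (h1 : hcomp Q Λ γ α 1 • m = m)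
    (h0 : ∀ r, toCGamma Q Λ χ γ r = 0 → hcomp Q Λ γ α r • m = 0) :
    ∃ g : IndC Q Λ χ γ α →ₗ[KLRWAlg Q Λ α] M, g (gen Q Λ χ γ α) = m := by
  let k : RGamma Q Λ γ →ₗ[𝕜] M :=
    (LinearMap.toSpanSingleton (KLRWAlg Q Λ α) _ m).restrictScalars 𝕜 ∘ₗ
      hcomp Q Λ γ α
  have hk : ∀ r, k r = hcomp Q Λ γ α r • m := fun _ => rfl
  let e := (toCGamma Q Λ χ γ).toLinearMap.quotKerEquivOfSurjective toCGamma_surjective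
  have hker : LinearMap.ker (toCGamma Q Λ χ γ).toLinearMap ≤ LinearMap.ker k := fun r hr =>
    LinearMap.mem_ker.2 ((hk r).trans (h0 r hr))
  let k' : CGamma Q Λ χ γ →ₗ[𝕜] M :=
    (LinearMap.ker (toCGamma Q Λ χ γ).toLinearMap).liftQ k hker ∘ₗ e.symm.toLinearMap
  have hk' : ∀ r, k' (toCGamma Q Λ χ γ r) = hcomp Q Λ γ α r • m := by
    intro r
    have : e.symm (toCGamma Q Λ χ γ r) = Submodule.Quotient.mk r := by
      rw [LinearEquiv.symm_apply_eq]; rfl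
    change (LinearMap.ker (toCGamma Q Λ χ γ).toLinearMap).liftQ k hker (e.symm _) = _
    rw [this]
    rfl
  let G : KLRWAlg Q Λ α ⊗[𝕜] CGamma Q Λ χ γ →ₗ[KLRWAlg Q Λ α] M :=
    TensorProduct.AlgebraTensorModule.lift (LinearMap.toSpanSingleton (KLRWAlg Q Λ α) _ k')
  have hG : ∀ a c, G (a ⊗ₜ c) = a • k' c := fun _ _ => rfl
  refine ⟨Submodule.liftQ _ G (Submodule.span_le.2 ?_), ?_⟩
  · rintro _ ⟨a, r, m, rfl⟩
    obtain ⟨s, rfl⟩ := toCGamma_surjective m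
    change G (_ - a ⊗ₜ[𝕜] (toCGamma Q Λ χ γ r * toCGamma Q Λ χ γ s)) = 0
    rw [map_sub, hG, hG, ← map_mul, hk', hk', hcomp_mul hγ.fits, mul_smul, mul_smul, sub_self]
  · change G (1 ⊗ₜ 1) = _
    rw [hG, one_smul, ← map_one (toCGamma Q Λ χ γ), hk', h1]

/-- The standard module is induced from `C_γ`. -/
theorem nonempty_standard_equiv :
    Nonempty (Standard Q Λ χ α γ ≃ₗ[KLRWAlg Q Λ α] IndC Q Λ χ γ α) := by
  obtain ⟨g, hg⟩ := exists_ofIndC (M := Standard Q Λ χ α γ) hγ (hcomp_one_smul_stdSum hγ)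
    fun r hr => hcomp_smul_standard_eq_zero hγ hr _
  refine ⟨LinearEquiv.ofLinearMap (toIndC hγ) g (indC_hom_ext ?_) ?_⟩
  on_goal 2 => refine standard_hom_ext fun p => ?_
  · rw [LinearMap.comp_apply, hg, toIndC_stdSum, LinearMap.id_apply]
  · rw [LinearMap.comp_apply, toIndC_stdGen, map_smul, hg, idemLR_smul_stdSum, LinearMap.id_apply]

end Iso

end

end KLRW

end

/-! ### The theorem: both isomorphisms -/

theorem mainTheorem11 {I : Type*} [DecidableEq I] {𝕜 : Type*} [CommRing 𝕜]
    (C : KLRW.CartanDatum I) (Q : I → I → MvPolynomial (Fin 2) 𝕜) (hQ : KLRW.IsAdmissible C Q)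
    (Λ : I → ℕ) (χ : I → ℝ) (α : Multiset I) (γ : KLRW.SlopeDatum I) (hγ : γ.IsFor χ α) :
    Nonempty (KLRW.Standard Q Λ χ α γ ≃ₗ[KLRW.KLRWAlg Q Λ α]
      KLRW.Induced Q Λ γ α (KLRW.CGamma Q Λ χ γ)) ∧
    Nonempty ((Module.End (KLRW.KLRWAlg Q Λ α) (KLRW.Standard Q Λ χ α γ))ᵐᵒᵖ ≃ₐ[𝕜]
      KLRW.CGamma Q Λ χ γ) := by
  obtain ⟨e⟩ := KLRW.nonempty_standard_equiv (Q := Q) (Λ := Λ) hγ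
  exact ⟨⟨e⟩, ⟨(AlgEquiv.op (e.conjAlgEquiv 𝕜)).trans
    (AlgEquiv.ofBijective _ (KLRW.toEnd_bijective hQ hγ)).symm⟩⟩
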